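/- Let $N>3$ be a prime, let $B$ be the definite quaternion algebra over $\mathbb Q$ of discriminant $N$ (i.e. ramified exactly at $N$ and $\infty$), and let $\mathcal O\subset B$ be a maximal order. Let $\mathrm{Cl}(\mathcal O)$ be the set of invertible right $\mathcal O$-ideals modulo left multiplication by $B^\times$. For each prime $p\mid N$ let $\sigma_p$ be the map $[I]\mapsto[I\mathfrak P_p]$ on $\mathrm{Cl}(\mathcal O)$, where $\mathfrak P_p$ is the two-sided $\mathcal O$-ideal of reduced norm $p$. For a sign pattern $\varepsilon$ for $N$ (a multiplicative function $d\mapsto\varepsilon_d\in\{\pm1\}$ on the divisors of $N$), let $\Sigma^\varepsilon$ be the signed multigraph on $\mathrm{Cl}(\mathcal O)$ having, for each prime $p\mid N$ and each orbit $\{x,\sigma_p(x)\}$ of $\sigma_p$, an edge (a loop if $\sigma_p(x)=x$) of sign $\varepsilon_p$ between $x$ and $\sigma_p(x)$. A class $x\in\mathrm{Cl}(\mathcal O)$ is called a trivial zero for $\varepsilon$ if its orbit under multiplication by the invertible two-sided $\mathcal O$-ideals contains a closed path (vertices and edges may repeat) of $\Sigma^\varepsilon$ the product of whose edge signs, counted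 with multiplicity, is $-1$. Let $-_N$ be the sign pattern with value $-1$ at every prime divisor of $N$. Let $h(\Delta_N)$ be the class number of $\mathbb Q(\sqrt{-N})$, and let $$b(N,1)=\begin{cases}1 & N\equiv 1 \pmod 4,\\ 2 & N\equiv 7\pmod 8,\\ 4 & N\equiv 3\pmod 8.\end{cases}$$ Then the number of trivial zeroes for $-_N$ is exactly $\tfrac12\,h(\Delta_N)\,b(N,1)$. Moreover, there is a unique two-sided $\mathcal O$-ideal of reduced norm $N$, the associated map $\sigma_N$ is an involution of $\mathrm{Cl}(\mathcal O)$, and $\sigma_N$ has exactly $\tfrac12\,h(\Delta_N)\,b(N,1)$ fixed points. -/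

import Mathlib

open scoped TensorProduct Pointwise

noncomputable section

namespace QuatForm

/-! ### Quaternion algebras over `ℚ` -/

/-- `B` is a quaternion algebra over `ℚ`: a central simple `ℚ`-algebra of dimension four. -/
structure IsQuaternionAlgebra (B : Type*) [Ring B] [Algebra ℚ B] : Prop where
  isCentral : Algebra.IsCentral ℚ B
  isSimpleRing : IsSimpleRing B
  finrank_eq : Module.finrank ℚ B = 4

/-- The quaternion algebra `B` is definite: `ℝ ⊗ B` is a division algebra. -/
def IsDefinite (B : Type*) [Ring B] [Algebra ℚ B] : Prop :=
  ∀ x : ℝ ⊗[ℚ] B, x ≠ 0 → IsUnit x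

/-- The set `Ram(B)` of rational primes `p` for which `ℚ_p ⊗ B` is a division algebra. -/
def ramifiedPrimes (B : Type*) [Ring B] [Algebra ℚ B] : Set ℕ :=
  {p | ∃ _ : Fact p.Prime, ∀ x : ℚ_[p] ⊗[ℚ] B, x ≠ 0 → IsUnit x}

/-- The discriminant of `B`, the product of its (finitely many) ramified primes. -/
def discriminant (B : Type*) [Ring B] [Algebra ℚ B] : ℕ :=
  ∏ᶠ p ∈ ramifiedPrimes B, p

/-! ### Orders and ideals -/

variable {B : Type*} [Ring B] [Algebra ℚ B]

/-- An order: a subring that is a full `ℤ`-lattice in `B`. -/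
def IsOrder (O : Subalgebra ℤ B) : Prop :=
  Submodule.IsLattice ℚ (Subalgebra.toSubmodule O)

/-- A maximal order: an order not properly contained in another order. -/
def IsMaximalOrder (O : Subalgebra ℤ B) : Prop :=
  Maximal IsOrder O

/-- The left order `{b | b I ⊆ I}` of a lattice `I`. -/
def leftOrder (I : Submodule ℤ B) : Submodule ℤ B where
  carrier := {b | ∀ x ∈ I, b * x ∈ I}
  add_mem' ha hb x hx := by
    rw [add_mul]
    exact I.add_mem (ha x hx) (hb x hx)
  zero_mem' x _ := by
    rw [zero_mul]
    exact I.zero_mem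
  smul_mem' n a ha x hx := by
    rw [smul_mul_assoc]
    exact I.smul_mem n (ha x hx)

/-- Invertible (fractional) right `O`-ideals: full lattices `I` in `B` with `I O = I` that have
an inverse lattice `J`, meaning `I J = O_l(I)` and `J I = O`. (It follows that `O` is the
full right order of `I`.) -/
@[ext] structure InvRightIdeal (O : Subalgebra ℤ B) where
  carrier : Submodule ℤ B
  isLattice : Submodule.IsLattice ℚ carrier
  mul_order : carrier * Subalgebra.toSubmodule O = carrier
  invertible : ∃ J : Submodule ℤ B,
    carrier * J = leftOrder carrier ∧ J * carrier = Subalgebra.toSubmodule O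

/-- Invertible (fractional) two-sided `O`-ideals: full lattices `P` in `B` with
`O P = P = P O` that have an inverse lattice `Q`, meaning `P Q = O = Q P`. -/
@[ext] structure InvTwoSidedIdeal (O : Subalgebra ℤ B) where
  carrier : Submodule ℤ B
  isLattice : Submodule.IsLattice ℚ carrier
  order_mul : Subalgebra.toSubmodule O * carrier = carrier
  mul_order : carrier * Subalgebra.toSubmodule O = carrier
  invertible : ∃ Q : Submodule ℤ B,
    carrier * Q = Subalgebra.toSubmodule O ∧ Q * carrier = Subalgebra.toSubmodule O

/-- `P` is an integral two-sided ideal of (reduced) norm `p`, i.e. `P ⊆ O` and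
`[O : P] = p ^ 2`. -/
def InvTwoSidedIdeal.HasNorm {O : Subalgebra ℤ B} (P : InvTwoSidedIdeal O) (p : ℕ) : Prop :=
  P.carrier ≤ Subalgebra.toSubmodule O ∧
    P.carrier.toAddSubgroup.relIndex (Subalgebra.toSubmodule O).toAddSubgroup = p ^ 2

theorem isLattice_mul {I J : Submodule ℤ B} (hI : Submodule.IsLattice ℚ I)
    (hJ : Submodule.IsLattice ℚ J) : Submodule.IsLattice ℚ (I * J) := by
  refine ⟨hI.fg.mul hJ.fg, ?_⟩
  have h1 : Submodule.span ℚ (I : Set B) * Submodule.span ℚ (J : Set B) = ⊤ := by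
    rw [hI.span_eq_top, hJ.span_eq_top]
    refine eq_top_iff.2 fun x _ => ?_
    simpa using Submodule.mul_mem_mul (Submodule.mem_top (R := ℚ) (x := x))
      (Submodule.mem_top (R := ℚ) (x := (1 : B)))
  rw [Submodule.span_mul_span] at h1
  refine eq_top_iff.2 (h1 ▸ Submodule.span_mono ?_)
  rintro _ ⟨x, hx, y, hy, rfl⟩
  exact Submodule.mul_mem_mul hx hy

/-- The product `I P` of an invertible right `O`-ideal with an invertible two-sided one. -/
def InvRightIdeal.mul {O : Subalgebra ℤ B} (I : InvRightIdeal O) (P : InvTwoSidedIdeal O) :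
    InvRightIdeal O where
  carrier := I.carrier * P.carrier
  isLattice := isLattice_mul I.isLattice P.isLattice
  mul_order := by rw [mul_assoc, P.mul_order]
  invertible := by
    obtain ⟨J, h1, h2⟩ := I.invertible
    obtain ⟨Q, h3, h4⟩ := P.invertible
    refine ⟨Q * J, ?_, ?_⟩
    · have e : I.carrier * P.carrier * (Q * J) = leftOrder I.carrier := by
        rw [← h1, mul_assoc, ← mul_assoc P.carrier, h3, ← mul_assoc, I.mul_order]
      have e' : I.carrier * P.carrier * Q = I.carrier := by
        rw [mul_assoc, h3, I.mul_order]
      rw [e]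
      apply le_antisymm
      · intro b hb x hx
        refine Submodule.mul_induction_on hx (fun m hm n hn => ?_) (fun u v hu hv => ?_)
        · rw [← mul_assoc]
          exact Submodule.mul_mem_mul (hb m hm) hn
        · rw [mul_add]
          exact Submodule.add_mem _ hu hv
      · intro b hb x hx
        rw [← e'] at hx ⊢
        refine Submodule.mul_induction_on hx (fun m hm n hn => ?_) (fun u v hu hv => ?_)
        · rw [← mul_assoc]
          exact Submodule.mul_mem_mul (hb m hm) hn
        · rw [mul_add]
          exact Submodule.add_mem _ hu hv
    · rw [mul_assoc, ← mul_assoc J, h2, P.order_mul, h4]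

/-! ### The class set -/

/-- Two right ideals are in the same class if `I' = b I` for some `b ∈ Bˣ`. -/
instance classSetoid (O : Subalgebra ℤ B) : Setoid (InvRightIdeal O) where
  r I I' := ∃ b : Bˣ, I'.carrier = b • I.carrier
  iseqv :=
    { refl := fun I => ⟨1, (one_smul _ _).symm⟩
      symm := by
        rintro I I' ⟨b, h⟩
        exact ⟨b⁻¹, by rw [h, inv_smul_smul]⟩
      trans := by
        rintro I I' I'' ⟨b, h⟩ ⟨c, h'⟩
        exact ⟨c * b, by rw [h', h, mul_smul]⟩ }

/-- `Cl(O)`: the set of invertible right `O`-ideal classes. -/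
def Cl (O : Subalgebra ℤ B) : Type _ := Quotient (classSetoid O)

/-- Right multiplication of ideal classes by an invertible two-sided ideal: `[I] ↦ [I P]`. -/
def Cl.mul {O : Subalgebra ℤ B} (x : Cl O) (P : InvTwoSidedIdeal O) : Cl O :=
  Quotient.map (fun I : InvRightIdeal O => I.mul P)
    (by
      rintro I I' ⟨b, h⟩
      refine ⟨b, ?_⟩
      change I'.carrier * P.carrier = b • (I.carrier * P.carrier)
      rw [h, smul_mul_assoc]) x

/-! ### Sign patterns and trivial zeroes -/

/-- A sign pattern for `N`: a multiplicative function from the divisors of `N` to `{±1}`. -/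
structure SignPattern (N : ℕ) where
  sign : N.divisors → ℤˣ
  map_mul : ∀ a b c : N.divisors, (a : ℕ).Coprime b → (c : ℕ) = a * b →
    sign c = sign a * sign b

/-- The sign pattern `-_N`, which is `-1` at every prime divisor of `N`. -/
def minusPattern (N : ℕ) : SignPattern N where
  sign d := (-1) ^ (d : ℕ).primeFactors.card
  map_mul a b c hab hc := by
    rw [hc, hab.primeFactors_mul, Finset.card_union_of_disjoint hab.disjoint_primeFactors,
      pow_add]

/-- The edges of the signed multigraph on `Cl(O)` attached to a sign pattern: for each prime
`p ∣ N`, with `P` the two-sided ideal of norm `p`, an edge of sign `ε_p` between each class `x`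
and `σ_p(x) = x P`. `IsEdge ε x y s` says that there is an edge of sign `s` joining `x`, `y`. -/
def IsEdge {N : ℕ} (ε : SignPattern N) {O : Subalgebra ℤ B} (x y : Cl O) (s : ℤˣ) : Prop :=
  ∃ p : N.divisors, (p : ℕ).Prime ∧ s = ε.sign p ∧
    ∃ P : InvTwoSidedIdeal O, P.HasNorm p ∧ (y = x.mul P ∨ x = y.mul P)

/-- `HasPath ε x y s`: there is a (not necessarily simple) path from `x` to `y` in the signed
multigraph whose parity, the product of the signs of its edges, is `s`. -/
inductive HasPath {N : ℕ} (ε : SignPattern N) {O : Subalgebra ℤ B} : Cl O → Cl O → ℤˣ → Prop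
  | nil (x : Cl O) : HasPath ε x x 1
  | cons {x y z : Cl O} {s t : ℤˣ} :
      IsEdge ε x y s → HasPath ε y z t → HasPath ε x z (s * t)

/-- The orbit of `x` under `Pic(O)`, the group of invertible two-sided `O`-ideals modulo `ℚˣ`
(scalars act trivially on classes, so the orbits are those of the two-sided ideals). -/
def orbit {O : Subalgebra ℤ B} (x : Cl O) : Set (Cl O) :=
  {y | ∃ P : InvTwoSidedIdeal O, y = x.mul P}

/-- The orbit of `x` is `ε`-admissible: it contains no cycle of parity `-1`. -/
def IsAdmissible {N : ℕ} (ε : SignPattern N) {O : Subalgebra ℤ B} (x : Cl O) : Prop :=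
  ∀ y ∈ orbit x, ¬ HasPath ε y y (-1)

/-- `x` is a trivial zero for `ε`: its orbit is not `ε`-admissible. -/
def IsTrivialZero {N : ℕ} (ε : SignPattern N) {O : Subalgebra ℤ B} (x : Cl O) : Prop :=
  ¬ IsAdmissible ε x

/-- The constant `b(N,1)` for odd `N`: `1` if `N ≡ 1 (mod 4)`, `2` if `N ≡ 7 (mod 8)` and
`4` if `N ≡ 3 (mod 8)`. -/
def bConst (N : ℕ) : ℕ :=
  if N % 4 = 1 then 1 else if N % 8 = 7 then 2 else 4

end QuatForm

end

/-! ### Definite quaternion algebras in the standard form `(-α, -β)` -/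

noncomputable section

namespace QuatForm

open Quaternion

section Structure

variable {B : Type*} [Ring B] [Algebra ℚ B]

/-! Let `P` be the two-sided prime above `N`, so that `P² = N O`, and let `σ` be right
multiplication by `P`. For the pattern `-_N` every edge has sign `-1` and joins `x` to `σ x`, so a
closed path of sign `-1` has odd length and its base point is fixed by `σ`. As `P` commutes with all
invertible two-sided ideals, trivial zeroes are exactly the fixed points of `σ`
(`isTrivialZero_minusPattern_iff`), and only these have to be counted.

A class `[I]` is fixed when `I P = c I` for a unit `c`. Since `N > 3`, this happens exactly when `c²
= -N` and `c I ⊆ I` (`mul_self_eq_of_mul_radPow`, `mul_radPow_one_eq_smul`). Fix `b` with `b² = -N`,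
and consider the `b`-stable right ideals modulo the centraliser of `b`, which is the image of `K`.
Their classes are counted in two ways.

Over the fixed classes: the fibre above `[I]` is the set of orbits of the stabiliser of `I` on the
square roots of `-N` in the left order of `I` (`card_fiber_stableToFixed`). The roots form a torsor
under the stabiliser, only `±1` fix a root, and these fix all of them, so Burnside's lemma gives two
orbits (`card_orbits_sqrtNegSet`).

Over the class group of `K`: send `I` to `O_K I`. Fractional ideals act simply transitively on the
`O_K`-stable right lattices (`exists_fracImage_mul_eq`, `fracImage_mul_injective`), and each such
lattice is generated by exactly `b(N,1)` stable ideals, a computation at the prime 2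
(`card_stableHull`). Hence there are `h b(N,1)` classes (`card_stable_eq_classNumber_mul`), and half
as many fixed points.

The existence of `b` (`exists_mul_self_eq_neg`) is proved by geometry of numbers: `O` is glued to an
explicit lattice in the algebra `(-q, -N)` to form an even unimodular lattice of signature `(4, 4)`,
which Minkowski's theorem shows to be totally hyperbolic. The resulting isotropic space is the graph
of a rational isometry, which carries a square root of `-N` into `B`.

The arithmetic of `O` rests on two local facts: modulo `p ≠ N` the order is `M₂(𝔽_p)`
(`exists_reduction`), and at `N` the norm defines a valuation whose powers are the `radPow`. The
inverse different is `P⁻¹` (`trdDual_eq_radPow`), which makes all right lattices invertible with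
maximal left order. -/

theorem IsQuaternionAlgebra.finiteDimensional (hB : IsQuaternionAlgebra B) :
    FiniteDimensional ℚ B :=
  Module.finite_of_finrank_pos (by rw [hB.finrank_eq]; norm_num)

theorem IsQuaternionAlgebra.isDomain (hB : IsQuaternionAlgebra B) (hdef : IsDefinite B) :
    IsDomain B := by
  have := hB.isSimpleRing
  have hinj : Function.Injective (Algebra.TensorProduct.includeRight : B →ₐ[ℚ] ℝ ⊗[ℚ] B) :=
    Algebra.TensorProduct.includeRight_injective (algebraMap ℚ ℝ).injective
  have : NoZeroDivisors B := by
    refine ⟨fun {x y} h => ?_⟩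
    by_contra hc
    push Not at hc
    have hu := hdef (Algebra.TensorProduct.includeRight x)
      (fun h0 => hc.1 (hinj (by rw [h0, map_zero])))
    have h2 : (Algebra.TensorProduct.includeRight x : ℝ ⊗[ℚ] B) *
        Algebra.TensorProduct.includeRight y = 0 := by
      rw [← map_mul, h, map_zero]
    exact hc.2 (hinj (by rw [(hu.mul_right_eq_zero).1 h2, map_zero]))
  have : Nontrivial B := inferInstance
  exact NoZeroDivisors.to_isDomain B

theorem IsQuaternionAlgebra.exists_algebraMap_eq_of_commute (hB : IsQuaternionAlgebra B) {x : B}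
    (h : ∀ y, x * y = y * x) : ∃ r : ℚ, algebraMap ℚ B r = x := by
  have hx : x ∈ Subalgebra.center ℚ B := by
    rw [Subalgebra.mem_center_iff]
    exact fun y => (h y).symm
  have := hB.isCentral.out hx
  rwa [Algebra.mem_bot] at this

/-- Elements of a central division algebra of dimension four are quadratic. -/
theorem IsQuaternionAlgebra.exists_quadratic (hB : IsQuaternionAlgebra B) [IsDomain B] (x : B) :
    ∃ s r : ℚ, x * x = algebraMap ℚ B s * x + algebraMap ℚ B r := by
  have := hB.finiteDimensional
  by_cases hx : ∃ r : ℚ, algebraMap ℚ B r = x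
  · obtain ⟨r, rfl⟩ := hx
    exact ⟨r, 0, by simp⟩
  let A := Algebra.adjoin ℚ ({x} : Set B)
  let _ : DivisionRing A := divisionRingOfFiniteDimensional ℚ A
  -- `B` is a vector space over the field `ℚ(x)`, so the degree of `x` divides 4; degree 4 would
  -- make `x` central.
  have h4 := Module.finrank_mul_finrank ℚ A B
  rw [hB.finrank_eq] at h4
  have hA4 : Module.finrank ℚ A ≠ 4 := by
    intro h
    have htop : Subalgebra.toSubmodule A = ⊤ :=
      Submodule.eq_top_of_finrank_eq (by rw [hB.finrank_eq]; exact h)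
    refine hx (hB.exists_algebraMap_eq_of_commute fun y => ?_)
    have hy : y ∈ A := by
      rw [← Subalgebra.mem_toSubmodule, htop]; trivial
    exact Algebra.commute_of_mem_adjoin_self hy
  have hA2 : Module.finrank ℚ A < 3 := by
    have hd : Module.finrank ℚ A ∣ 4 := ⟨_, h4.symm⟩
    have hle := Nat.le_of_dvd (by norm_num) hd
    generalize Module.finrank ℚ A = k at *
    interval_cases k <;> simp_all
  have hxA : x ∈ A := Algebra.self_mem_adjoin_singleton ℚ x
  have hnli : ¬ LinearIndependent ℚ (![1, ⟨x, hxA⟩, ⟨x, hxA⟩ * ⟨x, hxA⟩] : Fin 3 → A) := by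
    intro hli
    have := hli.fintype_card_le_finrank
    rw [Fintype.card_fin] at this
    omega
  rw [Fintype.not_linearIndependent_iff] at hnli
  obtain ⟨g, hg, hne⟩ := hnli
  rw [Fin.sum_univ_three] at hg
  have hg' : g 0 • (1 : B) + g 1 • x + g 2 • (x * x) = 0 := congrArg (Subtype.val) hg
  have hg2 : g 2 ≠ 0 := by
    intro h2
    rw [h2, zero_smul, add_zero] at hg'
    have hg1 : g 1 ≠ 0 := by
      intro h1
      rw [h1, zero_smul, add_zero, smul_eq_zero] at hg'
      obtain ⟨i, hi⟩ := hne
      fin_cases i <;> simp_all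
    refine hx ⟨-(g 0) / g 1, ?_⟩
    have : x = (g 1)⁻¹ • (g 1 • x) := by rw [smul_smul, inv_mul_cancel₀ hg1, one_smul]
    rw [this, eq_neg_of_add_eq_zero_right hg', Algebra.algebraMap_eq_smul_one]
    match_scalars
    field_simp
  refine ⟨-(g 1) / g 2, -(g 0) / g 2, ?_⟩
  have : x * x = (g 2)⁻¹ • (g 2 • (x * x)) := by rw [smul_smul, inv_mul_cancel₀ hg2, one_smul]
  rw [this, eq_neg_of_add_eq_zero_right hg', Algebra.algebraMap_eq_smul_one,
    Algebra.algebraMap_eq_smul_one, smul_mul_assoc, one_mul]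
  match_scalars <;> field_simp

/-- For `a ≥ 0` the relation `(√a - i)(√a + i) = 0` in the division algebra `ℝ ⊗ B` would make `i` a
scalar, hence central. -/
theorem IsDefinite.neg_of_sq (hdef : IsDefinite B) [Nontrivial B] {i y : B} {a : ℚ}
    (hi : i * i = algebraMap ℚ B a) (hy : i * y ≠ y * i) : a < 0 := by
  by_contra ha
  push Not at ha
  have hinj : Function.Injective (Algebra.TensorProduct.includeRight : B →ₐ[ℚ] ℝ ⊗[ℚ] B) :=
    Algebra.TensorProduct.includeRight_injective (algebraMap ℚ ℝ).injective
  set I : ℝ ⊗[ℚ] B := Algebra.TensorProduct.includeRight i with hI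
  set r : ℝ ⊗[ℚ] B := algebraMap ℝ _ (Real.sqrt a) with hr
  have hcomm : ∀ z, r * z = z * r := fun z => Algebra.commutes _ _
  have hrr : r * r = I * I := by
    rw [hI, hr, ← map_mul, ← map_mul, hi, AlgHom.commutes,
      Real.mul_self_sqrt (by exact_mod_cast ha), IsScalarTower.algebraMap_apply ℚ ℝ (ℝ ⊗[ℚ] B)]
    simp
  have hprod : (r - I) * (r + I) = 0 := by
    rw [sub_mul, mul_add, mul_add, hrr, hcomm I]; abel
  have hcen : ∀ s : ℝ ⊗[ℚ] B, (∀ z, s * z = z * s) → I = s → False := by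
    intro s hs h
    apply hy
    apply hinj
    rw [map_mul, map_mul, ← hI, h, hs]
  have h1 : r - I ≠ 0 := fun h => hcen r hcomm (sub_eq_zero.1 h).symm
  have h2 : r + I ≠ 0 := fun h => hcen (-r) (fun z => by rw [neg_mul, mul_neg, hcomm])
    (eq_neg_of_add_eq_zero_right h)
  exact h2 ((hdef _ h1).mul_right_eq_zero.1 hprod)

/-- A definite quaternion algebra is `(-α, -β)` with `α, β > 0`. -/
theorem IsQuaternionAlgebra.exists_equiv (hB : IsQuaternionAlgebra B) (hdef : IsDefinite B) :
    ∃ α β : ℚ, 0 < α ∧ 0 < β ∧ Nonempty (B ≃ₐ[ℚ] ℍ[ℚ,-α,0,-β]) := by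
  have := hB.isDomain hdef
  have : CharZero B := algebraRat.charZero B
  have := hB.finiteDimensional
  obtain ⟨x, hx⟩ : ∃ x : B, ∀ r : ℚ, algebraMap ℚ B r ≠ x := by
    by_contra hc
    push Not at hc
    have h1 : Module.finrank ℚ B ≤ 1 :=
      finrank_le_one (1 : B) fun w => by
        obtain ⟨r, hr⟩ := hc w
        exact ⟨r, by rw [← hr, Algebra.algebraMap_eq_smul_one]⟩
    rw [hB.finrank_eq] at h1
    omega
  obtain ⟨s, r, hsr⟩ := hB.exists_quadratic x
  set i : B := x - algebraMap ℚ B (s / 2) with hi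
  have hii : i * i = algebraMap ℚ B (r + s ^ 2 / 4) := by
    rw [hi, sub_mul, mul_sub, mul_sub, hsr, ← map_mul, ← Algebra.commutes (s / 2) x]
    simp only [Algebra.algebraMap_eq_smul_one, smul_mul_assoc, one_mul]
    match_scalars <;> ring
  obtain ⟨y, hy⟩ : ∃ y, i * y ≠ y * i := by
    by_contra hc
    push Not at hc
    obtain ⟨q, hq⟩ := hB.exists_algebraMap_eq_of_commute hc
    exact hx (q + s / 2) (by rw [map_add, hq, hi, sub_add_cancel])
  set a := r + s ^ 2 / 4
  have ha := hdef.neg_of_sq hii hy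
  -- A commutator with `i` anticommutes with `i`, because `i²` is central.
  set j := i * y - y * i with hj
  clear_value i
  have hj0 : j ≠ 0 := sub_ne_zero.2 hy
  have hi0 : i ≠ 0 := by rintro h; apply hy; rw [h, zero_mul, mul_zero]
  have hji : j * i = -(i * j) := by
    have e1 : y * (i * i) = i * i * y := by rw [hii, Algebra.commutes]
    rw [hj, sub_mul, mul_sub, mul_assoc y i i, e1, mul_assoc i y i, ← mul_assoc i i y]
    abel
  obtain ⟨s', r', hsr'⟩ := hB.exists_quadratic j
  have hjj : j * j = algebraMap ℚ B r' := by
    have e2 : i * (j * j) = (j * j) * i := by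
      rw [mul_assoc, hji, mul_neg, ← mul_assoc, ← mul_assoc, hji, neg_mul, neg_neg]
    rw [hsr', mul_add, add_mul, ← Algebra.commutes r', add_left_inj, mul_assoc, hji,
      ← mul_assoc, ← Algebra.commutes s', mul_assoc, mul_neg, eq_neg_iff_add_eq_zero, ← two_mul,
      ← mul_assoc, mul_eq_zero, mul_eq_zero] at e2
    have hs0 : algebraMap ℚ B s' = 0 := by
      rcases e2 with (h | h) | h
      · exact absurd h two_ne_zero
      · exact h
      · exact absurd h (mul_ne_zero hi0 hj0)
    rw [hsr', hs0, zero_mul, zero_add]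
  have hb := hdef.neg_of_sq (y := i) hjj (by
    rw [hji]
    intro h
    rw [neg_eq_iff_add_eq_zero, ← two_mul, mul_eq_zero] at h
    rcases h with h | h
    · exact absurd h two_ne_zero
    · exact absurd h (mul_ne_zero hi0 hj0))
  let q : QuaternionAlgebra.Basis B (-(-a)) 0 (-(-r')) :=
    { i := i
      j := j
      k := i * j
      i_mul_i := by rw [hii, Algebra.algebraMap_eq_smul_one]; simp
      j_mul_j := by rw [hjj, Algebra.algebraMap_eq_smul_one]; simp
      i_mul_j := rfl
      j_mul_i := by rw [hji]; simp }
  refine ⟨-a, -r', by linarith, by linarith, ⟨?_⟩⟩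
  -- The norm form has four positive diagonal coefficients, so it is anisotropic; bijectivity then
  -- follows by dimension.
  have hinj : Function.Injective q.liftHom := by
    rw [injective_iff_map_eq_zero]
    intro z hz
    have h1 : q.liftHom (z * star z) = 0 := by rw [map_mul, hz, zero_mul]
    rw [QuaternionAlgebra.mul_star_eq_coe, ← QuaternionAlgebra.coe_algebraMap,
      AlgHom.commutes, map_eq_zero_iff _ (algebraMap ℚ B).injective] at h1
    simp only [QuaternionAlgebra.re_mul, QuaternionAlgebra.re_star, QuaternionAlgebra.imI_star,
      QuaternionAlgebra.imJ_star, QuaternionAlgebra.imK_star] at h1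
    have hr2 : 0 < a * r' := mul_pos_of_neg_of_neg ha hb
    have e : z.re ^ 2 + (-a) * z.imI ^ 2 + (-r') * z.imJ ^ 2 + (a * r') * z.imK ^ 2 = 0 := by
      linear_combination h1
    have p1 := sq_nonneg z.re
    have p2 := mul_nonneg (neg_pos.2 ha).le (sq_nonneg z.imI)
    have p3 := mul_nonneg (neg_pos.2 hb).le (sq_nonneg z.imJ)
    have p4 := mul_nonneg hr2.le (sq_nonneg z.imK)
    ext
    · simpa using (show z.re ^ 2 = 0 by linarith)
    · simpa [ha.ne] using (show (-a) * z.imI ^ 2 = 0 by linarith)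
    · simpa [hb.ne] using (show (-r') * z.imJ ^ 2 = 0 by linarith)
    · simpa [hb.ne, ha.ne] using (show (a * r') * z.imK ^ 2 = 0 by linarith)
  exact (AlgEquiv.ofBijective q.liftHom ⟨hinj,
    (LinearMap.injective_iff_surjective_of_finrank_eq_finrank (f := q.liftHom.toLinearMap)
      (by rw [hB.finrank_eq, QuaternionAlgebra.finrank_eq_four])).1 hinj⟩).symm

end Structure

end QuatForm
end

/-! ### Reduced trace, reduced norm and conjugation -/

noncomputable section

namespace QuatForm

open Quaternion

/-- `B` is isomorphic to a quaternion algebra `(-α, -β)` over `ℚ` with `α, β > 0`. -/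
class DefiniteQuaternion (B : Type*) [Ring B] [Algebra ℚ B] : Prop where
  exists_equiv : ∃ α β : ℚ, 0 < α ∧ 0 < β ∧ Nonempty (B ≃ₐ[ℚ] ℍ[ℚ,-α,0,-β])

section Basic

variable (B : Type*) [Ring B] [Algebra ℚ B] [hDQ : DefiniteQuaternion B]

/-- The first parameter of a definite quaternion algebra. -/
def paramI : ℚ := (DefiniteQuaternion.exists_equiv (B := B)).choose

/-- The second parameter of a definite quaternion algebra. -/
def paramJ : ℚ := (DefiniteQuaternion.exists_equiv (B := B)).choose_spec.choose

theorem paramI_pos : 0 < paramI B :=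
  (DefiniteQuaternion.exists_equiv (B := B)).choose_spec.choose_spec.1

theorem paramJ_pos : 0 < paramJ B :=
  (DefiniteQuaternion.exists_equiv (B := B)).choose_spec.choose_spec.2.1

/-- Quaternionic coordinates. -/
def quatEquiv : B ≃ₐ[ℚ] ℍ[ℚ,-paramI B,0,-paramJ B] :=
  (DefiniteQuaternion.exists_equiv (B := B)).choose_spec.choose_spec.2.2.some

variable {B}

/-- The reduced trace. -/
def trd : B →ₗ[ℚ] ℚ where
  toFun x := 2 * (quatEquiv B x).re
  map_add' x y := by rw [map_add, QuaternionAlgebra.re_add, mul_add]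
  map_smul' r x := by
    rw [map_smul, QuaternionAlgebra.re_smul, smul_eq_mul, smul_eq_mul, RingHom.id_apply]; ring

theorem trd_apply (x : B) : trd x = 2 * (quatEquiv B x).re := rfl

/-- The reduced norm. -/
def nrd (x : B) : ℚ :=
  (quatEquiv B x).re ^ 2 + paramI B * (quatEquiv B x).imI ^ 2 +
    paramJ B * (quatEquiv B x).imJ ^ 2 + paramI B * paramJ B * (quatEquiv B x).imK ^ 2

/-- Quaternion conjugation. -/
def qconj (x : B) : B := algebraMap ℚ B (trd x) - x

theorem add_qconj (x : B) : x + qconj x = algebraMap ℚ B (trd x) := by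
  rw [qconj]; abel

theorem quatEquiv_qconj (x : B) : quatEquiv B (qconj x) = star (quatEquiv B x) := by
  rw [qconj, map_sub, AlgEquiv.commutes, QuaternionAlgebra.star_eq_two_re_sub, trd_apply,
    QuaternionAlgebra.coe_algebraMap, zero_mul, add_zero]

theorem mul_qconj (x : B) : x * qconj x = algebraMap ℚ B (nrd x) := by
  apply (quatEquiv B).injective
  rw [map_mul, quatEquiv_qconj, QuaternionAlgebra.mul_star_eq_coe, AlgEquiv.commutes,
    QuaternionAlgebra.coe_algebraMap]
  congr 1
  simp only [QuaternionAlgebra.re_mul, QuaternionAlgebra.re_star, QuaternionAlgebra.imI_star,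
    QuaternionAlgebra.imJ_star, QuaternionAlgebra.imK_star, nrd]
  ring

theorem commute_qconj (x : B) : Commute x (qconj x) := by
  rw [qconj]
  exact Commute.sub_right (Algebra.commutes _ _ : Commute (algebraMap ℚ B (trd x)) x).symm
    (Commute.refl x)

theorem qconj_mul_self (x : B) : qconj x * x = algebraMap ℚ B (nrd x) := by
  rw [← mul_qconj, (commute_qconj x).eq]

theorem qconj_mul (x y : B) : qconj (x * y) = qconj y * qconj x := by
  apply (quatEquiv B).injective
  rw [quatEquiv_qconj, map_mul, map_mul, quatEquiv_qconj, quatEquiv_qconj, star_mul]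

theorem qconj_qconj (x : B) : qconj (qconj x) = x := by
  apply (quatEquiv B).injective
  rw [quatEquiv_qconj, quatEquiv_qconj, star_star]

@[simp] theorem trd_algebraMap (r : ℚ) : trd (algebraMap ℚ B r) = 2 * r := by
  rw [trd_apply, AlgEquiv.commutes, QuaternionAlgebra.algebraMap_eq]

@[simp] theorem trd_one : trd (1 : B) = 2 := by
  have := trd_algebraMap (B := B) 1
  rwa [map_one, mul_one] at this

@[simp] theorem trd_qconj (x : B) : trd (qconj x) = trd x := by
  rw [qconj, map_sub, trd_algebraMap]; ring

theorem qconj_add (x y : B) : qconj (x + y) = qconj x + qconj y := by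
  simp only [qconj, map_add]; abel

@[simp] theorem qconj_algebraMap (r : ℚ) : qconj (algebraMap ℚ B r) = algebraMap ℚ B r := by
  rw [qconj, trd_algebraMap, ← map_sub]; congr 1; ring

theorem qconj_of_trd_eq_zero {x : B} (h : trd x = 0) : qconj x = -x := by
  rw [qconj, h, map_zero, zero_sub]

theorem trd_mul_comm (x y : B) : trd (x * y) = trd (y * x) := by
  simp only [trd_apply, map_mul, QuaternionAlgebra.re_mul]; ring

theorem mul_self_eq (x : B) :
    x * x = algebraMap ℚ B (trd x) * x - algebraMap ℚ B (nrd x) := by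
  rw [← qconj_mul_self, ← sub_mul, qconj, sub_sub_cancel]

theorem nrd_nonneg (x : B) : 0 ≤ nrd x := by
  have := paramI_pos B
  have := paramJ_pos B
  unfold nrd; positivity

instance : Nontrivial B := (quatEquiv B).toRingEquiv.toEquiv.nontrivial

instance : CharZero B := algebraRat.charZero B

theorem nrd_eq_zero {x : B} : nrd x = 0 ↔ x = 0 := by
  have ha := paramI_pos B
  have hb := paramJ_pos B
  constructor
  · intro h
    unfold nrd at h
    have p1 := sq_nonneg (quatEquiv B x).re
    have p2 := mul_nonneg ha.le (sq_nonneg (quatEquiv B x).imI)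
    have p3 := mul_nonneg hb.le (sq_nonneg (quatEquiv B x).imJ)
    have p4 := mul_nonneg (mul_pos ha hb).le (sq_nonneg (quatEquiv B x).imK)
    apply (quatEquiv B).injective
    rw [map_zero]
    ext
    · simpa using (show (quatEquiv B x).re ^ 2 = 0 by linarith)
    · simpa [ha.ne'] using (show paramI B * (quatEquiv B x).imI ^ 2 = 0 by linarith)
    · simpa [hb.ne'] using (show paramJ B * (quatEquiv B x).imJ ^ 2 = 0 by linarith)
    · simpa [hb.ne', ha.ne'] using
        (show paramI B * paramJ B * (quatEquiv B x).imK ^ 2 = 0 by linarith)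
  · rintro rfl
    simp [nrd]

theorem nrd_pos {x : B} (h : x ≠ 0) : 0 < nrd x :=
  lt_of_le_of_ne (nrd_nonneg x) (fun h0 => h (nrd_eq_zero.1 h0.symm))

theorem algebraMap_injective' : Function.Injective (algebraMap ℚ B) :=
  (algebraMap ℚ B).injective

@[simp] theorem nrd_qconj (x : B) : nrd (qconj x) = nrd x := by
  apply algebraMap_injective' (B := B)
  rw [← mul_qconj, qconj_qconj, qconj_mul_self]

theorem nrd_mul (x y : B) : nrd (x * y) = nrd x * nrd y := by
  apply algebraMap_injective' (B := B)
  rw [← mul_qconj, qconj_mul, mul_assoc, ← mul_assoc y, mul_qconj, Algebra.commutes, ← mul_assoc,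
    mul_qconj, ← map_mul]

@[simp] theorem nrd_algebraMap (r : ℚ) : nrd (algebraMap ℚ B r) = r ^ 2 := by
  apply algebraMap_injective' (B := B)
  rw [← mul_qconj, qconj_algebraMap, ← map_mul, sq]

@[simp] theorem nrd_one : nrd (1 : B) = 1 := by
  have := nrd_algebraMap (B := B) 1
  rwa [map_one, one_pow] at this

@[simp] theorem nrd_zero : nrd (0 : B) = 0 := nrd_eq_zero.2 rfl

theorem nrd_smul (r : ℚ) (x : B) : nrd (r • x) = r ^ 2 * nrd x := by
  rw [Algebra.smul_def, nrd_mul, nrd_algebraMap]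

@[simp] theorem nrd_neg (x : B) : nrd (-x) = nrd x := by
  have := nrd_smul (-1) x
  simpa using this

theorem nrd_add (x y : B) : nrd (x + y) = nrd x + nrd y + trd (x * qconj y) := by
  apply algebraMap_injective' (B := B)
  have h : qconj (x * qconj y) = y * qconj x := by rw [qconj_mul, qconj_qconj]
  rw [← mul_qconj, qconj_add, map_add, map_add, ← add_qconj (x * qconj y), h, ← mul_qconj,
    ← mul_qconj, mul_add, add_mul, add_mul]
  abel

theorem nrd_one_add (x : B) : nrd (1 + x) = 1 + trd x + nrd x := by
  rw [nrd_add, nrd_one, one_mul, trd_qconj]; ring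

theorem trd_mul_qconj_self (x : B) : trd (x * qconj x) = 2 * nrd x := by
  rw [mul_qconj, trd_algebraMap]

theorem nrd_eq_of_trd (x : B) : nrd x = ((trd x) ^ 2 - trd (x * x)) / 2 := by
  rw [mul_self_eq, map_sub, trd_algebraMap, ← Algebra.smul_def, map_smul, smul_eq_mul]; ring

instance : NoZeroDivisors B where
  eq_zero_or_eq_zero_of_mul_eq_zero {x y} h := by
    have : nrd x * nrd y = 0 := by rw [← nrd_mul, h, nrd_zero]
    simpa [nrd_eq_zero] using this

instance : IsDomain B := NoZeroDivisors.to_isDomain B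

instance : FiniteDimensional ℚ B :=
  Module.Finite.equiv (quatEquiv B).symm.toLinearEquiv

theorem finrank_eq_four : Module.finrank ℚ B = 4 := by
  rw [(quatEquiv B).toLinearEquiv.finrank_eq, QuaternionAlgebra.finrank_eq_four]

/-- The inverse of a quaternion. -/
def qinv (x : B) : B := algebraMap ℚ B (nrd x)⁻¹ * qconj x

theorem mul_qinv {x : B} (h : x ≠ 0) : x * qinv x = 1 := by
  rw [qinv, ← mul_assoc, ← Algebra.commutes, mul_assoc, mul_qconj, ← map_mul,
    inv_mul_cancel₀ (nrd_pos h).ne', map_one]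

theorem qinv_mul {x : B} (h : x ≠ 0) : qinv x * x = 1 := by
  rw [qinv, mul_assoc, qconj_mul_self, ← map_mul, inv_mul_cancel₀ (nrd_pos h).ne', map_one]

/-- A nonzero quaternion as a unit. -/
def qunit (x : B) (h : x ≠ 0) : Bˣ := ⟨x, qinv x, mul_qinv h, qinv_mul h⟩

theorem nrd_qinv (x : B) : nrd (qinv x) = (nrd x)⁻¹ := by
  by_cases h : x = 0
  · simp [h, qinv]
  · rw [qinv, nrd_mul, nrd_algebraMap, nrd_qconj]
    field_simp [(nrd_pos h).ne']

theorem eq_zero_of_trd_mul {x : B} (h : ∀ y, trd (x * y) = 0) : x = 0 := by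
  have := h (qconj x)
  rw [trd_mul_qconj_self] at this
  exact nrd_eq_zero.1 (by linarith)

/-- Only the scalar coordinate enters the trace, and the other terms of the norm form are
nonnegative. The bound later turns congruences on traces into equalities. -/
theorem trd_sq_le (x : B) : (trd x) ^ 2 ≤ 4 * nrd x := by
  have ha := paramI_pos B
  have hb := paramJ_pos B
  rw [trd_apply, nrd]
  have p2 := mul_nonneg ha.le (sq_nonneg (quatEquiv B x).imI)
  have p3 := mul_nonneg hb.le (sq_nonneg (quatEquiv B x).imJ)
  have p4 := mul_nonneg (mul_pos ha hb).le (sq_nonneg (quatEquiv B x).imK)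
  nlinarith

theorem exists_algebraMap_eq_of_central {x : B} (h : ∀ y, x * y = y * x) : ∃ r : ℚ, algebraMap ℚ B r = x := by
  have ha := paramI_pos B
  have hb := paramJ_pos B
  have h' : ∀ y, quatEquiv B x * y = y * quatEquiv B x := by
    intro y
    obtain ⟨y, rfl⟩ := (quatEquiv B).surjective y
    rw [← map_mul, h, map_mul]
  have h1 := h' ⟨0, 1, 0, 0⟩
  have h2 := h' ⟨0, 0, 1, 0⟩
  refine ⟨(quatEquiv B x).re, (quatEquiv B).injective ?_⟩
  rw [AlgEquiv.commutes]
  have e1 := congrArg QuaternionAlgebra.imJ h1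
  have e2 := congrArg QuaternionAlgebra.imK h1
  have e3 := congrArg QuaternionAlgebra.imK h2
  simp only [QuaternionAlgebra.imJ_mul, QuaternionAlgebra.imK_mul] at e1 e2 e3
  ext
  · simp [QuaternionAlgebra.algebraMap_eq]
  · simp only [QuaternionAlgebra.algebraMap_eq]; linarith
  · simp only [QuaternionAlgebra.algebraMap_eq]; linarith
  · simp only [QuaternionAlgebra.algebraMap_eq]
    have : paramI B * (quatEquiv B x).imK = 0 := by linarith
    simpa [ha.ne', eq_comm] using this

/-- The entry point for integrality: on an order, left multiplication has an integral matrix, which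
makes twice the reduced trace an integer. -/
theorem trace_mulLeft (x : B) : LinearMap.trace ℚ B (LinearMap.mulLeft ℚ x) = 2 * trd x := by
  rw [LinearMap.trace_eq_matrix_trace ℚ
    ((QuaternionAlgebra.basisOneIJK _ _ _).map (quatEquiv B).symm.toLinearEquiv), Matrix.trace]
  simp only [Fin.sum_univ_four, Matrix.diag_apply, LinearMap.toMatrix_apply, Module.Basis.map_apply,
    Module.Basis.map_repr, LinearMap.mulLeft_apply, LinearEquiv.trans_apply]
  have h : ∀ i, (quatEquiv B).symm.toLinearEquiv.symm
      (x * (quatEquiv B).symm.toLinearEquiv (QuaternionAlgebra.basisOneIJK _ _ _ i)) =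
      quatEquiv B x * QuaternionAlgebra.basisOneIJK _ _ _ i := by
    intro i
    apply (quatEquiv B).symm.injective
    simp
  simp only [h, QuaternionAlgebra.coe_basisOneIJK_repr]
  have hb : ∀ i, QuaternionAlgebra.basisOneIJK (-paramI B) 0 (-paramJ B) i =
    ⟨if i = 0 then 1 else 0, if i = 1 then 1 else 0, if i = 2 then 1 else 0,
      if i = 3 then 1 else 0⟩ := by
    intro i
    fin_cases i <;> simp [QuaternionAlgebra.basisOneIJK]
  simp [hb, trd_apply]
  ring

end Basic

end QuatForm
end

/-! ### Ramified and split primes -/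

noncomputable section

namespace QuatForm

open Quaternion

theorem ramifiedPrimes_eq_singleton {B : Type*} [Ring B] [Algebra ℚ B] {N : ℕ} (hN : N.Prime)
    (h : discriminant B = N) : ramifiedPrimes B = {N} := by
  have hprime : ∀ p ∈ ramifiedPrimes B, p.Prime := fun p ⟨hp, _⟩ => hp.out
  -- A `finprod` over infinitely many nontrivial factors has the default value 1, so `N ≠ 1` already
  -- forces finiteness.
  have hfin : (ramifiedPrimes B).Finite := by
    by_contra hinf
    have hs : ramifiedPrimes B ∩ Function.mulSupport (fun p : ℕ => p) = ramifiedPrimes B :=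
      Set.inter_eq_left.2 fun p hp => (hprime p hp).ne_one
    have : discriminant B = 1 := finprod_mem_eq_one_of_infinite (by rw [hs]; exact hinf)
    rw [h] at this
    exact hN.ne_one this
  have hprod : ∏ p ∈ hfin.toFinset, p = N := by
    rw [← h, discriminant, finprod_mem_eq_finite_toFinset_prod _ hfin]
  have hdvd : ∀ p ∈ ramifiedPrimes B, p = N := fun p hp =>
    (Nat.prime_dvd_prime_iff_eq (hprime p hp) hN).1
      (hprod ▸ Finset.dvd_prod_of_mem (fun p => p) (hfin.mem_toFinset.2 hp))
  refine Set.eq_singleton_iff_unique_mem.2 ⟨?_, hdvd⟩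
  by_contra hne
  have : hfin.toFinset = ∅ := by
    refine Finset.eq_empty_of_forall_notMem fun p hp => hne ?_
    have hp' := hfin.mem_toFinset.1 hp
    rwa [hdvd p hp'] at hp'
  rw [this, Finset.prod_empty] at hprod
  exact hN.ne_one hprod.symm

theorem IsQuaternionAlgebra.definiteQuaternion {B : Type*} [Ring B] [Algebra ℚ B]
    (hB : IsQuaternionAlgebra B) (hdef : IsDefinite B) : DefiniteQuaternion B :=
  ⟨hB.exists_equiv hdef⟩

section Local

variable {B : Type*} [Ring B] [Algebra ℚ B] [DefiniteQuaternion B] {p : ℕ}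

/-- Substituting `r = t z` gives `z² - z + n / t² = 0`, whose constant term is small and whose
derivative at 0 is a unit, so Hensel's lemma applies at 0. -/
theorem exists_root_of_norm_lt [hp : Fact p.Prime] {t n : ℚ_[p]} (ht : 1 < ‖t‖) (hn : ‖n‖ ≤ 1) :
    ∃ r : ℚ_[p], r * (t - r) = n := by
  have ht0 : t ≠ 0 := by rintro rfl; simp at ht; linarith
  have hc : ‖n / t ^ 2‖ < 1 := by
    rw [norm_div, norm_pow, div_lt_one (by positivity)]
    nlinarith
  let c : ℤ_[p] := ⟨n / t ^ 2, hc.le⟩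
  let F : Polynomial ℤ_[p] := Polynomial.X ^ 2 - Polynomial.X + Polynomial.C c
  obtain ⟨z, hz, -⟩ := hensels_lemma (p := p) (F := F) (a := 0) (by
    simp only [F, Polynomial.derivative_add, Polynomial.derivative_sub,
      Polynomial.derivative_X_pow, Polynomial.derivative_X, Polynomial.derivative_C, map_add,
      map_sub, map_pow, Polynomial.aeval_X, Polynomial.aeval_C, map_mul, map_one]
    rw [Algebra.algebraMap_self, RingHom.id_apply]
    have hc' : ‖c‖ < 1 := hc
    simpa using hc')
  refine ⟨t * z, ?_⟩
  have hz' : (z : ℚ_[p]) ^ 2 - z + n / t ^ 2 = 0 := by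
    have hz1 : z ^ 2 - z + c = 0 := by simpa [F] using hz
    exact congrArg (fun x : ℤ_[p] => (x : ℚ_[p])) hz1
  field_simp at hz'
  linear_combination -hz'

/-- With integral norm and nonintegral trace the reduced characteristic polynomial would split over
`ℚ_p`, giving zero divisors in `ℚ_p ⊗ B` unless `x` is a scalar; a scalar of integral norm has
integral trace. -/
theorem padicNorm_trd_le (h : p ∈ ramifiedPrimes B) {x : B} (hx : padicNorm p (nrd x) ≤ 1) :
    padicNorm p (trd x) ≤ 1 := by
  obtain ⟨hp, hdiv⟩ := h
  by_contra ht
  push Not at ht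
  obtain ⟨r, hr⟩ := exists_root_of_norm_lt (p := p) (t := (trd x : ℚ_[p])) (n := (nrd x : ℚ_[p]))
    (by rw [Padic.eq_padicNorm]; exact_mod_cast ht) (by rw [Padic.eq_padicNorm]; exact_mod_cast hx)
  set X : ℚ_[p] ⊗[ℚ] B := Algebra.TensorProduct.includeRight x with hX
  have hinj : Function.Injective (Algebra.TensorProduct.includeRight : B →ₐ[ℚ] ℚ_[p] ⊗[ℚ] B) :=
    Algebra.TensorProduct.includeRight_injective (algebraMap ℚ ℚ_[p]).injective
  have hcen : ∀ s : ℚ_[p], X ≠ algebraMap ℚ_[p] _ s := by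
    intro s hs
    obtain ⟨q, hq⟩ := exists_algebraMap_eq_of_central (x := x) (fun y => hinj (by
      rw [map_mul, map_mul, ← hX, hs, Algebra.commutes]))
    rw [← hq, nrd_algebraMap, sq, padicNorm.mul] at hx
    rw [← hq, trd_algebraMap, padicNorm.mul] at ht
    have h2 : padicNorm p (2 : ℚ) ≤ 1 := by exact_mod_cast padicNorm.of_int (p := p) 2
    have := padicNorm.nonneg (p := p) q
    nlinarith [padicNorm.nonneg (p := p) 2]
  have hXX : X * X = algebraMap ℚ_[p] _ (trd x : ℚ_[p]) * X - algebraMap ℚ_[p] _ (nrd x : ℚ_[p]) := by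
    have : ∀ q : ℚ, (algebraMap ℚ_[p] (ℚ_[p] ⊗[ℚ] B) (q : ℚ_[p])) =
        Algebra.TensorProduct.includeRight (algebraMap ℚ B q) := by
      intro q
      rw [AlgHom.commutes, IsScalarTower.algebraMap_apply ℚ ℚ_[p] (ℚ_[p] ⊗[ℚ] B)]
      simp
    rw [this, this, hX, ← map_mul, ← map_mul, ← map_sub, mul_self_eq]
  have hprod : (X - algebraMap ℚ_[p] _ r) * (X - algebraMap ℚ_[p] _ ((trd x : ℚ_[p]) - r)) = 0 := by
    rw [sub_mul, mul_sub, mul_sub, hXX, ← map_mul, hr, ← Algebra.commutes _ X, map_sub, sub_mul]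
    abel
  have := (hdiv _ (sub_ne_zero.2 (hcen r))).mul_right_eq_zero.1 hprod
  exact hcen _ (sub_eq_zero.1 this)

theorem isUnit_of_norm_ne_zero {F : Type*} [Field F] {a c : F} {z : ℍ[F,a,0,c]}
    (h : z.re ^ 2 - a * z.imI ^ 2 - c * z.imJ ^ 2 + a * c * z.imK ^ 2 ≠ 0) : IsUnit z := by
  set n := z.re ^ 2 - a * z.imI ^ 2 - c * z.imJ ^ 2 + a * c * z.imK ^ 2 with hn
  have h1 : z * star z = (n : ℍ[F,a,0,c]) := by
    rw [QuaternionAlgebra.mul_star_eq_coe]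
    congr 1
    simp only [QuaternionAlgebra.re_mul, QuaternionAlgebra.re_star, QuaternionAlgebra.imI_star,
      QuaternionAlgebra.imJ_star, QuaternionAlgebra.imK_star, hn]
    ring
  have h2 : star z * z = (n : ℍ[F,a,0,c]) := by
    rw [QuaternionAlgebra.star_mul_eq_coe]
    congr 1
    simp only [QuaternionAlgebra.re_mul, QuaternionAlgebra.re_star, QuaternionAlgebra.imI_star,
      QuaternionAlgebra.imJ_star, QuaternionAlgebra.imK_star, hn]
    ring
  refine ⟨⟨z, n⁻¹ • star z, ?_, ?_⟩, rfl⟩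
  · rw [mul_smul_comm, h1, QuaternionAlgebra.smul_coe, inv_mul_cancel₀ h, QuaternionAlgebra.coe_one]
  · rw [smul_mul_assoc, h2, QuaternionAlgebra.smul_coe, inv_mul_cancel₀ h,
      QuaternionAlgebra.coe_one]

/-- The norm form is a norm from `F(√a)` minus `c` times another, so a zero exhibits `c` as a
quotient of norms, hence as a norm. If the divisor vanishes, `a` is a square and `u² - a v²`
represents everything. -/
theorem exists_norm_eq_of_isotropic {F : Type*} [Field F] [NeZero (2 : F)] {a c : F} (ha : a ≠ 0)
    {z : ℍ[F,a,0,c]} (hz : z ≠ 0)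
    (h : z.re ^ 2 - a * z.imI ^ 2 - c * z.imJ ^ 2 + a * c * z.imK ^ 2 = 0) :
    ∃ u v : F, u ^ 2 - a * v ^ 2 = c := by
  by_cases hd : z.imJ ^ 2 - a * z.imK ^ 2 = 0
  · obtain ⟨e, he⟩ : ∃ e, a = e ^ 2 := by
      by_cases hK : z.imK = 0
      · have hJ : z.imJ = 0 := by simpa [hK] using hd
        by_cases hI : z.imI = 0
        · have hR : z.re = 0 := by simpa [hK, hJ, hI] using h
          exact absurd (by ext <;> simp [hR, hI, hJ, hK]) hz
        · refine ⟨z.re / z.imI, ?_⟩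
          rw [hK, hJ] at h
          field_simp
          linear_combination -h
      · refine ⟨z.imJ / z.imK, ?_⟩
        field_simp
        linear_combination -hd
    have he0 : e ≠ 0 := by rintro rfl; apply ha; rw [he]; ring
    have h2 : (2 : F) ≠ 0 := NeZero.ne 2
    refine ⟨(c + 1) / 2, (c - 1) / (2 * e), ?_⟩
    rw [he]
    field_simp
    ring
  · refine ⟨(z.re * z.imJ - a * z.imI * z.imK) / (z.imJ ^ 2 - a * z.imK ^ 2),
      (z.imI * z.imJ - z.re * z.imK) / (z.imJ ^ 2 - a * z.imK ^ 2), ?_⟩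
    field_simp
    linear_combination (z.imJ ^ 2 - a * z.imK ^ 2) * h

/-- The splitting of a quaternion algebra at an unramified prime. -/
theorem exists_splitting (hp : p.Prime) (h : p ∉ ramifiedPrimes B) :
    haveI : Fact p.Prime := ⟨hp⟩
    ∃ f : B →ₐ[ℚ] Matrix (Fin 2) (Fin 2) ℚ_[p], (∀ x, (f x).trace = trd x) ∧
      ∀ x, (f x).det = nrd x := by
  have : Fact p.Prime := ⟨hp⟩
  set α := paramI B with hα
  set β := paramJ B with hβ
  have hα0 : α ≠ 0 := (paramI_pos B).ne'
  obtain ⟨x, hx0, hxu⟩ : ∃ x : ℚ_[p] ⊗[ℚ] B, x ≠ 0 ∧ ¬ IsUnit x := by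
    by_contra hc
    push Not at hc
    exact h ⟨this, hc⟩
  let e := quatEquiv B
  let qB : QuaternionAlgebra.Basis B (-α) 0 (-β) := (QuaternionAlgebra.Basis.self ℚ).compHom
    (e.symm : _ →ₐ[ℚ] B)
  let inc : B →ₐ[ℚ] ℚ_[p] ⊗[ℚ] B := Algebra.TensorProduct.includeRight
  have hsm : ∀ (r : ℚ) (y : ℚ_[p] ⊗[ℚ] B), r • y = ((r : ℚ_[p])) • y := fun r y => by
    rw [← algebraMap_smul ℚ_[p] r y]; rfl
  let q : QuaternionAlgebra.Basis (ℚ_[p] ⊗[ℚ] B) (-(α : ℚ_[p])) 0 (-(β : ℚ_[p])) :=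
    { i := inc qB.i
      j := inc qB.j
      k := inc qB.k
      i_mul_i := by rw [← map_mul, qB.i_mul_i, map_add, map_smul, map_smul, hsm]; simp
      j_mul_j := by rw [← map_mul, qB.j_mul_j, map_smul, hsm]; simp
      i_mul_j := by rw [← map_mul, qB.i_mul_j]
      j_mul_i := by rw [← map_mul, qB.j_mul_i]; simp }
  have hrange : ∀ y : ℚ_[p] ⊗[ℚ] B, ∃ z, q.liftHom z = y := by
    intro y
    induction y using TensorProduct.induction_on with
    | zero => exact ⟨0, map_zero _⟩
    | add y z hy hz =>
      obtain ⟨a, rfl⟩ := hy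
      obtain ⟨b, rfl⟩ := hz
      exact ⟨a + b, map_add _ _ _⟩
    | tmul r b =>
      obtain ⟨w, rfl⟩ := e.symm.surjective b
      refine ⟨r • ⟨w.re, w.imI, w.imJ, w.imK⟩, ?_⟩
      rw [map_smul]
      have hw : e.symm w = w.re • (1 : B) + w.imI • qB.i + w.imJ • qB.j + w.imK • qB.k := by
        apply e.injective
        have h1 : e qB.i = ⟨0, 1, 0, 0⟩ := e.apply_symm_apply _
        have h2 : e qB.j = ⟨0, 0, 1, 0⟩ := e.apply_symm_apply _
        have h3 : e qB.k = ⟨0, 0, 0, 1⟩ := e.apply_symm_apply _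
        simp only [map_add, map_smul, h1, h2, h3, AlgEquiv.apply_symm_apply, map_one]
        ext <;> simp
      rw [hw]
      have : r ⊗ₜ[ℚ] (w.re • (1 : B) + w.imI • qB.i + w.imJ • qB.j + w.imK • qB.k) =
          r • inc (w.re • (1 : B) + w.imI • qB.i + w.imJ • qB.j + w.imK • qB.k) := by
        simp [inc, TensorProduct.smul_tmul', ← TensorProduct.tmul_add]
      rw [this]
      simp only [map_add, map_smul, hsm, map_one]
      congr 1
      simp only [QuaternionAlgebra.Basis.liftHom_apply, QuaternionAlgebra.Basis.lift,
        Algebra.algebraMap_eq_smul_one]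
      rfl
  obtain ⟨z, rfl⟩ := hrange x
  have hz0 : z ≠ 0 := by rintro rfl; exact hx0 (map_zero _)
  obtain ⟨u, v, huv⟩ := exists_norm_eq_of_isotropic (by simpa using hα0) hz0
    (not_not.1 fun hn => hxu ((isUnit_of_norm_ne_zero hn).map q.liftHom))
  have hsm' : ∀ (r : ℚ) (y : Matrix (Fin 2) (Fin 2) ℚ_[p]), r • y = ((r : ℚ_[p])) • y :=
    fun r y => by rw [← algebraMap_smul ℚ_[p] r y]; rfl
  -- `i` is the companion matrix of `X² + α`, and `j` is a matrix anticommuting with it whose square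
  -- is `u² + α v² = -β`.
  let m : QuaternionAlgebra.Basis (Matrix (Fin 2) (Fin 2) ℚ_[p]) (-α) 0 (-β) :=
    { i := !![0, -α; 1, 0]
      j := !![u, α * v; v, -u]
      k := !![0, -(α : ℚ_[p]); 1, 0] * !![u, α * v; v, -u]
      i_mul_i := by
        rw [hsm']
        ext i j; fin_cases i <;> fin_cases j <;> simp [Matrix.mul_apply]
      j_mul_j := by
        rw [hsm']
        ext i j
        fin_cases i <;> fin_cases j <;> simp [Matrix.mul_apply] <;>
          first | ring1 | linear_combination huv
      i_mul_j := rfl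
      j_mul_i := by
        ext i j; fin_cases i <;> fin_cases j <;> simp [Matrix.mul_apply, mul_comm] }
  refine ⟨m.liftHom.comp (e : B →ₐ[ℚ] _), fun x => ?_, fun x => ?_⟩
  · simp only [AlgHom.comp_apply, QuaternionAlgebra.Basis.liftHom_apply,
      QuaternionAlgebra.Basis.lift, Algebra.algebraMap_eq_smul_one, hsm', trd_apply, m]
    simp [Matrix.trace_fin_two, Matrix.mul_apply, e]
    ring
  · simp only [AlgHom.comp_apply, QuaternionAlgebra.Basis.liftHom_apply,
      QuaternionAlgebra.Basis.lift, Algebra.algebraMap_eq_smul_one, hsm', nrd, m]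
    simp [Matrix.det_fin_two, Matrix.mul_apply, e]
    change _ = ((quatEquiv B x).re : ℚ_[p]) ^ 2 + (α : ℚ_[p]) * ((quatEquiv B x).imI : ℚ_[p]) ^ 2 +
      (β : ℚ_[p]) * ((quatEquiv B x).imJ : ℚ_[p]) ^ 2 +
      (α : ℚ_[p]) * (β : ℚ_[p]) * ((quatEquiv B x).imK : ℚ_[p]) ^ 2
    linear_combination (-((quatEquiv B x).imJ : ℚ_[p]) ^ 2 -
      (α : ℚ_[p]) * ((quatEquiv B x).imK : ℚ_[p]) ^ 2) * huv

end Local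

end QuatForm
end

/-! ### Lattices, integrality on orders and the trace dual -/

noncomputable section

namespace QuatForm

section LatticeGeneral

variable {V : Type*} [AddCommGroup V] [Module ℚ V]

theorem exists_zsmul_mem {I : Submodule ℤ V} (hI : Submodule.IsLattice ℚ I) (x : V) :
    ∃ m : ℕ, 0 < m ∧ (m : ℤ) • x ∈ I := by
  have hx : x ∈ Submodule.span ℚ (I : Set V) := by rw [hI.span_eq_top]; trivial
  induction hx using Submodule.span_induction with
  | mem x h => exact ⟨1, one_pos, by simpa using h⟩
  | zero => exact ⟨1, one_pos, by simp⟩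
  | add x y _ _ hx hy =>
    obtain ⟨m, hm, h1⟩ := hx
    obtain ⟨n, hn, h2⟩ := hy
    refine ⟨m * n, Nat.mul_pos hm hn, ?_⟩
    rw [smul_add]
    refine I.add_mem ?_ ?_
    · rw [Nat.cast_mul, mul_comm, mul_smul]; exact I.smul_mem _ h1
    · rw [Nat.cast_mul, mul_smul]; exact I.smul_mem _ h2
  | smul q x _ hx =>
    obtain ⟨m, hm, h1⟩ := hx
    refine ⟨q.den * m, Nat.mul_pos q.den_pos hm, ?_⟩
    have : ((q.den * m : ℕ) : ℤ) • q • x = q.num • (m : ℤ) • x := by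
      rw [← Int.cast_smul_eq_zsmul ℚ, ← Int.cast_smul_eq_zsmul ℚ, ← Int.cast_smul_eq_zsmul ℚ,
        smul_smul, smul_smul]
      congr 1
      push_cast
      nth_rewrite 2 [← Rat.num_div_den q]
      have := q.den_nz
      field_simp
    rw [this]
    exact I.smul_mem _ h1

theorem exists_zsmul_le {I J : Submodule ℤ V} (hI : Submodule.IsLattice ℚ I) (hJ : J.FG) :
    ∃ m : ℕ, 0 < m ∧ ∀ x ∈ J, (m : ℤ) • x ∈ I := by
  classical
  obtain ⟨s, rfl⟩ := hJ
  choose f hf0 hf using fun x => exists_zsmul_mem hI x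
  refine ⟨∏ x ∈ s, f x, Finset.prod_pos fun x _ => hf0 x, fun x hx => ?_⟩
  induction hx using Submodule.span_induction with
  | mem x h =>
    rw [← Finset.mul_prod_erase s f h, Nat.cast_mul, mul_comm, mul_smul]
    exact I.smul_mem _ (hf x)
  | zero => simp
  | add x y _ _ hx hy => rw [smul_add]; exact I.add_mem hx hy
  | smul a x _ hx => rw [smul_comm]; exact I.smul_mem _ hx

theorem isLattice_of_le_of_le {I J K : Submodule ℤ V} (hI : Submodule.IsLattice ℚ I)
    (hK : K.FG) (h1 : I ≤ J) (h2 : J ≤ K) : Submodule.IsLattice ℚ J := by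
  have : Module.Finite ℤ K := Module.Finite.iff_fg.2 hK
  have : IsNoetherian ℤ J := isNoetherian_of_le h2
  exact Submodule.IsLattice.of_le_of_isLattice_of_fg ℚ h1 (Module.Finite.iff_fg.1 inferInstance)

omit [Module ℚ V] in
/-- A lattice between `m L` and `L` that surjects onto `L / p L` for all `p` is `L`. -/
theorem eq_of_forall_prime {T L : Submodule ℤ V} (hTL : T ≤ L) {m : ℕ} (hm : 0 < m)
    (hmT : ∀ x ∈ L, (m : ℤ) • x ∈ T)
    (hp : ∀ p : ℕ, p.Prime → p ∣ m → ∀ x ∈ L, ∃ t ∈ T, ∃ y ∈ L, x = t + (p : ℤ) • y) : T = L := by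
  refine le_antisymm hTL ?_
  induction m using Nat.strong_induction_on with
  | _ m ih =>
    by_cases h1 : m = 1
    · subst h1; intro x hx; simpa using hmT x hx
    · obtain ⟨p, hpp, k, rfl⟩ := Nat.exists_prime_and_dvd h1
      have hk : 0 < k := Nat.pos_of_mul_pos_left hm
      refine ih k ?_ hk ?_ ?_
      · nlinarith [hpp.two_le]
      · intro x hx
        obtain ⟨t, ht, y, hy, rfl⟩ := hp p hpp (dvd_mul_right _ _) x hx
        rw [smul_add, smul_smul]
        refine T.add_mem (T.smul_mem _ ht) ?_
        have := hmT y hy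
        rwa [Nat.cast_mul, mul_comm] at this
      · intro q hq hqk
        exact hp q hq (hqk.mul_left p)

theorem exists_basis_of_isLattice [FiniteDimensional ℚ V] {I : Submodule ℤ V}
    (hI : Submodule.IsLattice ℚ I) {d : ℕ} (hd : Module.finrank ℚ V = d) :
    ∃ b : Module.Basis (Fin d) ℚ V, I = Submodule.span ℤ (Set.range b) := by
  let b := Module.Free.chooseBasis ℤ I
  let b' := b.extendOfIsLattice ℚ
  have hcard : Fintype.card (Module.Free.ChooseBasisIndex ℤ I) = d := by
    rw [← hd, Module.finrank_eq_card_basis b']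
  refine ⟨b'.reindex (Fintype.equivFinOfCardEq hcard), ?_⟩
  rw [Module.Basis.range_reindex]
  have : Set.range b' = Submodule.subtype I '' Set.range b := by
    rw [← Set.range_comp]
    congr 1
    ext i
    simp [b']
  rw [this, ← Submodule.map_span, b.span_eq, Submodule.map_top, Submodule.range_subtype]

theorem repr_mem_int {ι : Type*} [Finite ι] (b : Module.Basis ι ℚ V) {x : V}
    (hx : x ∈ Submodule.span ℤ (Set.range b)) (i : ι) : ∃ z : ℤ, b.repr x i = z := by
  obtain ⟨c, hc⟩ := (b.mem_span_iff_repr_mem ℤ x).1 hx i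
  exact ⟨c, hc.symm⟩

end LatticeGeneral

section Orders

variable {B : Type*} [Ring B] [Algebra ℚ B] [DefiniteQuaternion B]

theorem two_mul_trd_int {O : Subalgebra ℤ B} (hO : IsOrder O) {x : B} (hx : x ∈ O) :
    ∃ z : ℤ, 2 * trd x = z := by
  obtain ⟨b, hb⟩ := exists_basis_of_isLattice hO finrank_eq_four
  have hmem : ∀ i, b i ∈ O := fun i => by
    rw [← Subalgebra.mem_toSubmodule, hb]
    exact Submodule.subset_span ⟨i, rfl⟩
  rw [← trace_mulLeft, LinearMap.trace_eq_matrix_trace ℚ b, Matrix.trace]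
  have : ∀ i, ∃ z : ℤ, Matrix.diag (LinearMap.toMatrix b b (LinearMap.mulLeft ℚ x)) i = z := by
    intro i
    rw [Matrix.diag_apply, LinearMap.toMatrix_apply, LinearMap.mulLeft_apply]
    apply repr_mem_int
    rw [← hb, Subalgebra.mem_toSubmodule]
    exact O.mul_mem hx (hmem i)
  choose z hz using this
  exact ⟨∑ i, z i, by rw [Finset.sum_congr rfl fun i _ => hz i]; push_cast; rfl⟩

theorem int_of_two_mul_of_sq {r : ℚ} (h1 : ∃ z : ℤ, 2 * r = z) (h2 : ∃ z : ℤ, 2 * r ^ 2 = z) :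
    ∃ z : ℤ, r = z := by
  obtain ⟨a, ha⟩ := h1
  obtain ⟨b, hb⟩ := h2
  have h : a ^ 2 = 2 * b := by
    have : (a : ℚ) ^ 2 = 2 * b := by rw [← ha, ← hb]; ring
    exact_mod_cast this
  have h2 : (2 : ℤ) ∣ a := Int.prime_two.dvd_of_dvd_pow (dvd_of_mul_right_eq _ h.symm)
  obtain ⟨c, rfl⟩ := h2
  exact ⟨c, by push_cast at ha; linarith⟩

/-- Only twice the trace is known to be integral. Writing `a`, `b`, `d` for the doubled traces of
`x`, `x²`, `x⁴`, the identity `nrd (x²) = (nrd x)²` becomes `16 d = 8 b² - (a² - 2 b)²`, which makes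
`a` even. -/
theorem trd_int {O : Subalgebra ℤ B} (hO : IsOrder O) {x : B} (hx : x ∈ O) :
    ∃ z : ℤ, trd x = z := by
  obtain ⟨a, ha⟩ := two_mul_trd_int hO hx
  obtain ⟨b, hb⟩ := two_mul_trd_int hO (O.mul_mem hx hx)
  obtain ⟨d, hd⟩ := two_mul_trd_int hO (O.mul_mem (O.mul_mem hx hx) (O.mul_mem hx hx))
  have h1 := nrd_eq_of_trd x
  have h2 := nrd_eq_of_trd (x * x)
  rw [nrd_mul] at h2
  have h3 : 16 * d = 8 * b ^ 2 - (a ^ 2 - 2 * b) ^ 2 := by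
    have : (16 * d : ℚ) = 8 * b ^ 2 - (a ^ 2 - 2 * b) ^ 2 := by
      rw [← ha, ← hb, ← hd]
      have e1 : (2 * trd x) ^ 2 - 2 * (2 * trd (x * x)) = 8 * nrd x := by linarith
      rw [e1]
      linarith
    exact_mod_cast this
  have h4 : Even ((a ^ 2 - 2 * b) ^ 2) := ⟨4 * b ^ 2 - 8 * d, by linarith⟩
  have h5 : Even (a ^ 2) := by
    have := (Int.even_pow.1 h4).1
    rw [Int.even_sub] at this
    exact this.2 (even_two_mul b)
  obtain ⟨c, hc⟩ := (Int.even_pow.1 h5).1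
  exact ⟨c, by rw [hc] at ha; push_cast at ha; linarith⟩

/-- `2 nrd` is integral on the order; applied to `x²` this makes `2 (nrd x)²` integral too, and the
two together exclude half-integers. -/
theorem nrd_int {O : Subalgebra ℤ B} (hO : IsOrder O) {x : B} (hx : x ∈ O) :
    ∃ z : ℤ, nrd x = z := by
  have key : ∀ y ∈ O, ∃ z : ℤ, 2 * nrd y = z := by
    intro y hy
    obtain ⟨a, ha⟩ := trd_int hO hy
    obtain ⟨b, hb⟩ := trd_int hO (O.mul_mem hy hy)
    refine ⟨a ^ 2 - b, ?_⟩
    rw [nrd_eq_of_trd, ha, hb]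
    push_cast; ring
  refine int_of_two_mul_of_sq (key x hx) ?_
  obtain ⟨z, hz⟩ := key _ (O.mul_mem hx hx)
  exact ⟨z, by rw [← hz, nrd_mul]; ring⟩

/-- The bilinear form `trd (x y)`. -/
def trdForm (B : Type*) [Ring B] [Algebra ℚ B] [DefiniteQuaternion B] :
    LinearMap.BilinForm ℚ B := (LinearMap.mul ℚ B).compr₂ trd

theorem trdForm_apply (x y : B) : trdForm B x y = trd (x * y) := rfl

theorem trdForm_isSymm : (trdForm B).IsSymm := ⟨fun x y => by
  simp only [trdForm_apply, trd_mul_comm]⟩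

theorem trdForm_nondegenerate : (trdForm B).Nondegenerate := by
  refine ⟨fun x hx => eq_zero_of_trd_mul fun y => hx y, fun x hx => eq_zero_of_trd_mul fun y => ?_⟩
  rw [trd_mul_comm]; exact hx y

/-- The trace dual of a lattice. -/
def trdDual (I : Submodule ℤ B) : Submodule ℤ B := (trdForm B).dualSubmodule I

theorem mem_trdDual {I : Submodule ℤ B} {x : B} :
    x ∈ trdDual I ↔ ∀ y ∈ I, ∃ z : ℤ, trd (x * y) = z := by
  rw [trdDual, LinearMap.BilinForm.mem_dualSubmodule]
  refine forall₂_congr fun y _ => ?_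
  rw [trdForm_apply, Submodule.mem_one]
  exact ⟨fun ⟨z, hz⟩ => ⟨z, hz.symm⟩, fun ⟨z, hz⟩ => ⟨z, hz.symm⟩⟩

theorem isLattice_span_basis {V ι : Type*} [AddCommGroup V] [Module ℚ V] [Finite ι]
    (b : Module.Basis ι ℚ V) : Submodule.IsLattice ℚ (Submodule.span ℤ (Set.range b)) where
  fg := Submodule.fg_span (Set.finite_range b)
  span_eq_top := by rw [Submodule.span_span_of_tower, b.span_eq]

theorem isLattice_trdDual {I : Submodule ℤ B} (hI : Submodule.IsLattice ℚ I) :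
    Submodule.IsLattice ℚ (trdDual I) := by
  obtain ⟨b, rfl⟩ := exists_basis_of_isLattice hI finrank_eq_four
  rw [trdDual, LinearMap.BilinForm.dualSubmodule_span_of_basis _ trdForm_nondegenerate]
  exact isLattice_span_basis _

theorem trdDual_trdDual {I : Submodule ℤ B} (hI : Submodule.IsLattice ℚ I) :
    trdDual (trdDual I) = I := by
  obtain ⟨b, rfl⟩ := exists_basis_of_isLattice hI finrank_eq_four
  exact LinearMap.BilinForm.dualSubmodule_dualSubmodule_of_basis _ trdForm_nondegenerate
    trdForm_isSymm b

theorem trdDual_anti {I J : Submodule ℤ B} (h : I ≤ J) : trdDual J ≤ trdDual I := fun _ hx =>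
  mem_trdDual.2 fun y hy => mem_trdDual.1 hx y (h hy)

omit [DefiniteQuaternion B] in
theorem IsMaximalOrder.isLattice {O : Subalgebra ℤ B} (hO : IsMaximalOrder O) :
    Submodule.IsLattice ℚ (Subalgebra.toSubmodule O) := hO.1

/-- A ring containing a maximal order with integral traces is that order. -/
theorem IsMaximalOrder.eq_of_le {O O' : Subalgebra ℤ B} (hO : IsMaximalOrder O) (h : O ≤ O')
    (ht : ∀ x ∈ O', ∃ z : ℤ, trd x = z) : O' = O := by
  refine le_antisymm (hO.2 ?_ h) h
  -- Products stay in `O'` and have integral trace, so `O'` lies between `O` and the trace dual of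
  -- `O`.
  refine isLattice_of_le_of_le hO.isLattice (isLattice_trdDual hO.isLattice).fg h ?_
  exact fun x hx => mem_trdDual.2 fun y hy => ht _ (O'.mul_mem hx (h hy))

theorem qconj_mem {O : Subalgebra ℤ B} (hO : IsOrder O) {x : B} (hx : x ∈ O) : qconj x ∈ O := by
  obtain ⟨z, hz⟩ := trd_int hO hx
  rw [qconj, hz, map_intCast]
  exact O.sub_mem (intCast_mem O z) hx

end Orders

end QuatForm
end

/-! ### Reduction of a maximal order at a prime `p ≠ N` -/

noncomputable section

namespace QuatForm

/-- The local conditions on a definite quaternion algebra of prime discriminant `N > 3`. -/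
class RamifiedOnlyAt (B : Type*) [Ring B] [Algebra ℚ B] [DefiniteQuaternion B] (N : ℕ) :
    Prop where
  prime : N.Prime
  three_lt : 3 < N
  padicNorm_trd_le : ∀ x : B, padicNorm N (nrd x) ≤ 1 → padicNorm N (trd x) ≤ 1
  split : ∀ (p : ℕ) [Fact p.Prime], p ≠ N →
    ∃ f : B →ₐ[ℚ] Matrix (Fin 2) (Fin 2) ℚ_[p], (∀ x, (f x).trace = trd x) ∧
      ∀ x, (f x).det = nrd x

theorem ramifiedOnlyAt {B : Type*} [Ring B] [Algebra ℚ B] [DefiniteQuaternion B] {N : ℕ}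
    (hN : N.Prime) (hN3 : 3 < N) (h : discriminant B = N) : RamifiedOnlyAt B N where
  prime := hN
  three_lt := hN3
  padicNorm_trd_le x hx := by
    refine QuatForm.padicNorm_trd_le ?_ hx
    rw [ramifiedPrimes_eq_singleton hN h]
    rfl
  split p hp hpN := by
    refine exists_splitting hp.out ?_
    rw [ramifiedPrimes_eq_singleton hN h]
    exact hpN

theorem padicNorm_pow {p : ℕ} [Fact p.Prime] (r : ℚ) (k : ℕ) :
    padicNorm p (r ^ k) = padicNorm p r ^ k := by
  induction k with
  | zero => simp
  | succ k ih => rw [pow_succ, padicNorm.mul, ih, pow_succ]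

theorem int_of_padicNorm_le_one {p : ℕ} [hp : Fact p.Prime] {r : ℚ} (h1 : padicNorm p r ≤ 1)
    {k : ℕ} (h2 : ∃ z : ℤ, (p : ℚ) ^ k * r = z) : ∃ z : ℤ, r = z := by
  obtain ⟨z, hz⟩ := h2
  have hp0 : (p : ℚ) ≠ 0 := by exact_mod_cast hp.out.ne_zero
  have hz' : padicNorm p (z : ℚ) ≤ (p : ℚ) ^ (-(k : ℤ)) := by
    have hpk : padicNorm p ((p : ℚ) ^ k) = (p : ℚ) ^ (-(k : ℤ)) := by
      rw [padicNorm_pow, padicNorm.padicNorm_p_of_prime, inv_pow, zpow_neg, zpow_natCast]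
    rw [← hz, padicNorm.mul, hpk]
    exact mul_le_of_le_one_right (by positivity) h1
  rw [← padicNorm.dvd_iff_norm_le] at hz'
  obtain ⟨c, hc⟩ := hz'
  refine ⟨c, mul_left_cancel₀ (pow_ne_zero k hp0) ?_⟩
  rw [hz, hc]; push_cast; rfl

section Unramified

variable {B : Type*} [Ring B] [Algebra ℚ B] [DefiniteQuaternion B]

/-- An order in a split quaternion algebra over `ℚ_p` stabilises a lattice. -/
theorem exists_integral_splitting {O : Subalgebra ℤ B} (hO : IsOrder O) {p : ℕ}
    [hp : Fact p.Prime] (f : B →ₐ[ℚ] Matrix (Fin 2) (Fin 2) ℚ_[p])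
    (hft : ∀ x, (f x).trace = trd x) (hfd : ∀ x, (f x).det = nrd x) :
    ∃ g : B →ₐ[ℚ] Matrix (Fin 2) (Fin 2) ℚ_[p], (∀ x, (g x).trace = trd x) ∧
      (∀ x, (g x).det = nrd x) ∧ ∀ x ∈ O, ∀ i j, ‖g x i j‖ ≤ 1 := by
  obtain ⟨s, hs⟩ := hO.fg
  -- The `ℤ_p`-lattice generated by the translates of the standard vectors under `O` is stable under
  -- `O`; in one of its bases the image of `O` is integral.
  let G : Set (Fin 2 → ℚ_[p]) := (fun q : B × Fin 2 => (f q.1).mulVec (Pi.single q.2 1)) ''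
    ((s : Set B) ×ˢ Set.univ)
  let L : Submodule ℤ_[p] (Fin 2 → ℚ_[p]) := Submodule.span ℤ_[p] G
  have hL1 : ∀ x ∈ O, ∀ i, (f x).mulVec (Pi.single i 1) ∈ L := by
    intro x hx i
    rw [← Subalgebra.mem_toSubmodule, ← hs] at hx
    induction hx using Submodule.span_induction with
    | mem x h => exact Submodule.subset_span ⟨(x, i), ⟨h, trivial⟩, rfl⟩
    | zero => rw [map_zero, Matrix.zero_mulVec]; exact L.zero_mem
    | add x y _ _ hx hy => rw [map_add, Matrix.add_mulVec]; exact L.add_mem hx hy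
    | smul a x _ hx =>
      rw [map_zsmul, Matrix.smul_mulVec]
      exact zsmul_mem hx a
  have hL2 : ∀ x ∈ O, ∀ v ∈ L, (f x).mulVec v ∈ L := by
    intro x hx v hv
    induction hv using Submodule.span_induction with
    | mem v h =>
      obtain ⟨⟨y, i⟩, ⟨hy, -⟩, rfl⟩ := h
      simp only [Matrix.mulVec_mulVec, ← map_mul]
      refine hL1 _ (O.mul_mem hx ?_) i
      rw [← Subalgebra.mem_toSubmodule, ← hs]
      exact Submodule.subset_span hy
    | zero => simp
    | add x y _ _ hx hy => rw [Matrix.mulVec_add]; exact L.add_mem hx hy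
    | smul a x _ hx =>
      rw [Matrix.mulVec_smul]
      exact L.smul_mem _ hx
  have hLat : Submodule.IsLattice ℚ_[p] L := by
    refine ⟨Submodule.fg_span (Set.Finite.image _ (s.finite_toSet.prod Set.finite_univ)), ?_⟩
    rw [eq_top_iff, ← (Pi.basisFun ℚ_[p] (Fin 2)).span_eq, Submodule.span_le]
    rintro _ ⟨i, rfl⟩
    apply Submodule.subset_span
    have := hL1 1 O.one_mem i
    rwa [map_one, Matrix.one_mulVec, ← Pi.basisFun_apply] at this
  let b0 := Module.finBasisOfFinrankEq ℤ_[p] L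
    (by rw [Submodule.IsLattice.finrank_of_pi ℚ_[p] L, Fintype.card_fin])
  let b := b0.extendOfIsLattice ℚ_[p]
  have hrepr : ∀ v ∈ L, ∀ i, ‖b.repr v i‖ ≤ 1 := by
    intro v hv i
    have hLb : L = Submodule.span ℤ_[p] (Set.range b) := by
      have : Set.range b = Submodule.subtype L '' Set.range b0 := by
        rw [← Set.range_comp]
        congr 1
        ext i
        simp [b]
      rw [this, ← Submodule.map_span, b0.span_eq, Submodule.map_top, Submodule.range_subtype]
    rw [hLb, b.mem_span_iff_repr_mem ℤ_[p]] at hv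
    obtain ⟨z, hz⟩ := hv i
    rw [← hz]
    exact PadicInt.norm_le_one _
  let E : Matrix (Fin 2) (Fin 2) ℚ_[p] ≃ₐ[ℚ_[p]] Matrix (Fin 2) (Fin 2) ℚ_[p] :=
    Matrix.toLinAlgEquiv'.trans (LinearMap.toMatrixAlgEquiv b)
  have hE : ∀ M, E M = LinearMap.toMatrix b b (Matrix.toLin' M) := fun M => rfl
  refine ⟨((E : _ →ₐ[ℚ_[p]] _).restrictScalars ℚ).comp f, fun x => ?_, fun x => ?_, fun x hx i j => ?_⟩
  · change (E (f x)).trace = _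
    rw [hE, ← LinearMap.trace_eq_matrix_trace, Matrix.trace_toLin'_eq, hft]
  · change (E (f x)).det = _
    rw [hE, LinearMap.det_toMatrix, LinearMap.det_toLin', hfd]
  · change ‖E (f x) i j‖ ≤ 1
    rw [hE, LinearMap.toMatrix_apply, Matrix.toLin'_apply]
    refine hrepr _ (hL2 x hx _ ?_) _
    simp [b]

/-- The elements of `O[1/p]` with integral image under `f` form a ring containing `O` with integral
traces, so maximality identifies it with `O`. -/
theorem exists_reduction_aux {O : Subalgebra ℤ B} (hO : IsMaximalOrder O) {p : ℕ}
    [hp : Fact p.Prime] (f : B →ₐ[ℚ] Matrix (Fin 2) (Fin 2) ℚ_[p])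
    (hft : ∀ x, (f x).trace = trd x)
    (hf : ∀ x ∈ O, ∀ i j, ‖f x i j‖ ≤ 1) {x : B} (hx : ∀ i j, ‖f x i j‖ ≤ 1) {k : ℕ}
    (hk : ((p ^ k : ℕ) : ℤ) • x ∈ O) : x ∈ O := by
  let O' : Subalgebra ℤ B :=
    { carrier := {x | (∃ k : ℕ, ((p ^ k : ℕ) : ℤ) • x ∈ O) ∧ ∀ i j, ‖f x i j‖ ≤ 1}
      mul_mem' := by
        rintro x y ⟨⟨k, hk⟩, hx⟩ ⟨⟨l, hl⟩, hy⟩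
        refine ⟨⟨k + l, ?_⟩, fun i j => ?_⟩
        · have := O.mul_mem hk hl
          rwa [smul_mul_smul_comm, ← Nat.cast_mul, ← pow_add] at this
        · rw [map_mul, Matrix.mul_apply, Fin.sum_univ_two]
          refine (Padic.nonarchimedean _ _).trans (max_le ?_ ?_) <;> rw [norm_mul] <;>
            exact mul_le_one₀ (hx _ _) (norm_nonneg _) (hy _ _)
      add_mem' := by
        rintro x y ⟨⟨k, hk⟩, hx⟩ ⟨⟨l, hl⟩, hy⟩
        refine ⟨⟨k + l, ?_⟩, fun i j => ?_⟩
        · rw [smul_add]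
          refine O.add_mem ?_ ?_
          · rw [pow_add, mul_comm, Nat.cast_mul, mul_smul]; exact O.smul_mem hk _
          · rw [pow_add, Nat.cast_mul, mul_smul]; exact O.smul_mem hl _
        · rw [map_add, Matrix.add_apply]
          exact (Padic.nonarchimedean _ _).trans (max_le (hx i j) (hy i j))
      algebraMap_mem' := fun r => ⟨⟨0, by simp [intCast_mem]⟩, hf _ (O.algebraMap_mem r)⟩ }
  have h1 : O ≤ O' := fun x hx => ⟨⟨0, by simpa using hx⟩, hf x hx⟩
  have h2 : O' = O := by
    refine hO.eq_of_le h1 ?_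
    rintro x ⟨⟨k, hk⟩, hx⟩
    refine int_of_padicNorm_le_one (p := p) (k := k) ?_ ?_
    · have : ‖((trd x : ℚ) : ℚ_[p])‖ ≤ 1 := by
        rw [← hft, Matrix.trace_fin_two]
        exact (Padic.nonarchimedean _ _).trans (max_le (hx 0 0) (hx 1 1))
      rw [Padic.eq_padicNorm] at this
      exact_mod_cast this
    · obtain ⟨z, hz⟩ := trd_int hO.1 hk
      refine ⟨z, ?_⟩
      rw [← hz, map_zsmul, zsmul_eq_mul]; push_cast; rfl
  rw [← h2]
  exact ⟨⟨k, hk⟩, hx⟩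

/-- The entrywise integral matrices, as matrices over `ℤ_p`. -/
def integralMatrixHom {R : Type*} [Ring R] {p : ℕ} [Fact p.Prime]
    (f : R →+* Matrix (Fin 2) (Fin 2) ℚ_[p]) (hf : ∀ x i j, ‖f x i j‖ ≤ 1) :
    R →+* Matrix (Fin 2) (Fin 2) ℤ_[p] where
  toFun x := Matrix.of fun i j => ⟨f x i j, hf x i j⟩
  map_one' := Matrix.ext fun i j => Subtype.ext <| by
    change f 1 i j = (((1 : Matrix (Fin 2) (Fin 2) ℤ_[p]) i j : ℤ_[p]) : ℚ_[p])
    rw [map_one]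
    by_cases h : i = j
    · subst h; simp
    · simp [h]
  map_mul' x y := Matrix.ext fun i j => Subtype.ext <| by
    rw [Matrix.mul_apply, Fin.sum_univ_two]
    change f (x * y) i j = f x i 0 * f y 0 j + f x i 1 * f y 1 j
    rw [map_mul, Matrix.mul_apply, Fin.sum_univ_two]
  map_zero' := Matrix.ext fun i j => Subtype.ext <| by
    change f 0 i j = 0
    rw [map_zero]; rfl
  map_add' x y := Matrix.ext fun i j => Subtype.ext <| by
    change f (x + y) i j = f x i j + f y i j
    rw [map_add]; rfl

/-- A maximal order modulo an unramified prime is a matrix ring. -/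
theorem exists_reduction (N : ℕ) [hR : RamifiedOnlyAt B N] {O : Subalgebra ℤ B}
    (hO : IsMaximalOrder O) (p : ℕ) [hp : Fact p.Prime] (hpN : p ≠ N) :
    ∃ ψ : O →+* Matrix (Fin 2) (Fin 2) (ZMod p), Function.Surjective ψ ∧
      (∀ x, ψ x = 0 ↔ ∃ y : O, x = (p : ℤ) • y) ∧
      (∀ (x : O) (t : ℤ), trd (x : B) = t → (ψ x).trace = t) ∧
      (∀ (x : O) (t : ℤ), nrd (x : B) = t → (ψ x).det = t) := by
  obtain ⟨f0, h1, h2⟩ := hR.split p hpN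
  obtain ⟨f, hft, hfd, hf⟩ := exists_integral_splitting hO.1 f0 h1 h2
  let A : O →+* Matrix (Fin 2) (Fin 2) ℤ_[p] :=
    integralMatrixHom ((f : B →+* _).comp (O.val : O →+* B)) (fun x => hf x x.2)
  have hA : ∀ x i j, ((A x i j : ℤ_[p]) : ℚ_[p]) = f x i j := fun x i j => rfl
  let ψ : O →+* Matrix (Fin 2) (Fin 2) (ZMod p) := (PadicInt.toZMod.mapMatrix).comp A
  have hψ : ∀ x i j, ψ x i j = PadicInt.toZMod (A x i j) := fun x i j => rfl
  have hker : ∀ x, ψ x = 0 ↔ ∃ y : O, x = (p : ℤ) • y := by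
    intro x
    constructor
    · intro hx
      have hp0 : (p : ℚ) ≠ 0 := by exact_mod_cast hp.out.ne_zero
      have hmem : (p : ℚ)⁻¹ • (x : B) ∈ O := by
        refine exists_reduction_aux (k := 1) hO f hft hf (fun i j => ?_) ?_
        · have h3 : PadicInt.toZMod (A x i j) = 0 := by rw [← hψ, hx]; rfl
          rw [← RingHom.mem_ker, PadicInt.ker_toZMod, PadicInt.maximalIdeal_eq_span_p,
            Ideal.mem_span_singleton] at h3
          obtain ⟨c, hc⟩ := h3
          have h4 : f x i j = (p : ℚ_[p]) * c := by rw [← hA, hc]; push_cast; rfl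
          have hp0' : (p : ℚ_[p]) ≠ 0 := by exact_mod_cast hp.out.ne_zero
          have h5 : f ((p : ℚ)⁻¹ • (x : B)) i j = c := by
            rw [map_smul, Matrix.smul_apply, h4, Algebra.smul_def]
            simp [hp0']
          rw [h5]
          exact PadicInt.norm_le_one c
        · rw [pow_one, ← Int.cast_smul_eq_zsmul ℚ, smul_smul]
          push_cast
          rw [mul_inv_cancel₀ hp0, one_smul]
          exact x.2
      refine ⟨⟨_, hmem⟩, Subtype.ext ?_⟩
      change (x : B) = (p : ℤ) • ((p : ℚ)⁻¹ • (x : B))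
      rw [← Int.cast_smul_eq_zsmul ℚ, smul_smul]
      push_cast
      rw [mul_inv_cancel₀ hp0, one_smul]
    · rintro ⟨y, rfl⟩
      rw [map_zsmul]
      ext i j
      simp
  refine ⟨ψ, ?_, hker, fun x t ht => ?_, fun x t ht => ?_⟩
  · obtain ⟨b, hb⟩ := exists_basis_of_isLattice hO.isLattice finrank_eq_four
    have hbm : ∀ i, b i ∈ O := fun i => by
      rw [← Subalgebra.mem_toSubmodule, hb]
      exact Submodule.subset_span ⟨i, rfl⟩
    let c : Fin 4 → O := fun i => ⟨b i, hbm i⟩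
    -- Since the kernel is `pO`, a `ℤ`-basis of `O` stays independent modulo `p`; four independent
    -- matrices span, which gives surjectivity.
    have hli : LinearIndependent (ZMod p) (fun i => ψ (c i)) := by
      rw [Fintype.linearIndependent_iff]
      intro g hg i
      choose k hk using fun i => ZMod.intCast_surjective (g i)
      have h3 : ψ (∑ i, k i • c i) = 0 := by
        rw [map_sum, ← hg]
        refine Finset.sum_congr rfl fun i _ => ?_
        rw [map_zsmul, ← hk, Int.cast_smul_eq_zsmul]
      obtain ⟨y, hy⟩ := (hker _).1 h3
      have h4 := congrArg (fun z : O => b.repr (z : B) i) hy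
      simp only [AddSubmonoidClass.coe_finsetSum, Subalgebra.coe_smul] at h4
      have hyr : ∃ z : ℤ, b.repr (y : B) i = z := repr_mem_int b (by
        rw [← hb]; exact y.2) i
      obtain ⟨z, hz⟩ := hyr
      have h5 : ∑ j, k j • (c j : B) = ∑ j, (k j : ℚ) • b j :=
        Finset.sum_congr rfl fun j _ => (Int.cast_smul_eq_zsmul ℚ _ _).symm
      rw [h5, b.repr_sum_self, map_zsmul, Finsupp.smul_apply, hz, zsmul_eq_mul] at h4
      have h6 : k i = p * z := by exact_mod_cast h4
      rw [← hk, h6]; simp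
    have hspan := hli.span_eq_top_of_card_eq_finrank' (by
      rw [Module.finrank_matrix]; simp)
    intro M
    have hM : M ∈ Submodule.span (ZMod p) (Set.range fun i => ψ (c i)) := by
      rw [hspan]; trivial
    obtain ⟨g, rfl⟩ := (Submodule.mem_span_range_iff_exists_fun _).1 hM
    choose k hk using fun i => ZMod.intCast_surjective (g i)
    refine ⟨∑ i, k i • c i, ?_⟩
    rw [map_sum]
    refine Finset.sum_congr rfl fun i _ => ?_
    rw [map_zsmul, ← hk, Int.cast_smul_eq_zsmul]
  · have h3 : (A x).trace = (t : ℤ_[p]) := by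
      apply Subtype.coe_injective
      have := hft x
      rw [ht, Matrix.trace_fin_two] at this
      rw [Matrix.trace_fin_two]
      push_cast
      rw [hA, hA, this]; simp
    have h4 := congrArg PadicInt.toZMod h3
    rw [Matrix.trace_fin_two, map_add, map_intCast] at h4
    rw [Matrix.trace_fin_two, hψ, hψ, h4]
  · have h3 : (A x).det = (t : ℤ_[p]) := by
      apply Subtype.coe_injective
      have := hfd x
      rw [ht, Matrix.det_fin_two] at this
      rw [Matrix.det_fin_two]
      push_cast
      rw [hA, hA, hA, hA, this]; simp
    have h4 := congrArg PadicInt.toZMod h3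
    rw [Matrix.det_fin_two, map_sub, map_mul, map_mul, map_intCast] at h4
    rw [Matrix.det_fin_two, hψ, hψ, hψ, hψ, h4]

end Unramified

end QuatForm
end

/-! ### The valuation of `B` at `N` -/

noncomputable section

namespace QuatForm

section Valuation

variable {B : Type*} [Ring B] [Algebra ℚ B] [DefiniteQuaternion B]

/-- The `N`-adic absolute value of the reduced norm. -/
def qv (N : ℕ) (x : B) : ℚ := padicNorm N (nrd x)

variable (N : ℕ) [hN : Fact N.Prime]

theorem qv_nonneg (x : B) : 0 ≤ qv N x := padicNorm.nonneg _

theorem qv_mul (x y : B) : qv N (x * y) = qv N x * qv N y := by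
  rw [qv, nrd_mul, padicNorm.mul]; rfl

@[simp] theorem qv_one : qv N (1 : B) = 1 := by simp [qv]

@[simp] theorem qv_zero : qv N (0 : B) = 0 := by simp [qv]

theorem qv_pos {x : B} (hx : x ≠ 0) : 0 < qv N x :=
  lt_of_le_of_ne (qv_nonneg N x) (padicNorm.nonzero (nrd_pos hx).ne').symm

theorem qv_smul (r : ℚ) (x : B) : qv N (r • x) = padicNorm N r ^ 2 * qv N x := by
  rw [qv, nrd_smul, padicNorm.mul, padicNorm_pow]; rfl

theorem qv_zsmul (r : ℤ) (x : B) : qv N (r • x) = padicNorm N r ^ 2 * qv N x := by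
  rw [← Int.cast_smul_eq_zsmul ℚ, qv_smul]

@[simp] theorem qv_neg (x : B) : qv N (-x) = qv N x := by rw [qv, nrd_neg]; rfl

theorem qv_qinv (x : B) : qv N (qinv x) = (qv N x)⁻¹ := by
  rw [qv, nrd_qinv, ← one_div, padicNorm.div, padicNorm.one, one_div]; rfl

theorem qv_eq_zpow {x : B} (hx : x ≠ 0) : ∃ z : ℤ, qv N x = (N : ℚ) ^ z := by
  obtain ⟨z, hz⟩ := padicNorm.values_discrete (p := N) (nrd_pos hx).ne'
  exact ⟨-z, hz⟩

theorem one_lt_cast : (1 : ℚ) < N := by exact_mod_cast hN.out.one_lt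

theorem padicNorm_self_sq : padicNorm N (N : ℚ) ^ 2 = (N : ℚ) ^ (-2 : ℤ) := by
  rw [padicNorm.padicNorm_p_of_prime, inv_pow, zpow_neg]; rfl

theorem qv_le_inv_of_lt_one {x : B} (hx : qv N x < 1) : qv N x ≤ (N : ℚ) ^ (-1 : ℤ) := by
  have h1 := one_lt_cast N
  by_cases h0 : x = 0
  · rw [h0, qv_zero]; positivity
  obtain ⟨z, hz⟩ := qv_eq_zpow N h0
  rw [hz] at hx ⊢
  rw [zpow_lt_one_iff_right₀ h1] at hx
  exact zpow_le_zpow_right₀ h1.le (by omega)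

theorem padicNorm_le_one_of_lt {r : ℚ} (hr : padicNorm N r < N) : padicNorm N r ≤ 1 := by
  have h1 := one_lt_cast N
  by_cases h0 : r = 0
  · rw [h0, padicNorm.zero]; norm_num
  obtain ⟨z, hz⟩ := padicNorm.values_discrete (p := N) h0
  rw [hz] at hr ⊢
  have : (N : ℚ) ^ (-z) < (N : ℚ) ^ (1 : ℤ) := by simpa using hr
  rw [zpow_lt_zpow_iff_right₀ h1] at this
  exact zpow_le_one_of_nonpos₀ h1.le (by omega)

variable [hR : RamifiedOnlyAt B N]

include hR

/-- `nrd (1 + x) = 1 + trd x + nrd x`, and ramification at `N` bounds the trace. After a division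
this becomes the ultrametric inequality for `qv`. -/
theorem qv_one_add_le {x : B} (hx : qv N x ≤ 1) : qv N (1 + x) ≤ 1 := by
  rw [qv, nrd_one_add]
  refine padicNorm.nonarchimedean.trans (max_le ?_ hx)
  refine padicNorm.nonarchimedean.trans (max_le ?_ (hR.padicNorm_trd_le x hx))
  rw [padicNorm.one]

theorem qv_add_le (x y : B) : qv N (x + y) ≤ max (qv N x) (qv N y) := by
  wlog h : qv N y ≤ qv N x generalizing x y
  · rw [add_comm, max_comm]; exact this y x (le_of_not_ge h)
  by_cases hx : x = 0
  · subst hx; rw [zero_add]; exact le_max_right _ _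
  have h1 : x + y = x * (1 + qinv x * y) := by
    rw [mul_add, mul_one, ← mul_assoc, mul_qinv hx, one_mul]
  have h2 : qv N (qinv x * y) ≤ 1 := by
    rw [qv_mul, qv_qinv, inv_mul_le_one₀ (qv_pos N hx)]; exact h
  rw [h1, qv_mul]
  exact (mul_le_of_le_one_right (qv_nonneg N x) (qv_one_add_le N h2)).trans (le_max_left _ _)

/-- If the trace were a unit, `trd x · x = x² + nrd x` would have value `qv x` on the left and at
most `(qv x)²` on the right. -/
theorem padicNorm_trd_lt_one {x : B} (hx : qv N x < 1) : padicNorm N (trd x) < 1 := by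
  refine lt_of_le_of_ne (hR.padicNorm_trd_le x hx.le) fun h => ?_
  have hx0 : x ≠ 0 := by rintro rfl; simp at h
  have hn := qv_pos N hx0
  have h1 : trd x • x = x * x + algebraMap ℚ B (nrd x) := by
    rw [mul_self_eq, Algebra.smul_def, sub_add_cancel]
  have h2 : qv N (trd x • x) = qv N x := by rw [qv_smul, h]; ring
  have h3 : qv N (algebraMap ℚ B (nrd x)) = qv N x * qv N x := by
    rw [qv, nrd_algebraMap, sq, padicNorm.mul]; rfl
  have h4 := qv_add_le N (x * x) (algebraMap ℚ B (nrd x))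
  rw [← h1, h2, h3, qv_mul, max_self] at h4
  nlinarith

/-- Scaling by `N` moves `x` to where traces are divisible by `N`. So a norm with a simple pole at
`N` still has integral trace: one half of the computation of the inverse different. -/
theorem padicNorm_trd_le_one {x : B} (hx : qv N x ≤ N) : padicNorm N (trd x) ≤ 1 := by
  have h1 := one_lt_cast N
  have h2 : qv N ((N : ℚ) • x) < 1 := by
    rw [qv_smul, padicNorm.padicNorm_p_of_prime, inv_pow, inv_mul_lt_one₀ (by positivity)]
    nlinarith
  have h3 := padicNorm_trd_lt_one N h2
  rw [map_smul, smul_eq_mul, padicNorm.mul, padicNorm.padicNorm_p_of_prime,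
    inv_mul_lt_one₀ (by positivity)] at h3
  exact padicNorm_le_one_of_lt N h3

theorem exists_uniformizer_of_odd {x : B} (hx : x ≠ 0) {z : ℤ} (hz : qv N x = (N : ℚ) ^ (2 * z + 1)) :
    ∃ y : B, qv N y = (N : ℚ) ^ (-1 : ℤ) := by
  have hN0 : (N : ℚ) ≠ 0 := by exact_mod_cast hN.out.ne_zero
  refine ⟨((N : ℚ) ^ (z + 1)) • x, ?_⟩
  have h1 : padicNorm N ((N : ℚ) ^ (z + 1)) = (N : ℚ) ^ (-(z + 1)) := by
    have := padicNorm.eq_zpow_of_nonzero (p := N) (zpow_ne_zero (z + 1) hN0)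
    rw [this, padicValRat.zpow, padicValRat.self hN.out.one_lt, mul_one]
  rw [qv_smul, h1, hz, ← zpow_natCast, ← zpow_mul, ← zpow_add₀ hN0]
  congr 1
  push_cast; ring

theorem exists_integral_unit_multiple {x : B} (hx : x ≠ 0) {z : ℤ} (hz : qv N x = (N : ℚ) ^ (2 * z)) :
    ∃ (r : ℚ) (m : ℤ), nrd (r • x) = m ∧ ¬ (N : ℤ) ∣ m := by
  have hN0 : (N : ℚ) ≠ 0 := by exact_mod_cast hN.out.ne_zero
  have h1 : padicNorm N ((N : ℚ) ^ z) = (N : ℚ) ^ (-z) := by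
    have := padicNorm.eq_zpow_of_nonzero (p := N) (zpow_ne_zero z hN0)
    rw [this, padicValRat.zpow, padicValRat.self hN.out.one_lt, mul_one]
  set y := ((N : ℚ) ^ z) • x with hy
  have hy1 : padicNorm N (nrd y) = 1 := by
    change qv N y = 1
    rw [hy, qv_smul, h1, hz, ← zpow_natCast, ← zpow_mul, ← zpow_add₀ hN0]
    rw [show -z * ((2 : ℕ) : ℤ) + 2 * z = 0 by push_cast; ring, zpow_zero]
  refine ⟨(nrd y).den * (N : ℚ) ^ z, (nrd y).den * (nrd y).num, ?_, ?_⟩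
  · rw [mul_smul, ← hy, nrd_smul]
    push_cast
    nth_rewrite 2 [← Rat.num_div_den (nrd y)]
    have := (nrd y).den_nz
    field_simp
  · intro hdvd
    have hd : padicNorm N ((nrd y).num : ℚ) = padicNorm N ((nrd y).den : ℚ) := by
      rw [← Rat.num_div_den (nrd y), padicNorm.div,
        div_eq_one_iff_eq (padicNorm.nonzero (by exact_mod_cast (nrd y).den_nz))] at hy1
      exact hy1
    have hnum := padicNorm.int_lt_one_iff (p := N) (nrd y).num
    have hden := padicNorm.int_lt_one_iff (p := N) (nrd y).den
    rw [hd] at hnum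
    rw [Int.cast_natCast] at hden
    have hboth : (N : ℤ) ∣ (nrd y).num ∧ (N : ℤ) ∣ (nrd y).den := by
      rcases (Nat.prime_iff_prime_int.1 hN.out).dvd_or_dvd hdvd with h | h
      · exact ⟨hnum.1 (hden.2 h), h⟩
      · exact ⟨h, hden.1 (hnum.2 h)⟩
    have hcop := (nrd y).reduced
    have := Nat.dvd_gcd (Int.natCast_dvd.1 hboth.1) (Int.natCast_dvd_natCast.1 hboth.2)
    rw [hcop] at this
    exact hN.out.one_lt.ne' (Nat.dvd_one.1 this)

/-- A quaternion algebra ramified at `N` has elements whose norm has valuation one. -/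
theorem exists_uniformizer : ∃ z : B, qv N z = (N : ℚ) ^ (-1 : ℤ) := by
  by_contra hno
  -- If all valuations were even, `i` and `j` could be rescaled to have integral norms `a`, `b`
  -- prime to `N`; then `x² + a y² + b` has a zero modulo `N`, the source of the element `X` below.
  have heven : ∀ x : B, x ≠ 0 → ∃ z : ℤ, qv N x = (N : ℚ) ^ (2 * z) := by
    intro x hx
    obtain ⟨w, hw⟩ := qv_eq_zpow N hx
    rcases Int.even_or_odd' w with ⟨z, rfl | rfl⟩
    · exact ⟨z, hw⟩
    · exact absurd (exists_uniformizer_of_odd N hx hw) hno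
  set e := quatEquiv B
  set i0 : B := e.symm ⟨0, 1, 0, 0⟩
  set j0 : B := e.symm ⟨0, 0, 1, 0⟩
  have hei : e i0 = ⟨0, 1, 0, 0⟩ := e.apply_symm_apply _
  have hej : e j0 = ⟨0, 0, 1, 0⟩ := e.apply_symm_apply _
  have hi0 : i0 ≠ 0 := by
    intro h
    rw [h, map_zero] at hei
    have := congrArg QuaternionAlgebra.imI hei
    simp at this
  have hj0 : j0 ≠ 0 := by
    intro h
    rw [h, map_zero] at hej
    have := congrArg QuaternionAlgebra.imJ hej
    simp at this
  have htj : trd j0 = 0 := by rw [trd_apply, hej]; simp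
  have hti : trd i0 = 0 := by rw [trd_apply, hei]; simp
  have htij : trd (i0 * j0) = 0 := by rw [trd_apply, map_mul, hei, hej]; simp
  obtain ⟨z1, hz1⟩ := heven i0 hi0
  obtain ⟨z2, hz2⟩ := heven j0 hj0
  obtain ⟨r, a, ha, haN⟩ := exists_integral_unit_multiple N hi0 hz1
  obtain ⟨s, b, hb, hbN⟩ := exists_integral_unit_multiple N hj0 hz2
  obtain ⟨u, v, huv⟩ : ∃ u v : ZMod N, u ^ 2 + a * v ^ 2 + b = 0 := by
    have ha0 : (a : ZMod N) ≠ 0 := by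
      rwa [Ne, ZMod.intCast_zmod_eq_zero_iff_dvd]
    obtain ⟨u, v, h⟩ := FiniteField.exists_root_sum_quadratic (R := ZMod N)
      (f := Polynomial.X ^ 2) (g := Polynomial.C (a : ZMod N) * Polynomial.X ^ 2 + Polynomial.C (b : ZMod N))
      (by simp) (by compute_degree!) (by
        rw [ZMod.card]
        rcases hN.out.eq_two_or_odd with h | h
        · have := hR.three_lt; omega
        · exact h)
    refine ⟨u, v, ?_⟩
    simpa [add_assoc] using h
  obtain ⟨x, rfl⟩ := ZMod.intCast_surjective u
  obtain ⟨y, rfl⟩ := ZMod.intCast_surjective v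
  set X : B := algebraMap ℚ B x + y • (r • i0) + s • j0 with hX
  have hnX : nrd X = x ^ 2 + a * y ^ 2 + b := by
    rw [hX, nrd_add, nrd_add, hb, nrd_algebraMap, ← Int.cast_smul_eq_zsmul ℚ, nrd_smul, ha]
    have e1 : trd (algebraMap ℚ B x * qconj ((y : ℚ) • r • i0)) = 0 := by
      rw [← Algebra.smul_def, map_smul, trd_qconj, map_smul, map_smul, hti]; simp
    have e2 : qconj (s • j0) = - (s • j0) := qconj_of_trd_eq_zero (by rw [map_smul, htj, smul_zero])
    have e3 : trd ((algebraMap ℚ B x + (y : ℚ) • r • i0) * qconj (s • j0)) = 0 := by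
      rw [e2, mul_neg, map_neg, add_mul, map_add, ← Algebra.smul_def, map_smul, map_smul, htj,
        smul_mul_assoc, smul_mul_assoc, mul_smul_comm, map_smul, map_smul, map_smul, htij]
      simp
    rw [e1, e3]; ring
  have hqX : qv N X < 1 := by
    have : nrd X = ((x ^ 2 + a * y ^ 2 + b : ℤ) : ℚ) := by rw [hnX]; push_cast; ring
    rw [qv, this, padicNorm.int_lt_one_iff, ← ZMod.intCast_zmod_eq_zero_iff_dvd]
    push_cast
    linear_combination huv
  have hN1 := one_lt_cast N
  have hN0 : (N : ℚ) ≠ 0 := by exact_mod_cast hN.out.ne_zero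
  have hqX2 : qv N X ≤ (N : ℚ) ^ (-2 : ℤ) := by
    by_cases hX0 : X = 0
    · rw [hX0, qv_zero]; positivity
    obtain ⟨z, hz⟩ := heven X hX0
    rw [hz] at hqX ⊢
    rw [zpow_lt_one_iff_right₀ hN1] at hqX
    exact zpow_le_zpow_right₀ hN1.le (by omega)
  have hqj : qv N (s • j0) ≤ 1 := by rw [qv, hb]; exact padicNorm.of_int _
  -- By evenness the norm of `X` is divisible by `N²` at `N`, so this element has `N`-integral norm.
  -- Its trace is `-2b/N`, which contradicts ramification.
  have h1 : qv N ((N : ℚ)⁻¹ • (X * (s • j0))) ≤ 1 := by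
    rw [qv_smul, ← one_div, padicNorm.div, padicNorm.one, padicNorm.padicNorm_p_of_prime, one_div,
      inv_inv, qv_mul]
    rw [zpow_neg, zpow_ofNat] at hqX2
    have h2 : (N : ℚ) ^ 2 * (qv N X) ≤ 1 := by
      rw [← mul_inv_cancel₀ (pow_ne_zero 2 hN0)]
      gcongr
    rw [← mul_assoc]
    exact mul_le_one₀ h2 (qv_nonneg _ _) hqj
  have h2 := hR.padicNorm_trd_le _ h1
  have h3 : trd ((N : ℚ)⁻¹ • (X * (s • j0))) = (N : ℚ)⁻¹ * ((-2 * b : ℤ) : ℚ) := by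
    rw [map_smul, hX, add_mul, map_add, add_mul, map_add, ← Algebra.smul_def, map_smul, map_smul,
      htj, ← Int.cast_smul_eq_zsmul ℚ, smul_mul_assoc, smul_mul_assoc, mul_smul_comm, map_smul,
      map_smul, map_smul, htij, mul_self_eq, map_sub, trd_algebraMap, hb, map_smul, htj]
    simp
  have h4 : padicNorm N ((-2 * b : ℤ) : ℚ) = 1 := by
    rw [padicNorm.int_eq_one_iff]
    intro hd
    rcases (Nat.prime_iff_prime_int.1 hN.out).dvd_or_dvd hd with h | h
    · have := Int.le_of_dvd (by norm_num) ((Int.dvd_neg).2 h)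
      have := hR.three_lt
      omega
    · exact hbN h
  rw [h3, padicNorm.mul, h4, mul_one, ← one_div, padicNorm.div, padicNorm.one,
    padicNorm.padicNorm_p_of_prime, one_div, inv_inv] at h2
  linarith

end Valuation

end QuatForm
end

/-! ### Powers of the prime above `N` and the inverse different -/

noncomputable section

namespace QuatForm

section Radical

variable {B : Type*} [Ring B] [Algebra ℚ B] [DefiniteQuaternion B]

/-- The `j`-th power of the two-sided prime above `N` of a maximal order `O`. -/
def radPow (O : Subalgebra ℤ B) (N : ℕ) [Fact N.Prime] [RamifiedOnlyAt B N] (j : ℤ) :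
    Submodule ℤ B where
  carrier := {x | qv N x ≤ (N : ℚ) ^ (-j) ∧ ∃ k : ℕ, ((N : ℤ) ^ k) • x ∈ O}
  add_mem' := by
    rintro x y ⟨hx, k, hk⟩ ⟨hy, l, hl⟩
    refine ⟨(qv_add_le N x y).trans (max_le hx hy), k + l, ?_⟩
    rw [smul_add]
    refine add_mem ?_ ?_
    · rw [pow_add, mul_comm, mul_smul]; exact O.smul_mem hk _
    · rw [pow_add, mul_smul]; exact O.smul_mem hl _
  zero_mem' := ⟨by rw [qv_zero]; positivity, 0, by simp⟩
  smul_mem' := by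
    rintro c x ⟨hx, k, hk⟩
    refine ⟨?_, k, ?_⟩
    · rw [qv_zsmul]
      refine (mul_le_of_le_one_left (qv_nonneg N x) ?_).trans hx
      exact pow_le_one₀ (padicNorm.nonneg _) (padicNorm.of_int c)
    · rw [smul_comm]; exact O.smul_mem hk _

variable (N : ℕ) [hN : Fact N.Prime] [hR : RamifiedOnlyAt B N]
variable {O : Subalgebra ℤ B}

theorem natCast_ne_zero_rat : (N : ℚ) ≠ 0 := by exact_mod_cast hN.out.ne_zero

theorem qv_intCast_smul_of_coprime {s : ℤ} (hs : ¬ (N : ℤ) ∣ s) (x : B) :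
    qv N (s • x) = qv N x := by
  rw [qv_zsmul, (padicNorm.int_eq_one_iff s).2 hs, one_pow, one_mul]

theorem qv_pow_smul (k : ℕ) (x : B) :
    qv N (((N : ℤ) ^ k) • x) = (N : ℚ) ^ (-(2 * k : ℤ)) * qv N x := by
  rw [qv_zsmul]
  congr 1
  push_cast
  rw [padicNorm_pow, padicNorm.padicNorm_p_of_prime, ← pow_mul, inv_pow, zpow_neg]
  congr 1
  rw [mul_comm]; exact_mod_cast rfl

theorem radPow_anti {i j : ℤ} (h : i ≤ j) : radPow O N j ≤ radPow O N i := by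
  rintro x ⟨h1, h2⟩
  exact ⟨h1.trans (zpow_le_zpow_right₀ (one_lt_cast N).le (by omega)), h2⟩

theorem mul_mem_radPow {i j : ℤ} {x y : B} (hx : x ∈ radPow O N i) (hy : y ∈ radPow O N j) :
    x * y ∈ radPow O N (i + j) := by
  obtain ⟨h1, k, hk⟩ := hx
  obtain ⟨h2, l, hl⟩ := hy
  refine ⟨?_, k + l, ?_⟩
  · rw [qv_mul, neg_add, zpow_add₀ (natCast_ne_zero_rat N)]
    exact mul_le_mul h1 h2 (qv_nonneg _ _) (by positivity)
  · rw [pow_add, ← smul_mul_smul_comm]; exact O.mul_mem hk hl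

/-- Every lattice point denominators away from `N` can be cleared. -/
theorem exists_coprime_smul (hO : IsOrder O) (x : B) :
    ∃ (s : ℤ) (k : ℕ), ¬ (N : ℤ) ∣ s ∧ ((N : ℤ) ^ k) • (s • x) ∈ O := by
  obtain ⟨m, hm, hmx⟩ := exists_zsmul_mem hO x
  obtain ⟨k, s, hs, rfl⟩ := Nat.exists_eq_pow_mul_and_not_dvd hm.ne' N hN.out.ne_one
  refine ⟨s, k, by exact_mod_cast hs, ?_⟩
  rw [smul_smul]
  exact_mod_cast hmx

theorem exists_coprime_smul_mem_radPow (hO : IsOrder O) (x : B) {j : ℤ}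
    (hx : qv N x ≤ (N : ℚ) ^ (-j)) :
    ∃ s : ℤ, ¬ (N : ℤ) ∣ s ∧ s • x ∈ radPow O N j := by
  obtain ⟨s, k, hs, hk⟩ := exists_coprime_smul N hO x
  exact ⟨s, hs, by rwa [qv_intCast_smul_of_coprime N hs], k, hk⟩

theorem exists_qv_eq (i : ℤ) : ∃ w : B, qv N w = (N : ℚ) ^ (-i) := by
  obtain ⟨z, hz⟩ := exists_uniformizer (B := B) N
  have hz0 : z ≠ 0 := by
    rintro rfl
    rw [qv_zero] at hz
    exact zpow_ne_zero _ (natCast_ne_zero_rat N) hz.symm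
  have key : ∀ n : ℕ, qv N (z ^ n) = (N : ℚ) ^ (-(n : ℤ)) := by
    intro n
    induction n with
    | zero => simp
    | succ n ih =>
      rw [pow_succ, qv_mul, ih, hz, ← zpow_add₀ (natCast_ne_zero_rat N)]
      congr 1; push_cast; ring
  obtain ⟨n, rfl | rfl⟩ := i.eq_nat_or_neg
  · exact ⟨_, key n⟩
  · refine ⟨qinv (z ^ n), ?_⟩
    rw [qv_qinv, key, ← zpow_neg]

/-- A pair of mutually inverse local generators, up to an integer prime to `N`. -/
theorem exists_local_generators (hO : IsOrder O) (i : ℤ) :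
    ∃ (w w' : B) (s : ℤ), w ∈ radPow O N i ∧ w' ∈ radPow O N (-i) ∧ ¬ (N : ℤ) ∣ s ∧
      w * w' = algebraMap ℚ B s ∧ qv N w = (N : ℚ) ^ (-i) := by
  obtain ⟨w₀, hw₀⟩ := exists_qv_eq (B := B) N i
  obtain ⟨s, hs, hsw⟩ := exists_coprime_smul_mem_radPow N hO w₀ hw₀.le
  set w := s • w₀ with hw
  have hqw : qv N w = (N : ℚ) ^ (-i) := by rw [hw, qv_intCast_smul_of_coprime N hs, hw₀]
  have hw0 : w ≠ 0 := by
    intro h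
    rw [h, qv_zero] at hqw
    exact zpow_ne_zero _ (natCast_ne_zero_rat N) hqw.symm
  obtain ⟨s', hs', hsw'⟩ := exists_coprime_smul_mem_radPow N hO (qinv w) (j := -i)
    (by rw [qv_qinv, hqw, ← zpow_neg])
  refine ⟨w, s' • qinv w, s', hsw, hsw', hs', ?_, hqw⟩
  rw [mul_smul_comm, mul_qinv hw0, Algebra.algebraMap_eq_smul_one, Int.cast_smul_eq_zsmul]

/-- Bézout between `s` and a power of `N`: this glues statements at `N` and away from `N` without
localising. -/
theorem mem_of_coprime_smul (T : Submodule ℤ B) {s : ℤ} (hs : ¬ (N : ℤ) ∣ s) {e : ℕ} {x : B}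
    (h1 : s • x ∈ T) (h2 : ((N : ℤ) ^ e) • x ∈ T) : x ∈ T := by
  have hc : IsCoprime s ((N : ℤ) ^ e) := by
    refine IsCoprime.pow_right ?_
    refine ((Nat.prime_iff_prime_int.1 hN.out).irreducible.coprime_iff_not_dvd.2 hs).symm
  obtain ⟨u, v, huv⟩ := hc
  have : x = u • (s • x) + v • (((N : ℤ) ^ e) • x) := by
    rw [smul_smul, smul_smul, ← add_smul, huv, one_smul]
  rw [this]
  exact T.add_mem (T.smul_mem _ h1) (T.smul_mem _ h2)

theorem pow_mem_radPow {j : ℤ} {k : ℕ} (hk : j ≤ 2 * k) {x : B} (hx : x ∈ O) (hqx : qv N x ≤ 1) :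
    ((N : ℤ) ^ k) • x ∈ radPow O N j := by
  refine ⟨?_, 0, by rw [pow_zero, one_smul]; exact O.smul_mem hx _⟩
  rw [qv_pow_smul]
  refine (mul_le_of_le_one_right (by positivity) hqx).trans ?_
  exact zpow_le_zpow_right₀ (one_lt_cast N).le (by omega)

/-- At `N` an element factors as `w (w⁻¹ x)` with `w` a local generator; away from `N` it factors
through a power of `N`. The two are combined by `mem_of_coprime_smul`. -/
theorem radPow_mul (hO : IsOrder O) (i j : ℤ) :
    radPow O N i * radPow O N j = radPow O N (i + j) := by
  apply le_antisymm
  · exact Submodule.mul_le.2 fun x hx y hy => mul_mem_radPow N hx hy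
  intro x hx
  obtain ⟨w, w', s, hw, hw', hs, hww, -⟩ := exists_local_generators N hO i
  obtain ⟨hx1, k, hk⟩ := hx
  refine mem_of_coprime_smul N _ hs (e := i.natAbs + (i.natAbs + k)) ?_ ?_
  · have : s • x = w * (w' * x) := by
      rw [← mul_assoc, hww, ← Algebra.smul_def, Int.cast_smul_eq_zsmul]
    rw [this]
    refine Submodule.mul_mem_mul hw ?_
    have := mul_mem_radPow N hw' (⟨hx1, k, hk⟩ : x ∈ radPow O N (i + j))
    rwa [neg_add_cancel_left] at this
  · have : ((N : ℤ) ^ (i.natAbs + (i.natAbs + k))) • x =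
        (((N : ℤ) ^ i.natAbs) • (1 : B)) * (((N : ℤ) ^ (i.natAbs + k)) • x) := by
      rw [smul_mul_smul_comm, one_mul, pow_add]
    rw [this]
    refine Submodule.mul_mem_mul (pow_mem_radPow N (by omega) O.one_mem (by simp)) ⟨?_, 0, ?_⟩
    · rw [qv_pow_smul]
      calc (N : ℚ) ^ (-(2 * (i.natAbs + k : ℕ) : ℤ)) * qv N x
          ≤ (N : ℚ) ^ (-(2 * (i.natAbs + k : ℕ) : ℤ)) * (N : ℚ) ^ (-(i + j)) := by gcongr
        _ ≤ (N : ℚ) ^ (-j) := by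
          rw [← zpow_add₀ (natCast_ne_zero_rat N)]
          exact zpow_le_zpow_right₀ (one_lt_cast N).le (by omega)
    · rw [pow_zero, one_smul, pow_add, mul_smul]
      exact O.smul_mem hk _

/-- Elements with `N`-integral norm and only `N`-power denominators form a ring with integral
traces, so maximality makes it no larger than `O`. -/
theorem radPow_zero (hO : IsMaximalOrder O) : radPow O N 0 = Subalgebra.toSubmodule O := by
  let O' : Subalgebra ℤ B :=
    { carrier := radPow O N 0
      mul_mem' := fun {x y} hx hy => by simpa using mul_mem_radPow N hx hy
      one_mem' := ⟨by simp, 0, by simpa using O.one_mem⟩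
      add_mem' := fun {x y} hx hy => (radPow O N 0).add_mem hx hy
      zero_mem' := (radPow O N 0).zero_mem
      algebraMap_mem' := fun r => by
        rw [Algebra.algebraMap_eq_smul_one]
        exact (radPow O N 0).smul_mem _ ⟨by simp, 0, by simpa using O.one_mem⟩ }
  have hle : O ≤ O' := by
    intro x hx
    refine ⟨?_, 0, by simpa using hx⟩
    obtain ⟨m, hm⟩ := nrd_int hO.1 hx
    rw [qv, hm]; simpa using padicNorm.of_int m
  have h := hO.eq_of_le hle fun x hx => by
    obtain ⟨h1, k, hk⟩ := (hx : x ∈ radPow O N 0)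
    obtain ⟨m, hm⟩ := trd_int hO.1 hk
    refine int_of_padicNorm_le_one (p := N) (k := k) (hR.padicNorm_trd_le x (by simpa [qv] using h1)) ⟨m, ?_⟩
    rw [← hm, ← Int.cast_smul_eq_zsmul ℚ, map_smul]; push_cast; rfl
  exact (show radPow O N 0 = Subalgebra.toSubmodule O' from rfl).trans (by rw [h])

/-- At `p ≠ N` the trace form on `O / pO ≅ M₂(𝔽_p)` is nondegenerate, so an element of the dual has
no `p` in its denominator; the factors of `s` are removed one by one. -/
theorem mem_of_smul_mem_of_mem_trdDual (hO : IsMaximalOrder O) {x : B}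
    (hx : x ∈ trdDual (Subalgebra.toSubmodule O)) (s : ℕ) (hs0 : s ≠ 0) (hs : ¬ N ∣ s)
    (hsx : (s : ℤ) • x ∈ O) : x ∈ O := by
  induction s using Nat.recOnMul generalizing x with
  | zero => exact absurd rfl hs0
  | one => simpa using hsx
  | prime p hp =>
    haveI : Fact p.Prime := ⟨hp⟩
    obtain ⟨ψ, hsurj, hker, htr, -⟩ := exists_reduction N hO p (by rintro rfl; exact hs dvd_rfl)
    have h0 : ψ ⟨_, hsx⟩ = 0 := by
      refine Matrix.ext_iff_trace_mul_right.2 fun M => ?_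
      obtain ⟨y, rfl⟩ := hsurj M
      rw [← map_mul, zero_mul, Matrix.trace_zero]
      obtain ⟨m, hm⟩ := (mem_trdDual.1 hx) y y.2
      rw [htr _ (p * m) ?_]
      · push_cast; simp
      · change trd (((p : ℤ) • x) * y) = _
        rw [smul_mul_assoc, ← Int.cast_smul_eq_zsmul ℚ, map_smul, hm]
        push_cast; rfl
    obtain ⟨y, hy⟩ := (hker _).1 h0
    have hy' : (p : ℤ) • x = (p : ℤ) • (y : B) := congrArg Subtype.val hy
    have : x = y := by
      rw [← Int.cast_smul_eq_zsmul ℚ, ← Int.cast_smul_eq_zsmul ℚ] at hy'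
      exact smul_right_injective B (by exact_mod_cast hp.ne_zero) hy'
    rw [this]; exact y.2
  | mul a b iha ihb =>
    have ha0 : a ≠ 0 := left_ne_zero_of_mul hs0
    have hb0 : b ≠ 0 := right_ne_zero_of_mul hs0
    refine iha hx ha0 (fun h => hs (h.mul_right b)) ?_
    refine ihb (Submodule.smul_mem _ _ hx) hb0 (fun h => hs (h.mul_left a)) ?_
    rw [smul_smul, mul_comm]; exact_mod_cast hsx

/-- If `x` in the dual had `qv x ≥ N²`, some multiple of `N⁻¹ x⁻¹` by an integer `s` prime to `N`
would lie in `O`; paired with `x` it has trace `2 s / N`, which is not integral. The other inclusion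
is `padicNorm_trd_le_one`. -/
theorem trdDual_eq_radPow (hO : IsMaximalOrder O) :
    trdDual (Subalgebra.toSubmodule O) = radPow O N (-1) := by
  have h1N := one_lt_cast N
  apply le_antisymm
  · intro x hx
    have hk : ∃ k : ℕ, ((N : ℤ) ^ k) • x ∈ O := by
      obtain ⟨s, k, hs, hk⟩ := exists_coprime_smul N hO.1 x
      refine ⟨k, mem_of_smul_mem_of_mem_trdDual N hO (Submodule.smul_mem _ _ hx) s.natAbs ?_ ?_ ?_⟩
      · rintro h
        rw [Int.natAbs_eq_zero] at h
        exact hs (h ▸ dvd_zero _)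
      · intro h; exact hs (Int.natCast_dvd.2 h)
      · rw [smul_comm] at hk
        rcases Int.natAbs_eq s with h | h
        · rwa [h] at hk
        · rw [h, neg_smul] at hk
          simpa using O.neg_mem hk
    refine ⟨?_, hk⟩
    by_contra hlt
    rw [neg_neg, zpow_one, not_le] at hlt
    have hx0 : x ≠ 0 := by rintro rfl; rw [qv_zero] at hlt; linarith
    have h2 : (N : ℚ) ^ 2 ≤ qv N x := by
      obtain ⟨z, hz⟩ := qv_eq_zpow N hx0
      rw [hz] at hlt ⊢
      have : (N : ℚ) ^ (1 : ℤ) < (N : ℚ) ^ z := by simpa using hlt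
      rw [zpow_lt_zpow_iff_right₀ h1N] at this
      exact_mod_cast zpow_le_zpow_right₀ h1N.le (show (2 : ℤ) ≤ z by omega)
    obtain ⟨s, hs, hs'⟩ := exists_coprime_smul_mem_radPow N hO.1 ((N : ℚ)⁻¹ • qinv x) (j := 0) (by
      rw [qv_smul, qv_qinv, ← one_div (N : ℚ), padicNorm.div, padicNorm.one,
        padicNorm.padicNorm_p_of_prime, one_div, inv_inv]
      rw [mul_inv_le_iff₀ (qv_pos N hx0)]; simpa using h2)
    rw [radPow_zero N hO] at hs'
    obtain ⟨m, hm⟩ := mem_trdDual.1 hx _ hs'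
    rw [mul_smul_comm, mul_smul_comm, mul_qinv hx0, ← Int.cast_smul_eq_zsmul ℚ, map_smul, map_smul,
      trd_one] at hm
    have h3 : s * 2 = N * m := by
      have hN0 := natCast_ne_zero_rat N
      simp only [smul_eq_mul] at hm
      field_simp at hm
      exact_mod_cast hm
    rcases (Nat.prime_iff_prime_int.1 hN.out).dvd_or_dvd (Dvd.intro m h3.symm) with h | h
    · exact hs h
    · have := Int.le_of_dvd (by norm_num) h
      have := hR.three_lt
      omega
  · rintro x ⟨hx, k, hk⟩
    refine mem_trdDual.2 fun y hy => ?_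
    obtain ⟨m, hm⟩ := trd_int hO.1 (O.mul_mem hk hy)
    refine int_of_padicNorm_le_one (p := N) (k := k) (padicNorm_trd_le_one N ?_) ⟨m, ?_⟩
    · have hy' : y ∈ radPow O N 0 := by rw [radPow_zero N hO]; exact hy
      rw [qv_mul]
      have h1 := hy'.1
      rw [neg_zero, zpow_zero] at h1
      rw [neg_neg, zpow_one] at hx
      calc qv N x * qv N y ≤ N * 1 := mul_le_mul hx h1 (qv_nonneg _ _) (by positivity)
        _ = N := mul_one _
    · rw [← hm, smul_mul_assoc, ← Int.cast_smul_eq_zsmul ℚ, map_smul]; push_cast; rfl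

end Radical

end QuatForm
end

/-! ### The two-sided prime as the unique ideal of norm `N` -/

noncomputable section

namespace QuatForm

section RadicalIdeal

variable {B : Type*} [Ring B] [Algebra ℚ B] [DefiniteQuaternion B]

theorem isLattice_of_forall_smul_mem {I J K : Submodule ℤ B} (hI : Submodule.IsLattice ℚ I)
    (hK : K.FG) (hJK : J ≤ K) {n : ℤ} (hn : n ≠ 0) (h : ∀ x ∈ I, n • x ∈ J) :
    Submodule.IsLattice ℚ J := by
  haveI : IsNoetherian ℤ K := isNoetherian_of_fg_of_noetherian _ hK
  refine ⟨?_, ?_⟩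
  · exact Submodule.FG.of_le hK hJK
  · refine eq_top_iff.2 fun x _ => ?_
    obtain ⟨m, hm, hmx⟩ := exists_zsmul_mem hI x
    have h1 : (n * m : ℤ) • x ∈ Submodule.span ℚ (J : Set B) := by
      rw [mul_smul]; exact Submodule.subset_span (h _ hmx)
    have h2 : x = ((n * m : ℤ) : ℚ)⁻¹ • ((n * m : ℤ) • x) := by
      rw [← Int.cast_smul_eq_zsmul ℚ, smul_smul, inv_mul_cancel₀, one_smul]
      exact_mod_cast mul_ne_zero hn (by exact_mod_cast hm.ne')
    rw [h2]; exact Submodule.smul_mem _ _ h1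

variable (N : ℕ) [hN : Fact N.Prime] [hR : RamifiedOnlyAt B N]
variable {O O' : Subalgebra ℤ B}

theorem radPow_two (hO : IsMaximalOrder O) {x : B} :
    x ∈ radPow O N 2 ↔ ∃ y ∈ O, x = (N : ℤ) • y := by
  constructor
  · rintro ⟨h1, k, hk⟩
    refine ⟨(N : ℚ)⁻¹ • x, ?_, ?_⟩
    · change _ ∈ Subalgebra.toSubmodule O
      rw [← radPow_zero N hO]
      have hsm : (N : ℤ) ^ (k + 1) • ((N : ℚ)⁻¹ • x) = (N : ℤ) ^ k • x := by
        rw [pow_succ, mul_smul, ← Int.cast_smul_eq_zsmul ℚ (N : ℤ), smul_smul]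
        have := natCast_ne_zero_rat N
        push_cast
        rw [mul_inv_cancel₀ this, one_smul]
      refine ⟨?_, k + 1, by rwa [hsm]⟩
      rw [qv_smul, ← one_div, padicNorm.div, padicNorm.one, padicNorm.padicNorm_p_of_prime, one_div,
        inv_inv]
      calc (N : ℚ) ^ 2 * qv N x ≤ (N : ℚ) ^ 2 * (N : ℚ) ^ (-2 : ℤ) := by gcongr
        _ = (N : ℚ) ^ (-0 : ℤ) := by
          rw [← zpow_natCast, ← zpow_add₀ (natCast_ne_zero_rat N)]; rfl
    · rw [← Int.cast_smul_eq_zsmul ℚ, smul_smul]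
      push_cast
      rw [mul_inv_cancel₀ (natCast_ne_zero_rat N), one_smul]
  · rintro ⟨y, hy, rfl⟩
    have hy' : y ∈ radPow O N 0 := by rw [radPow_zero N hO]; exact hy
    have := pow_mem_radPow N (j := 2) (k := 1) (by norm_num) hy (by simpa using hy'.1)
    simpa using this

theorem isLattice_radPow_one (hO : IsMaximalOrder O) :
    Submodule.IsLattice ℚ (radPow O N 1) := by
  refine isLattice_of_forall_smul_mem (I := Subalgebra.toSubmodule O) hO.1 hO.1.fg ?_
    (n := N) (by exact_mod_cast hN.out.ne_zero) fun x hx => ?_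
  · rw [← radPow_zero N hO]; exact radPow_anti N (by norm_num)
  · exact radPow_anti N (by norm_num) ((radPow_two N hO).2 ⟨x, hx, rfl⟩)

theorem order_mul_radPow (hO : IsMaximalOrder O) (j : ℤ) :
    Subalgebra.toSubmodule O * radPow O N j = radPow O N j := by
  rw [← radPow_zero N hO, radPow_mul N hO.1, zero_add]

theorem radPow_mul_order (hO : IsMaximalOrder O) (j : ℤ) :
    radPow O N j * Subalgebra.toSubmodule O = radPow O N j := by
  rw [← radPow_zero N hO, radPow_mul N hO.1, add_zero]

/-- The two-sided prime ideal above `N`. -/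
def radIdeal (hO : IsMaximalOrder O) : InvTwoSidedIdeal O where
  carrier := radPow O N 1
  isLattice := isLattice_radPow_one N hO
  order_mul := order_mul_radPow N hO 1
  mul_order := radPow_mul_order N hO 1
  invertible := ⟨radPow O N (-1), by rw [radPow_mul N hO.1, ← radPow_zero N hO]; rfl,
    by rw [radPow_mul N hO.1, ← radPow_zero N hO]; rfl⟩

theorem relIndex_radPow_two (hO : IsMaximalOrder O) :
    (radPow O N 2).toAddSubgroup.relIndex (Subalgebra.toSubmodule O).toAddSubgroup = N ^ 4 := by
  obtain ⟨b, hb⟩ := exists_basis_of_isLattice (d := 4) hO.1 finrank_eq_four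
  have hli : LinearIndependent ℤ b := b.linearIndependent.restrict_scalars' ℤ
  let b' : Module.Basis (Fin 4) ℤ (Subalgebra.toSubmodule O) :=
    (Module.Basis.span hli).map (LinearEquiv.ofEq _ _ hb.symm)
  haveI : Module.Free ℤ (Subalgebra.toSubmodule O).toAddSubgroup.toIntSubmodule :=
    Module.Free.of_basis b'
  haveI : Module.Finite ℤ (Subalgebra.toSubmodule O).toAddSubgroup.toIntSubmodule :=
    Module.Finite.of_basis b'
  have h1 := AddSubgroup.relIndex_map_nsmul N (Subalgebra.toSubmodule O).toAddSubgroup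
  have h2 : Module.finrank ℤ (Subalgebra.toSubmodule O).toAddSubgroup = 4 :=
    (Module.finrank_eq_card_basis b').trans (by simp)
  rw [h2] at h1
  rw [← h1]
  congr 1
  ext x
  simp only [Submodule.mem_toAddSubgroup, radPow_two N hO, AddSubgroup.mem_map]
  constructor
  · rintro ⟨y, hy, rfl⟩; exact ⟨y, hy, by simp⟩
  · rintro ⟨y, hy, rfl⟩; exact ⟨y, hy, by simp⟩

/-- Left multiplication by a local generator `w` induces an isomorphism from `O / P` to `P / P²`. As
`P² = N O` has index `N⁴`, the index of `P` is `N²`. -/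
theorem relIndex_radPow_one_two (hO : IsMaximalOrder O) :
    (radPow O N 2).toAddSubgroup.relIndex (radPow O N 1).toAddSubgroup =
      (radPow O N 1).toAddSubgroup.relIndex (radPow O N 0).toAddSubgroup := by
  obtain ⟨w, w', s, hw, hw', hs, hww, hqw⟩ := exists_local_generators N hO.1 1
  let f : (radPow O N 0).toAddSubgroup →+ (radPow O N 1).toAddSubgroup :=
    { toFun := fun x => ⟨w * x, by simpa using mul_mem_radPow N hw x.2⟩
      map_zero' := by ext; simp
      map_add' := fun x y => by ext; simp [mul_add] }
  have hker : ((radPow O N 2).toAddSubgroup.addSubgroupOf (radPow O N 1).toAddSubgroup).comap f =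
      (radPow O N 1).toAddSubgroup.addSubgroupOf (radPow O N 0).toAddSubgroup := by
    ext x
    rw [AddSubgroup.mem_comap, AddSubgroup.mem_addSubgroupOf, AddSubgroup.mem_addSubgroupOf]
    change w * (x : B) ∈ radPow O N 2 ↔ (x : B) ∈ radPow O N 1
    constructor
    · rintro ⟨h1, -⟩
      refine ⟨?_, x.2.2⟩
      rw [qv_mul, hqw] at h1
      have h2 : (N : ℚ) ^ (-2 : ℤ) = (N : ℚ) ^ (-1 : ℤ) * (N : ℚ) ^ (-1 : ℤ) := by
        rw [← zpow_add₀ (natCast_ne_zero_rat N)]; rfl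
      rw [h2] at h1
      exact le_of_mul_le_mul_left h1 (zpow_pos (by exact_mod_cast hN.out.pos) _)
    · intro h
      have h2 := mul_mem_radPow N hw h
      rwa [one_add_one_eq_two] at h2
  have hsup : f.range ⊔
      (radPow O N 2).toAddSubgroup.addSubgroupOf (radPow O N 1).toAddSubgroup = ⊤ := by
    refine eq_top_iff.2 fun y _ => ?_
    have hc : IsCoprime s (N : ℤ) := by
      refine ((Nat.prime_iff_prime_int.1 hN.out).irreducible.coprime_iff_not_dvd.2 hs).symm
    obtain ⟨u, v, huv⟩ := hc
    have hwy : w' * y ∈ radPow O N 0 := by simpa using mul_mem_radPow N hw' y.2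
    have hyO : (y : B) ∈ O := by
      change (y : B) ∈ Subalgebra.toSubmodule O
      rw [← radPow_zero N hO]; exact radPow_anti N (by norm_num) y.2
    have hy2 : v • ((N : ℤ) • (y : B)) ∈ radPow O N 2 :=
      Submodule.smul_mem _ _ ((radPow_two N hO).2 ⟨y, hyO, rfl⟩)
    refine AddSubgroup.mem_sup.2 ⟨f ⟨u • (w' * y), Submodule.smul_mem _ _ hwy⟩, ⟨_, rfl⟩,
      ⟨v • ((N : ℤ) • (y : B)), radPow_anti N (by norm_num) hy2⟩, hy2, ?_⟩
    ext
    change w * (u • (w' * (y : B))) + v • ((N : ℤ) • (y : B)) = y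
    rw [mul_smul_comm, ← mul_assoc, hww, ← Algebra.smul_def, Int.cast_smul_eq_zsmul, smul_smul,
      smul_smul, ← add_smul, huv, one_smul]
  change ((radPow O N 2).toAddSubgroup.addSubgroupOf (radPow O N 1).toAddSubgroup).index = 
    ((radPow O N 1).toAddSubgroup.addSubgroupOf (radPow O N 0).toAddSubgroup).index
  rw [← hker, AddSubgroup.index_comap, ← AddSubgroup.relIndex_sup_right, hsup,
    AddSubgroup.relIndex_top_right]

theorem relIndex_radPow_one (hO : IsMaximalOrder O) :
    (radPow O N 1).toAddSubgroup.relIndex (Subalgebra.toSubmodule O).toAddSubgroup = N ^ 2 := by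
  have h1 := relIndex_radPow_two N hO
  have h2 := relIndex_radPow_one_two N hO
  rw [radPow_zero N hO] at h2
  have h21 : (radPow O N 2).toAddSubgroup ≤ (radPow O N 1).toAddSubgroup :=
    fun x hx => radPow_anti N (by norm_num) hx
  have h10 : (radPow O N 1).toAddSubgroup ≤ (Subalgebra.toSubmodule O).toAddSubgroup := by
    rw [← radPow_zero N hO]; exact fun x hx => radPow_anti N (by norm_num) hx
  have h3 := AddSubgroup.relIndex_mul_relIndex _ _ _ h21 h10
  rw [h1, h2, ← sq, show N ^ 4 = (N ^ 2) ^ 2 by ring] at h3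
  exact Nat.pow_left_injective (n := 2) (by norm_num) h3

/-- If `Q` contained an element `x` of norm `m` prime to `N`, then `m = x x̄` and the index `N²`
would both lie in `Q`, forcing `Q = O`. So `Q` lies in the prime above `N`, and the indices agree.
-/
theorem hasNorm_iff_eq_radIdeal (hO : IsMaximalOrder O) (Q : InvTwoSidedIdeal O) :
    Q.HasNorm N ↔ Q = radIdeal N hO := by
  constructor
  · rintro ⟨h1, h2⟩
    have hle : Q.carrier ≤ radPow O N 1 := by
      intro x hx
      have hx0 : x ∈ radPow O N 0 := by rw [radPow_zero N hO]; exact h1 hx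
      refine ⟨?_, hx0.2⟩
      refine qv_le_inv_of_lt_one N (lt_of_le_of_ne (by simpa using hx0.1) fun hq => ?_)
      obtain ⟨m, hm⟩ := nrd_int hO.1 (h1 hx)
      have hmN : ¬ (N : ℤ) ∣ m := by
        rw [qv, hm] at hq
        exact (padicNorm.int_eq_one_iff m).1 hq
      have e1 : m • (1 : B) ∈ Q.carrier := by
        have : m • (1 : B) = x * qconj x := by
          rw [mul_qconj, hm, Algebra.algebraMap_eq_smul_one, Int.cast_smul_eq_zsmul]
        rw [this, ← Q.mul_order]
        exact Submodule.mul_mem_mul hx (qconj_mem hO.1 (h1 hx))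
      have e2 : ((N : ℤ) ^ 2) • (1 : B) ∈ Q.carrier := by
        have := AddSubgroup.nsmul_index_mem
          (Q.carrier.toAddSubgroup.addSubgroupOf (Subalgebra.toSubmodule O).toAddSubgroup)
          ⟨1, O.one_mem⟩
        rw [← AddSubgroup.relIndex, h2, AddSubgroup.mem_addSubgroupOf] at this
        have h3 : (N ^ 2) • (1 : B) ∈ Q.carrier := this
        rw [← natCast_zsmul] at h3
        exact_mod_cast h3
      have e3 := mem_of_coprime_smul N Q.carrier hmN e1 e2
      have e4 : Q.carrier = Subalgebra.toSubmodule O := by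
        refine le_antisymm h1 fun y hy => ?_
        rw [← Q.mul_order, ← one_mul y]
        exact Submodule.mul_mem_mul e3 hy
      rw [e4, AddSubgroup.relIndex_self] at h2
      have := Nat.one_lt_pow two_ne_zero hN.out.one_lt
      omega
    have h10 : (radPow O N 1).toAddSubgroup ≤ (Subalgebra.toSubmodule O).toAddSubgroup := by
      rw [← radPow_zero N hO]; exact fun x hx => radPow_anti N (by norm_num) hx
    have hle' : Q.carrier.toAddSubgroup ≤ (radPow O N 1).toAddSubgroup := hle
    have h3 := AddSubgroup.relIndex_mul_relIndex _ _ _ hle' h10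
    rw [h2, relIndex_radPow_one N hO] at h3
    have h4 : Q.carrier.toAddSubgroup.relIndex (radPow O N 1).toAddSubgroup = 1 := by
      have : 0 < N ^ 2 := pow_pos hN.out.pos 2
      exact Nat.eq_of_mul_eq_mul_right this (by rw [h3, one_mul])
    rw [AddSubgroup.relIndex_eq_one] at h4
    exact InvTwoSidedIdeal.ext (le_antisymm hle h4)
  · rintro rfl
    refine ⟨?_, relIndex_radPow_one N hO⟩
    rw [← radPow_zero N hO]; exact radPow_anti N (by norm_num)

/-- Apart from denominators, membership in `radPow` depends only on the norm, and `qv (x y z) = qv y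
· qv (x z)` with `x z` in `O'`. -/
theorem mul_radPow_mul_le (hO' : IsMaximalOrder O') {I J : Submodule ℤ B}
    (hIr : I * Subalgebra.toSubmodule O = I) (hIJ : I * J = Subalgebra.toSubmodule O') {j : ℤ} :
    I * radPow O N j * J ≤ radPow O' N j := by
  have key : ∀ x ∈ I, ∀ y ∈ radPow O N j, ∀ z ∈ J, x * y * z ∈ radPow O' N j := by
    rintro x hx y ⟨hy1, k, hk⟩ z hz
    refine ⟨?_, k, ?_⟩
    · have : x * z ∈ radPow O' N 0 := by
        rw [radPow_zero N hO', ← hIJ]; exact Submodule.mul_mem_mul hx hz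
      have h0 := this.1
      rw [neg_zero, zpow_zero] at h0
      calc qv N (x * y * z) = qv N y * qv N (x * z) := by rw [qv_mul, qv_mul, qv_mul]; ring
        _ ≤ (N : ℚ) ^ (-j) * 1 := mul_le_mul hy1 h0 (qv_nonneg _ _) (by positivity)
        _ = _ := mul_one _
    · change _ ∈ Subalgebra.toSubmodule O'
      rw [← smul_mul_assoc, ← mul_smul_comm, ← hIJ]
      refine Submodule.mul_mem_mul ?_ hz
      rw [← hIr]; exact Submodule.mul_mem_mul hx hk
  refine Submodule.mul_le.2 fun u hu z hz => ?_
  refine Submodule.mul_induction_on hu (fun x hx y hy => key x hx y hy z hz) fun u v h1 h2 => ?_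
  rw [add_mul]; exact Submodule.add_mem _ h1 h2

/-- Lattices with inverses carry the radical of one order to the radical of the other. -/
theorem mul_radPow_comm (hO : IsMaximalOrder O) (hO' : IsMaximalOrder O') {I J : Submodule ℤ B}
    (hIr : I * Subalgebra.toSubmodule O = I)
    (hJO : J * Subalgebra.toSubmodule O' = J)
    (hIJ : I * J = Subalgebra.toSubmodule O') (hJI : J * I = Subalgebra.toSubmodule O) (j : ℤ) :
    I * radPow O N j = radPow O' N j * I := by
  apply le_antisymm
  · calc I * radPow O N j = I * radPow O N j * J * I := by
          rw [mul_assoc _ J, hJI, mul_assoc, radPow_mul_order N hO]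
      _ ≤ _ := mul_le_mul' (mul_radPow_mul_le N hO' hIr hIJ) le_rfl
  · calc radPow O' N j * I = I * (J * radPow O' N j * I) := by
          rw [← mul_assoc, ← mul_assoc, hIJ, order_mul_radPow N hO']
      _ ≤ _ := mul_le_mul' le_rfl (mul_radPow_mul_le N hO hJO hJI)

end RadicalIdeal

end QuatForm
end

/-! ### Invertibility of right lattices; when the prime above `N` acts as an element -/

noncomputable section

namespace QuatForm

section RightLattice

variable {B : Type*} [Ring B] [Algebra ℚ B]

/-- The left order of a submodule, as a subalgebra. -/
def leftOrderAlg (I : Submodule ℤ B) : Subalgebra ℤ B where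
  carrier := leftOrder I
  mul_mem' {a b} ha hb x hx := by rw [mul_assoc]; exact ha _ (hb x hx)
  one_mem' x hx := by rwa [one_mul]
  add_mem' ha hb := (leftOrder I).add_mem ha hb
  zero_mem' := (leftOrder I).zero_mem
  algebraMap_mem' r x hx := by
    rw [Algebra.algebraMap_eq_smul_one, smul_mul_assoc, one_mul]; exact I.smul_mem r hx

/-- The right order of a submodule, as a subalgebra. -/
def rightOrderAlg (I : Submodule ℤ B) : Subalgebra ℤ B where
  carrier := {b | ∀ x ∈ I, x * b ∈ I}
  mul_mem' {a b} ha hb x hx := by rw [← mul_assoc]; exact hb _ (ha x hx)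
  one_mem' x hx := by rwa [mul_one]
  add_mem' ha hb x hx := by rw [mul_add]; exact I.add_mem (ha x hx) (hb x hx)
  zero_mem' x _ := by rw [mul_zero]; exact I.zero_mem
  algebraMap_mem' r x hx := by
    rw [Algebra.algebraMap_eq_smul_one, mul_smul_comm, mul_one]; exact I.smul_mem r hx

theorem toSubmodule_leftOrderAlg (I : Submodule ℤ B) :
    Subalgebra.toSubmodule (leftOrderAlg I) = leftOrder I := rfl

theorem mem_leftOrderAlg {I : Submodule ℤ B} {b : B} :
    b ∈ leftOrderAlg I ↔ ∀ x ∈ I, b * x ∈ I := Iff.rfl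

theorem mem_rightOrderAlg {I : Submodule ℤ B} {b : B} :
    b ∈ rightOrderAlg I ↔ ∀ x ∈ I, x * b ∈ I := Iff.rfl

theorem leftOrder_mul_self (I : Submodule ℤ B) : leftOrder I * I = I := by
  apply le_antisymm
  · exact Submodule.mul_le.2 fun b hb x hx => hb x hx
  · intro x hx
    rw [← one_mul x]
    exact Submodule.mul_mem_mul (leftOrderAlg I).one_mem hx

theorem le_leftOrder_iff {I L : Submodule ℤ B} : L ≤ leftOrder I ↔ L * I ≤ I :=
  Submodule.mul_le.symm

variable [DefiniteQuaternion B]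

theorem fg_of_forall_smul_mem {I J : Submodule ℤ B} (hI : Submodule.IsLattice ℚ I) {m : ℤ}
    (hm : m ≠ 0) (h : ∀ x ∈ J, m • x ∈ I) : J.FG := by
  let f : B →ₗ[ℤ] B := LinearMap.lsmul ℤ B m
  have hf : Function.Injective f := by
    intro x y hxy
    have : (m : ℤ) • x = m • y := hxy
    rw [← Int.cast_smul_eq_zsmul ℚ, ← Int.cast_smul_eq_zsmul ℚ m y] at this
    exact smul_right_injective B (by exact_mod_cast hm) this
  haveI : IsNoetherian ℤ I := isNoetherian_of_fg_of_noetherian _ hI.fg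
  have h1 : (J.map f).FG := by
    refine Submodule.FG.of_le hI.fg ?_
    rintro _ ⟨x, hx, rfl⟩; exact h x hx
  exact Submodule.fg_of_fg_map_injective f hf h1

theorem isOrder_leftOrderAlg {I : Submodule ℤ B} (hI : Submodule.IsLattice ℚ I) :
    IsOrder (leftOrderAlg I) := by
  refine ⟨?_, eq_top_iff.2 fun x _ => ?_⟩
  · obtain ⟨m, hm, hm1⟩ := exists_zsmul_mem hI (1 : B)
    refine fg_of_forall_smul_mem hI (m := m) (by exact_mod_cast hm.ne') fun x hx => ?_
    have := hx _ hm1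
    rwa [mul_smul_comm, mul_one] at this
  · obtain ⟨m, hm, h⟩ := exists_zsmul_le hI (J := I.map (LinearMap.mulLeft ℤ x)) (hI.fg.map _)
    have h1 : (m : ℤ) • x ∈ leftOrder I := fun y hy => by
      rw [smul_mul_assoc]; exact h _ ⟨y, hy, rfl⟩
    have h2 : x = ((m : ℤ) : ℚ)⁻¹ • ((m : ℤ) • x) := by
      rw [← Int.cast_smul_eq_zsmul ℚ, smul_smul, inv_mul_cancel₀, one_smul]
      exact_mod_cast hm.ne'
    rw [h2]
    exact Submodule.smul_mem _ _ (Submodule.subset_span h1)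

theorem isOrder_rightOrderAlg {I : Submodule ℤ B} (hI : Submodule.IsLattice ℚ I) :
    IsOrder (rightOrderAlg I) := by
  refine ⟨?_, eq_top_iff.2 fun x _ => ?_⟩
  · obtain ⟨m, hm, hm1⟩ := exists_zsmul_mem hI (1 : B)
    refine fg_of_forall_smul_mem hI (m := m) (by exact_mod_cast hm.ne') fun x hx => ?_
    have := (mem_rightOrderAlg.1 hx) _ hm1
    rwa [smul_mul_assoc, one_mul] at this
  · obtain ⟨m, hm, h⟩ := exists_zsmul_le hI (J := I.map (LinearMap.mulRight ℤ x)) (hI.fg.map _)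
    have h1 : (m : ℤ) • x ∈ rightOrderAlg I := mem_rightOrderAlg.2 fun y hy => by
      rw [mul_smul_comm]; exact h _ ⟨y, hy, rfl⟩
    have h2 : x = ((m : ℤ) : ℚ)⁻¹ • ((m : ℤ) • x) := by
      rw [← Int.cast_smul_eq_zsmul ℚ, smul_smul, inv_mul_cancel₀, one_smul]
      exact_mod_cast hm.ne'
    rw [h2]
    exact Submodule.smul_mem _ _ (Submodule.subset_span h1)

/-- The dual of a product is a colon module. Together with biduality this turns the products of `I`
with its dual into duals of its left and right orders. -/
theorem mem_trdDual_mul {I J : Submodule ℤ B} {x : B} :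
    x ∈ trdDual (I * J) ↔ ∀ y ∈ I, x * y ∈ trdDual J := by
  simp only [mem_trdDual]
  constructor
  · intro h y hy z hz
    rw [mul_assoc]; exact h _ (Submodule.mul_mem_mul hy hz)
  · intro h u hu
    refine Submodule.mul_induction_on hu (fun y hy z hz => ?_) fun u v hu hv => ?_
    · rw [← mul_assoc]; exact h y hy z hz
    · obtain ⟨a, ha⟩ := hu
      obtain ⟨b, hb⟩ := hv
      exact ⟨a + b, by rw [mul_add, map_add, ha, hb]; push_cast; rfl⟩

theorem mem_trdDual_mul' {I J : Submodule ℤ B} {x : B} :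
    x ∈ trdDual (I * J) ↔ ∀ z ∈ J, z * x ∈ trdDual I := by
  rw [mem_trdDual_mul]
  simp only [mem_trdDual]
  constructor
  · intro h z hz y hy
    have := h y hy z hz
    rwa [trd_mul_comm, ← mul_assoc] at this
  · intro h y hy z hz
    have := h z hz y hy
    rwa [mul_assoc, trd_mul_comm] at this

variable {O : Subalgebra ℤ B} {I : Submodule ℤ B}

theorem mem_order_of_forall_mul_mem (hO : IsMaximalOrder O) (hI : Submodule.IsLattice ℚ I)
    (hIr : I * Subalgebra.toSubmodule O = I) {x : B} : (∀ y ∈ I, y * x ∈ I) ↔ x ∈ O := by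
  have hle : O ≤ rightOrderAlg I := fun x hx => mem_rightOrderAlg.2 fun y hy => by
    rw [← hIr]; exact Submodule.mul_mem_mul hy hx
  have := hO.eq_of_ge (isOrder_rightOrderAlg hI) hle
  rw [← mem_rightOrderAlg, ← this]

theorem trdDual_mul_self (hO : IsMaximalOrder O) (hI : Submodule.IsLattice ℚ I)
    (hIr : I * Subalgebra.toSubmodule O = I) :
    trdDual I * I = trdDual (Subalgebra.toSubmodule O) := by
  rw [← trdDual_trdDual (isLattice_mul (isLattice_trdDual hI) hI)]
  congr 1
  ext x
  rw [mem_trdDual_mul', trdDual_trdDual hI, mem_order_of_forall_mul_mem hO hI hIr]; rfl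

theorem self_mul_trdDual (hI : Submodule.IsLattice ℚ I) :
    I * trdDual I = trdDual (leftOrder I) := by
  rw [← trdDual_trdDual (isLattice_mul hI (isLattice_trdDual hI))]
  congr 1
  ext x
  rw [mem_trdDual_mul, trdDual_trdDual hI]; rfl

theorem trdDual_mul_leftOrder : trdDual I * leftOrder I = trdDual I := by
  apply le_antisymm
  · refine Submodule.mul_le.2 fun x hx o ho => mem_trdDual.2 fun y hy => ?_
    rw [mul_assoc]; exact mem_trdDual.1 hx _ (ho y hy)
  · intro x hx
    rw [← mul_one x]
    exact Submodule.mul_mem_mul hx (leftOrderAlg I).one_mem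

theorem order_mul_trdDual (hIr : I * Subalgebra.toSubmodule O = I) :
    Subalgebra.toSubmodule O * trdDual I = trdDual I := by
  apply le_antisymm
  · refine Submodule.mul_le.2 fun o ho x hx => mem_trdDual.2 fun y hy => ?_
    rw [mul_assoc, trd_mul_comm, mul_assoc]
    refine mem_trdDual.1 hx _ ?_
    rw [← hIr]; exact Submodule.mul_mem_mul hy ho
  · intro x hx
    rw [← one_mul x]
    exact Submodule.mul_mem_mul O.one_mem hx

variable (N : ℕ) [hN : Fact N.Prime] [hR : RamifiedOnlyAt B N]

/-- The inverse of a right lattice over a maximal order. -/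
def latticeInv (O : Subalgebra ℤ B) (I : Submodule ℤ B) : Submodule ℤ B := radPow O N 1 * trdDual I

/-- The dual of `I` times `I` is the dual of `O`, which is the inverse of the prime above `N`;
multiplying by that prime on the left leaves `O`. -/
theorem latticeInv_mul_self (hO : IsMaximalOrder O) (hI : Submodule.IsLattice ℚ I)
    (hIr : I * Subalgebra.toSubmodule O = I) :
    latticeInv N O I * I = Subalgebra.toSubmodule O := by
  rw [latticeInv, mul_assoc, trdDual_mul_self hO hI hIr, trdDual_eq_radPow N hO,
    radPow_mul N hO.1, ← radPow_zero N hO]; rfl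

theorem order_mul_latticeInv (hO : IsMaximalOrder O) :
    Subalgebra.toSubmodule O * latticeInv N O I = latticeInv N O I := by
  rw [latticeInv, ← mul_assoc, order_mul_radPow N hO]

theorem latticeInv_mul_leftOrder : latticeInv N O I * leftOrder I = latticeInv N O I := by
  rw [latticeInv, mul_assoc, trdDual_mul_leftOrder]

theorem mul_latticeInv_le (hO : IsMaximalOrder O) (hI : Submodule.IsLattice ℚ I)
    (hIr : I * Subalgebra.toSubmodule O = I) : I * latticeInv N O I ≤ leftOrder I := by
  rw [le_leftOrder_iff, mul_assoc, latticeInv_mul_self N hO hI hIr, hIr]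

/-- Write `I⁻¹` for `latticeInv`, so far only a left inverse. For an order `O₂` containing the left
order put `I₂ = O₂ I`. Then `I₂⁻¹ I = I₂⁻¹ O₂ I = O`, and multiplying by `I⁻¹` gives `I⁻¹ ≤ I₂⁻¹`;
the reverse inclusion is duality. Equal inverses give equal duals, so `I₂ = I` and `O₂` preserves
`I`. -/
theorem isMaximalOrder_leftOrderAlg (N : ℕ) [Fact N.Prime] [RamifiedOnlyAt B N]
    (hO : IsMaximalOrder O) (hI : Submodule.IsLattice ℚ I)
    (hIr : I * Subalgebra.toSubmodule O = I) : IsMaximalOrder (leftOrderAlg I) := by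
  refine ⟨isOrder_leftOrderAlg hI, fun O₂ hO₂ hle => ?_⟩
  set L := Subalgebra.toSubmodule O₂
  set I₂ := L * I with hI₂def
  have hLL : L * L = L := O₂.isIdempotentElem_toSubmodule
  have hI₂ : Submodule.IsLattice ℚ I₂ := isLattice_mul hO₂ hI
  have hI₂O : I₂ * Subalgebra.toSubmodule O = I₂ := by rw [hI₂def, mul_assoc, hIr]
  have hLI₂ : L ≤ leftOrder I₂ := by rw [le_leftOrder_iff, hI₂def, ← mul_assoc, hLL]
  have hII₂ : I ≤ I₂ := fun x hx => by
    rw [← one_mul x]; exact Submodule.mul_mem_mul O₂.one_mem hx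
  have hJJ : latticeInv N O I₂ ≤ latticeInv N O I := mul_le_mul' le_rfl (trdDual_anti hII₂)
  have hJ₂L : latticeInv N O I₂ * L = latticeInv N O I₂ := by
    apply le_antisymm
    · calc _ ≤ latticeInv N O I₂ * leftOrder I₂ := mul_le_mul' le_rfl hLI₂
        _ = _ := latticeInv_mul_leftOrder N
    · intro x hx
      rw [← mul_one x]; exact Submodule.mul_mem_mul hx O₂.one_mem
  have hJ₂I : latticeInv N O I₂ * I = Subalgebra.toSubmodule O := by
    rw [← hJ₂L, mul_assoc]; exact latticeInv_mul_self N hO hI₂ hI₂O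
  have hJle : latticeInv N O I ≤ latticeInv N O I₂ := by
    calc latticeInv N O I = latticeInv N O I₂ * (I * latticeInv N O I) := by
          rw [← mul_assoc, hJ₂I, order_mul_latticeInv N hO]
      _ ≤ latticeInv N O I₂ * L :=
          mul_le_mul' le_rfl ((mul_latticeInv_le N hO hI hIr).trans hle)
      _ = _ := hJ₂L
  have hJ : latticeInv N O I = latticeInv N O I₂ := le_antisymm hJle hJJ
  have hdual : trdDual I = trdDual I₂ := by
    have h := congrArg (fun M => radPow O N (-1) * M) hJ
    simp only [latticeInv, ← mul_assoc, radPow_mul N hO.1, neg_add_cancel, radPow_zero N hO,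
      order_mul_trdDual hIr, order_mul_trdDual hI₂O] at h
    exact h
  have hI₂I : I₂ = I := by rw [← trdDual_trdDual hI₂, ← hdual, trdDual_trdDual hI]
  rw [hI₂I] at hLI₂
  exact hLI₂

/-- The left order is now known to be maximal, so its own inverse different produces a right inverse
of `I`, which must coincide with the left inverse. -/
theorem mul_latticeInv (hO : IsMaximalOrder O) (hI : Submodule.IsLattice ℚ I)
    (hIr : I * Subalgebra.toSubmodule O = I) : I * latticeInv N O I = leftOrder I := by
  have hO' := isMaximalOrder_leftOrderAlg N hO hI hIr
  set J₁ := trdDual I * radPow (leftOrderAlg I) N 1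
  have h1 : I * J₁ = leftOrder I := by
    rw [← mul_assoc, self_mul_trdDual hI, ← toSubmodule_leftOrderAlg, trdDual_eq_radPow N hO',
      radPow_mul N hO'.1, ← radPow_zero N hO']; rfl
  have h2 : J₁ = latticeInv N O I := by
    calc J₁ = Subalgebra.toSubmodule O * J₁ := by
          rw [← mul_assoc, order_mul_trdDual hIr]
      _ = latticeInv N O I * (I * J₁) := by
          rw [← latticeInv_mul_self N hO hI hIr, mul_assoc]
      _ = _ := by rw [h1, latticeInv_mul_leftOrder]
  rw [← h2, h1]

/-- Right lattices over a maximal order are invertible. -/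
def rightIdealOf (hO : IsMaximalOrder O) (I : Submodule ℤ B) (hI : Submodule.IsLattice ℚ I)
    (hIr : I * Subalgebra.toSubmodule O = I) : InvRightIdeal O where
  carrier := I
  isLattice := hI
  mul_order := hIr
  invertible := ⟨latticeInv N O I, mul_latticeInv N hO hI hIr, latticeInv_mul_self N hO hI hIr⟩

theorem mul_radPow_eq_radPow_mul (hO : IsMaximalOrder O) (hI : Submodule.IsLattice ℚ I)
    (hIr : I * Subalgebra.toSubmodule O = I) (j : ℤ) :
    I * radPow O N j = radPow (leftOrderAlg I) N j * I :=
  mul_radPow_comm N hO (isMaximalOrder_leftOrderAlg N hO hI hIr) hIr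
    (latticeInv_mul_leftOrder N) (mul_latticeInv N hO hI hIr) (latticeInv_mul_self N hO hI hIr) j

theorem mem_unit_smul {I : Submodule ℤ B} {c : Bˣ} {x : B} :
    x ∈ c • I ↔ ∃ y ∈ I, (c : B) * y = x := Iff.rfl

/-- `c` has the value of a uniformiser, so for `x` in the prime above `N` the product `c x` lies in
`N O = c² O`. -/
theorem radPow_one_eq_smul (hO : IsMaximalOrder O) {c : Bˣ} (hc : (c : B) * c = -(N : B))
    (hcO : (c : B) ∈ O) : radPow O N 1 = c • Subalgebra.toSubmodule O := by
  have hN0 := natCast_ne_zero_rat N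
  have hq : qv N (c : B) = (N : ℚ) ^ (-1 : ℤ) := by
    have h1 : qv N (c : B) * qv N (c : B) = (N : ℚ) ^ (-1 : ℤ) * (N : ℚ) ^ (-1 : ℤ) := by
      rw [← qv_mul, hc, qv_neg, qv, ← map_natCast (algebraMap ℚ B), nrd_algebraMap, padicNorm_pow,
        padicNorm.padicNorm_p_of_prime, zpow_neg, zpow_one, sq]
    have h2 := qv_nonneg N (c : B)
    have h3 : 0 < (N : ℚ) ^ (-1 : ℤ) := zpow_pos (by exact_mod_cast hN.out.pos) _
    nlinarith
  have hcP : (c : B) ∈ radPow O N 1 := ⟨hq.le, 0, by simpa using hcO⟩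
  apply le_antisymm
  · intro x hx
    have h1 := mul_mem_radPow N hcP hx
    rw [one_add_one_eq_two, radPow_two N hO] at h1
    obtain ⟨y, hy, hxy⟩ := h1
    refine mem_unit_smul.2 ⟨-y, O.neg_mem hy, ?_⟩
    refine c.isUnit.mul_left_cancel ?_
    rw [hxy, ← mul_assoc, hc]
    simp
  · intro x hx
    obtain ⟨y, hy, rfl⟩ := mem_unit_smul.1 hx
    rw [← radPow_mul_order N hO]
    exact Submodule.mul_mem_mul hcP hy

theorem unit_smul_mul (c : Bˣ) (I J : Submodule ℤ B) : (c • I) * J = c • (I * J) :=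
  smul_mul_assoc c I J

/-- An element of square `-N` acts on a stable lattice as the radical does. -/
theorem mul_radPow_one_eq_smul (hO : IsMaximalOrder O) (hI : Submodule.IsLattice ℚ I)
    (hIr : I * Subalgebra.toSubmodule O = I) {c : Bˣ} (hc : (c : B) * c = -(N : B))
    (hcI : ∀ x ∈ I, (c : B) * x ∈ I) : I * radPow O N 1 = c • I := by
  rw [mul_radPow_eq_radPow_mul N hO hI hIr,
    radPow_one_eq_smul N (isMaximalOrder_leftOrderAlg N hO hI hIr) hc hcI, unit_smul_mul,
    toSubmodule_leftOrderAlg, leftOrder_mul_self]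

theorem one_of_smul_eq_self_of_nrd (hI : Submodule.IsLattice ℚ I) {u : Bˣ} (hu : u • I = I) :
    nrd (u : B) = 1 := by
  have h1 : (u : B) ∈ leftOrderAlg I := fun x hx => by
    rw [← hu]; exact mem_unit_smul.2 ⟨x, hx, rfl⟩
  have h2 : ((u⁻¹ : Bˣ) : B) ∈ leftOrderAlg I := fun x hx => by
    have hu' : u⁻¹ • I = I := by rw [inv_smul_eq_iff, hu]
    rw [← hu']; exact mem_unit_smul.2 ⟨x, hx, rfl⟩
  obtain ⟨a, ha⟩ := nrd_int (isOrder_leftOrderAlg hI) h1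
  obtain ⟨b, hb⟩ := nrd_int (isOrder_leftOrderAlg hI) h2
  have h3 : nrd (u : B) * nrd ((u⁻¹ : Bˣ) : B) = 1 := by
    rw [← nrd_mul, Units.mul_inv, nrd_one]
  have h4 : 0 ≤ nrd (u : B) := nrd_nonneg _
  rw [ha] at h3 h4 ⊢
  rw [hb] at h3
  have h5 : a * b = 1 := by exact_mod_cast h3
  have h6 : 0 ≤ a := by exact_mod_cast h4
  rcases Int.mul_eq_one_iff_eq_one_or_neg_one.1 h5 with ⟨h, -⟩ | ⟨h, -⟩
  · rw [h]; norm_num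
  · omega

/-- If the radical acts on a lattice as an element does, this element has square `-N`. -/
theorem mul_self_eq_of_mul_radPow (hO : IsMaximalOrder O) (hI : Submodule.IsLattice ℚ I)
    (hIr : I * Subalgebra.toSubmodule O = I) {c : Bˣ} (h : I * radPow O N 1 = c • I) :
    (c : B) * c = -(N : B) ∧ ∀ x ∈ I, (c : B) * x ∈ I := by
  have hN0 := natCast_ne_zero_rat N
  have hcI : ∀ x ∈ I, (c : B) * x ∈ I := fun x hx => by
    have h1 : (c : B) * x ∈ I * radPow O N 1 := by rw [h]; exact mem_unit_smul.2 ⟨x, hx, rfl⟩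
    refine (?_ : I * radPow O N 1 ≤ I) h1
    calc _ ≤ I * radPow O N 0 := mul_le_mul' le_rfl (radPow_anti N (by norm_num))
      _ = I := by rw [radPow_zero N hO, hIr]
  refine ⟨?_, hcI⟩
  -- Applying the prime twice is multiplication by `N`, so `c²` and `N` differ by an automorphism of
  -- `I`, which has norm 1; hence `nrd c = N`.
  have hNc : (c * c) • I = (Units.mk0 (N : ℚ) hN0).map (algebraMap ℚ B).toMonoidHom • I := by
    have h2 : I * (radPow O N 1 * radPow O N 1) = (c * c) • I := by
      rw [← mul_assoc, h, unit_smul_mul, h, mul_smul]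
    rw [← h2, radPow_mul N hO.1, one_add_one_eq_two]
    apply le_antisymm
    · refine Submodule.mul_le.2 fun x hx y hy => ?_
      obtain ⟨z, hz, rfl⟩ := (radPow_two N hO).1 hy
      refine mem_unit_smul.2 ⟨x * z, ?_, ?_⟩
      · rw [← hIr]; exact Submodule.mul_mem_mul hx hz
      · simp [← mul_assoc, (Nat.cast_commute N x).eq]
    · intro x hx
      obtain ⟨y, hy, rfl⟩ := mem_unit_smul.1 hx
      have : (N : B) * y = y * ((N : ℤ) • (1 : B)) := by simp [(Nat.cast_commute N y).eq]
      simp only [Units.coe_map, RingHom.toMonoidHom_eq_coe, MonoidHom.coe_coe, Units.val_mk0,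
        map_natCast, this]
      exact Submodule.mul_mem_mul hy ((radPow_two N hO).2 ⟨1, O.one_mem, rfl⟩)
  have hnrd : nrd (c : B) = N := by
    have h3 : ((Units.mk0 (N : ℚ) hN0).map (algebraMap ℚ B).toMonoidHom)⁻¹ • (c * c) • I = I := by
      rw [inv_smul_eq_iff, hNc]
    rw [smul_smul] at h3
    have h4 := one_of_smul_eq_self_of_nrd hI h3
    have h5 : nrd (((Units.mk0 (N : ℚ) hN0).map (algebraMap ℚ B).toMonoidHom : Bˣ) : B) *
        nrd ((((Units.mk0 (N : ℚ) hN0).map (algebraMap ℚ B).toMonoidHom)⁻¹ * (c * c) : Bˣ) : B)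
        = nrd (c : B) * nrd (c : B) := by
      rw [← nrd_mul, ← nrd_mul, ← Units.val_mul, mul_inv_cancel_left, Units.val_mul]
    rw [h4, mul_one] at h5
    simp only [Units.coe_map, RingHom.toMonoidHom_eq_coe, MonoidHom.coe_coe, Units.val_mk0,
      nrd_algebraMap] at h5
    have h6 : 0 ≤ nrd (c : B) := nrd_nonneg _
    have h7 : (0 : ℚ) < N := by exact_mod_cast hN.out.pos
    nlinarith
  have hq : qv N (c : B) < 1 := by
    rw [qv, hnrd, padicNorm.padicNorm_p_of_prime]
    exact inv_lt_one_of_one_lt₀ (one_lt_cast N)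
  obtain ⟨t, ht⟩ := trd_int (isOrder_leftOrderAlg hI) (x := (c : B)) hcI
  have h1 := padicNorm_trd_lt_one N hq
  rw [ht, padicNorm.int_lt_one_iff] at h1
  obtain ⟨k, rfl⟩ := h1
  -- The trace is `N k`, and `(N k)² ≤ 4 N` means `N k² ≤ 4`. Here `N > 3` makes the trace vanish.
  have h2 := trd_sq_le (c : B)
  rw [ht, hnrd] at h2
  have h3 : (N : ℤ) * (N * k ^ 2) ≤ N * 4 := by
    have : ((N * k : ℤ) : ℚ) ^ 2 ≤ 4 * N := h2
    have : (N * k : ℤ) ^ 2 ≤ 4 * N := by exact_mod_cast this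
    linarith
  have h4 : (N : ℤ) * k ^ 2 ≤ 4 := le_of_mul_le_mul_left h3 (by exact_mod_cast hN.out.pos)
  have h5 : 3 < N := hR.three_lt
  have h6 : N ≠ 4 := by
    rintro rfl; exact absurd hN.out (by norm_num)
  have h7 : k = 0 := by
    by_contra hk
    have : 1 ≤ k ^ 2 := by nlinarith [sq_nonneg k, Int.one_le_abs hk, sq_abs k]
    have : (N : ℤ) * 1 ≤ 4 := (mul_le_mul_of_nonneg_left this (by positivity)).trans h4
    omega
  rw [mul_self_eq, ht, h7, hnrd]
  simp

end RightLattice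

end QuatForm
end

/-! ### Even unimodular lattices of signature `(n, n)`, `n ≤ 4`, by Minkowski's theorem -/

noncomputable section

namespace QuatForm

section Minkowski

open MeasureTheory

theorem volume_sum_sq_lt_two (n : ℕ) [NeZero n] : volume {x : Fin n → ℝ | ∑ i, x i ^ 2 < 2} =
    ENNReal.ofReal ((2 * Real.pi) ^ ((n : ℝ) / 2) / Real.Gamma (n / 2 + 1)) := by
  have h := MeasureTheory.volume_sum_rpow_lt (ι := Fin n) (p := 2) (by norm_num) (Real.sqrt 2)
  have e : {x : Fin n → ℝ | ∑ i, x i ^ 2 < 2} =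
      {x : Fin n → ℝ | (∑ i, |x i| ^ (2 : ℝ)) ^ (1 / (2 : ℝ)) < Real.sqrt 2} := by
    ext x
    change (∑ i, x i ^ 2 < 2) ↔ ((∑ i, |x i| ^ (2 : ℝ)) ^ (1 / (2 : ℝ)) < Real.sqrt 2)
    rw [← Real.sqrt_eq_rpow, Real.sqrt_lt_sqrt_iff (by positivity)]
    simp
  rw [e, h, ← ENNReal.ofReal_pow (by positivity), ← ENNReal.ofReal_mul (by positivity)]
  congr 1
  have h3 : Real.Gamma (1 / 2 + 1) = Real.sqrt Real.pi / 2 := by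
    rw [Real.Gamma_add_one (by norm_num), Real.Gamma_one_half_eq]; ring
  rw [h3, Fintype.card_fin, mul_div_cancel₀ _ (two_ne_zero), mul_div_assoc', ← mul_pow,
    ← Real.sqrt_mul (by norm_num)]
  rw [Real.sqrt_eq_rpow, ← Real.rpow_natCast, ← Real.rpow_mul (by positivity)]
  congr 2; ring

/-- Minkowski's theorem needs volume above `2^(2n)` for a product of two balls, so each ball of
squared radius 2 must exceed `2^n`. The bound `π > 3` suffices here; the inequality is false for `n
= 5`. -/
theorem two_pow_lt_ball_volume {n : ℕ} (h0 : 0 < n) (h4 : n ≤ 4) :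
    (2 : ℝ) ^ n < (2 * Real.pi) ^ ((n : ℝ) / 2) / Real.Gamma (n / 2 + 1) := by
  have hpi := Real.pi_gt_three
  have hG : 0 < Real.Gamma ((n : ℝ) / 2 + 1) := Real.Gamma_pos_of_pos (by positivity)
  rw [lt_div_iff₀ hG]
  refine lt_of_pow_lt_pow_left₀ 2 (by positivity) ?_
  rw [← Real.rpow_mul_natCast (by positivity), Nat.cast_ofNat, div_mul_cancel₀ _ two_ne_zero,
    Real.rpow_natCast, mul_pow]
  have hs : Real.sqrt Real.pi ^ 2 = Real.pi := Real.sq_sqrt (by positivity)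
  have g1 : Real.Gamma (1 / 2 + 1) = Real.sqrt Real.pi / 2 := by
    rw [Real.Gamma_add_one (by norm_num), Real.Gamma_one_half_eq]; ring
  interval_cases n
  · rw [show ((1 : ℕ) : ℝ) / 2 + 1 = 1 / 2 + 1 by norm_num, g1, div_pow, hs]
    nlinarith
  · rw [show ((2 : ℕ) : ℝ) / 2 + 1 = ((1 : ℕ) : ℝ) + 1 by norm_num, Real.Gamma_nat_eq_factorial]
    norm_num; nlinarith
  · rw [show ((3 : ℕ) : ℝ) / 2 + 1 = (1 / 2 + 1) + 1 by norm_num, Real.Gamma_add_one (by norm_num),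
      g1, mul_pow, div_pow, hs]
    norm_num; nlinarith [pow_pos Real.pi_pos 3, sq_nonneg (Real.pi - 3)]
  · rw [show ((4 : ℕ) : ℝ) / 2 + 1 = ((2 : ℕ) : ℝ) + 1 by norm_num, Real.Gamma_nat_eq_factorial]
    have : (3 : ℝ) ^ 4 < Real.pi ^ 4 := by gcongr
    norm_num [mul_pow] at this ⊢; nlinarith

theorem convex_sum_sq_lt_two (n : ℕ) : Convex ℝ {x : Fin n → ℝ | ∑ i, x i ^ 2 < 2} := by
  intro x hx y hy a b ha hb hab
  change ∑ i, (a * x i + b * y i) ^ 2 < 2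
  have hx' : ∑ i, x i ^ 2 < 2 := hx
  have hy' : ∑ i, y i ^ 2 < 2 := hy
  calc ∑ i, (a * x i + b * y i) ^ 2 ≤ ∑ i, (a * x i ^ 2 + b * y i ^ 2) := by
        refine Finset.sum_le_sum fun i _ => ?_
        have h1 : b = 1 - a := by linarith
        subst h1
        nlinarith [mul_nonneg (mul_nonneg ha hb) (sq_nonneg (x i - y i))]
    _ = a * ∑ i, x i ^ 2 + b * ∑ i, y i ^ 2 := by
        rw [Finset.sum_add_distrib, Finset.mul_sum, Finset.mul_sum]
    _ ≤ a * max (∑ i, x i ^ 2) (∑ i, y i ^ 2) + b * max (∑ i, x i ^ 2) (∑ i, y i ^ 2) := by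
        gcongr
        · exact le_max_left _ _
        · exact le_max_right _ _
    _ = max (∑ i, x i ^ 2) (∑ i, y i ^ 2) := by rw [← add_mul, hab, one_mul]
    _ < 2 := max_lt hx' hy'

theorem exists_int_vector {n : ℕ} (h0 : 0 < n) (h4 : n ≤ 4)
    (A : Matrix (Fin n ⊕ Fin n) (Fin n ⊕ Fin n) ℝ) (hA : |A.det| = 1) :
    ∃ v : Fin n ⊕ Fin n → ℤ, v ≠ 0 ∧ ∑ i, (A.mulVec (fun j => (v j : ℝ)) (Sum.inl i)) ^ 2 < 2 ∧
      ∑ i, (A.mulVec (fun j => (v j : ℝ)) (Sum.inr i)) ^ 2 < 2 := by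
  have : NeZero n := ⟨h0.ne'⟩
  set D : Set (Fin n → ℝ) := {x | ∑ i, x i ^ 2 < 2} with hD
  let φ := MeasurableEquiv.sumPiEquivProdPi (fun _ : Fin n ⊕ Fin n => ℝ)
  set T : Set (Fin n ⊕ Fin n → ℝ) := φ ⁻¹' (D ×ˢ D) with hT
  have hvD : ENNReal.ofReal ((2 : ℝ) ^ n) < volume D := by
    rw [hD, volume_sum_sq_lt_two]
    have := two_pow_lt_ball_volume h0 h4
    exact (ENNReal.ofReal_lt_ofReal_iff (lt_trans (by positivity) this)).2 this
  have hvT : ENNReal.ofReal ((2 : ℝ) ^ n) * ENNReal.ofReal ((2 : ℝ) ^ n) < volume T := by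
    rw [hT, (volume_measurePreserving_sumPiEquivProdPi _).measure_preimage_equiv,
      Measure.volume_eq_prod, Measure.prod_prod]
    exact ENNReal.mul_lt_mul hvD hvD
  have hdet : LinearMap.det (Matrix.toLin' A) ≠ 0 := by
    rw [LinearMap.det_toLin']; intro h; rw [h] at hA; simp at hA
  set S := (Matrix.toLin' A) ⁻¹' T with hS
  have hvS : volume S = volume T := by
    rw [hS, Measure.addHaar_preimage_linearMap volume hdet, LinearMap.det_toLin', abs_inv, hA]
    simp
  have hTsymm : ∀ x ∈ T, -x ∈ T := by
    rintro x ⟨h1, h2⟩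
    refine ⟨?_, ?_⟩
    · change ∑ i, (-x (Sum.inl i)) ^ 2 < 2
      simp only [neg_sq]
      exact h1
    · change ∑ i, (-x (Sum.inr i)) ^ 2 < 2
      simp only [neg_sq]
      exact h2
  have hTconv : Convex ℝ T :=
    ((convex_sum_sq_lt_two n).prod (convex_sum_sq_lt_two n)).linear_preimage
      (LinearEquiv.sumPiEquivProdPi ℝ (Fin n) (Fin n) (fun _ => ℝ)).toLinearMap
  have : Countable
      (Submodule.span ℤ (Set.range (Pi.basisFun ℝ (Fin n ⊕ Fin n)))).toAddSubgroup :=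
    inferInstanceAs (Countable (Submodule.span ℤ (Set.range (Pi.basisFun ℝ (Fin n ⊕ Fin n)))))
  obtain ⟨⟨x, hx⟩, hx0, hxS⟩ := exists_ne_zero_mem_lattice_of_measure_mul_two_pow_lt_measure
    (μ := (volume : Measure (Fin n ⊕ Fin n → ℝ))) (s := S)
    (ZSpan.isAddFundamentalDomain' (Pi.basisFun ℝ (Fin n ⊕ Fin n)) volume)
    (fun x hx => by
      change Matrix.toLin' A (-x) ∈ T
      rw [map_neg]; exact hTsymm _ hx)
    (hTconv.linear_preimage (Matrix.toLin' A))
    (by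
      rw [hvS]
      refine lt_of_eq_of_lt ?_ hvT
      rw [ZSpan.volume_fundamentalDomain, ← ENNReal.ofReal_mul (by positivity)]
      have : (Matrix.of ⇑(Pi.basisFun ℝ (Fin n ⊕ Fin n))) = 1 := by
        ext i j; simp [Matrix.one_apply, Pi.single_apply, eq_comm]
      rw [this, Matrix.det_one, abs_one, ENNReal.ofReal_one, one_mul, Module.finrank_fintype_fun_eq_card,
        Fintype.card_sum, Fintype.card_fin, ← pow_add, ENNReal.ofReal_pow (by norm_num)]
      norm_num)
  have hx' : x ∈ Submodule.span ℤ (Set.range (Pi.basisFun ℝ (Fin n ⊕ Fin n))) := hx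
  rw [Module.Basis.mem_span_iff_repr_mem] at hx'
  choose v hv using hx'
  have hvx : (fun j => (v j : ℝ)) = x := by
    funext j; simpa using hv j
  refine ⟨v, ?_, ?_⟩
  · rintro rfl
    apply hx0
    ext j
    simp [← hvx]
  · rw [hvx]
    exact ⟨hxS.1, hxS.2⟩

/-- Used when a hyperbolic plane is split off: the positive and the negative part each lose the
direction of the isotropic vector. -/
theorem exists_projection {E : Type*} [NormedAddCommGroup E] [InnerProductSpace ℝ E] {u : E}
    (hu : u ≠ 0) : ∃ P : E →+ (Submodule.span ℝ {u})ᗮ, ∀ x y, inner ℝ (P x) (P y) =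
      inner ℝ x y - inner ℝ u x * inner ℝ u y / ‖u‖ ^ 2 := by
  have hu2 : ‖u‖ ^ 2 ≠ 0 := pow_ne_zero 2 (norm_ne_zero_iff.2 hu)
  refine ⟨AddMonoidHom.mk' (fun x => ⟨x - (inner ℝ u x / ‖u‖ ^ 2) • u, ?_⟩) ?_, ?_⟩
  · rw [Submodule.mem_orthogonal_singleton_iff_inner_right, inner_sub_right, inner_smul_right,
      real_inner_self_eq_norm_sq, div_mul_cancel₀ _ hu2, sub_self]
  · intro x y
    ext
    simp only [Submodule.coe_add, inner_add_right, add_div, add_smul]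
    abel
  · intro x y
    change inner ℝ (x - (inner ℝ u x / ‖u‖ ^ 2) • u) (y - (inner ℝ u y / ‖u‖ ^ 2) • u) = _
    simp only [inner_sub_left, inner_sub_right, inner_smul_left, inner_smul_right,
      real_inner_self_eq_norm_sq, real_inner_comm u x]
    simp
    field_simp
    ring

theorem abs_det_eq_one_of_gram {n : ℕ} {G : Matrix (Fin n ⊕ Fin n) (Fin n ⊕ Fin n) ℤ}
    {A D : Matrix (Fin n ⊕ Fin n) (Fin n ⊕ Fin n) ℝ} (hG : IsUnit G.det) (hD : |D.det| = 1)
    (h : G.map (Int.castRingHom ℝ) = A.transpose * D * A) : |A.det| = 1 := by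
  have h1 := congrArg Matrix.det h
  rw [Matrix.det_mul, Matrix.det_mul, Matrix.det_transpose, ← RingHom.mapMatrix_apply,
    ← RingHom.map_det] at h1
  have h2 := congrArg abs h1
  rw [abs_mul, abs_mul, hD, mul_one] at h2
  have h3 : |(Int.castRingHom ℝ) G.det| = 1 := by
    rcases Int.isUnit_iff.1 hG with h | h <;> simp [h]
  rw [h3] at h2
  have := abs_nonneg A.det
  nlinarith

/-- Minkowski gives a nonzero `v` whose positive and negative parts both have squared norm below 2.
Then `b v v` lies strictly between `-2` and `2`, and evenness makes it 0. -/
theorem exists_isotropic_vector {n : ℕ} (h0 : 0 < n) (h4 : n ≤ 4) {M E₁ E₂ : Type*} [AddCommGroup M]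
    [Module.Free ℤ M] [Module.Finite ℤ M] [NormedAddCommGroup E₁] [InnerProductSpace ℝ E₁]
    [FiniteDimensional ℝ E₁] [NormedAddCommGroup E₂] [InnerProductSpace ℝ E₂]
    [FiniteDimensional ℝ E₂] (b : M →ₗ[ℤ] M →ₗ[ℤ] ℤ) (f₁ : M →+ E₁) (f₂ : M →+ E₂)
    (hM : Module.finrank ℤ M = 2 * n) (hE₁ : Module.finrank ℝ E₁ = n)
    (hE₂ : Module.finrank ℝ E₂ = n)
    (hb : ∀ x y, (b x y : ℝ) = inner ℝ (f₁ x) (f₁ y) - inner ℝ (f₂ x) (f₂ y))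
    (heven : ∀ x, Even (b x x)) (huni : ∀ φ : M →ₗ[ℤ] ℤ, ∃ x, ∀ y, b x y = φ y) :
    ∃ v : M, v ≠ 0 ∧ b v v = 0 := by
  let e : Module.Basis (Fin n ⊕ Fin n) ℤ M :=
    (Module.finBasisOfFinrankEq ℤ M (by omega : Module.finrank ℤ M = n + n)).reindex
      finSumFinEquiv.symm
  let o₁ := (stdOrthonormalBasis ℝ E₁).reindex (finCongr hE₁)
  let o₂ := (stdOrthonormalBasis ℝ E₂).reindex (finCongr hE₂)
  let A : Matrix (Fin n ⊕ Fin n) (Fin n ⊕ Fin n) ℝ := Matrix.of fun i j =>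
    Sum.elim (fun i => inner ℝ (o₁ i) (f₁ (e j))) (fun i => inner ℝ (o₂ i) (f₂ (e j))) i
  let D : Matrix (Fin n ⊕ Fin n) (Fin n ⊕ Fin n) ℝ :=
    Matrix.diagonal (Sum.elim (fun _ => 1) (fun _ => -1))
  let G : Matrix (Fin n ⊕ Fin n) (Fin n ⊕ Fin n) ℤ := Matrix.of fun i j => b (e i) (e j)
  have hD : |D.det| = 1 := by
    simp [D, Matrix.det_diagonal, abs_pow]
  have hGA : G.map (Int.castRingHom ℝ) = A.transpose * D * A := by
    ext i j
    rw [Matrix.mul_assoc, Matrix.mul_apply, Fintype.sum_sum_type]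
    simp only [D, Matrix.diagonal_mul, Matrix.transpose_apply, A, Matrix.of_apply, Sum.elim_inl,
      Sum.elim_inr, G, Matrix.map_apply, Int.coe_castRingHom, hb]
    rw [← o₁.sum_inner_mul_inner, ← o₂.sum_inner_mul_inner, sub_eq_add_neg, ← Finset.sum_neg_distrib]
    congr 1
    · exact Finset.sum_congr rfl fun k _ => by rw [real_inner_comm (o₁ k)]; ring
    · exact Finset.sum_congr rfl fun k _ => by rw [real_inner_comm (o₂ k)]; ring
  have hG : IsUnit G.det := by
    choose x hx using fun i => huni (e.coord i)
    let X : Matrix (Fin n ⊕ Fin n) (Fin n ⊕ Fin n) ℤ := Matrix.of fun i j => e.repr (x i) j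
    have hX : X * G = 1 := by
      ext i j
      have h1 := hx i (e j)
      rw [← e.sum_repr (x i)] at h1
      simp only [map_sum, map_smul, LinearMap.sum_apply, LinearMap.smul_apply, smul_eq_mul] at h1
      rw [Matrix.mul_apply]
      simp only [X, G, Matrix.of_apply]
      rw [h1]
      simp [Matrix.one_apply, Finsupp.single_apply, eq_comm]
    exact Matrix.isUnit_det_of_left_inverse hX
  obtain ⟨v, hv0, hv1, hv2⟩ := exists_int_vector h0 h4 A (abs_det_eq_one_of_gram hG hD hGA)
  set V := ∑ j, v j • e j with hV
  have hf₁ : ‖f₁ V‖ ^ 2 < 2 := by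
    rw [← real_inner_self_eq_norm_sq, ← o₁.sum_inner_mul_inner]
    refine lt_of_eq_of_lt (Finset.sum_congr rfl fun i _ => ?_) hv1
    have h1 : f₁ V = ∑ j, (v j : ℝ) • f₁ (e j) := by
      simp only [hV, map_sum, map_zsmul, Int.cast_smul_eq_zsmul]
    rw [real_inner_comm (o₁ i), ← sq, h1, inner_sum]
    congr 1
    exact Finset.sum_congr rfl fun j _ => by rw [inner_smul_right, mul_comm]; rfl
  have hf₂ : ‖f₂ V‖ ^ 2 < 2 := by
    rw [← real_inner_self_eq_norm_sq, ← o₂.sum_inner_mul_inner]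
    refine lt_of_eq_of_lt (Finset.sum_congr rfl fun i _ => ?_) hv2
    have h1 : f₂ V = ∑ j, (v j : ℝ) • f₂ (e j) := by
      simp only [hV, map_sum, map_zsmul, Int.cast_smul_eq_zsmul]
    rw [real_inner_comm (o₂ i), ← sq, h1, inner_sum]
    congr 1
    exact Finset.sum_congr rfl fun j _ => by rw [inner_smul_right, mul_comm]; rfl
  refine ⟨V, fun h => hv0 ?_, ?_⟩
  · rw [hV, ← e.equivFun_symm_apply] at h
    exact e.equivFun.symm.map_eq_zero_iff.1 h
  · have h1 := hb V V
    rw [real_inner_self_eq_norm_sq, real_inner_self_eq_norm_sq] at h1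
    have h2 : (b V V : ℝ) < 2 := by nlinarith [sq_nonneg ‖f₂ V‖]
    have h3 : (-2 : ℝ) < b V V := by nlinarith [sq_nonneg ‖f₁ V‖]
    have h2' : b V V < 2 := by exact_mod_cast h2
    have h3' : -2 < b V V := by exact_mod_cast h3
    obtain ⟨k, hk⟩ := heven V
    omega

/-- The values of all functionals on `v` form an ideal of `ℤ`; its generator `g` divides the
coordinates of `v`, and a functional attaining `g` on `v` takes the value 1 on `v / g`. -/
theorem exists_primitive {M : Type*} [AddCommGroup M] [Module.Free ℤ M] [Module.Finite ℤ M]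
    {v : M} (hv : v ≠ 0) :
    ∃ (g : ℤ) (v₀ : M) (φ : M →ₗ[ℤ] ℤ), v = g • v₀ ∧ φ v₀ = 1 ∧ g ≠ 0 := by
  let e := Module.finBasis ℤ M
  let R : Submodule ℤ ℤ := LinearMap.range (LinearMap.applyₗ (R := ℤ) (M₂ := ℤ) v)
  obtain ⟨φ, hφ⟩ : Submodule.IsPrincipal.generator R ∈ R := Submodule.IsPrincipal.generator_mem R
  set g := Submodule.IsPrincipal.generator R
  have hφ' : φ v = g := hφ
  have hdvd : ∀ i, g ∣ e.repr v i := fun i =>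
    (Submodule.IsPrincipal.mem_iff_generator_dvd R).1 ⟨e.coord i, rfl⟩
  choose c hc using hdvd
  have hg0 : g ≠ 0 := by
    intro h
    apply hv
    rw [← e.sum_repr v]
    exact Finset.sum_eq_zero fun i _ => by rw [hc, h, zero_mul, zero_smul]
  have hv₀ : v = g • ∑ i, c i • e i := by
    rw [Finset.smul_sum]
    nth_rewrite 1 [← e.sum_repr v]
    exact Finset.sum_congr rfl fun i _ => by rw [smul_smul, hc]
  refine ⟨g, _, φ, hv₀, ?_, hg0⟩
  rw [hv₀, map_smul, smul_eq_mul] at hφ'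
  exact mul_left_cancel₀ hg0 (hφ'.trans (mul_one g).symm)

/-- An even unimodular lattice of signature `(n, n)` with `n ≤ 4` is totally hyperbolic. -/
theorem exists_isotropic_family (n : ℕ) (h4 : n ≤ 4) : ∀ {M E₁ E₂ : Type*} [AddCommGroup M]
    [Module.Free ℤ M] [Module.Finite ℤ M] [NormedAddCommGroup E₁] [InnerProductSpace ℝ E₁]
    [FiniteDimensional ℝ E₁] [NormedAddCommGroup E₂] [InnerProductSpace ℝ E₂]
    [FiniteDimensional ℝ E₂] (b : M →ₗ[ℤ] M →ₗ[ℤ] ℤ) (f₁ : M →+ E₁) (f₂ : M →+ E₂)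
    (_ : Module.finrank ℤ M = 2 * n) (_ : Module.finrank ℝ E₁ = n)
    (_ : Module.finrank ℝ E₂ = n)
    (_ : ∀ x y, (b x y : ℝ) = inner ℝ (f₁ x) (f₁ y) - inner ℝ (f₂ x) (f₂ y))
    (_ : ∀ x, Even (b x x)) (_ : ∀ φ : M →ₗ[ℤ] ℤ, ∃ x, ∀ y, b x y = φ y),
    ∃ t : Fin n → M, LinearIndependent ℤ t ∧ ∀ i j, b (t i) (t j) = 0 := by
  induction n with
  | zero =>
    intros
    exact ⟨Fin.elim0, linearIndependent_empty_type, fun i => i.elim0⟩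
  | succ n ih =>
    intro M E₁ E₂ _ _ _ _ _ _ _ _ _ b f₁ f₂ hM hE₁ hE₂ hb heven huni
    have hsymm : ∀ x y, b x y = b y x := fun x y => by
      have h1 := hb x y
      rw [real_inner_comm, real_inner_comm (f₂ y), ← hb] at h1
      exact_mod_cast h1
    obtain ⟨v₁, hv₁, hbv₁⟩ := exists_isotropic_vector (Nat.succ_pos n) h4 b f₁ f₂ hM hE₁ hE₂ hb
      heven huni
    obtain ⟨g, v, φ, rfl, hφ, hg⟩ := exists_primitive hv₁
    have hbv : b v v = 0 := by
      simp only [map_smul, LinearMap.smul_apply, smul_eq_mul] at hbv₁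
      simpa [hg] using hbv₁
    obtain ⟨w₁, hw₁⟩ := huni φ
    obtain ⟨k, hk⟩ := heven w₁
    -- As `b w₁ w₁ = 2 k`, this correction makes `w` isotropic without changing its pairing 1 with
    -- `v`, so `v` and `w` span a hyperbolic plane.
    set w := w₁ - k • v with hw
    have hwv : b w v = 1 := by
      rw [hw, map_sub, map_smul, LinearMap.sub_apply, LinearMap.smul_apply, hbv, hw₁, hφ]; simp
    have hvw : b v w = 1 := by rw [hsymm, hwv]
    have hww : b w w = 0 := by
      have h1 : b w₁ v = 1 := by rw [hw₁, hφ]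
      rw [hw]
      simp only [map_sub, map_smul, LinearMap.sub_apply, LinearMap.smul_apply, hbv, h1, hsymm v w₁, hk,
        smul_eq_mul]
      ring
    let γ : M →ₗ[ℤ] ℤ × ℤ := (b v).prod (b w)
    let M' := LinearMap.ker γ
    have hM' : ∀ x : M', b v x = 0 ∧ b w x = 0 := fun x => by
      have := x.2
      rw [LinearMap.mem_ker] at this
      exact Prod.ext_iff.1 this
    have hγ : Function.Surjective γ := by
      rintro ⟨p, q⟩
      refine ⟨p • w + q • v, ?_⟩
      change (b v (p • w + q • v), b w (p • w + q • v)) = _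
      simp [hvw, hwv, hbv, hww]
    have hrank : Module.finrank ℤ M' = 2 * n := by
      have h1 := Submodule.finrank_quotient_add_finrank (LinearMap.ker γ)
      rw [(γ.quotKerEquivOfSurjective hγ).finrank_eq, hM, Module.finrank_prod,
        Module.finrank_self] at h1
      change Module.finrank ℤ (LinearMap.ker γ) = _
      omega
    have hf₁ : f₁ v ≠ 0 := by
      intro h
      have h1 := hb v v
      rw [h, hbv, inner_zero_left, real_inner_self_eq_norm_sq] at h1
      have h2 : f₂ v = 0 := by
        have : ‖f₂ v‖ ^ 2 = 0 := by push_cast at h1; linarith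
        simpa using this
      have h3 := hb v w
      rw [h, h2, hvw] at h3
      simp at h3
    have hnorm : ‖f₁ v‖ ^ 2 = ‖f₂ v‖ ^ 2 := by
      have h1 := hb v v
      rw [hbv, real_inner_self_eq_norm_sq, real_inner_self_eq_norm_sq] at h1
      push_cast at h1; linarith
    have hf₂ : f₂ v ≠ 0 := by
      intro h
      rw [h] at hnorm
      simp at hnorm
      exact hf₁ hnorm
    -- On the complement of `v` the inner products with `f₁ v` and `f₂ v` agree, and so do the
    -- lengths of these vectors; the two projections subtract the same term and the difference of
    -- the forms is unchanged.
    obtain ⟨P₁, hP₁⟩ := exists_projection hf₁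
    obtain ⟨P₂, hP₂⟩ := exists_projection hf₂
    have : Fact (Module.finrank ℝ E₁ = n + 1) := ⟨hE₁⟩
    have : Fact (Module.finrank ℝ E₂ = n + 1) := ⟨hE₂⟩
    have : Module.Finite ℤ M' := inferInstance
    let b' : M' →ₗ[ℤ] M' →ₗ[ℤ] ℤ := (b.compl₂ M'.subtype).comp M'.subtype
    have hb' : ∀ x y : M', b' x y = b x y := fun x y => rfl
    obtain ⟨t, ht, htb⟩ := ih (by omega) b'
      ((P₁.comp f₁).comp M'.subtype.toAddMonoidHom) ((P₂.comp f₂).comp M'.subtype.toAddMonoidHom)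
      hrank (Submodule.finrank_orthogonal_span_singleton hf₁) (Submodule.finrank_orthogonal_span_singleton hf₂)
      (by
        intro x y
        change (b x y : ℝ) = inner ℝ (P₁ (f₁ x)) (P₁ (f₁ y)) - inner ℝ (P₂ (f₂ x)) (P₂ (f₂ y))
        have hx : inner ℝ (f₁ v) (f₁ x) = inner ℝ (f₂ v) (f₂ x) := by
          have := hb v x
          rw [(hM' x).1] at this
          push_cast at this; linarith
        rw [hP₁, hP₂, hb, hx, hnorm]
        have hy : inner ℝ (f₁ v) (f₁ y) = inner ℝ (f₂ v) (f₂ y) := by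
          have := hb v y
          rw [(hM' y).1] at this
          push_cast at this; linarith
        rw [hy]; ring)
      (fun x => heven x)
      (by
        -- A functional on the complement extends to `M` through the projection along the hyperbolic
        -- plane; projecting the vector representing it shows that the complement is unimodular.
        intro ψ
        have hmem : ∀ y : M, y - b w y • v - b v y • w ∈ M' := fun y => by
          rw [LinearMap.mem_ker]
          change (b v _, b w _) = ((0 : ℤ), (0 : ℤ))
          simp [hvw, hwv, hbv, hww]
        let π : M →ₗ[ℤ] M' :=
          { toFun := fun y => ⟨_, hmem y⟩
            map_add' := fun x y => by
              ext; simp only [map_add, add_smul, Submodule.coe_add]; abel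
            map_smul' := fun c x => by
              ext; simp only [map_smul, smul_eq_mul, mul_smul, Submodule.coe_smul, smul_sub,
                RingHom.id_apply] }
        obtain ⟨x, hx⟩ := huni (ψ.comp π)
        refine ⟨π x, fun y => ?_⟩
        have h1 : π y = y := by
          ext
          change (y : M) - b w y • v - b v y • w = y
          rw [(hM' y).1, (hM' y).2]; simp
        have h2 := hx y
        rw [LinearMap.comp_apply, h1] at h2
        rw [← h2, hb']
        change b (x - b w x • v - b v x • w) y = _
        simp [(hM' y).1, (hM' y).2])
    refine ⟨Fin.cons v (fun i => (t i : M)), ?_, ?_⟩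
    · refine LinearIndependent.finCons' _ _ (ht.map' M'.subtype (Submodule.ker_subtype _)) ?_
      intro c y hy hcy
      have hyM : y ∈ M' := by
        refine (Submodule.span_le.2 ?_) hy
        rintro _ ⟨i, rfl⟩; exact (t i).2
      have h1 := congrArg (b w) hcy
      have h2 := (hM' ⟨y, hyM⟩).2
      simp only [map_add, map_smul, hwv, map_zero] at h1
      rw [h2] at h1
      simpa using h1
    · intro i j
      refine Fin.cases ?_ (fun i => ?_) i <;> refine Fin.cases ?_ (fun j => ?_) j
      · simpa using hbv
      · simpa using (hM' (t j)).1
      · simpa using (hsymm _ _).trans (hM' (t i)).1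
      · exact htb i j

end Minkowski

end QuatForm
end

/-! ### An auxiliary prime, and the discriminant group of `O` -/

noncomputable section

namespace QuatForm

section Arithmetic

/-- Dirichlet's theorem gives `q ≡ 3 (mod 4)` with `-q` a nonresidue modulo `N`; reciprocity makes
`-N` a square modulo `q`. Under these conditions `(-q, -N)` is ramified exactly at `N` and infinity,
and `a`, `c` describe a lattice of discriminant `N²` in it. -/
theorem exists_prime_of_nonresidue (N : ℕ) [hN : Fact N.Prime] (hN3 : 3 < N) :
    ∃ q : ℕ, q.Prime ∧ q % 4 = 3 ∧ q ≠ N ∧ legendreSym N (-q) = -1 ∧ ∃ a c : ℤ, a ^ 2 + N = q * c := by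
  have hN2 : N ≠ 2 := by omega
  have hNodd : N % 2 = 1 := (hN.out.eq_two_or_odd).resolve_left hN2
  obtain ⟨g, hg⟩ := FiniteField.exists_nonsquare (F := ZMod N) (by rwa [ZMod.ringChar_zmod_n])
  have hg0 : g ≠ 0 := by rintro rfl; exact hg (IsSquare.zero)
  have hcop : Nat.Coprime N 4 := by
    rw [Nat.coprime_comm]
    exact Nat.Coprime.pow_left 2 ((Nat.coprime_primes Nat.prime_two hN.out).2 (Ne.symm hN2))
  let e := ZMod.chineseRemainder hcop
  have hu : IsUnit (e.symm (-g, -1)) := by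
    rw [← MulEquiv.isUnit_map e]
    rw [RingEquiv.apply_symm_apply, Prod.isUnit_iff]
    exact ⟨(isUnit_iff_ne_zero.2 hg0).neg, isUnit_one.neg⟩
  have : NeZero (N * 4) := ⟨by have := hN.out.pos; omega⟩
  obtain ⟨q, hqN, hq, hqe⟩ := Nat.forall_exists_prime_gt_and_eq_mod hu N
  have : Fact q.Prime := ⟨hq⟩
  have he : e (q : ZMod (N * 4)) = (-g, -1) := by rw [hqe, RingEquiv.apply_symm_apply]
  rw [map_natCast] at he
  have h1 : (q : ZMod N) = -g := congrArg Prod.fst he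
  have h2 : (q : ZMod 4) = -1 := congrArg Prod.snd he
  have hq4 : q % 4 = 3 := by
    have : (q : ZMod 4) = ((3 : ℕ) : ZMod 4) := by rw [h2]; rfl
    exact (ZMod.natCast_eq_natCast_iff' q 3 4).1 this
  have hleg : legendreSym N (-q) = -1 := by
    rw [legendreSym.eq_neg_one_iff]
    push_cast
    rwa [h1, neg_neg]
  refine ⟨q, hq, hq4, by omega, hleg, ?_⟩
  have hq2 : q ≠ 2 := by omega
  have hsq : legendreSym q (-N) = 1 := by
    have e1 := legendreSym.quadratic_reciprocity (p := N) (q := q) hN2 hq2 (by omega)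
    rw [neg_eq_neg_one_mul, legendreSym.mul, legendreSym.at_neg_one hN2,
      ZMod.χ₄_eq_neg_one_pow hNodd] at hleg
    rw [neg_eq_neg_one_mul, legendreSym.mul, legendreSym.at_neg_one hq2,
      ZMod.χ₄_eq_neg_one_pow (by omega)]
    have hodd : Odd (q / 2) := by rw [Nat.odd_iff]; omega
    rw [mul_comm (N / 2), pow_mul, hodd.neg_one_pow] at e1
    rw [hodd.neg_one_pow]
    rcases neg_one_pow_eq_or ℤ (N / 2) with h | h <;> rw [h] at e1 hleg
    · have : legendreSym N q = -1 := by linarith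
      rw [this] at e1; linarith
    · have : legendreSym N q = 1 := by linarith
      rw [this] at e1; linarith
  have hNq : ((-N : ℤ) : ZMod q) ≠ 0 := by
    intro h
    rw [(legendreSym.eq_zero_iff q (-N)).2 h] at hsq
    exact zero_ne_one hsq
  obtain ⟨s, hs⟩ := (legendreSym.eq_one_iff q hNq).1 hsq
  obtain ⟨a, rfl⟩ := ZMod.intCast_surjective s
  have h3 : ((a ^ 2 + N : ℤ) : ZMod q) = 0 := by
    push_cast at hs ⊢
    rw [sq, ← hs]; ring
  obtain ⟨c, hc⟩ := (ZMod.intCast_zmod_eq_zero_iff_dvd _ q).1 h3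
  exact ⟨a, c, hc⟩

end Arithmetic

section Residue

variable {B : Type*} [Ring B] [Algebra ℚ B] [DefiniteQuaternion B]
variable (N : ℕ) [hN : Fact N.Prime] [hR : RamifiedOnlyAt B N] {O : Subalgebra ℤ B}

theorem card_residue (hO : IsMaximalOrder O) :
    Nat.card ((Subalgebra.toSubmodule O).toAddSubgroup ⧸
      (radPow O N 1).toAddSubgroup.addSubgroupOf (Subalgebra.toSubmodule O).toAddSubgroup) = N ^ 2 :=
  relIndex_radPow_one N hO

theorem intCast_mem_order (k : ℤ) : (k : B) ∈ O := by
  have := O.smul_mem O.one_mem k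
  simpa using this

theorem mem_radPow_one_iff_dvd {x : B} (hx : x ∈ O) {m : ℤ} (hm : nrd x = m) :
    x ∈ radPow O N 1 ↔ (N : ℤ) ∣ m := by
  rw [← padicNorm.int_lt_one_iff, ← hm]
  constructor
  · rintro ⟨h, -⟩
    exact lt_of_le_of_lt h (by
      rw [zpow_neg, zpow_one]; exact inv_lt_one_of_one_lt₀ (one_lt_cast N))
  · intro h
    exact ⟨qv_le_inv_of_lt_one N h, 0, by simpa using hx⟩

theorem intCast_mem_radPow_one (k : ℤ) :
    (k : B) ∈ radPow O N 1 ↔ (N : ℤ) ∣ k := by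
  have h1 : nrd (k : B) = ((k ^ 2 : ℤ) : ℚ) := by
    rw [← map_intCast (algebraMap ℚ B), nrd_algebraMap]; push_cast; rfl
  rw [mem_radPow_one_iff_dvd N (intCast_mem_order k) h1]
  exact ⟨fun h => Int.Prime.dvd_pow' hN.out h, fun h => dvd_pow h two_ne_zero⟩

/-- `O / P` has `N²` elements and the integers fill at most `N` classes. -/
theorem exists_nonscalar_mod_radPow (hO : IsMaximalOrder O) :
    ∃ w ∈ O, ∀ k : ℤ, w - k ∉ radPow O N 1 := by
  by_contra! h
  let Q := (Subalgebra.toSubmodule O).toAddSubgroup ⧸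
      (radPow O N 1).toAddSubgroup.addSubgroupOf (Subalgebra.toSubmodule O).toAddSubgroup
  let f : Fin N → Q := fun i => QuotientAddGroup.mk ⟨((i : ℕ) : ℤ), intCast_mem_order _⟩
  have hf : Function.Surjective f := by
    intro y
    obtain ⟨⟨w, hw⟩, rfl⟩ := QuotientAddGroup.mk_surjective y
    obtain ⟨k, hk⟩ := h w hw
    have hpos : (0 : ℤ) < N := by exact_mod_cast hN.out.pos
    have hk0 := Int.emod_nonneg k hpos.ne'
    have hkN := Int.emod_lt_of_pos k hpos
    refine ⟨⟨(k % N).toNat, by omega⟩, QuotientAddGroup.eq.2 ?_⟩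
    rw [AddSubgroup.mem_addSubgroupOf]
    change -(((((k % N).toNat : ℕ) : ℤ) : B)) + w ∈ radPow O N 1
    rw [Int.toNat_of_nonneg hk0]
    have e : -((k % N : ℤ) : B) + w = (w - k) + ((k - k % N : ℤ) : B) := by push_cast; abel
    rw [e]
    refine add_mem hk ((intCast_mem_radPow_one N _).2 ?_)
    exact Int.dvd_self_sub_emod
  have h1 := Nat.card_le_card_of_surjective f hf
  rw [Nat.card_fin, card_residue N hO] at h1
  have := hN.out.one_lt
  nlinarith

/-- Take a nonscalar `w` modulo the prime and `y = 2 w - trd w`, with `y² = -ν`. If `-ν ≡ d²`, then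
`(y - d)(y + d)` lies in the prime, hence so does one factor by multiplicativity of the norm, and as
2 is invertible modulo `N` this would make `w` scalar. -/
theorem exists_pure_nonresidue (hO : IsMaximalOrder O) :
    ∃ y ∈ O, trd y = 0 ∧ ∃ ν : ℤ, nrd y = ν ∧ ¬ IsSquare (-ν : ZMod N) := by
  obtain ⟨w, hw, hwk⟩ := exists_nonscalar_mod_radPow N hO
  obtain ⟨t, ht⟩ := trd_int hO.1 hw
  obtain ⟨n, hn⟩ := nrd_int hO.1 hw
  set y : B := (2 : ℤ) • w - t with hy
  have hyO : y ∈ O := sub_mem (O.smul_mem hw _) (intCast_mem_order t)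
  have hty : trd y = 0 := by
    rw [hy, map_sub, ← Int.cast_smul_eq_zsmul ℚ, map_smul, ht, ← map_intCast (algebraMap ℚ B),
      trd_algebraMap]; push_cast; simp
  have hqy : qconj y = -y := qconj_of_trd_eq_zero hty
  have hyy : y * y = ((t ^ 2 - 4 * n : ℤ) : B) := by
    rw [hy]
    have h1 := mul_self_eq w
    rw [ht, hn, map_intCast, map_intCast] at h1
    have h2 : (t : B) * w = w * t := (Int.cast_commute t w).eq
    simp only [sub_mul, mul_sub, smul_mul_assoc, mul_smul_comm, h1]
    push_cast
    rw [← h2]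
    simp only [zsmul_eq_mul]
    push_cast
    noncomm_ring
  have hnu : nrd y = ((-(t ^ 2 - 4 * n) : ℤ) : ℚ) := by
    apply algebraMap_injective' (B := B)
    rw [← mul_qconj, hqy, mul_neg, hyy, map_intCast]; push_cast; rfl
  refine ⟨y, hyO, hty, _, hnu, ?_⟩
  rintro ⟨d', hd⟩
  obtain ⟨d, rfl⟩ := ZMod.intCast_surjective d'
  have hdvd : (N : ℤ) ∣ (t ^ 2 - 4 * n) - d ^ 2 := by
    rw [← ZMod.intCast_zmod_eq_zero_iff_dvd]
    push_cast at hd ⊢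
    rw [sq (d : ZMod N), ← hd]; ring
  have hprod : (y - d) * (y + d) ∈ radPow O N 1 := by
    have : (y - d) * (y + d) = (((t ^ 2 - 4 * n) - d ^ 2 : ℤ) : B) := by
      rw [sub_mul, mul_add, mul_add, hyy, (Int.cast_commute d y).eq]; push_cast; noncomm_ring
    rw [this]; exact (intCast_mem_radPow_one N _).2 hdvd
  have hcase : y - d ∈ radPow O N 1 ∨ y + d ∈ radPow O N 1 := by
    have m1 : y - d ∈ O := sub_mem hyO (intCast_mem_order d)
    have m2 : y + d ∈ O := add_mem hyO (intCast_mem_order d)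
    obtain ⟨n1, hn1⟩ := nrd_int hO.1 m1
    obtain ⟨n2, hn2⟩ := nrd_int hO.1 m2
    rw [mem_radPow_one_iff_dvd N m1 hn1, mem_radPow_one_iff_dvd N m2 hn2]
    rw [mem_radPow_one_iff_dvd N (mul_mem m1 m2) (m := n1 * n2)
      (by rw [nrd_mul, hn1, hn2]; push_cast; rfl)] at hprod
    exact (Nat.prime_iff_prime_int.1 hN.out).dvd_or_dvd hprod
  have hcontra : ∀ e : ℤ, y - e ∉ radPow O N 1 := by
    intro e he
    obtain ⟨h, hh⟩ : ∃ h : ℤ, 2 * h = N + 1 := by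
      have := hN.out.eq_two_or_odd
      have := hR.three_lt
      exact ⟨(N + 1) / 2, by omega⟩
    apply hwk (h * (t + e))
    have e1 : w - ((h * (t + e) : ℤ) : B) = h • (y - e) - ((N : ℤ) : B) * w := by
      have e2 : (2 * h : ℤ) • w = (N + 1 : ℤ) • w := by rw [hh]
      rw [hy]
      have e3 : h • ((2 : ℤ) • w - (t : B) - e) = (2 * h : ℤ) • w - ((h * (t + e) : ℤ) : B) := by
        rw [smul_sub, smul_sub, smul_smul, mul_comm h 2]
        simp only [zsmul_eq_mul]; push_cast; noncomm_ring
      rw [e3, e2, add_smul, one_smul, zsmul_eq_mul]; push_cast; abel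
    rw [e1]
    refine sub_mem (Submodule.smul_mem _ _ he) ?_
    rw [← radPow_mul_order N hO]
    exact Submodule.mul_mem_mul ((intCast_mem_radPow_one N _).2 dvd_rfl) hw
  rcases hcase with h | h
  · exact hcontra d h
  · exact hcontra (-d) (by push_cast; rwa [sub_neg_eq_add])

/-- The elements `i + j y` have norm `i² + ν j²`, anisotropic modulo `N`, so for `i`, `j` in `0, …,
N - 1` they represent `N²` distinct classes, which is all of them. -/
theorem exists_residue_coords (hO : IsMaximalOrder O) {y : B} (hy : y ∈ O) (hty : trd y = 0) {ν : ℤ}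
    (hν : nrd y = ν) (hns : ¬ IsSquare (-ν : ZMod N)) {w : B} (hw : w ∈ O) :
    ∃ α γ : ℤ, w - α - γ • y ∈ radPow O N 1 := by
  let Q := (Subalgebra.toSubmodule O).toAddSubgroup ⧸
      (radPow O N 1).toAddSubgroup.addSubgroupOf (Subalgebra.toSubmodule O).toAddSubgroup
  have hmem : ∀ i j : ℤ, (i : B) + j • y ∈ O := fun i j =>
    add_mem (intCast_mem_order i) (O.smul_mem hy j)
  have hnrd : ∀ i j : ℤ, nrd ((i : B) + j • y) = ((i ^ 2 + j ^ 2 * ν : ℤ) : ℚ) := fun i j => by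
    rw [nrd_add, ← map_intCast (algebraMap ℚ B), nrd_algebraMap, ← Int.cast_smul_eq_zsmul ℚ, nrd_smul,
      hν, ← Algebra.smul_def, map_smul, trd_qconj, map_smul, hty]
    push_cast; simp
  have hzero : ∀ i j : ℤ, (i : B) + j • y ∈ radPow O N 1 → (N : ℤ) ∣ i ∧ (N : ℤ) ∣ j := by
    intro i j h
    rw [mem_radPow_one_iff_dvd N (hmem i j) (hnrd i j), ← ZMod.intCast_zmod_eq_zero_iff_dvd] at h
    push_cast at h
    have hj : (j : ZMod N) = 0 := by
      by_contra hj
      apply hns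
      refine ⟨(i : ZMod N) / j, ?_⟩
      field_simp
      linear_combination -h
    rw [hj] at h
    have hi : (i : ZMod N) = 0 := by simpa using h
    exact ⟨(ZMod.intCast_zmod_eq_zero_iff_dvd _ _).1 hi, (ZMod.intCast_zmod_eq_zero_iff_dvd _ _).1 hj⟩
  let f : Fin N × Fin N → Q := fun ij =>
    QuotientAddGroup.mk ⟨((ij.1 : ℕ) : ℤ) + (((ij.2 : ℕ) : ℤ)) • y, hmem _ _⟩
  have hf : Function.Injective f := by
    rintro ⟨i, j⟩ ⟨i', j'⟩ h
    have h1 := QuotientAddGroup.eq.1 h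
    rw [AddSubgroup.mem_addSubgroupOf] at h1
    have h2 : ((((i' : ℕ) : ℤ) - ((i : ℕ) : ℤ) : ℤ) : B) + (((j' : ℕ) : ℤ) - ((j : ℕ) : ℤ)) • y ∈
        radPow O N 1 := by
      have : ((((i' : ℕ) : ℤ) - ((i : ℕ) : ℤ) : ℤ) : B) + (((j' : ℕ) : ℤ) - ((j : ℕ) : ℤ)) • y =
        -((((i : ℕ) : ℤ) : B) + (((j : ℕ) : ℤ)) • y) + ((((i' : ℕ) : ℤ) : B) + (((j' : ℕ) : ℤ)) • y) := by
        rw [sub_smul]; push_cast; abel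
      rw [this]; exact h1
    obtain ⟨⟨a, ha⟩, ⟨b, hb⟩⟩ := hzero _ _ h2
    have hi := i.2; have hi' := i'.2; have hj := j.2; have hj' := j'.2
    have ha0 : a = 0 := by
      have h3 : (N : ℤ) * a < N * 1 := by omega
      have h4 : (N : ℤ) * (-1) < N * a := by omega
      have hp : (0 : ℤ) < N := by omega
      have := lt_of_mul_lt_mul_left h3 hp.le
      have := lt_of_mul_lt_mul_left h4 hp.le
      omega
    have hb0 : b = 0 := by
      have h3 : (N : ℤ) * b < N * 1 := by omega
      have h4 : (N : ℤ) * (-1) < N * b := by omega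
      have hp : (0 : ℤ) < N := by omega
      have := lt_of_mul_lt_mul_left h3 hp.le
      have := lt_of_mul_lt_mul_left h4 hp.le
      omega
    subst ha0 hb0
    ext
    · simp only; omega
    · simp only; omega
  have hcard : Nat.card Q = N ^ 2 := card_residue N hO
  have : Finite Q := Nat.finite_of_card_ne_zero (by
    rw [hcard]; exact pow_ne_zero 2 hN.out.ne_zero)
  have hbij := hf.bijective_of_nat_card_le (by rw [hcard]; simp [sq])
  obtain ⟨⟨i, j⟩, hij⟩ := hbij.2 (QuotientAddGroup.mk ⟨w, hw⟩)
  have h1 := QuotientAddGroup.eq.1 hij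
  rw [AddSubgroup.mem_addSubgroupOf] at h1
  refine ⟨((i : ℕ) : ℤ), ((j : ℕ) : ℤ), ?_⟩
  have : w - (((i : ℕ) : ℤ) : B) - (((j : ℕ) : ℤ)) • y =
    -((((i : ℕ) : ℤ) : B) + (((j : ℕ) : ℤ)) • y) + w := by abel
  rw [this]; exact h1

/-- Generators of the dual of a maximal order modulo the order. -/
theorem exists_dual_generators (hO : IsMaximalOrder O) : ∃ (x₁ x₂ : B) (r ν : ℤ),
    x₁ ∈ trdDual (Subalgebra.toSubmodule O) ∧ x₂ ∈ trdDual (Subalgebra.toSubmodule O) ∧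
    nrd x₁ = r / N ∧ nrd x₂ = r * ν / N ∧ trd (x₁ * qconj x₂) = 0 ∧ ¬ (N : ℤ) ∣ r ∧
    ¬ IsSquare (-ν : ZMod N) ∧
    ∀ x ∈ trdDual (Subalgebra.toSubmodule O), ∃ α γ : ℤ, x - α • x₁ - γ • x₂ ∈ O := by
  rw [trdDual_eq_radPow N hO]
  have hN0 := natCast_ne_zero_rat N
  obtain ⟨y, hy, hty, ν, hν, hns⟩ := exists_pure_nonresidue N hO
  -- `x₁` generates the inverse of the prime locally at `N`; multiplying the basis `1, y` of the
  -- residue ring by it gives orthogonal generators of the discriminant group.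
  obtain ⟨x₁, w', s, hx₁, hw', hs, hxw, hq⟩ := exists_local_generators N hO.1 (-1)
  have hO0 : ∀ {x}, x ∈ radPow O N 0 ↔ x ∈ O := fun {x} => by rw [radPow_zero N hO]; rfl
  have hx₂ : x₁ * y ∈ radPow O N (-1) := by
    have := mul_mem_radPow N hx₁ (hO0.2 hy)
    rwa [add_zero] at this
  have hNmem : ∀ {x}, x ∈ radPow O N (-1) → (N : ℤ) • x ∈ O := fun {x} hx => by
    have h1 := mul_mem_radPow N ((intCast_mem_radPow_one N N).2 dvd_rfl) hx
    rw [add_neg_cancel, hO0] at h1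
    simpa using h1
  obtain ⟨M, hM⟩ := nrd_int hO.1 (hNmem hx₁)
  have hM' : (N : ℚ) ^ 2 * nrd x₁ = M := by
    rw [← hM, ← Int.cast_smul_eq_zsmul ℚ, nrd_smul]; push_cast; rfl
  have hqM : padicNorm N (M : ℚ) = (N : ℚ) ^ (-1 : ℤ) := by
    have h1 : qv N x₁ = (N : ℚ) ^ (1 : ℤ) := by rw [hq, neg_neg]
    rw [← hM', padicNorm.mul, padicNorm_pow, padicNorm_self_sq]
    change _ * qv N x₁ = _
    rw [h1, ← zpow_add₀ hN0]; rfl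
  obtain ⟨r, rfl⟩ : (N : ℤ) ∣ M := by
    rw [← padicNorm.int_lt_one_iff, hqM, zpow_neg, zpow_one]
    exact inv_lt_one_of_one_lt₀ (one_lt_cast N)
  have hr : ¬ (N : ℤ) ∣ r := by
    rw [← padicNorm.int_eq_one_iff]
    push_cast at hqM
    rw [padicNorm.mul, padicNorm.padicNorm_p_of_prime, zpow_neg, zpow_one] at hqM
    exact mul_left_cancel₀ (inv_ne_zero hN0) (by rw [hqM, mul_one])
  have hnx₁ : nrd x₁ = r / N := by
    push_cast at hM'
    field_simp
    have : (N : ℚ) * (N * nrd x₁) = N * r := by rw [← hM']; ring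
    linarith [mul_left_cancel₀ hN0 this]
  refine ⟨x₁, x₁ * y, r, ν, hx₁, hx₂, hnx₁, ?_, ?_, hr, hns, ?_⟩
  · rw [nrd_mul, hnx₁, hν]; ring
  · rw [qconj_mul, ← mul_assoc, trd_mul_comm, ← mul_assoc, qconj_mul_self, ← Algebra.smul_def, map_smul,
      trd_qconj, hty, smul_zero]
  · intro x hx
    have hwx : w' * x ∈ O := by
      have := mul_mem_radPow N hw' hx
      rwa [neg_neg, add_neg_cancel, hO0] at this
    obtain ⟨α, γ, hαγ⟩ := exists_residue_coords N hO hy hty hν hns hwx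
    have h1 := mul_mem_radPow N hx₁ hαγ
    rw [neg_add_cancel, hO0, mul_sub, mul_sub, ← mul_assoc, hxw, mul_smul_comm, ← Algebra.smul_def,
      Int.cast_smul_eq_zsmul, ← (Int.cast_commute α x₁).eq, ← zsmul_eq_mul] at h1
    have hc : IsCoprime s (N : ℤ) := by
      refine ((Nat.prime_iff_prime_int.1 hN.out).irreducible.coprime_iff_not_dvd.2 hs).symm
    obtain ⟨u, v, huv⟩ := hc
    refine ⟨u * α, u * γ, ?_⟩
    have : x - (u * α) • x₁ - (u * γ) • (x₁ * y) =
        u • (s • x - α • x₁ - γ • (x₁ * y)) + v • ((N : ℤ) • x) := by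
      nth_rewrite 1 [← one_smul ℤ x]
      rw [← huv, add_smul, smul_sub, smul_sub, mul_smul, mul_smul, mul_smul, mul_smul]
      abel
    rw [this]
    exact add_mem (O.smul_mem h1 u) (O.smul_mem (hNmem hx) v)

end Residue

end QuatForm
end

/-! ### Self-dual rational lattices, and the norm form of `(-q, -N)` -/

noncomputable section

namespace QuatForm

section SelfDual

/-- Transfers `exists_isotropic_family` to a rational quadratic space: a functional on the lattice
is represented by a combination of dual basis vectors, which self-duality places in the lattice. -/
theorem exists_isotropic_of_selfDual {n : ℕ} (h4 : n ≤ 4) {V E₁ E₂ : Type*} [AddCommGroup V]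
    [Module ℚ V] [FiniteDimensional ℚ V] [NormedAddCommGroup E₁] [InnerProductSpace ℝ E₁]
    [FiniteDimensional ℝ E₁] [NormedAddCommGroup E₂] [InnerProductSpace ℝ E₂]
    [FiniteDimensional ℝ E₂] (hV : Module.finrank ℚ V = 2 * n) (hE₁ : Module.finrank ℝ E₁ = n)
    (hE₂ : Module.finrank ℝ E₂ = n) (β : LinearMap.BilinForm ℚ V) (hβ : β.Nondegenerate)
    {L : Submodule ℤ V} (hL : Submodule.IsLattice ℚ L)
    (hint : ∀ x ∈ L, ∀ y ∈ L, ∃ z : ℤ, β x y = z) (heven : ∀ x ∈ L, ∃ z : ℤ, β x x = 2 * z)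
    (hself : ∀ x, (∀ y ∈ L, ∃ z : ℤ, β x y = z) → x ∈ L) (f₁ : V →+ E₁) (f₂ : V →+ E₂)
    (hf : ∀ x y, (β x y : ℝ) = inner ℝ (f₁ x) (f₁ y) - inner ℝ (f₂ x) (f₂ y)) :
    ∃ t : Fin n → V, LinearIndependent ℚ t ∧ ∀ i j, β (t i) (t j) = 0 := by
  obtain ⟨e, he⟩ := exists_basis_of_isLattice hL hV
  have hli : LinearIndependent ℤ e := e.linearIndependent.restrict_scalars' ℤ
  let e' : Module.Basis (Fin (2 * n)) ℤ L := (Module.Basis.span hli).map (LinearEquiv.ofEq _ _ he.symm)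
  have hee : ∀ i, (e' i : V) = e i := fun i => by simp [e', Module.Basis.span_apply]
  have : Module.Free ℤ L := Module.Free.of_basis e'
  have : Module.Finite ℤ L := Module.Finite.of_basis e'
  have hint' : ∀ x y : L, ∃ z : ℤ, β x y = z := fun x y => hint x x.2 y y.2
  choose z hz using hint'
  let b : L →ₗ[ℤ] L →ₗ[ℤ] ℤ := LinearMap.mk₂ ℤ z
    (fun x x' y => by
      apply Int.cast_injective (α := ℚ); push_cast
      rw [← hz, ← hz, ← hz, Submodule.coe_add, map_add, LinearMap.add_apply])
    (fun c x y => by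
      apply Int.cast_injective (α := ℚ); push_cast
      rw [smul_eq_mul, Int.cast_mul, ← hz, ← hz, Submodule.coe_smul, ← Int.cast_smul_eq_zsmul ℚ,
        map_smul, LinearMap.smul_apply, smul_eq_mul])
    (fun x y y' => by
      apply Int.cast_injective (α := ℚ); push_cast
      rw [← hz, ← hz, ← hz, Submodule.coe_add, map_add])
    (fun c x y => by
      apply Int.cast_injective (α := ℚ); push_cast
      rw [smul_eq_mul, Int.cast_mul, ← hz, ← hz, Submodule.coe_smul, ← Int.cast_smul_eq_zsmul ℚ,
        map_smul, smul_eq_mul])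
  have hb : ∀ x y : L, (b x y : ℚ) = β x y := fun x y => (hz x y).symm
  obtain ⟨t, ht, htb⟩ := exists_isotropic_family n h4 b (f₁.comp L.subtype.toAddMonoidHom)
    (f₂.comp L.subtype.toAddMonoidHom) (by simpa using Module.finrank_eq_card_basis e') hE₁ hE₂
    (fun x y => by
      change (b x y : ℝ) = inner ℝ (f₁ x) (f₁ y) - inner ℝ (f₂ x) (f₂ y)
      rw [← hf, ← hb]; push_cast; rfl)
    (fun x => by
      obtain ⟨k, hk⟩ := heven x x.2
      refine ⟨k, Int.cast_injective (α := ℚ) ?_⟩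
      rw [hb, hk]; push_cast; ring)
    (fun φ => by
      let x : V := ∑ i, φ (e' i) • β.dualBasis hβ e i
      have key : ∀ y : L, β x y = φ y := by
        intro y
        have h1 : y = ∑ i, e'.repr y i • e' i := (e'.sum_repr y).symm
        have h2 : (y : V) = ∑ i, (e'.repr y i : ℚ) • e i := by
          nth_rewrite 1 [h1]
          simp only [Submodule.coe_sum, Submodule.coe_smul, hee, Int.cast_smul_eq_zsmul]
        have h3 : ∀ j, β x (e j) = φ (e' j) := by
          intro j
          simp only [x, map_sum, LinearMap.sum_apply, ← Int.cast_smul_eq_zsmul ℚ, map_smul,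
            LinearMap.smul_apply, LinearMap.BilinForm.apply_dualBasis_left, smul_eq_mul]
          simp
        have h4 : φ y = ∑ i, e'.repr y i * φ (e' i) := by
          nth_rewrite 1 [h1]
          rw [map_sum]
          exact Finset.sum_congr rfl fun i _ => by rw [map_smul, smul_eq_mul]
        rw [h2, map_sum, h4]
        push_cast
        exact Finset.sum_congr rfl fun i _ => by rw [map_smul, h3, smul_eq_mul]
      refine ⟨⟨x, hself x fun y hy => ⟨φ ⟨y, hy⟩, key ⟨y, hy⟩⟩⟩, fun y => ?_⟩
      apply Int.cast_injective (α := ℚ)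
      rw [hb]; exact key y)
  refine ⟨fun i => t i, ?_, fun i j => ?_⟩
  · rw [← LinearIndependent.iff_fractionRing ℤ ℚ]
    exact ht.map' L.subtype (Submodule.ker_subtype _)
  · rw [← hb, htb]; simp

end SelfDual

section GlueForm

/-- Bilinear form of the rank four lattice with norm form
`k₀² + k₀k₁ + m k₁² + c (k₂² + k₂k₃ + m k₃²) + a (k₀k₃ - k₁k₂)`. -/
def coForm (m c a : ℚ) : LinearMap.BilinForm ℚ (Fin 4 → ℚ) :=
  LinearMap.mk₂ ℚ (fun k l => 2 * k 0 * l 0 + k 0 * l 1 + k 1 * l 0 + 2 * m * k 1 * l 1 +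
    c * (2 * k 2 * l 2 + k 2 * l 3 + k 3 * l 2 + 2 * m * k 3 * l 3) +
    a * (k 0 * l 3 + k 3 * l 0 - k 1 * l 2 - k 2 * l 1))
    (fun _ _ _ => by simp only [Pi.add_apply]; ring)
    (fun _ _ _ => by simp only [Pi.smul_apply, smul_eq_mul]; ring)
    (fun _ _ _ => by simp only [Pi.add_apply]; ring)
    (fun _ _ _ => by simp only [Pi.smul_apply, smul_eq_mul]; ring)

theorem coForm_apply (m c a : ℚ) (k l : Fin 4 → ℚ) : coForm m c a k l =
    2 * k 0 * l 0 + k 0 * l 1 + k 1 * l 0 + 2 * m * k 1 * l 1 +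
    c * (2 * k 2 * l 2 + k 2 * l 3 + k 3 * l 2 + 2 * m * k 3 * l 3) +
    a * (k 0 * l 3 + k 3 * l 0 - k 1 * l 2 - k 2 * l 1) := rfl

/-- Completing squares turns the form into `2 ⟨1, q, N, qN⟩`, the polarised norm form of `(-q, -N)`;
square roots of the coefficients rescale it to the standard inner product. -/
theorem exists_real_coords {m c a q N : ℚ} (hq : q = 4 * m - 1) (hq0 : 0 < q) (hN : 0 < N)
    (hac : a ^ 2 + N = q * c) : ∃ f : (Fin 4 → ℚ) →+ EuclideanSpace ℝ (Fin 4),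
    ∀ k l, (coForm m c a k l : ℝ) = inner ℝ (f k) (f l) := by
  have hqr : (0 : ℝ) < q := by exact_mod_cast hq0
  have hNr : (0 : ℝ) < N := by exact_mod_cast hN
  refine ⟨AddMonoidHom.mk' (fun k => !₂[Real.sqrt 2 * ((k 0 + k 1 / 2 + a * k 3 / 2 : ℚ) : ℝ),
    Real.sqrt (2 * q) * ((k 1 / 2 - a * (k 2 + k 3 / 2) / q : ℚ) : ℝ),
    Real.sqrt (2 * N) * ((k 3 / 2 : ℚ) : ℝ),
    Real.sqrt (2 * q * N) * (((k 2 + k 3 / 2) / q : ℚ) : ℝ)]) ?_, fun k l => ?_⟩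
  · intro k l
    ext i
    fin_cases i <;> simp <;> ring
  · have s1 : Real.sqrt 2 * Real.sqrt 2 = 2 := Real.mul_self_sqrt (by norm_num)
    have s2 : Real.sqrt (2 * q) * Real.sqrt (2 * q) = 2 * q := Real.mul_self_sqrt (by positivity)
    have s3 : Real.sqrt (2 * N) * Real.sqrt (2 * N) = 2 * N := Real.mul_self_sqrt (by positivity)
    have s4 : Real.sqrt (2 * q * N) * Real.sqrt (2 * q * N) = 2 * q * N :=
      Real.mul_self_sqrt (by positivity)
    have hNe : N = q * c - a ^ 2 := by linarith
    have hm : m = (q + 1) / 4 := by linarith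
    have key : coForm m c a k l = 2 * ((k 0 + k 1 / 2 + a * k 3 / 2) * (l 0 + l 1 / 2 + a * l 3 / 2)) +
        2 * q * ((k 1 / 2 - a * (k 2 + k 3 / 2) / q) * (l 1 / 2 - a * (l 2 + l 3 / 2) / q)) +
        2 * N * ((k 3 / 2) * (l 3 / 2)) +
        2 * q * N * (((k 2 + k 3 / 2) / q) * ((l 2 + l 3 / 2) / q)) := by
      rw [coForm_apply, hNe, hm]
      field_simp
      ring
    rw [key, PiLp.inner_apply, Fin.sum_univ_four]
    simp only [AddMonoidHom.mk'_apply, PiLp.toLp_apply, Matrix.cons_val_zero, Matrix.cons_val_one,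
      Matrix.cons_val, RCLike.inner_apply, conj_trivial]
    push_cast
    linear_combination (-(((k 0 : ℝ) + k 1 / 2 + a * k 3 / 2) * (l 0 + l 1 / 2 + a * l 3 / 2))) * s1 -
      (((k 1 : ℝ) / 2 - a * (k 2 + k 3 / 2) / q) * (l 1 / 2 - a * (l 2 + l 3 / 2) / q)) * s2 -
      (((k 3 : ℝ) / 2) * (l 3 / 2)) * s3 - ((((k 2 : ℝ) + k 3 / 2) / q) * ((l 2 + l 3 / 2) / q)) * s4

theorem coForm_self_pos {m c a q N : ℚ} (hq : q = 4 * m - 1) (hq0 : 0 < q) (hN : 0 < N)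
    (hac : a ^ 2 + N = q * c) {k : Fin 4 → ℚ} (hk : coForm m c a k k ≤ 0) : k = 0 := by
  have hNe : N = q * c - a ^ 2 := by linarith
  have hm : m = (q + 1) / 4 := by linarith
  have key : coForm m c a k k = 2 * (k 0 + k 1 / 2 + a * k 3 / 2) ^ 2 +
      2 * q * (k 1 / 2 - a * (k 2 + k 3 / 2) / q) ^ 2 + 2 * N * (k 3 / 2) ^ 2 +
      2 * q * N * ((k 2 + k 3 / 2) / q) ^ 2 := by
    rw [coForm_apply, hNe, hm]
    field_simp
    ring
  rw [key] at hk
  have p1 : 0 ≤ 2 * (k 0 + k 1 / 2 + a * k 3 / 2) ^ 2 := by positivity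
  have p2 : 0 ≤ 2 * q * (k 1 / 2 - a * (k 2 + k 3 / 2) / q) ^ 2 := by positivity
  have p3 : 0 ≤ 2 * N * (k 3 / 2) ^ 2 := by positivity
  have p4 : 0 ≤ 2 * q * N * ((k 2 + k 3 / 2) / q) ^ 2 := by positivity
  have z3 : k 3 = 0 := by
    have : 2 * N * (k 3 / 2) ^ 2 = 0 := by linarith
    simpa [hN.ne'] using this
  have z4 : k 2 = 0 := by
    have : 2 * q * N * ((k 2 + k 3 / 2) / q) ^ 2 = 0 := by linarith
    simpa [hN.ne', hq0.ne', z3] using this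
  have z2 : k 1 = 0 := by
    have : 2 * q * (k 1 / 2 - a * (k 2 + k 3 / 2) / q) ^ 2 = 0 := by linarith
    simpa [hq0.ne', z3, z4] using this
  have z1 : k 0 = 0 := by
    have : 2 * (k 0 + k 1 / 2 + a * k 3 / 2) ^ 2 = 0 := by linarith
    simpa [z2, z3, z4] using this
  funext i
  fin_cases i <;> simp [z1, z2, z3, z4]

variable {B : Type*} [Ring B] [Algebra ℚ B] [DefiniteQuaternion B]

theorem trd_mul_qconj_comm (x y : B) : trd (x * qconj y) = trd (y * qconj x) := by
  rw [← trd_qconj, qconj_mul, qconj_qconj]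

theorem exists_real_coords_nrd : ∃ f : B →+ EuclideanSpace ℝ (Fin 4),
    ∀ x y : B, (trd (x * qconj y) : ℝ) = inner ℝ (f x) (f y) := by
  have hα := paramI_pos B
  have hβ := paramJ_pos B
  set α := paramI B
  set β := paramJ B
  have hαr : (0 : ℝ) < α := by exact_mod_cast hα
  have hβr : (0 : ℝ) < β := by exact_mod_cast hβ
  let e := quatEquiv B
  refine ⟨AddMonoidHom.mk' (fun x => !₂[Real.sqrt 2 * ((e x).re : ℝ),
    Real.sqrt (2 * α) * ((e x).imI : ℝ), Real.sqrt (2 * β) * ((e x).imJ : ℝ),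
    Real.sqrt (2 * α * β) * ((e x).imK : ℝ)]) ?_, fun x y => ?_⟩
  · intro k l
    ext i
    fin_cases i <;> simp <;> ring
  · have s1 : Real.sqrt 2 * Real.sqrt 2 = 2 := Real.mul_self_sqrt (by norm_num)
    have s2 : Real.sqrt (2 * α) * Real.sqrt (2 * α) = 2 * α := Real.mul_self_sqrt (by positivity)
    have s3 : Real.sqrt (2 * β) * Real.sqrt (2 * β) = 2 * β := Real.mul_self_sqrt (by positivity)
    have s4 : Real.sqrt (2 * α * β) * Real.sqrt (2 * α * β) = 2 * α * β :=
      Real.mul_self_sqrt (by positivity)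
    have key : trd (x * qconj y) = 2 * ((e x).re * (e y).re + α * ((e x).imI * (e y).imI) +
        β * ((e x).imJ * (e y).imJ) + α * β * ((e x).imK * (e y).imK)) := by
      rw [qconj, trd_apply, mul_sub, map_sub, map_mul, map_mul, trd_apply]
      change 2 * (e x * e _ - e x * e y).re = _
      rw [AlgEquiv.commutes]
      simp [QuaternionAlgebra.re_mul, α, β, QuaternionAlgebra.algebraMap_eq]
      ring
    rw [key, PiLp.inner_apply, Fin.sum_univ_four]
    simp only [AddMonoidHom.mk'_apply, PiLp.toLp_apply, Matrix.cons_val_zero, Matrix.cons_val_one,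
      Matrix.cons_val, RCLike.inner_apply, conj_trivial]
    push_cast
    linear_combination (-((e x).re * (e y).re : ℝ)) * s1 - ((e x).imI * (e y).imI : ℝ) * s2 -
      ((e x).imJ * (e y).imJ : ℝ) * s3 - ((e x).imK * (e y).imK : ℝ) * s4

end GlueForm

end QuatForm
end

/-! ### The difference form and the dual of the explicit lattice -/

noncomputable section

namespace QuatForm

section Glue

variable {B : Type*} [Ring B] [Algebra ℚ B] [DefiniteQuaternion B]

/-- The difference of the norm form of `B` and the form `coForm`. -/
def glueForm (B : Type*) [Ring B] [Algebra ℚ B] [DefiniteQuaternion B] (m c a : ℚ) :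
    LinearMap.BilinForm ℚ (B × (Fin 4 → ℚ)) :=
  LinearMap.mk₂ ℚ (fun x y => trd (x.1 * qconj y.1) - coForm m c a x.2 y.2)
    (fun _ _ _ => by simp only [Prod.fst_add, Prod.snd_add, add_mul, map_add, LinearMap.add_apply]; ring)
    (fun _ _ _ => by
      simp only [Prod.smul_fst, Prod.smul_snd, smul_mul_assoc, map_smul, LinearMap.smul_apply,
        smul_eq_mul]; ring)
    (fun _ _ _ => by simp only [Prod.fst_add, Prod.snd_add, qconj_add, mul_add, map_add]; ring)
    (fun _ x y => by
      simp only [Prod.smul_fst, Prod.smul_snd, trd_mul_qconj_comm x.1, smul_mul_assoc, map_smul,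
        smul_eq_mul]; ring)

theorem glueForm_apply (m c a : ℚ) (x y : B × (Fin 4 → ℚ)) :
    glueForm B m c a x y = trd (x.1 * qconj y.1) - coForm m c a x.2 y.2 := rfl

theorem glueForm_comm (m c a : ℚ) (x y : B × (Fin 4 → ℚ)) :
    glueForm B m c a x y = glueForm B m c a y x := by
  rw [glueForm_apply, glueForm_apply, trd_mul_qconj_comm, coForm_apply, coForm_apply]; ring

theorem glueForm_nondegenerate {m c a q N : ℚ} (hq : q = 4 * m - 1) (hq0 : 0 < q) (hN : 0 < N)
    (hac : a ^ 2 + N = q * c) : (glueForm B m c a).Nondegenerate := by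
  have key : ∀ x : B × (Fin 4 → ℚ), (∀ y, glueForm B m c a x y = 0) → x = 0 := by
    rintro ⟨x, y⟩ h
    have h1 := h (x, -y)
    rw [glueForm_apply, map_neg, trd_mul_qconj_self] at h1
    have h2 := nrd_nonneg x
    have hy : y = 0 := coForm_self_pos hq hq0 hN hac (by simp only at h1; linarith)
    subst hy
    have hx : nrd x = 0 := by
      simp only [map_zero, LinearMap.zero_apply] at h1; linarith
    rw [nrd_eq_zero] at hx
    rw [hx]; rfl
  exact ⟨key, fun x hx => key x fun y => by rw [glueForm_comm]; exact hx y⟩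

/-- Integral vectors. -/
def intVec : Submodule ℤ (Fin 4 → ℚ) where
  carrier := {y | ∀ i, ∃ z : ℤ, y i = z}
  add_mem' {x y} hx hy i := by
    obtain ⟨a, ha⟩ := hx i
    obtain ⟨b, hb⟩ := hy i
    exact ⟨a + b, by rw [Pi.add_apply, ha, hb]; push_cast; rfl⟩
  zero_mem' _ := ⟨0, by simp⟩
  smul_mem' c x hx i := by
    obtain ⟨a, ha⟩ := hx i
    exact ⟨c * a, by rw [Pi.smul_apply, ha]; simp⟩

theorem isLattice_intVec : Submodule.IsLattice ℚ intVec := by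
  have : intVec = Submodule.span ℤ (Set.range (Pi.basisFun ℚ (Fin 4))) := by
    ext y
    rw [Module.Basis.mem_span_iff_repr_mem]
    simp only [Pi.basisFun_repr]
    exact forall_congr' fun i => ⟨fun ⟨z, hz⟩ => ⟨z, hz.symm⟩, fun ⟨z, hz⟩ => ⟨z, hz.symm⟩⟩
  rw [this]
  exact isLattice_span_basis _

theorem isLattice_prod {V W : Type*} [AddCommGroup V] [Module ℚ V] [AddCommGroup W] [Module ℚ W]
    {I : Submodule ℤ V} {J : Submodule ℤ W} (hI : Submodule.IsLattice ℚ I)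
    (hJ : Submodule.IsLattice ℚ J) : Submodule.IsLattice ℚ (I.prod J) := by
  refine ⟨hI.fg.prod hJ.fg, eq_top_iff.2 ?_⟩
  rintro ⟨x, y⟩ -
  have hx : (x, (0 : W)) ∈ Submodule.span ℚ ((I.prod J : Submodule ℤ (V × W)) : Set (V × W)) := by
    have h1 : x ∈ Submodule.span ℚ (I : Set V) := by rw [hI.span_eq_top]; trivial
    have h2 := Submodule.mem_map_of_mem (f := LinearMap.inl ℚ V W) h1
    rw [Submodule.map_span] at h2
    refine Submodule.span_mono ?_ h2
    rintro _ ⟨z, hz, rfl⟩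
    exact ⟨hz, J.zero_mem⟩
  have hy : ((0 : V), y) ∈ Submodule.span ℚ ((I.prod J : Submodule ℤ (V × W)) : Set (V × W)) := by
    have h1 : y ∈ Submodule.span ℚ (J : Set W) := by rw [hJ.span_eq_top]; trivial
    have h2 := Submodule.mem_map_of_mem (f := LinearMap.inr ℚ V W) h1
    rw [Submodule.map_span] at h2
    refine Submodule.span_mono ?_ h2
    rintro _ ⟨z, hz, rfl⟩
    exact ⟨I.zero_mem, hz⟩
  have := add_mem hx hy
  simpa using this

/-- For integral parameters both vectors pair with integral vectors into `N ℤ`, so after division by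
`N` they lie in the dual lattice. They are orthogonal, of norms `N` and `q N`. -/
theorem coForm_left_frame {m c a q N : ℚ} (hq : q = 4 * m - 1) (hac : a ^ 2 + N = q * c)
    (k : Fin 4 → ℚ) :
    coForm m c a k ![-a, 0, -1, 2] = N * k 3 ∧
      coForm m c a k ![a, -2 * a, -q, 0] = -N * (2 * k 2 + k 3) := by
  have hNe : N = q * c - a ^ 2 := by linarith
  have hm : m = (q + 1) / 4 := by linarith
  rw [coForm_apply, coForm_apply, hNe, hm]
  constructor
  · simp; ring
  · simp; ring

/-- Bezout for rational numbers that become integral after two coprime multiplications. -/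
theorem int_of_coprime_mul {s t : ℤ} (h : IsCoprime s t) {x : ℚ} (hs : ∃ z : ℤ, s * x = z)
    (ht : ∃ z : ℤ, t * x = z) : ∃ z : ℤ, x = z := by
  obtain ⟨u, v, huv⟩ := h
  obtain ⟨z, hz⟩ := hs
  obtain ⟨w, hw⟩ := ht
  refine ⟨u * z + v * w, ?_⟩
  have : (u * s + v * t : ℚ) = 1 := by exact_mod_cast huv
  push_cast
  rw [← hz, ← hw]
  linear_combination (-x) * this

/-- Coordinates become integral after multiplication by two coprime integers, `q` and `a` for `k 1`,
`2` and `a² + c` for `k 2`; then `k 0` follows. So `k 3` and `2 k 2 + k 3` detect the whole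
discriminant group. -/
theorem int_mem_of_dual {m c a q : ℤ} {N : ℕ} (hN : N.Prime) (hN2 : N ≠ 2) (hqp : Prime q) (hqN : ¬ q ∣ N)
    (hq : q = 4 * m - 1) (hac : a ^ 2 + N = q * c) {k : Fin 4 → ℚ}
    (h0 : ∃ z : ℤ, coForm m c a k ![1, 0, 0, 0] = z) (h1 : ∃ z : ℤ, coForm m c a k ![0, 1, 0, 0] = z)
    (h2 : ∃ z : ℤ, coForm m c a k ![0, 0, 1, 0] = z) (h3 : ∃ z : ℤ, coForm m c a k ![0, 0, 0, 1] = z)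
    (hA : ∃ z : ℤ, k 3 = z) (hC : ∃ z : ℤ, 2 * k 2 + k 3 = z) : k ∈ intVec := by
  obtain ⟨A, hA⟩ := hA
  obtain ⟨C, hC⟩ := hC
  obtain ⟨z0, h0⟩ := h0
  obtain ⟨z1, h1⟩ := h1
  obtain ⟨z2, h2⟩ := h2
  obtain ⟨z3, h3⟩ := h3
  simp [coForm_apply] at h0 h1 h2 h3
  have hqQ : (q : ℚ) = 4 * m - 1 := by exact_mod_cast hq
  have haq : IsCoprime q a := by
    refine (hqp.irreducible.coprime_iff_not_dvd).2 fun h => hqN ?_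
    have h5 : q ∣ q * c - a ^ 2 := (dvd_mul_right q c).sub (dvd_pow h two_ne_zero)
    rw [← hac] at h5
    simpa using h5
  have k1 : ∃ z : ℤ, k 1 = z := by
    refine int_of_coprime_mul haq ⟨2 * z1 - z0 + a * C, ?_⟩ ⟨c * C - z2, ?_⟩
    · push_cast
      rw [← h0, ← h1, ← hC, hqQ]; ring
    · push_cast
      rw [← h2, ← hC]; ring
  obtain ⟨K1, k1⟩ := k1
  have k2 : ∃ z : ℤ, k 2 = z := by
    -- `N` and `q` are odd, so `N = q c - a²` forces `a` and `c` to have different parity.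
    have hodd : Odd (a ^ 2 + c) := by
      have hNo : (N : ℤ) % 2 = 1 := by
        have := hN.eq_two_or_odd; omega
      have h5 := congrArg (· % 2) hac
      rcases Int.even_or_odd a with ⟨s, rfl⟩ | ⟨s, rfl⟩ <;>
        rcases Int.even_or_odd c with ⟨t, rfl⟩ | ⟨t, rfl⟩
      · exfalso
        have : (N : ℤ) = 2 * (q * t - 2 * s ^ 2) := by linear_combination hac
        omega
      · exact ⟨2 * s ^ 2 + t, by ring⟩
      · exact ⟨2 * s ^ 2 + 2 * s + t, by ring⟩
      · exfalso
        have : (N : ℤ) = 2 * ((4 * m - 1) * t + 2 * m - 1 - 2 * s ^ 2 - 2 * s) := by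
          rw [hq] at hac; linear_combination hac
        omega
    have hcop : IsCoprime (2 : ℤ) (a ^ 2 + c) := by
      refine (Int.prime_two.irreducible.coprime_iff_not_dvd).2 ?_
      rwa [← even_iff_two_dvd, Int.not_even_iff_odd]
    refine int_of_coprime_mul hcop ⟨C - A, ?_⟩
      ⟨z3 - 2 * c * m * A - a * z1 + 2 * a * m * K1, ?_⟩
    · push_cast
      rw [← hC, ← hA]; ring
    · push_cast
      rw [← h3, ← h1, ← hA, ← k1]; ring
  obtain ⟨K2, k2⟩ := k2
  have k0 : ∃ z : ℤ, k 0 = z := ⟨z1 - 2 * m * K1 + a * K2, by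
    push_cast
    rw [← h1, ← k1, ← k2]; ring⟩
  intro i
  fin_cases i
  · exact k0
  · exact ⟨K1, k1⟩
  · exact ⟨K2, k2⟩
  · exact ⟨A, hA⟩

end Glue

end QuatForm
end

/-! ### The glued unimodular lattice and a square root of `-N` in `B` -/

noncomputable section

namespace QuatForm

section GlueLattice

variable {B : Type*} [Ring B] [Algebra ℚ B] [DefiniteQuaternion B]

/-- Parameters of a rank four lattice of discriminant `N ^ 2` and of an isometry of its discriminant
form with that of an order. -/
structure GlueData (N : ℕ) (O : Subalgebra ℤ B) where
  (m c a q r ν u v k : ℤ) (x₁ x₂ : B)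
  q_eq : q = 4 * m - 1
  q_pos : 0 < q
  q_prime : Prime q
  q_not_dvd : ¬ q ∣ N
  ac : a ^ 2 + N = q * c
  x₁_mem : x₁ ∈ trdDual (Subalgebra.toSubmodule O)
  x₂_mem : x₂ ∈ trdDual (Subalgebra.toSubmodule O)
  nrd_x₁ : nrd x₁ = r / N
  nrd_x₂ : nrd x₂ = r * ν / N
  orth : trd (x₁ * qconj x₂) = 0
  not_dvd_r : ¬ (N : ℤ) ∣ r
  not_dvd_k : ¬ (N : ℤ) ∣ k
  gen : ∀ x ∈ trdDual (Subalgebra.toSubmodule O), ∃ α γ : ℤ, x - α • x₁ - γ • x₂ ∈ O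
  dvd_r : (N : ℤ) ∣ r - (u ^ 2 + q * v ^ 2)
  dvd_ν : (N : ℤ) ∣ ν - k ^ 2 * q

/-- The discriminant form of `O` is `⟨r, rν⟩ / N`, that of `coForm` is `⟨1, q⟩ / N`. Both `-ν` and
`-q` are nonresidues, so `νq` is a square and the determinants agree up to squares; a representation
`r ≡ u² + q v²` then yields the isometry. -/
theorem exists_glueData (N : ℕ) [hN : Fact N.Prime] [hR : RamifiedOnlyAt B N] {O : Subalgebra ℤ B}
    (hO : IsMaximalOrder O) : Nonempty (GlueData N O) := by
  obtain ⟨q, hq, hq4, hqN, hleg, a, c, hac⟩ := exists_prime_of_nonresidue N hR.three_lt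
  obtain ⟨x₁, x₂, r, ν, hx₁, hx₂, hn₁, hn₂, horth, hr, hns, hgen⟩ := exists_dual_generators N hO
  have hq0 : ((q : ℤ) : ZMod N) ≠ 0 := by
    rw [Int.cast_natCast, Ne, ZMod.natCast_eq_zero_iff]
    intro h
    exact hqN ((Nat.prime_dvd_prime_iff_eq hN.out hq).1 h).symm
  have hqns : ¬ IsSquare (-(q : ZMod N)) := by
    have := (legendreSym.eq_neg_one_iff N).1 hleg
    push_cast at this
    exact this
  obtain ⟨h, hh⟩ : IsSquare (ν * q : ZMod N) := by
    have hodd : ringChar (ZMod N) ≠ 2 := by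
      rw [ZMod.ringChar_zmod_n]; have := hR.three_lt; omega
    have h1 : quadraticChar (ZMod N) (-ν) = -1 := (quadraticChar_neg_one_iff_not_isSquare).2 hns
    have h2 : quadraticChar (ZMod N) (-q) = -1 := (quadraticChar_neg_one_iff_not_isSquare).2 hqns
    have h3 : quadraticChar (ZMod N) (ν * q) = 1 := by
      rw [← neg_mul_neg, map_mul, h1, h2]; norm_num
    have h4 : (ν * q : ZMod N) ≠ 0 := by
      intro h0; rw [h0, MulChar.map_zero] at h3; exact zero_ne_one h3
    exact (quadraticChar_one_iff_isSquare h4).1 h3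
  obtain ⟨u, v, huv⟩ : ∃ u v : ZMod N, u ^ 2 + ((q : ℤ) : ZMod N) * v ^ 2 - r = 0 := by
    obtain ⟨u, v, h⟩ := FiniteField.exists_root_sum_quadratic (R := ZMod N)
      (f := Polynomial.X ^ 2)
      (g := Polynomial.C ((q : ℤ) : ZMod N) * Polynomial.X ^ 2 + Polynomial.C (-(r : ZMod N)))
      (by simp) (by compute_degree!; simpa using hq0) (by
        rw [ZMod.card]
        rcases hN.out.eq_two_or_odd with h | h
        · have := hR.three_lt; omega
        · exact h)
    refine ⟨u, v, ?_⟩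
    simp only [Polynomial.eval_pow, Polynomial.eval_X, Polynomial.eval_add, Polynomial.eval_mul,
      Polynomial.eval_C] at h
    linear_combination h
  obtain ⟨u, rfl⟩ := ZMod.intCast_surjective u
  obtain ⟨v, rfl⟩ := ZMod.intCast_surjective v
  obtain ⟨k, hk⟩ := ZMod.intCast_surjective (h / ((q : ℤ) : ZMod N))
  have hkq : (ν : ZMod N) - k ^ 2 * (q : ℤ) = 0 := by
    rw [hk]
    push_cast at hq0 ⊢
    field_simp
    linear_combination hh
  refine ⟨⟨(q + 1) / 4, c, a, q, r, ν, u, v, k, x₁, x₂, by omega, by exact_mod_cast hq.pos,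
    Nat.prime_iff_prime_int.1 hq, ?_, hac, hx₁, hx₂, hn₁, hn₂, horth, hr, ?_, hgen, ?_, ?_⟩⟩
  · intro h
    exact hqN ((Nat.prime_dvd_prime_iff_eq hq hN.out).1 (by exact_mod_cast h))
  · intro h
    rw [← ZMod.intCast_zmod_eq_zero_iff_dvd] at h
    apply hns
    have : (ν : ZMod N) = 0 := by rw [h] at hkq; linear_combination hkq
    rw [this, neg_zero]; exact IsSquare.zero
  · rw [← ZMod.intCast_zmod_eq_zero_iff_dvd]; push_cast at huv ⊢; linear_combination -huv
  · rw [← ZMod.intCast_zmod_eq_zero_iff_dvd]; push_cast at hkq ⊢; linear_combination hkq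

namespace GlueData

variable {N : ℕ} {O : Subalgebra ℤ B} (d : GlueData N O)

/-- Discriminant vectors of norm `N` and `q N`. -/
def e₂ : Fin 4 → ℚ := ![-(d.a : ℚ), 0, -1, 2]
def e₃ : Fin 4 → ℚ := ![(d.a : ℚ), -2 * d.a, -d.q, 0]
def y₁ : Fin 4 → ℚ := (N : ℚ)⁻¹ • ((d.u : ℚ) • d.e₂ + (d.v : ℚ) • d.e₃)
def y₂ : Fin 4 → ℚ := ((d.k : ℚ) * (N : ℚ)⁻¹) • ((-d.q * d.v : ℚ) • d.e₂ + (d.u : ℚ) • d.e₃)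

/-- The form on the ambient space of the glued lattice. -/
abbrev form : LinearMap.BilinForm ℚ (B × (Fin 4 → ℚ)) := glueForm B d.m d.c d.a

/-- The glued lattice. -/
def lat : Submodule ℤ (B × (Fin 4 → ℚ)) :=
  (Subalgebra.toSubmodule O).prod intVec ⊔ Submodule.span ℤ {(d.x₁, d.y₁), (d.x₂, d.y₂)}

theorem mem_lat {x : B × (Fin 4 → ℚ)} : x ∈ d.lat ↔
    ∃ w ∈ (Subalgebra.toSubmodule O).prod intVec, ∃ α γ : ℤ,
      w + (α • (d.x₁, d.y₁) + γ • (d.x₂, d.y₂)) = x := by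
  simp only [lat, Submodule.mem_sup, Submodule.mem_span_pair]
  constructor
  · rintro ⟨w, hw, _, ⟨α, γ, rfl⟩, rfl⟩; exact ⟨w, hw, α, γ, rfl⟩
  · rintro ⟨w, hw, α, γ, rfl⟩; exact ⟨w, hw, _, ⟨α, γ, rfl⟩, rfl⟩

theorem isLattice_lat (hO : IsMaximalOrder O) : Submodule.IsLattice ℚ d.lat := by
  have h0 := isLattice_prod (I := Subalgebra.toSubmodule O) hO.1 isLattice_intVec
  refine ⟨h0.fg.sup (Submodule.fg_span (by simp)), eq_top_iff.2 ?_⟩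
  rw [← h0.span_eq_top]
  exact Submodule.span_mono (fun x hx => (le_sup_left : _ ≤ d.lat) hx)

theorem q_cast : (d.q : ℚ) = 4 * d.m - 1 := by exact_mod_cast d.q_eq

theorem ac_cast : (d.a : ℚ) ^ 2 + N = d.q * d.c := by exact_mod_cast d.ac

theorem coForm_y₁ (hN0 : (N : ℚ) ≠ 0) (k : Fin 4 → ℚ) :
    coForm d.m d.c d.a k d.y₁ = d.u * k 3 - d.v * (2 * k 2 + k 3) := by
  obtain ⟨h1, h2⟩ := coForm_left_frame d.q_cast d.ac_cast k
  rw [y₁, map_smul, map_add, map_smul, map_smul, e₂, e₃, h1, h2]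
  simp only [smul_eq_mul]
  field_simp
  ring

theorem coForm_y₂ (hN0 : (N : ℚ) ≠ 0) (k : Fin 4 → ℚ) :
    coForm d.m d.c d.a k d.y₂ = d.k * (-d.q * d.v * k 3 - d.u * (2 * k 2 + k 3)) := by
  obtain ⟨h1, h2⟩ := coForm_left_frame d.q_cast d.ac_cast k
  rw [y₂, map_smul, map_add, map_smul, map_smul, e₂, e₃, h1, h2]
  simp only [smul_eq_mul]
  field_simp
  ring

theorem y₁_two : 2 * d.y₁ 2 + d.y₁ 3 = -2 * d.q * d.v / N := by
  simp [y₁, e₂, e₃]; ring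

theorem y₁_three : d.y₁ 3 = 2 * d.u / N := by
  simp [y₁, e₂, e₃]; ring

theorem y₂_two : 2 * d.y₂ 2 + d.y₂ 3 = -2 * d.q * d.k * d.u / N := by
  simp [y₂, e₂, e₃]; ring

theorem y₂_three : d.y₂ 3 = -2 * d.q * d.k * d.v / N := by
  simp [y₂, e₂, e₃]; ring

theorem form_base (hO : IsMaximalOrder O) {x : B × (Fin 4 → ℚ)}
    (hx : x ∈ (Subalgebra.toSubmodule O).prod intVec) : ∃ z : ℤ, d.form x x = 2 * z := by
  obtain ⟨z, hz⟩ := nrd_int hO.1 hx.1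
  choose k hk using hx.2
  refine ⟨z - (k 0 ^ 2 + k 0 * k 1 + d.m * k 1 ^ 2 + d.c * (k 2 ^ 2 + k 2 * k 3 + d.m * k 3 ^ 2) +
    d.a * (k 0 * k 3 - k 1 * k 2)), ?_⟩
  rw [form, glueForm_apply, trd_mul_qconj_self, coForm_apply, hz, hk 0, hk 1, hk 2, hk 3]
  push_cast; ring

theorem form_base_x₁ (hN0 : (N : ℚ) ≠ 0) (hO : IsMaximalOrder O) {x : B × (Fin 4 → ℚ)}
    (hx : x ∈ (Subalgebra.toSubmodule O).prod intVec) :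
    ∃ z : ℤ, d.form x (d.x₁, d.y₁) = z := by
  obtain ⟨z, hz⟩ := mem_trdDual.1 d.x₁_mem _ (qconj_mem hO.1 hx.1)
  choose k hk using hx.2
  refine ⟨z - (d.u * k 3 - d.v * (2 * k 2 + k 3)), ?_⟩
  rw [form, glueForm_apply, trd_mul_qconj_comm, hz, d.coForm_y₁ hN0, hk 2, hk 3]
  push_cast; ring

theorem form_base_x₂ (hN0 : (N : ℚ) ≠ 0) (hO : IsMaximalOrder O) {x : B × (Fin 4 → ℚ)}
    (hx : x ∈ (Subalgebra.toSubmodule O).prod intVec) :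
    ∃ z : ℤ, d.form x (d.x₂, d.y₂) = z := by
  obtain ⟨z, hz⟩ := mem_trdDual.1 d.x₂_mem _ (qconj_mem hO.1 hx.1)
  choose k hk using hx.2
  refine ⟨z - (d.k * (-d.q * d.v * k 3 - d.u * (2 * k 2 + k 3))), ?_⟩
  rw [form, glueForm_apply, trd_mul_qconj_comm, hz, d.coForm_y₂ hN0, hk 2, hk 3]
  push_cast; ring

theorem form_x₁_x₁ (hN0 : (N : ℚ) ≠ 0) :
    ∃ z : ℤ, d.form (d.x₁, d.y₁) (d.x₁, d.y₁) = 2 * z := by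
  obtain ⟨z, hz⟩ := d.dvd_r
  refine ⟨z, ?_⟩
  have hz' : (d.r : ℚ) - (d.u ^ 2 + d.q * d.v ^ 2) = N * z := by exact_mod_cast hz
  rw [form, glueForm_apply, trd_mul_qconj_self, d.coForm_y₁ hN0, d.nrd_x₁]
  dsimp only
  rw [d.y₁_two, d.y₁_three]
  field_simp
  linear_combination hz'

theorem form_x₂_x₂ (hN0 : (N : ℚ) ≠ 0) :
    ∃ z : ℤ, d.form (d.x₂, d.y₂) (d.x₂, d.y₂) = 2 * z := by
  obtain ⟨z, hz⟩ := d.dvd_r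
  obtain ⟨w, hw⟩ := d.dvd_ν
  refine ⟨d.r * w + d.k ^ 2 * d.q * z, ?_⟩
  have hz' : (d.r : ℚ) - (d.u ^ 2 + d.q * d.v ^ 2) = N * z := by exact_mod_cast hz
  have hw' : (d.ν : ℚ) - d.k ^ 2 * d.q = N * w := by exact_mod_cast hw
  rw [form, glueForm_apply, trd_mul_qconj_self, d.coForm_y₂ hN0, d.nrd_x₂]
  dsimp only
  rw [d.y₂_two, d.y₂_three]
  push_cast
  field_simp
  linear_combination d.k ^ 2 * d.q * hz' + d.r * hw'

theorem form_x₁_x₂ (hN0 : (N : ℚ) ≠ 0) : d.form (d.x₁, d.y₁) (d.x₂, d.y₂) = 0 := by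
  rw [form, glueForm_apply, d.orth, d.coForm_y₂ hN0]
  dsimp only
  rw [d.y₁_two, d.y₁_three]
  field_simp
  ring

theorem form_even (hN0 : (N : ℚ) ≠ 0) (hO : IsMaximalOrder O) {x : B × (Fin 4 → ℚ)}
    (hx : x ∈ d.lat) : ∃ z : ℤ, d.form x x = 2 * z := by
  obtain ⟨w, hw, α, γ, rfl⟩ := d.mem_lat.1 hx
  obtain ⟨z0, h0⟩ := d.form_base hO hw
  obtain ⟨z1, h1⟩ := d.form_base_x₁ hN0 hO hw
  obtain ⟨z2, h2⟩ := d.form_base_x₂ hN0 hO hw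
  obtain ⟨z3, h3⟩ := d.form_x₁_x₁ hN0
  obtain ⟨z4, h4⟩ := d.form_x₂_x₂ hN0
  have h5 := d.form_x₁_x₂ hN0
  have h1' : d.form (d.x₁, d.y₁) w = z1 := by rw [form, glueForm_comm]; exact h1
  have h2' : d.form (d.x₂, d.y₂) w = z2 := by rw [form, glueForm_comm]; exact h2
  have h5' : d.form (d.x₂, d.y₂) (d.x₁, d.y₁) = 0 := by rw [form, glueForm_comm]; exact h5
  refine ⟨z0 + α * z1 + γ * z2 + α ^ 2 * z3 + γ ^ 2 * z4, ?_⟩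
  simp only [← Int.cast_smul_eq_zsmul ℚ α, ← Int.cast_smul_eq_zsmul ℚ γ, map_add, map_smul,
    LinearMap.add_apply, LinearMap.smul_apply, h0, h1, h2, h3, h4, h5, h1', h2', h5', smul_eq_mul]
  push_cast; ring

theorem form_int (hN0 : (N : ℚ) ≠ 0) (hO : IsMaximalOrder O) {x y : B × (Fin 4 → ℚ)}
    (hx : x ∈ d.lat) (hy : y ∈ d.lat) : ∃ z : ℤ, d.form x y = z := by
  obtain ⟨z1, h1⟩ := d.form_even hN0 hO hx
  obtain ⟨z2, h2⟩ := d.form_even hN0 hO hy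
  obtain ⟨z3, h3⟩ := d.form_even hN0 hO (d.lat.add_mem hx hy)
  refine ⟨z3 - z1 - z2, ?_⟩
  have h4 : d.form y x = d.form x y := glueForm_comm _ _ _ _ _
  simp only [map_add, LinearMap.add_apply, h1, h2, h4] at h3
  push_cast
  linarith

/-- After subtraction of glue vectors the first component lies in `O`, leaving a vector `k` that
pairs integrally with integral vectors, `y₁` and `y₂`. The last two conditions are linear in `k 3`
and `2 k 2 + k 3` with determinant `-d.k (u² + q v²)`, prime to `N`, while `e₂` and `e₃` bound the
denominators by `N`. -/
theorem mem_lat_of_dual (hN : N.Prime) (hN2 : N ≠ 2) (hO : IsMaximalOrder O) {x : B × (Fin 4 → ℚ)}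
    (hx : ∀ y ∈ d.lat, ∃ z : ℤ, d.form x y = z) : x ∈ d.lat := by
  have hN0 : (N : ℚ) ≠ 0 := by exact_mod_cast hN.ne_zero
  have hbase : ∀ {w}, w ∈ (Subalgebra.toSubmodule O).prod intVec → w ∈ d.lat := fun {w} hw =>
    (le_sup_left : _ ≤ d.lat) hw
  have hx₁ : (d.x₁, d.y₁) ∈ d.lat := d.mem_lat.2 ⟨0, zero_mem _, 1, 0, by simp⟩
  have hx₂ : (d.x₂, d.y₂) ∈ d.lat := d.mem_lat.2 ⟨0, zero_mem _, 0, 1, by simp⟩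
  have hfst : x.1 ∈ trdDual (Subalgebra.toSubmodule O) := mem_trdDual.2 fun o ho => by
    obtain ⟨z, hz⟩ := hx (qconj o, 0) (hbase ⟨qconj_mem hO.1 ho, zero_mem _⟩)
    refine ⟨z, ?_⟩
    rw [← hz, form, glueForm_apply]
    simp [qconj_qconj]
  obtain ⟨α, γ, hαγ⟩ := d.gen _ hfst
  set x' := x - (α • (d.x₁, d.y₁) + γ • (d.x₂, d.y₂)) with hx'
  have hx'1 : x'.1 ∈ O := by
    have : x'.1 = x.1 - α • d.x₁ - γ • d.x₂ := by rw [hx']; simp [sub_sub]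
    rw [this]; exact hαγ
  set k := x'.2 with hk
  have hvec : ∀ y ∈ d.lat, ∃ z : ℤ, d.form (0, k) y = z := by
    intro y hy
    have e : ((0 : B), k) = x - (α • (d.x₁, d.y₁) + γ • (d.x₂, d.y₂) + (x'.1, 0)) := by
      rw [← sub_sub, ← hx']; ext <;> simp [hk]
    obtain ⟨z1, h1⟩ := hx y hy
    obtain ⟨z2, h2⟩ := d.form_int hN0 hO (add_mem (add_mem (d.lat.smul_mem α hx₁) (d.lat.smul_mem γ hx₂))
      (hbase (show (x'.1, (0 : Fin 4 → ℚ)) ∈ _ from ⟨hx'1, zero_mem _⟩))) hy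
    refine ⟨z1 - z2, ?_⟩
    rw [e, map_sub, LinearMap.sub_apply, h1, h2]; push_cast; rfl
  have hform : ∀ y : B × (Fin 4 → ℚ), d.form (0, k) y = -coForm d.m d.c d.a k y.2 := fun y => by
    rw [form, glueForm_apply]; simp
  have hint : ∀ l ∈ intVec, ∃ z : ℤ, coForm d.m d.c d.a k l = z := fun l hl => by
    obtain ⟨z, hz⟩ := hvec (0, l) (hbase ⟨zero_mem _, hl⟩)
    rw [hform] at hz
    exact ⟨-z, by push_cast; linarith⟩
  obtain ⟨p, hp⟩ := hvec _ hx₁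
  obtain ⟨s, hs⟩ := hvec _ hx₂
  rw [hform, d.coForm_y₁ hN0] at hp
  rw [hform, d.coForm_y₂ hN0] at hs
  obtain ⟨h1, h2⟩ := coForm_left_frame d.q_cast d.ac_cast k
  have he₂ : (![-(d.a : ℚ), 0, -1, 2] : Fin 4 → ℚ) ∈ intVec := by
    intro i
    fin_cases i
    exacts [⟨-d.a, by simp⟩, ⟨0, by simp⟩, ⟨-1, by simp⟩, ⟨2, by simp⟩]
  have he₃ : (![(d.a : ℚ), -2 * d.a, -d.q, 0] : Fin 4 → ℚ) ∈ intVec := by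
    intro i
    fin_cases i
    exacts [⟨d.a, by simp⟩, ⟨-2 * d.a, by simp⟩, ⟨-d.q, by simp⟩, ⟨0, by simp⟩]
  obtain ⟨z2, hz2⟩ := hint _ he₂
  obtain ⟨z3, hz3⟩ := hint _ he₃
  rw [h1] at hz2
  rw [h2] at hz3
  have hNp : Prime (N : ℤ) := Nat.prime_iff_prime_int.1 hN
  have hcop : IsCoprime (N : ℤ) (d.k * (d.u ^ 2 + d.q * d.v ^ 2)) := by
    refine (hNp.irreducible.coprime_iff_not_dvd).2 fun h => ?_
    rcases hNp.dvd_or_dvd h with h | h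
    · exact d.not_dvd_k h
    · exact d.not_dvd_r (by simpa using dvd_add d.dvd_r h)
  have hA : ∃ z : ℤ, k 3 = z := by
    refine int_of_coprime_mul hcop ⟨z2, by exact_mod_cast hz2⟩ ⟨-d.k * d.u * p + d.v * s, ?_⟩
    push_cast
    rw [← hp, ← hs]; ring
  have hC : ∃ z : ℤ, 2 * k 2 + k 3 = z := by
    refine int_of_coprime_mul hcop ⟨-z3, by push_cast; linarith⟩ ⟨d.u * s - d.k * d.q * d.v * (-p), ?_⟩
    push_cast
    rw [← hp, ← hs]; ring
  have hk : k ∈ intVec := by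
    refine int_mem_of_dual hN hN2 d.q_prime d.q_not_dvd d.q_eq d.ac (hint _ ?_) (hint _ ?_) (hint _ ?_)
      (hint _ ?_) hA hC
    · intro i; fin_cases i
      exacts [⟨1, by simp⟩, ⟨0, by simp⟩, ⟨0, by simp⟩, ⟨0, by simp⟩]
    · intro i; fin_cases i
      exacts [⟨0, by simp⟩, ⟨1, by simp⟩, ⟨0, by simp⟩, ⟨0, by simp⟩]
    · intro i; fin_cases i
      exacts [⟨0, by simp⟩, ⟨0, by simp⟩, ⟨1, by simp⟩, ⟨0, by simp⟩]
    · intro i; fin_cases i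
      exacts [⟨0, by simp⟩, ⟨0, by simp⟩, ⟨0, by simp⟩, ⟨1, by simp⟩]
  refine d.mem_lat.2 ⟨x', ⟨hx'1, hk⟩, α, γ, ?_⟩
  rw [hx']; abel

end GlueData

/-- `ℚ(√-N)` embeds in the quaternion algebra ramified at `N`. -/
theorem exists_mul_self_eq_neg (N : ℕ) [hN : Fact N.Prime] [hR : RamifiedOnlyAt B N]
    {O : Subalgebra ℤ B} (hO : IsMaximalOrder O) : ∃ b : B, b * b = -(N : B) := by
  obtain ⟨d⟩ := exists_glueData N hO
  have hN0 := natCast_ne_zero_rat N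
  have hNpos : (0 : ℚ) < N := by exact_mod_cast hN.out.pos
  have hqpos : (0 : ℚ) < d.q := by exact_mod_cast d.q_pos
  have hN2 : N ≠ 2 := by have := hR.three_lt; omega
  obtain ⟨f₁, hf₁⟩ := exists_real_coords_nrd (B := B)
  obtain ⟨f₂, hf₂⟩ := exists_real_coords d.q_cast hqpos hNpos d.ac_cast
  obtain ⟨t, ht, htt⟩ := exists_isotropic_of_selfDual (n := 4) le_rfl
    (V := B × (Fin 4 → ℚ)) (by rw [Module.finrank_prod, finrank_eq_four]; simp)
    (finrank_euclideanSpace_fin (𝕜 := ℝ)) (finrank_euclideanSpace_fin (𝕜 := ℝ)) d.form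
    (glueForm_nondegenerate d.q_cast hqpos hNpos d.ac_cast) (d.isLattice_lat hO)
    (fun x hx y hy => d.form_int hN0 hO hx hy) (fun x hx => d.form_even hN0 hO hx)
    (fun x hx => d.mem_lat_of_dual hN.out hN2 hO hx)
    (f₁.comp (AddMonoidHom.fst _ _)) (f₂.comp (AddMonoidHom.snd _ _))
    (fun x y => by
      rw [GlueData.form, glueForm_apply]
      push_cast
      rw [hf₁, hf₂]; rfl)
  have hT : ∀ x ∈ Submodule.span ℚ (Set.range t), ∀ y ∈ Submodule.span ℚ (Set.range t),
      d.form x y = 0 := by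
    intro x hx y hy
    induction hx using Submodule.span_induction with
    | mem x h =>
      obtain ⟨i, rfl⟩ := h
      induction hy using Submodule.span_induction with
      | mem y h => obtain ⟨j, rfl⟩ := h; exact htt i j
      | zero => simp
      | add _ _ _ _ h1 h2 => rw [map_add, h1, h2, add_zero]
      | smul _ _ _ h => rw [map_smul, h, smul_zero]
    | zero => simp
    | add _ _ _ _ h1 h2 => rw [map_add, LinearMap.add_apply, h1, h2, add_zero]
    | smul _ _ _ h => rw [map_smul, LinearMap.smul_apply, h, smul_zero]
  -- The totally isotropic space meets `B × 0` trivially because `nrd` is anisotropic, so by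
  -- dimension it is the graph of an isometry from the second factor to `B`.
  have hker : ∀ x ∈ Submodule.span ℚ (Set.range t), x.2 = 0 → x = 0 := by
    rintro ⟨x, y⟩ hx (rfl : y = 0)
    have h1 := hT _ hx _ hx
    rw [GlueData.form, glueForm_apply, trd_mul_qconj_self] at h1
    have h2 : nrd x = 0 := by simp at h1; exact h1
    rw [nrd_eq_zero] at h2
    rw [h2]; rfl
  have hli : LinearIndependent ℚ (LinearMap.snd ℚ B (Fin 4 → ℚ) ∘ t) := by
    refine ht.map (Submodule.disjoint_def.2 fun x hx hx2 => hker x hx hx2)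
  have hspan : ⊤ ≤ Submodule.span ℚ (Set.range (LinearMap.snd ℚ B (Fin 4 → ℚ) ∘ t)) := by
    rw [hli.span_eq_top_of_card_eq_finrank' (by simp)]
  have hsurj : ∀ y : Fin 4 → ℚ, ∃ x : B, (x, y) ∈ Submodule.span ℚ (Set.range t) := by
    intro y
    have h1 := hspan (Submodule.mem_top (x := y))
    rw [Set.range_comp, ← Submodule.map_span] at h1
    obtain ⟨⟨x, y'⟩, hx, rfl⟩ := h1
    exact ⟨x, hx⟩
  -- This vector and `e₂` are orthogonal, of norms 1 and `N`; their images give a product `x₂ x̄₀`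
  -- of trace 0 and norm `N`.
  obtain ⟨x₀, hx₀⟩ := hsurj ![1, 0, 0, 0]
  obtain ⟨x₂, hx₂⟩ := hsurj ![-(d.a : ℚ), 0, -1, 2]
  have h00 := hT _ hx₀ _ hx₀
  have h20 := hT _ hx₂ _ hx₀
  have h22 := hT _ hx₂ _ hx₂
  obtain ⟨g, -⟩ := coForm_left_frame d.q_cast d.ac_cast ![-(d.a : ℚ), 0, -1, 2]
  rw [GlueData.form, glueForm_apply, trd_mul_qconj_self, coForm_apply] at h00
  rw [GlueData.form, glueForm_apply, coForm_apply] at h20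
  rw [GlueData.form, glueForm_apply, trd_mul_qconj_self, g] at h22
  simp at h00 h20 h22
  refine ⟨x₂ * qconj x₀, ?_⟩
  have hn : nrd (x₂ * qconj x₀) = N := by
    rw [nrd_mul, nrd_qconj]
    have e1 : nrd x₀ = 1 := by linarith
    have e2 : nrd x₂ = N := by linarith
    rw [e1, e2, mul_one]
  have htr : trd (x₂ * qconj x₀) = 0 := by linarith
  rw [mul_self_eq, htr, hn]
  simp

end GlueLattice

end QuatForm
end

/-! ### The centraliser and the conjugates of a square root of `-N` -/

noncomputable section

namespace QuatForm

section SqrtNeg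

variable {B : Type*} [Ring B] [Algebra ℚ B] [DefiniteQuaternion B] {N : ℕ} {b : B}

theorem nrd_natCast (n : ℕ) : nrd (n : B) = (n : ℚ) ^ 2 := by
  rw [← map_natCast (algebraMap ℚ B) n, nrd_algebraMap]

theorem nrd_of_mul_self_eq_neg (hb : b * b = -(N : B)) : nrd b = N := by
  have h1 : nrd b ^ 2 = (N : ℚ) ^ 2 := by
    rw [← nrd_natCast (B := B), ← nrd_neg (N : B), ← hb, nrd_mul, sq]
  exact (pow_left_inj₀ (nrd_nonneg b) (Nat.cast_nonneg N) two_ne_zero).1 h1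

theorem ne_zero_of_mul_self_eq_neg (hN : N ≠ 0) (hb : b * b = -(N : B)) : b ≠ 0 := by
  rintro rfl
  rw [mul_zero, eq_comm, neg_eq_zero] at hb
  exact hN (Nat.cast_eq_zero.1 hb)

theorem trd_of_mul_self_eq_neg (hN : N ≠ 0) (hb : b * b = -(N : B)) : trd b = 0 := by
  have h1 := mul_self_eq b
  rw [nrd_of_mul_self_eq_neg hb, hb, map_natCast, eq_sub_iff_add_eq, neg_add_cancel, eq_comm,
    mul_eq_zero] at h1
  rcases h1 with h1 | h1
  · exact (algebraMap_injective' (B := B)) (h1.trans (map_zero _).symm)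
  · exact absurd h1 (ne_zero_of_mul_self_eq_neg hN hb)

theorem trd_add_smul (hN : N ≠ 0) (hb : b * b = -(N : B)) (r s : ℚ) :
    trd (algebraMap ℚ B r + s • b) = 2 * r := by
  rw [map_add, map_smul, trd_of_mul_self_eq_neg hN hb, smul_zero, add_zero, trd_algebraMap]

theorem nrd_add_smul (hN : N ≠ 0) (hb : b * b = -(N : B)) (r s : ℚ) :
    nrd (algebraMap ℚ B r + s • b) = r ^ 2 + N * s ^ 2 := by
  have h0 := trd_of_mul_self_eq_neg hN hb
  have h1 : algebraMap ℚ B r * qconj (s • b) = (-(r * s)) • b := by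
    rw [qconj_of_trd_eq_zero (by rw [map_smul, h0, smul_zero]), ← Algebra.smul_def, smul_neg, smul_smul,
      neg_smul]
  rw [nrd_add, h1, map_smul, h0, nrd_smul, nrd_algebraMap, nrd_of_mul_self_eq_neg hb]
  simp; ring

/-- The trace-zero part `x₀` of `x` also commutes with `b`, so `x₀ b` equals its own conjugate and
is rational. -/
theorem exists_of_commute_sqrt (hN : N ≠ 0) (hb : b * b = -(N : B)) {x : B} (hx : x * b = b * x) :
    ∃ r s : ℚ, x = algebraMap ℚ B r + s • b := by
  set x₀ := x - algebraMap ℚ B (trd x / 2) with hx₀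
  have ht : trd x₀ = 0 := by rw [hx₀, map_sub, trd_algebraMap]; ring
  have hc : x₀ * b = b * x₀ := by rw [hx₀, sub_mul, mul_sub, hx, Algebra.commutes]
  have h1 : x₀ * b = algebraMap ℚ B (trd (x₀ * b) / 2) := by
    have h2 := add_qconj (x₀ * b)
    rw [qconj_mul, qconj_of_trd_eq_zero ht, qconj_of_trd_eq_zero (trd_of_mul_self_eq_neg hN hb),
      neg_mul_neg, ← hc, ← two_smul ℚ] at h2
    rw [div_eq_inv_mul, map_mul, ← h2, ← Algebra.smul_def, smul_smul, inv_mul_cancel₀ two_ne_zero, one_smul]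
  refine ⟨trd x / 2, -(trd (x₀ * b) / 2) / N, ?_⟩
  have h3 : x₀ * b * b = (trd (x₀ * b) / 2) • b := by rw [h1, ← Algebra.smul_def, ← h1]
  rw [mul_assoc, hb, mul_neg, ← Nat.cast_comm, ← nsmul_eq_mul, ← Nat.cast_smul_eq_nsmul ℚ] at h3
  have h4 : x₀ = (-(trd (x₀ * b) / 2) / N) • b := by
    rw [neg_div, div_eq_inv_mul, neg_smul, mul_smul, ← h3, smul_neg, smul_smul,
      inv_mul_cancel₀ (Nat.cast_ne_zero.2 hN), one_smul, neg_neg]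
  rw [← h4, hx₀]; abel

/-- Skolem–Noether by hand: `g = b c - N = b (b + c)` intertwines `c` and `b` and vanishes only for
`c = -b`, in which case a nonzero commutator with `b` works, because it anticommutes with `b`. -/
theorem exists_conj_eq (hN : N ≠ 0) (hb : b * b = -(N : B)) {c : B} (hc : c * c = -(N : B)) :
    ∃ g : Bˣ, (g : B) * c = b * g := by
  by_cases h : c = -b
  · have hncen : ∃ x : B, b * x ≠ x * b := by
      by_contra! hcen
      obtain ⟨r, hr⟩ := exists_algebraMap_eq_of_central hcen
      have h1 := nrd_of_mul_self_eq_neg hb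
      have h2 := trd_of_mul_self_eq_neg hN hb
      rw [← hr, trd_algebraMap] at h2
      rw [← hr, nrd_algebraMap] at h1
      have : r = 0 := by linarith
      rw [this] at h1
      exact hN (by exact_mod_cast (show (N : ℚ) = 0 by rw [← h1]; norm_num))
    obtain ⟨x, hx⟩ := hncen
    refine ⟨qunit (b * x - x * b) (sub_ne_zero.2 hx), ?_⟩
    change (b * x - x * b) * c = b * (b * x - x * b)
    have e : x * b * b = b * b * x := by
      rw [mul_assoc, hb, mul_neg, neg_mul, Nat.cast_comm]
    rw [h, mul_neg, sub_mul, mul_sub, e, ← mul_assoc, ← mul_assoc]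
    abel
  · have hg : b * c - (N : B) ≠ 0 := by
      intro h0
      rw [sub_eq_zero] at h0
      apply h
      have h2 : b * (b * c) = b * N := by rw [h0]
      rw [← mul_assoc, hb, neg_mul, ← Nat.cast_comm, ← mul_neg] at h2
      exact mul_left_cancel₀ (Nat.cast_ne_zero.2 hN) (by rw [mul_neg, ← h2, mul_neg, neg_neg]) 
    refine ⟨qunit _ hg, ?_⟩
    change (b * c - (N : B)) * c = b * (b * c - (N : B))
    rw [sub_mul, mul_sub, mul_assoc, hc, ← mul_assoc, hb, mul_neg, neg_mul, Nat.cast_comm]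
    abel

/-- If `s ≠ 0`, then `N (2s)² = 4 - t²` with `t² < 4`. The left side has odd `N`-adic valuation,
while the right side is 3 or 4, prime to `N`. -/
theorem eq_one_or_neg_one_of_integral [Fact N.Prime] (hN3 : 3 < N) {r s : ℚ} {t : ℤ}
    (ht : 2 * r = t) (hn : r ^ 2 + N * s ^ 2 = 1) : s = 0 ∧ (r = 1 ∨ r = -1) := by
  have h1 : (t : ℚ) ^ 2 + N * (2 * s) ^ 2 = 4 := by rw [← ht]; linarith
  have hs : s = 0 := by
    by_contra hs
    have hs' : 2 * s ≠ 0 := mul_ne_zero two_ne_zero hs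
    have hN0 : (0 : ℚ) < N := by exact_mod_cast (by omega : 0 < N)
    have h2 : (t : ℚ) ^ 2 < 4 := by have := mul_pos hN0 (pow_pos (sq_pos_of_ne_zero hs') 1); linarith
    have h3 : t ^ 2 < 4 := by exact_mod_cast h2
    have h4 : (N : ℚ) * (2 * s) ^ 2 = ((4 - t ^ 2 : ℤ) : ℚ) := by push_cast; linarith
    have h5 : ¬ (N : ℤ) ∣ 4 - t ^ 2 := by
      intro hd
      have hN3' : (3 : ℤ) < N := by exact_mod_cast hN3
      have hle := Int.le_of_dvd (by linarith) hd
      have : t ^ 2 = 0 := by nlinarith [sq_nonneg t]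
      rw [this, sub_zero] at hd
      have h6 : N ∣ 2 ^ 2 := by exact_mod_cast hd
      have := Nat.le_of_dvd (by norm_num) ((Fact.out : N.Prime).dvd_of_dvd_pow h6)
      omega
    have h6 := congrArg (padicValRat N) h4
    rw [padicValRat.mul hN0.ne' (pow_ne_zero _ hs'), padicValRat.pow, padicValRat.of_int,
      padicValInt.eq_zero_of_not_dvd h5, padicValRat.self (by omega)] at h6
    push_cast at h6
    omega
  subst hs
  refine ⟨rfl, ?_⟩
  have : (r - 1) * (r + 1) = 0 := by linarith [hn]
  rcases mul_eq_zero.1 this with h | h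
  · left; linarith
  · right; linarith

/-- An element of norm one commuting with `√-N` and having integral trace is `±1`. -/
theorem eq_one_or_neg_one_of_commute_sqrt [Fact N.Prime] (hN3 : 3 < N) (hb : b * b = -(N : B)) {x : B}
    (hx : x * b = b * x) {t : ℤ} (ht : trd x = t) (hn : nrd x = 1) : x = 1 ∨ x = -1 := by
  have hN : N ≠ 0 := by omega
  obtain ⟨r, s, rfl⟩ := exists_of_commute_sqrt hN hb hx
  rw [trd_add_smul hN hb] at ht
  rw [nrd_add_smul hN hb] at hn
  obtain ⟨rfl, rfl | rfl⟩ := eq_one_or_neg_one_of_integral hN3 ht hn <;> simp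

end SqrtNeg

end QuatForm

end

/-! ### Square roots of `-N` in a left order, up to conjugation by its units -/

noncomputable section

namespace QuatForm

section SqrtNegSet

variable {B : Type*} [Ring B] [Algebra ℚ B] [DefiniteQuaternion B]

/-- The square roots of `-N` in the left order of `I`. -/
def sqrtNegSet (N : ℕ) (I : Submodule ℤ B) : Set B := {c | c * c = -(N : B) ∧ ∀ x ∈ I, c * x ∈ I}

theorem mul_mem_of_smul_eq_self {I : Submodule ℤ B} {u : Bˣ} (hu : u • I = I) {x : B} (hx : x ∈ I) :
    (u : B) * x ∈ I :=
  (congrArg (fun J : Submodule ℤ B => (u : B) * x ∈ J) hu).mp (mem_unit_smul.2 ⟨x, hx, rfl⟩)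

theorem coe_mem_leftOrderAlg {I : Submodule ℤ B} {u : Bˣ} (hu : u • I = I) :
    (u : B) ∈ leftOrderAlg I := fun _ hx => mul_mem_of_smul_eq_self hu hx

instance (N : ℕ) (I : Submodule ℤ B) : MulAction (MulAction.stabilizer Bˣ I) (sqrtNegSet N I) where
  smul u c := ⟨(u : Bˣ) * c * ((u : Bˣ)⁻¹ : Bˣ), by
    have := c.2.1
    have e : ((u : Bˣ) : B) * c * ((u : Bˣ)⁻¹ : Bˣ) * ((u : Bˣ) * c * ((u : Bˣ)⁻¹ : Bˣ))
        = (u : Bˣ) * (c * c) * ((u : Bˣ)⁻¹ : Bˣ) := by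
      simp only [mul_assoc, Units.inv_mul_cancel_left]
    rw [e, this, mul_neg, neg_mul, ← Nat.cast_comm, mul_assoc, Units.mul_inv, mul_one], by
    intro x hx
    rw [mul_assoc, mul_assoc]
    exact mul_mem_of_smul_eq_self u.2
      (c.2.2 _ (mul_mem_of_smul_eq_self (inv_mem u.2 : (u : Bˣ)⁻¹ ∈ MulAction.stabilizer Bˣ I) hx))⟩
  one_smul c := by ext; change ((1 : Bˣ) : B) * c * ((1 : Bˣ)⁻¹ : Bˣ) = c; simp
  mul_smul u v c := by
    ext
    change ((u * v : Bˣ) : B) * c * ((u * v : Bˣ)⁻¹ : Bˣ)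
      = (u : Bˣ) * ((v : Bˣ) * c * ((v : Bˣ)⁻¹ : Bˣ)) * ((u : Bˣ)⁻¹ : Bˣ)
    simp [mul_assoc]

theorem coe_stabilizer_smul {N : ℕ} {I : Submodule ℤ B} (u : MulAction.stabilizer Bˣ I)
    (c : sqrtNegSet N I) : ((u • c : sqrtNegSet N I) : B) = (u : Bˣ) * c * ((u : Bˣ)⁻¹ : Bˣ) := rfl

variable (N : ℕ) [Fact N.Prime] [hR : RamifiedOnlyAt B N] {O : Subalgebra ℤ B} {I : Submodule ℤ B}

/-- Reduction modulo 3 is injective on the stabiliser: if `u v⁻¹ = 1 + 3 z`, norm 1 gives `trd z =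
-3 nrd z`, and the trace bound reads `(2 - 9 nrd z)² ≤ 4`, so `z = 0`. -/
theorem finite_stabilizer (N : ℕ) [Fact N.Prime] [hR : RamifiedOnlyAt B N] (hO : IsMaximalOrder O) (hI : Submodule.IsLattice ℚ I)
    (hIr : I * Subalgebra.toSubmodule O = I) : Finite (MulAction.stabilizer Bˣ I) := by
  have hO' := isMaximalOrder_leftOrderAlg N hO hI hIr
  have : Fact (Nat.Prime 3) := ⟨Nat.prime_three⟩
  obtain ⟨ψ, -, hker, -, -⟩ := exists_reduction N hO' 3 (by have := hR.three_lt; omega)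
  have hmem : ∀ u : MulAction.stabilizer Bˣ I, ((u : Bˣ) : B) ∈ leftOrderAlg I :=
    fun u => coe_mem_leftOrderAlg u.2
  refine Finite.of_injective (fun u => ψ ⟨_, hmem u⟩) fun u v h => ?_
  have h1 : ψ (⟨_, hmem u⟩ - ⟨_, hmem v⟩) = 0 := by rw [map_sub, sub_eq_zero]; exact h
  obtain ⟨y, hy⟩ := (hker _).1 h1
  set z : B := y * ((v⁻¹ : MulAction.stabilizer Bˣ I) : Bˣ) with hz
  have hzO : z ∈ leftOrderAlg I := mul_mem y.2 (hmem _)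
  have hy' : ((u : Bˣ) : B) - (v : Bˣ) = (3 : B) * y := by
    have h := congrArg Subtype.val hy
    change ((u : Bˣ) : B) - (v : Bˣ) = (((3 : ℕ) : ℤ) • y : leftOrderAlg I) at h
    rw [h, Nat.cast_ofNat, Subalgebra.coe_smul, zsmul_eq_mul, Int.cast_ofNat]
  have h2 : (((u * v⁻¹ : MulAction.stabilizer Bˣ I) : Bˣ) : B) = 1 + (3 : ℚ) • z := by
    have e : ((u : Bˣ) : B) = (v : Bˣ) + (3 : B) * y := by rw [← hy']; abel
    have e3 : (3 : ℚ) • z = (3 : B) * z := by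
      rw [Algebra.smul_def, map_ofNat]
    rw [e3, hz, ← mul_assoc]
    push_cast
    rw [e, add_mul, Units.mul_inv]
  have h3 := one_of_smul_eq_self_of_nrd hI (u * v⁻¹).2
  have h4 := trd_sq_le (((u * v⁻¹ : MulAction.stabilizer Bˣ I) : Bˣ) : B)
  rw [h3, h2, map_add, trd_one, map_smul] at h4
  rw [h2, nrd_one_add, nrd_smul, map_smul] at h3
  obtain ⟨n, hn⟩ := nrd_int hO'.1 hzO
  rw [hn] at h3
  simp only [smul_eq_mul] at h3 h4
  have h5 : 3 * trd z = -9 * n := by linarith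
  rw [h5] at h4
  have h6 : (2 + -9 * n) ^ 2 ≤ 4 := by
    have : ((2 : ℚ) + -9 * n) ^ 2 ≤ 4 := by linarith
    exact_mod_cast this
  have h7 : n = 0 := by nlinarith
  have h8 : z = 0 := by rw [← nrd_eq_zero, hn, h7, Int.cast_zero]
  rw [h8, smul_zero, add_zero] at h2
  have h9 : u * v⁻¹ = 1 := Subtype.ext (Units.ext h2)
  exact mul_inv_eq_one.1 h9

theorem smul_eq_of_mem_sqrtNegSet (hO : IsMaximalOrder O) (hI : Submodule.IsLattice ℚ I)
    (hIr : I * Subalgebra.toSubmodule O = I) {c : Bˣ} :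
    (c : B) ∈ sqrtNegSet N I ↔ c • I = I * radPow O N 1 := by
  constructor
  · rintro ⟨h1, h2⟩
    exact (mul_radPow_one_eq_smul N hO hI hIr h1 h2).symm
  · intro h
    exact mul_self_eq_of_mul_radPow N hO hI hIr h.symm

omit hR in
theorem exists_unit_of_mem_sqrtNegSet {c : B} (hc : c ∈ sqrtNegSet N I) : ∃ c' : Bˣ, (c' : B) = c :=
  ⟨qunit c (ne_zero_of_mul_self_eq_neg (Fact.out : N.Prime).ne_zero hc.1), rfl⟩

/-- All roots `c` satisfy `c I = I P`, so two of them differ by right multiplication with an element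
of the stabiliser of `I`: the roots form a torsor. -/
theorem card_sqrtNegSet (hO : IsMaximalOrder O) (hI : Submodule.IsLattice ℚ I)
    (hIr : I * Subalgebra.toSubmodule O = I) (hne : (sqrtNegSet N I).Nonempty) :
    Nat.card (sqrtNegSet N I) = Nat.card (MulAction.stabilizer Bˣ I) := by
  obtain ⟨b₀, hb₀⟩ := hne
  obtain ⟨b, rfl⟩ := exists_unit_of_mem_sqrtNegSet N hb₀
  have hb := (smul_eq_of_mem_sqrtNegSet N hO hI hIr).1 hb₀
  refine (Nat.card_eq_of_bijective (fun u : MulAction.stabilizer Bˣ I =>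
    (⟨(b * (u : Bˣ) : Bˣ), ?_⟩ : sqrtNegSet N I)) ⟨?_, ?_⟩).symm
  · rw [smul_eq_of_mem_sqrtNegSet N hO hI hIr, mul_smul, u.2, hb]
  · intro u v h
    have h1 : b * (u : Bˣ) = b * (v : Bˣ) := Units.ext (congrArg Subtype.val h)
    exact Subtype.ext (mul_left_cancel h1)
  · rintro ⟨c₀, hc₀⟩
    obtain ⟨c, rfl⟩ := exists_unit_of_mem_sqrtNegSet N hc₀
    have hc := (smul_eq_of_mem_sqrtNegSet N hO hI hIr).1 hc₀
    refine ⟨⟨b⁻¹ * c, ?_⟩, ?_⟩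
    · rw [MulAction.mem_stabilizer_iff, mul_smul, hc, ← hb, inv_smul_smul]
    · ext; simp

/-- Burnside's lemma for conjugation. A stabiliser element fixing a root commutes with it, has norm
1 and integral trace, hence is `±1`; these two fix every root. There are as many roots as group
elements, which leaves two orbits. -/
theorem card_orbits_sqrtNegSet (hO : IsMaximalOrder O) (hI : Submodule.IsLattice ℚ I)
    (hIr : I * Subalgebra.toSubmodule O = I) (hne : (sqrtNegSet N I).Nonempty) :
    Nat.card (MulAction.orbitRel.Quotient (MulAction.stabilizer Bˣ I) (sqrtNegSet N I)) = 2 := by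
  classical
  have hN0 := (Fact.out : N.Prime).ne_zero
  have hO' := isMaximalOrder_leftOrderAlg N hO hI hIr
  have hcard := card_sqrtNegSet N hO hI hIr hne
  have := finite_stabilizer N hO hI hIr
  have : Nonempty (sqrtNegSet N I) := hne.to_subtype
  have hfin : Finite (sqrtNegSet N I) :=
    Nat.finite_of_card_ne_zero (by rw [hcard]; exact Nat.card_pos.ne')
  have := Fintype.ofFinite (MulAction.stabilizer Bˣ I)
  have := Fintype.ofFinite (sqrtNegSet N I)
  have := Fintype.ofFinite
    (Quotient (MulAction.orbitRel (MulAction.stabilizer Bˣ I) (sqrtNegSet N I)))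
  have hB := MulAction.sum_card_fixedBy_eq_card_orbits_mul_card_group
    (MulAction.stabilizer Bˣ I) (sqrtNegSet N I)
  have hm1 : (-1 : Bˣ) ∈ MulAction.stabilizer Bˣ I := by
    rw [MulAction.mem_stabilizer_iff]
    ext x
    rw [mem_unit_smul]
    constructor
    · rintro ⟨y, hy, rfl⟩
      simpa using hy
    · intro hx
      exact ⟨-x, neg_mem hx, by simp⟩
  have hne1 : (1 : MulAction.stabilizer Bˣ I) ≠ ⟨-1, hm1⟩ := by
    intro h
    have h1 : (1 : B) = -1 := by
      have := congrArg (fun u : MulAction.stabilizer Bˣ I => ((u : Bˣ) : B)) h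
      simpa using this
    have h2 := congrArg nrd (show (2 : B) = 0 by
      rw [← one_add_one_eq_two]; nth_rewrite 1 [h1]; abel)
    rw [nrd_eq_zero.2 rfl] at h2
    have := nrd_natCast (B := B) 2
    push_cast at this
    rw [h2] at this
    norm_num at this
  have hfix : ∀ u : MulAction.stabilizer Bˣ I,
      Fintype.card (MulAction.fixedBy (sqrtNegSet N I) u) =
        if u ∈ ({1, ⟨-1, hm1⟩} : Finset (MulAction.stabilizer Bˣ I)) then
          Fintype.card (sqrtNegSet N I) else 0 := by
    intro u
    split_ifs with hu
    · refine Fintype.card_of_subtype Finset.univ ?_ |>.trans Finset.card_univ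
      intro c
      simp only [Finset.mem_univ, true_iff, MulAction.mem_fixedBy]
      simp only [Finset.mem_insert, Finset.mem_singleton] at hu
      rcases hu with rfl | rfl
      · exact one_smul _ _
      · ext
        rw [coe_stabilizer_smul]
        simp
    · rw [Fintype.card_eq_zero_iff]
      refine ⟨fun ⟨c, hc⟩ => hu ?_⟩
      rw [MulAction.mem_fixedBy] at hc
      have h1 : ((u : Bˣ) : B) * c = c * (u : Bˣ) := by
        have := congrArg Subtype.val hc
        rw [coe_stabilizer_smul] at this
        exact (Units.mul_inv_eq_iff_eq_mul _).1 this
      obtain ⟨t, ht⟩ := trd_int hO'.1 (coe_mem_leftOrderAlg u.2)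
      rcases eq_one_or_neg_one_of_commute_sqrt hR.three_lt c.2.1 h1 ht
        (one_of_smul_eq_self_of_nrd hI u.2) with h | h
      · have : u = 1 := Subtype.ext (Units.ext h)
        simp [this]
      · have : u = ⟨-1, hm1⟩ := Subtype.ext (Units.ext (by simpa using h))
        simp [this]
  rw [Finset.sum_congr rfl (fun u _ => hfix u), Finset.sum_ite_mem, Finset.univ_inter,
    Finset.sum_const, Finset.card_pair hne1, ← Nat.card_eq_fintype_card, hcard,
    ← Nat.card_eq_fintype_card, ← Nat.card_eq_fintype_card, smul_eq_mul] at hB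
  exact (Nat.eq_of_mul_eq_mul_right Nat.card_pos hB).symm

end SqrtNegSet

end QuatForm

end

/-! ### Stable ideals lie two-to-one over the fixed classes -/

noncomputable section

namespace QuatForm

theorem card_eq_card_mul_of_fibers {α β : Type*} (f : α → β) {n : ℕ} (hn : n ≠ 0)
    (h : ∀ y, Nat.card {x // f x = y} = n) : Nat.card α = Nat.card β * n := by
  have e : ∀ y, Nonempty ({x // f x = y} ≃ Fin n) := fun y => by
    have hf : Finite {x // f x = y} := Nat.finite_of_card_ne_zero (by rw [h]; exact hn)
    exact ⟨Finite.equivFinOfCardEq (h y)⟩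
  have e := fun y => (e y).some
  rw [Nat.card_congr ((Equiv.sigmaFiberEquiv f).symm.trans
    ((Equiv.sigmaCongrRight e).trans (Equiv.sigmaEquivProd β (Fin n)))), Nat.card_prod,
    Nat.card_fin]

section StableIdeals

variable {B : Type*} [Ring B] [Algebra ℚ B] [DefiniteQuaternion B]

omit [DefiniteQuaternion B] in
theorem isLattice_unit_smul {I : Submodule ℤ B} (hI : Submodule.IsLattice ℚ I) (c : Bˣ) :
    Submodule.IsLattice ℚ (c • I) := by
  refine ⟨hI.fg.map _, ?_⟩
  have h1 : ((c • I : Submodule ℤ B) : Set B) = LinearMap.mulLeft ℚ (c : B) '' (I : Set B) := rfl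
  rw [h1, ← Submodule.map_span, hI.span_eq_top, Submodule.map_top, LinearMap.range_eq_top]
  intro x
  exact ⟨(c⁻¹ : Bˣ) * x, by simp⟩

variable (N : ℕ) [Fact N.Prime] [hR : RamifiedOnlyAt B N] {O : Subalgebra ℤ B}

/-- The ideal `c I`. -/
def smulIdeal (hO : IsMaximalOrder O) (c : Bˣ) (I : InvRightIdeal O) : InvRightIdeal O :=
  rightIdealOf N hO (c • I.carrier) (isLattice_unit_smul I.isLattice c)
    (by rw [unit_smul_mul, I.mul_order])

variable (O) in
/-- The right ideals stable under left multiplication by `b`. -/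
def StableIdeal (b : B) : Type _ := {I : InvRightIdeal O // ∀ x ∈ I.carrier, b * x ∈ I.carrier}

/-- Two `b`-stable ideals are equivalent if they differ by an element commuting with `b`. -/
instance stableSetoid (b : B) : Setoid (StableIdeal O b) where
  r I I' := ∃ c : Bˣ, (c : B) * b = b * c ∧ I'.1.carrier = c • I.1.carrier
  iseqv :=
    { refl := fun I => ⟨1, by simp, (one_smul _ _).symm⟩
      symm := by
        rintro I I' ⟨c, hc, h⟩
        exact ⟨c⁻¹, (Commute.units_inv_left (show Commute (c : B) b from hc)).eq,
          by rw [h, inv_smul_smul]⟩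
      trans := by
        rintro I I' I'' ⟨c, hc, h⟩ ⟨d, hd, h'⟩
        exact ⟨d * c, by rw [Units.val_mul, mul_assoc, hc, ← mul_assoc, hd, mul_assoc],
          by rw [h', h, mul_smul]⟩ }

/-- The class is fixed when `I = c I P` for a unit `c`, and then `c⁻¹` is the square root of `-N`.
-/
theorem mul_radIdeal_eq_iff (hO : IsMaximalOrder O) (I : InvRightIdeal O) :
    Cl.mul (Quotient.mk _ I) (radIdeal N hO) = (Quotient.mk _ I : Cl O) ↔
      (sqrtNegSet N I.carrier).Nonempty := by
  have e : Cl.mul (Quotient.mk _ I) (radIdeal N hO) = (Quotient.mk _ I : Cl O) ↔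
      ∃ c : Bˣ, I.carrier = c • (I.carrier * radPow O N 1) := Quotient.eq
  rw [e]
  constructor
  · rintro ⟨c, hc⟩
    refine ⟨((c⁻¹ : Bˣ) : B), ?_⟩
    rw [smul_eq_of_mem_sqrtNegSet N hO I.isLattice I.mul_order, inv_smul_eq_iff]
    exact hc
  · rintro ⟨c₀, hc₀⟩
    obtain ⟨c, rfl⟩ := exists_unit_of_mem_sqrtNegSet N hc₀
    rw [smul_eq_of_mem_sqrtNegSet N hO I.isLattice I.mul_order] at hc₀
    exact ⟨c⁻¹, by rw [← hc₀, inv_smul_smul]⟩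

variable {b : B}

/-- The class of a stable ideal, which is fixed by the radical. -/
def stableToFixed (hO : IsMaximalOrder O) (hb : b * b = -(N : B)) :
    Quotient (stableSetoid (O := O) b) → {x : Cl O // x.mul (radIdeal N hO) = x} :=
  Quotient.lift (fun I => ⟨Quotient.mk _ I.1,
    (mul_radIdeal_eq_iff N hO I.1).2 ⟨b, hb, I.2⟩⟩) (by
    rintro I I' ⟨c, -, h⟩
    exact Subtype.ext (Quotient.sound ⟨c, h⟩))

omit [Fact N.Prime] hR in
theorem mul_mem_smul_of_conj {I : Submodule ℤ B} {c : B} (hc : c ∈ sqrtNegSet N I) {g : Bˣ}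
    (hg : (g : B) * c = b * g) : ∀ x ∈ g • I, b * x ∈ g • I := by
  rintro _ ⟨y, hy, rfl⟩
  exact mem_unit_smul.2 ⟨c * y, hc.2 y hy, by
    change (g : B) * (c * y) = b * (g * y)
    rw [← mul_assoc, hg, mul_assoc]⟩

/-- The fibre over the class of `I` corresponds to the orbits of the stabiliser on the square roots
of `-N` in the left order: a root `c` is conjugated to `b` by some `g`, and `g I` is then
`b`-stable. -/
theorem card_fiber_stableToFixed (hO : IsMaximalOrder O) (hb : b * b = -(N : B))
    (x : {x : Cl O // x.mul (radIdeal N hO) = x}) :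
    Nat.card {q // stableToFixed N hO hb q = x} = 2 := by
  have hN0 := (Fact.out : N.Prime).ne_zero
  obtain ⟨x, hx⟩ := x
  induction x using Quotient.inductionOn with | _ I
  have hne := (mul_radIdeal_eq_iff N hO I).1 hx
  rw [← card_orbits_sqrtNegSet N hO I.isLattice I.mul_order hne]
  choose g hg using fun c : sqrtNegSet N I.carrier => exists_conj_eq hN0 hb c.2.1
  let φ : sqrtNegSet N I.carrier → {q // stableToFixed N hO hb q = ⟨Quotient.mk _ I, hx⟩} := fun c =>
    ⟨Quotient.mk _ ⟨smulIdeal N hO (g c) I, mul_mem_smul_of_conj N c.2 (hg c)⟩,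
      Subtype.ext (Quotient.sound (Setoid.symm (show classSetoid O I _ from ⟨g c, rfl⟩)))⟩
  have hconj : ∀ c : sqrtNegSet N I.carrier,
      (c : B) = ((g c)⁻¹ : Bˣ) * (b * (g c)) := fun c => by
    rw [← hg c, Units.inv_mul_cancel_left]
  have hφ : ∀ c c', φ c = φ c' ↔ MulAction.orbitRel (MulAction.stabilizer Bˣ I.carrier) _ c c' := by
    intro c c'
    have e : φ c = φ c' ↔ ∃ z : Bˣ, (z : B) * b = b * z ∧
        g c' • I.carrier = z • g c • I.carrier := by
      rw [Subtype.ext_iff]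
      exact Quotient.eq
    rw [e, ← Setoid.comm', MulAction.orbitRel_apply]
    constructor
    · rintro ⟨z, hz, h⟩
      -- An equivalence `z` commutes with `b`; transported back by the two conjugators it becomes an
      -- automorphism of `I` carrying `c` to `c'`.
      refine ⟨⟨(g c')⁻¹ * (z * g c), ?_⟩, ?_⟩
      · rw [MulAction.mem_stabilizer_iff, mul_smul, mul_smul, ← h, inv_smul_smul]
      · apply Subtype.ext
        change (((g c')⁻¹ * (z * g c) : Bˣ) : B) * c * (((g c')⁻¹ * (z * g c))⁻¹ : Bˣ) = c'
        rw [Units.mul_inv_eq_iff_eq_mul, hconj c']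
        simp only [Units.val_mul, mul_assoc, Units.mul_inv_cancel_left, hg c]
        rw [← mul_assoc (z : B), hz, mul_assoc]
    · rintro ⟨u, rfl⟩
      have hu : (u : Bˣ) • I.carrier = I.carrier := u.2
      have hu' : (u : Bˣ)⁻¹ • I.carrier = I.carrier := by rw [inv_smul_eq_iff, hu]
      set c'' := u • c with hc''
      have h1 : (c'' : B) * (u : Bˣ) = (u : Bˣ) * c := by
        rw [hc'', coe_stabilizer_smul, Units.inv_mul_cancel_right]
      refine ⟨g c'' * (u : Bˣ) * (g c)⁻¹, ?_, ?_⟩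
      · have h2 : ((g c)⁻¹ : Bˣ) * b = c * ((g c)⁻¹ : Bˣ) := by
          rw [Units.eq_mul_inv_iff_mul_eq, mul_assoc]
          exact (hconj c).symm
        simp only [Units.val_mul, mul_assoc]
        rw [h2, ← mul_assoc ((u : Bˣ) : B), ← h1, ← mul_assoc, ← mul_assoc, hg c'']
        simp only [mul_assoc]
      · rw [mul_smul, mul_smul, inv_smul_smul, hu]
  have hsurj : Function.Surjective φ := by
    rintro ⟨q, hq⟩
    induction q using Quotient.inductionOn with | _ J
    obtain ⟨d, hd⟩ : ∃ d : Bˣ, I.carrier = d • J.1.carrier :=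
      Quotient.exact (congrArg Subtype.val hq)
    have hJ : J.1.carrier = d⁻¹ • I.carrier := by rw [hd, inv_smul_smul]
    have hc : (d : B) * b * ((d⁻¹ : Bˣ) : B) ∈ sqrtNegSet N I.carrier := by
      constructor
      · simp only [mul_assoc, Units.inv_mul_cancel_left]
        rw [← mul_assoc b, hb, neg_mul, mul_neg, ← mul_assoc, ← Nat.cast_comm, mul_assoc, Units.mul_inv,
          mul_one]
      · intro y hy
        rw [hd] at hy ⊢
        obtain ⟨w, hw, rfl⟩ := mem_unit_smul.1 hy
        exact mem_unit_smul.2 ⟨b * w, J.2 w hw, by simp only [mul_assoc, Units.inv_mul_cancel_left]⟩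
    refine ⟨⟨_, hc⟩, Subtype.ext (Quotient.sound ?_)⟩
    set c : sqrtNegSet N I.carrier := ⟨_, hc⟩ with hcdef
    refine ⟨d⁻¹ * (g c)⁻¹, ?_, ?_⟩
    · have h2 : ((g c)⁻¹ : Bˣ) * b = c * ((g c)⁻¹ : Bˣ) := by
        rw [Units.eq_mul_inv_iff_mul_eq, mul_assoc]
        exact (hconj c).symm
      rw [Units.val_mul, mul_assoc, h2, hcdef]
      simp only [mul_assoc, Units.inv_mul_cancel_left]
    · change J.1.carrier = (d⁻¹ * (g c)⁻¹) • (g c • I.carrier)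
      rw [mul_smul, inv_smul_smul, hJ]
  have e1 : Setoid.ker φ = MulAction.orbitRel (MulAction.stabilizer Bˣ I.carrier) _ :=
    Setoid.ext hφ
  rw [Nat.card_congr (Setoid.quotientKerEquivOfSurjective φ hsurj).symm, e1]

theorem card_stable_eq (hO : IsMaximalOrder O) (hb : b * b = -(N : B)) :
    Nat.card (Quotient (stableSetoid (O := O) b)) =
      Nat.card {x : Cl O // x.mul (radIdeal N hO) = x} * 2 :=
  card_eq_card_mul_of_fibers (stableToFixed N hO hb) two_ne_zero (card_fiber_stableToFixed N hO hb)

end StableIdeals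

end QuatForm

end

/-! ### The quadratic field inside `B` and lattices from its fractional ideals -/

noncomputable section

namespace QuatForm

section QuadraticField

variable {K : Type*} [Field K] [NumberField K]

/-- A quadratic field generated by a square root of `-N` maps to every algebra with such a root. -/
theorem exists_lift_sqrt (hK2 : Module.finrank ℚ K = 2) {N : ℕ} (hN : N ≠ 0) {a : K}
    (ha : a ^ 2 = -(N : K)) {A : Type*} [Ring A] [Algebra ℚ A] {β : A} (hβ : β * β = -(N : A)) :
    ∃ f : K →ₐ[ℚ] A, f a = β := by
  have hli : LinearIndependent ℚ ![(1 : K), a] := by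
    rw [LinearIndependent.pair_iff]
    intro s t hst
    have ht : t = 0 := by
      by_contra ht
      have h1 : a = algebraMap ℚ K (-s / t) := by
        have h2 : a = t⁻¹ • (t • a) := by rw [smul_smul, inv_mul_cancel₀ ht, one_smul]
        rw [h2, eq_neg_of_add_eq_zero_right hst, Algebra.algebraMap_eq_smul_one, smul_neg, smul_smul,
          ← neg_smul]
        congr 1
        field_simp
      have h3 : (-s / t) ^ 2 = -(N : ℚ) := by
        apply (algebraMap ℚ K).injective
        rw [map_pow, ← h1, ha, map_neg, map_natCast]
      have h4 : (0 : ℚ) < N := by exact_mod_cast Nat.pos_of_ne_zero hN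
      nlinarith [sq_nonneg (-s / t)]
    refine ⟨?_, ht⟩
    rw [ht, zero_smul, add_zero, smul_eq_zero] at hst
    exact hst.resolve_right one_ne_zero
  let bs := basisOfLinearIndependentOfCardEqFinrank hli (by simp [hK2])
  have hb0 : bs 0 = 1 := by simp [bs]
  have hb1 : bs 1 = a := by simp [bs]
  let f := bs.constr ℚ ![(1 : A), β]
  have hf0 : f 1 = 1 := by rw [← hb0]; simp [f, Module.Basis.constr_basis]
  have hf1 : f a = β := by rw [← hb1]; simp [f, Module.Basis.constr_basis]
  have hdec : ∀ x : K, ∃ r s : ℚ, x = r • 1 + s • a := fun x => by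
    refine ⟨bs.repr x 0, bs.repr x 1, ?_⟩
    conv_lhs => rw [← bs.sum_repr x]
    rw [Fin.sum_univ_two, hb0, hb1]
  refine ⟨AlgHom.ofLinearMap f hf0 fun x y => ?_, hf1⟩
  obtain ⟨r, s, rfl⟩ := hdec x
  obtain ⟨r', s', rfl⟩ := hdec y
  have e1 : (r • (1 : K) + s • a) * (r' • 1 + s' • a) =
      (r * r' - N * (s * s')) • 1 + (r * s' + s * r') • a := by
    simp only [Algebra.smul_def, map_sub, map_mul, map_add, map_natCast]
    linear_combination (algebraMap ℚ K s * algebraMap ℚ K s') * ha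
  have hNβ : ∀ t : ℚ, t • (β * β) = -((N * t) • (1 : A)) := fun t => by
    rw [hβ, smul_neg, mul_comm, mul_smul, Nat.cast_smul_eq_nsmul, nsmul_eq_mul, mul_one]
  rw [e1]
  simp only [map_add, map_smul, hf0, hf1, add_mul, mul_add, smul_mul_smul_comm, one_mul, mul_one, hNβ]
  module

end QuadraticField

section FractionalIdealImage

open scoped NumberField nonZeroDivisors

variable {B : Type*} [Ring B] [Algebra ℚ B] {K : Type*} [Field K] [NumberField K] (ι : K →ₐ[ℚ] B)

/-- The image of a fractional ideal under an embedding of fields. -/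
def fracImage (𝔞 : FractionalIdeal (𝓞 K)⁰ K) : Submodule ℤ B where
  carrier := {x | ∃ k ∈ 𝔞, ι k = x}
  add_mem' := by
    rintro _ _ ⟨k, hk, rfl⟩ ⟨l, hl, rfl⟩
    exact ⟨k + l, (𝔞 : Submodule (𝓞 K) K).add_mem hk hl, map_add _ _ _⟩
  zero_mem' := ⟨0, (𝔞 : Submodule (𝓞 K) K).zero_mem, map_zero _⟩
  smul_mem' := by
    rintro n _ ⟨k, hk, rfl⟩
    exact ⟨n • k, zsmul_mem (S := Submodule (𝓞 K) K) hk n, map_zsmul _ _ _⟩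

variable {ι} {𝔞 𝔟 : FractionalIdeal (𝓞 K)⁰ K}

theorem apply_mem_fracImage {k : K} (hk : k ∈ 𝔞) : ι k ∈ fracImage ι 𝔞 := ⟨k, hk, rfl⟩

theorem apply_mem_fracImage_one [Nontrivial B] {k : K} :
    ι k ∈ fracImage ι (1 : FractionalIdeal (𝓞 K)⁰ K) ↔ IsIntegral ℤ k := by
  constructor
  · rintro ⟨l, hl, h⟩
    obtain ⟨z, rfl⟩ := (FractionalIdeal.mem_one_iff _).1 hl
    rw [← (ι : K →+* B).injective h]
    exact z.isIntegral_coe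
  · intro hk
    exact apply_mem_fracImage ((FractionalIdeal.mem_one_iff _).2 ⟨⟨k, hk⟩, rfl⟩)

theorem one_mem_fracImage_one : (1 : B) ∈ fracImage ι (1 : FractionalIdeal (𝓞 K)⁰ K) :=
  ⟨1, FractionalIdeal.one_mem_one _, map_one _⟩

theorem fracImage_mul : fracImage ι (𝔞 * 𝔟) = fracImage ι 𝔞 * fracImage ι 𝔟 := by
  apply le_antisymm
  · rintro _ ⟨k, hk, rfl⟩
    refine FractionalIdeal.mul_induction_on hk (fun i hi j hj => ?_) fun x y hx hy => ?_
    · rw [map_mul]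
      exact Submodule.mul_mem_mul ⟨i, hi, rfl⟩ ⟨j, hj, rfl⟩
    · rw [map_add]
      exact add_mem hx hy
  · refine Submodule.mul_le.2 ?_
    rintro _ ⟨k, hk, rfl⟩ _ ⟨l, hl, rfl⟩
    exact ⟨k * l, FractionalIdeal.mul_mem_mul hk hl, map_mul _ _ _⟩

theorem fg_fracImage : (fracImage ι 𝔞).FG := by
  have h1 : IsNoetherian (𝓞 K) 𝔞 := FractionalIdeal.isNoetherian 𝔞
  have h2 : Module.Finite ℤ (𝔞 : Submodule (𝓞 K) K) := Module.Finite.trans (𝓞 K) _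
  let f : (𝔞 : Submodule (𝓞 K) K) →ₗ[ℤ] B :=
    ((ι : K →+* B).toAddMonoidHom.comp (𝔞 : Submodule (𝓞 K) K).subtype.toAddMonoidHom).toIntLinearMap
  have h3 : fracImage ι 𝔞 = LinearMap.range f := by
    ext x
    constructor
    · rintro ⟨k, hk, rfl⟩
      exact ⟨⟨k, hk⟩, rfl⟩
    · rintro ⟨⟨k, hk⟩, rfl⟩
      exact ⟨k, hk, rfl⟩
  rw [h3]
  exact Module.Finite.iff_fg.1 (Module.Finite.range f)

theorem fracImage_mul_mul (J : Submodule ℤ B) :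
    fracImage ι 𝔞 * (fracImage ι 𝔟 * J) = fracImage ι (𝔞 * 𝔟) * J := by
  rw [fracImage_mul, mul_assoc]

theorem le_fracImage_one_mul (J : Submodule ℤ B) : J ≤ fracImage ι (1 : FractionalIdeal (𝓞 K)⁰ K) * J :=
  fun x hx => by
    rw [← one_mul x]; exact Submodule.mul_mem_mul one_mem_fracImage_one hx

variable [DefiniteQuaternion B]

theorem fracImage_spanSingleton {k : K} {c : Bˣ} (hc : (c : B) = ι k) :
    fracImage ι (FractionalIdeal.spanSingleton (𝓞 K)⁰ k) = c • fracImage ι 1 := by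
  ext x
  rw [mem_unit_smul, hc]
  constructor
  · rintro ⟨l, hl, rfl⟩
    obtain ⟨z, rfl⟩ := (FractionalIdeal.mem_spanSingleton _).1 hl
    refine ⟨_, apply_mem_fracImage ((FractionalIdeal.mem_one_iff _).2 ⟨z, rfl⟩), ?_⟩
    rw [← map_mul, Algebra.smul_def, mul_comm]
  · rintro ⟨_, ⟨l, hl, rfl⟩, rfl⟩
    obtain ⟨z, rfl⟩ := (FractionalIdeal.mem_one_iff _).1 hl
    exact ⟨_, (FractionalIdeal.mem_spanSingleton _).2 ⟨z, rfl⟩, by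
      rw [← map_mul, Algebra.smul_def, mul_comm]⟩

theorem isLattice_fracImage_mul (h𝔞 : 𝔞 ≠ 0) {J : Submodule ℤ B} (hJ : Submodule.IsLattice ℚ J) :
    Submodule.IsLattice ℚ (fracImage ι 𝔞 * J) := by
  refine ⟨fg_fracImage.mul hJ.fg, ?_⟩
  obtain ⟨k, hk, hk0⟩ : ∃ k ∈ 𝔞, k ≠ 0 := by
    by_contra! h
    exact h𝔞 (FractionalIdeal.eq_zero_iff.2 h)
  have hc : ι k ≠ 0 := (map_ne_zero_iff _ (ι : K →+* B).injective).2 hk0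
  have h1 := (isLattice_unit_smul hJ (qunit _ hc)).span_eq_top
  refine eq_top_iff.2 (h1 ▸ Submodule.span_mono ?_)
  rintro _ ⟨y, hy, rfl⟩
  exact Submodule.mul_mem_mul (apply_mem_fracImage hk) hy

/-- A fractional ideal preserving a lattice is trivial. -/
theorem eq_one_of_fracImage_mul_eq {J : Submodule ℤ B} (hJ : Submodule.IsLattice ℚ J)
    (𝔞 : (FractionalIdeal (𝓞 K)⁰ K)ˣ) (hJ1 : fracImage ι (1 : FractionalIdeal (𝓞 K)⁰ K) * J = J)
    (h : fracImage ι (𝔞 : FractionalIdeal (𝓞 K)⁰ K) * J = J) : 𝔞 = 1 := by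
  -- An element of `𝔠` lies in the left order of `J`, so its trace and norm make it integral.
  -- Applied to `𝔞` and `𝔞⁻¹` this leaves only the unit ideal.
  have key : ∀ 𝔠 : FractionalIdeal (𝓞 K)⁰ K, fracImage ι 𝔠 * J = J → 𝔠 ≤ 1 := by
    intro 𝔠 h𝔠 k hk
    have hmem : ι k ∈ leftOrderAlg J := fun x hx => by
      rw [← h𝔠]; exact Submodule.mul_mem_mul (apply_mem_fracImage hk) hx
    obtain ⟨t, ht⟩ := trd_int (isOrder_leftOrderAlg hJ) hmem
    obtain ⟨n, hn⟩ := nrd_int (isOrder_leftOrderAlg hJ) hmem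
    have h1 := mul_self_eq (ι k)
    rw [ht, hn, map_intCast, map_intCast] at h1
    have h2 : k * k - t * k + n = 0 := by
      apply (ι : K →+* B).injective
      simp only [map_add, map_sub, map_mul, map_intCast, map_zero, RingHom.coe_coe]
      rw [h1]; abel
    have h3 : IsIntegral ℤ k := by
      refine ⟨Polynomial.X ^ 2 + (Polynomial.C (-t) * Polynomial.X + Polynomial.C n), ?_, ?_⟩
      · exact Polynomial.monic_X_pow_add (by
          refine lt_of_le_of_lt (Polynomial.degree_linear_le) (by norm_num))
      · simp only [Polynomial.eval₂_add, Polynomial.eval₂_mul, Polynomial.eval₂_pow,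
          Polynomial.eval₂_X, Polynomial.eval₂_C]
        simp only [algebraMap_int_eq, eq_intCast]
        push_cast
        linear_combination h2
    exact (FractionalIdeal.mem_one_iff _).2 ⟨⟨k, h3⟩, rfl⟩
  have h2 := key _ h
  have h3 : fracImage ι ((𝔞⁻¹ : (FractionalIdeal (𝓞 K)⁰ K)ˣ) : FractionalIdeal (𝓞 K)⁰ K) * J = J := by
    conv_lhs => rw [← h]
    rw [fracImage_mul_mul, Units.inv_mul, hJ1]
  have h4 := key _ h3
  apply Units.ext
  refine le_antisymm h2 ?_
  calc ((1 : (FractionalIdeal (𝓞 K)⁰ K)ˣ) : FractionalIdeal (𝓞 K)⁰ K)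
      = 𝔞 * (𝔞⁻¹ : (FractionalIdeal (𝓞 K)⁰ K)ˣ) := (Units.mul_inv 𝔞).symm
    _ ≤ 𝔞 * 1 := mul_le_mul' le_rfl h4
    _ = 𝔞 := mul_one _

end FractionalIdealImage

end QuatForm

end

/-! ### Enlarging a proper `O_K`-stable right lattice -/

noncomputable section

namespace QuatForm

section ProperRightIdeal

variable {F : Type*} [Field F]

/-- The columns of the elements of a proper right ideal of `M₂(F)` are proportional. -/
theorem mul_eq_mul_of_mem_right_ideal {r : AddSubgroup (Matrix (Fin 2) (Fin 2) F)}
    (hr : ∀ x ∈ r, ∀ y, x * y ∈ r) (h1 : (1 : Matrix (Fin 2) (Fin 2) F) ∉ r) :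
    ∀ x ∈ r, ∀ y ∈ r, ∀ i j, x 0 i * y 1 j = x 1 i * y 0 j := by
  intro x hx y hy i j
  by_contra hne
  -- `z` has column `i` of `x` and column `j` of `y`; were they independent, `z` would be invertible
  -- and the right ideal would contain 1.
  set z := x * (Matrix.single i 0 1 : Matrix (Fin 2) (Fin 2) F) +
    y * (Matrix.single j 1 1 : Matrix (Fin 2) (Fin 2) F) with hz
  have hzr : z ∈ r := add_mem (hr x hx _) (hr y hy _)
  have hdet : z.det = x 0 i * y 1 j - x 1 i * y 0 j := by
    have e : z = !![x 0 i, y 0 j; x 1 i, y 1 j] := by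
      ext k l
      fin_cases k <;> fin_cases l <;> simp [hz, Matrix.mul_apply, Matrix.single_apply]
    rw [e, Matrix.det_fin_two_of]; ring
  have hu : IsUnit z.det := by rw [hdet]; exact (sub_ne_zero.2 hne).isUnit
  apply h1
  rw [← Matrix.mul_nonsing_inv z hu]
  exact hr z hzr _

/-- A matrix preserving a proper right ideal of `M₂(F)` acts on it as a scalar. -/
theorem exists_scalar_of_mul_mem {r : AddSubgroup (Matrix (Fin 2) (Fin 2) F)}
    (hr : ∀ x ∈ r, ∀ y, x * y ∈ r) (h1 : (1 : Matrix (Fin 2) (Fin 2) F) ∉ r)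
    {M : Matrix (Fin 2) (Fin 2) F} (hM : ∀ x ∈ r, M * x ∈ r) : ∃ l : F, ∀ x ∈ r, M * x = l • x := by
  have hcol := mul_eq_mul_of_mem_right_ideal hr h1
  by_cases h0 : ∀ x ∈ r, x = 0
  · exact ⟨0, fun x hx => by rw [h0 x hx]; simp⟩
  push Not at h0
  obtain ⟨x, hx, hx0⟩ := h0
  obtain ⟨k, i, hki⟩ : ∃ k i, x k i ≠ 0 := by
    by_contra! h
    exact hx0 (by ext k i; exact h k i)
  have E2 := hcol x hx _ (hM x hx) i i
  simp only [Matrix.mul_apply, Fin.sum_univ_two] at E2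
  refine ⟨(M * x) k i / x k i, fun y hy => ?_⟩
  ext l j
  have E1 := hcol x hx y hy i j
  simp only [Matrix.mul_apply, Fin.sum_univ_two, Matrix.smul_apply, smul_eq_mul]
  fin_cases k
  · simp only [Fin.zero_eta, Fin.isValue] at hki ⊢
    have e : y 1 j = x 1 i / x 0 i * y 0 j := by field_simp; linear_combination E1
    fin_cases l <;> simp only [Fin.zero_eta, Fin.mk_one, Fin.isValue] <;> rw [e] <;> field_simp
    linear_combination y 0 j * E2
  · simp only [Fin.mk_one, Fin.isValue] at hki ⊢
    have e : y 0 j = x 0 i / x 1 i * y 1 j := by field_simp; linear_combination -E1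
    fin_cases l <;> simp only [Fin.zero_eta, Fin.mk_one, Fin.isValue] <;> rw [e] <;> field_simp
    linear_combination -y 1 j * E2

end ProperRightIdeal

section Transitivity

open scoped NumberField nonZeroDivisors

variable {B : Type*} [Ring B] [Algebra ℚ B] [DefiniteQuaternion B] {K : Type*} [Field K] [NumberField K]
  {ι : K →ₐ[ℚ] B} {a : K}

omit [NumberField K] in
theorem isIntegral_of_sq {k : K} {t n : ℤ} (h : k * k = t * k - n) : IsIntegral ℤ k := by
  refine ⟨Polynomial.X ^ 2 + (Polynomial.C (-t) * Polynomial.X + Polynomial.C n), ?_, ?_⟩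
  · exact Polynomial.monic_X_pow_add (by
      refine lt_of_le_of_lt (Polynomial.degree_linear_le) (by norm_num))
  · simp only [Polynomial.eval₂_add, Polynomial.eval₂_mul, Polynomial.eval₂_pow,
      Polynomial.eval₂_X, Polynomial.eval₂_C]
    simp only [algebraMap_int_eq, eq_intCast]
    push_cast
    linear_combination h

variable (N : ℕ)

omit [DefiniteQuaternion B] in
theorem apply_mul_self_of_sq (ha : a ^ 2 = -(N : K)) : ι a * ι a = -(N : B) := by
  rw [← map_mul, ← sq, ha, map_neg, map_natCast]

/-- The element `(1 + √-N) / 2`. -/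
def halfSqrt (a : K) : K := (1 + a) / 2

theorem halfSqrt_mul_self (ha : a ^ 2 = -(N : K)) {n : ℤ} (hn : 4 * n = N + 1) :
    halfSqrt a * halfSqrt a = (1 : ℤ) * halfSqrt a - n := by
  have h1 : (4 : K) * n = N + 1 := by exact_mod_cast congrArg (Int.cast : ℤ → K) hn
  rw [halfSqrt]
  field_simp
  push_cast
  linear_combination ha + h1

omit [DefiniteQuaternion B] in
theorem apply_halfSqrt : ι (halfSqrt a) = algebraMap ℚ B (1 / 2) + (1 / 2 : ℚ) • ι a := by
  rw [← AlgHom.commutes ι, ← map_smul, ← map_add]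
  congr 1
  rw [halfSqrt, Algebra.smul_def]
  simp
  ring

/-- The last condition says that the discriminant of `θ` cannot lose a factor `p²` for `p ≠ N`, so
no `(θ - m) / p` is integral. It is phrased through trace and norm since these are what membership
in an order controls. The generator is `√-N` or `(1 + √-N) / 2` according to `N` modulo 4. -/
theorem exists_integral_generator [hNp : Fact N.Prime] (hN3 : 3 < N) (ha : a ^ 2 = -(N : K)) :
    ∃ θ : K, IsIntegral ℤ θ ∧ ∃ t n : ℤ, trd (ι θ) = t ∧ nrd (ι θ) = n ∧
      ∀ p : ℕ, p.Prime → p ≠ N → ∀ u v : ℤ, (4 * v - u ^ 2) * p ^ 2 ≠ 4 * n - t ^ 2 := by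
  have hN0 : N ≠ 0 := by omega
  have hb := apply_mul_self_of_sq (ι := ι) N ha
  have hodd : N % 2 = 1 := hNp.out.eq_two_or_odd.resolve_left (by omega)
  have h2 : N % 4 = 1 ∨ N % 4 = 3 := by omega
  have hpN : ∀ p : ℕ, p.Prime → p ≠ N → ¬ p ∣ N := fun p hp hne h =>
    hne ((Nat.prime_dvd_prime_iff_eq hp hNp.out).1 h)
  rcases h2 with h2 | h2
  · refine ⟨a, isIntegral_of_sq (t := 0) (n := N) (by push_cast; linear_combination ha), 0, N,
      by rw [trd_of_mul_self_eq_neg hN0 hb]; simp, by rw [nrd_of_mul_self_eq_neg hb]; simp, ?_⟩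
    intro p hp hpN' u v h
    have hd : p ∣ 4 * N := by
      have : (p : ℤ) ∣ ((4 * N : ℕ) : ℤ) := ⟨(4 * v - u ^ 2) * p, by push_cast; linarith⟩
      exact_mod_cast this
    have hp2 : p = 2 := by
      rcases (Nat.Prime.dvd_mul hp).1 hd with h3 | h3
      · have : p ∣ 2 ^ 2 := h3
        exact (Nat.prime_dvd_prime_iff_eq hp Nat.prime_two).1 (hp.dvd_of_dvd_pow this)
      · exact absurd h3 (hpN p hp hpN')
    subst hp2
    have h4 : 4 * v - u ^ 2 = N := by push_cast at h; linarith
    have h5 : u % 4 = 0 ∨ u % 4 = 1 ∨ u % 4 = 2 ∨ u % 4 = 3 := by omega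
    have h6 : u ^ 2 % 4 = 0 ∨ u ^ 2 % 4 = 1 := by
      rcases h5 with h5 | h5 | h5 | h5 <;> simp [sq, Int.mul_emod, h5]
    omega
  · obtain ⟨n, hn⟩ : ∃ n : ℤ, 4 * n = N + 1 := ⟨(N + 1) / 4, by omega⟩
    refine ⟨halfSqrt a, isIntegral_of_sq (halfSqrt_mul_self N ha hn), 1, n, ?_, ?_, ?_⟩
    · rw [apply_halfSqrt, trd_add_smul hN0 hb]; norm_num
    · rw [apply_halfSqrt, nrd_add_smul hN0 hb]
      have : (4 : ℚ) * n = N + 1 := by exact_mod_cast hn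
      linarith
    · intro p hp hpN' u v h
      apply hpN p hp hpN'
      have : (p : ℤ) ∣ (N : ℤ) := ⟨(4 * v - u ^ 2) * p, by linarith⟩
      exact_mod_cast this

variable {N} [hNp : Fact N.Prime] [hR : RamifiedOnlyAt B N] {O : Subalgebra ℤ B}

/-- A proper sublattice stable under the ring of integers can be enlarged by an element of the
field. -/
theorem exists_enlarging (hO : IsMaximalOrder O) (ha : a ^ 2 = -(N : K))
    (hS : fracImage ι (1 : FractionalIdeal (𝓞 K)⁰ K) ≤ Subalgebra.toSubmodule O)
    {J : Submodule ℤ B} (hJ : Submodule.IsLattice ℚ J) (hJO : J * Subalgebra.toSubmodule O = J)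
    (hSJ : fracImage ι (1 : FractionalIdeal (𝓞 K)⁰ K) * J = J) (hle : J ≤ Subalgebra.toSubmodule O)
    (hne : J ≠ Subalgebra.toSubmodule O) :
    ∃ k : K, (∀ x ∈ J, ι k * x ∈ O) ∧ ι k ∉ leftOrderAlg J := by
  have hN0 := hNp.out.ne_zero
  have hmul : ∀ x ∈ J, ∀ y ∈ O, x * y ∈ J := fun x hx y hy => by
    rw [← hJO]; exact Submodule.mul_mem_mul hx hy
  have hSmul : ∀ k : K, IsIntegral ℤ k → ∀ x ∈ J, ι k * x ∈ J := fun k hk x hx => by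
    rw [← hSJ]; exact Submodule.mul_mem_mul (apply_mem_fracImage_one.2 hk) hx
  have hb := apply_mul_self_of_sq (ι := ι) N ha
  -- If `J + pO` contained 1 for every prime `p`, then `J` would surject onto every `O / pO` and
  -- equal `O`.
  obtain ⟨p, hp, hpJ⟩ : ∃ p : ℕ, p.Prime ∧ ¬ ∃ t ∈ J, ∃ y ∈ O, (1 : B) = t + (p : ℤ) • y := by
    by_contra! hall
    obtain ⟨m, hm, hmJ⟩ := exists_zsmul_le hJ hO.1.fg
    refine hne (eq_of_forall_prime hle hm hmJ fun p hp _ x hx => ?_)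
    obtain ⟨t, ht, y, hy, h1⟩ := hall p hp
    refine ⟨t * x, hmul t ht x hx, y * x, O.mul_mem hy hx, ?_⟩
    rw [← smul_mul_assoc, ← add_mul, ← h1, one_mul]
  -- At `p = N` an element of `J` of norm prime to `N` would put 1 in `J + N O`, so `J` lies in the
  -- prime above `N`. That prime is generated by `ι a`, and `a⁻¹` enlarges `J`.
  by_cases hpN : p = N
  · subst hpN
    have hbO : ι a ∈ O := hS (apply_mem_fracImage_one.2
      (isIntegral_of_sq (t := 0) (n := p) (by push_cast; linear_combination ha)))
    set c := qunit (ι a) (ne_zero_of_mul_self_eq_neg hN0 hb) with hc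
    have hP := radPow_one_eq_smul p hO (c := c) hb hbO
    have hcinv : ι a⁻¹ = ((c⁻¹ : Bˣ) : B) := by
      rw [← Units.mul_eq_one_iff_eq_inv]
      change ι a⁻¹ * ι a = 1
      rw [← map_mul, inv_mul_cancel₀, map_one]
      rintro rfl
      rw [map_zero] at hb
      exact ne_zero_of_mul_self_eq_neg hN0 hb rfl
    refine ⟨a⁻¹, fun x hx => ?_, fun hmem => ?_⟩
    · have hxP : x ∈ radPow O p 1 := by
        obtain ⟨n, hn⟩ := nrd_int hO.1 (hle hx)
        rw [mem_radPow_one_iff_dvd p (hle hx) hn]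
        by_contra hd
        obtain ⟨u, v, huv⟩ : IsCoprime n (p : ℤ) :=
          ((Nat.prime_iff_prime_int.1 hp).coprime_iff_not_dvd.2 hd).symm
        refine hpJ ⟨x * (u • qconj x), hmul x hx _ (O.toSubmodule.smul_mem u (qconj_mem hO.1 (hle hx))),
          v • 1, O.toSubmodule.smul_mem v O.one_mem, ?_⟩
        rw [mul_smul_comm, mul_qconj, hn, map_intCast, zsmul_eq_mul, zsmul_eq_mul, zsmul_eq_mul, mul_one,
          ← Int.cast_mul, ← Int.cast_mul, ← Int.cast_add, mul_comm (p : ℤ), huv, Int.cast_one]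
      rw [hP] at hxP
      obtain ⟨y, hy, rfl⟩ := mem_unit_smul.1 hxP
      rw [hcinv, Units.inv_mul_cancel_left]
      exact hy
    · obtain ⟨n, hn⟩ := nrd_int (isOrder_leftOrderAlg hJ) hmem
      have h1 : nrd (ι a⁻¹) * nrd (ι a) = 1 := by
        rw [← nrd_mul, hcinv]
        change nrd (((c⁻¹ : Bˣ) : B) * (c : B)) = 1
        rw [Units.inv_mul, nrd_one]
      rw [hn, nrd_of_mul_self_eq_neg hb] at h1
      have h2 : n * p = 1 := by exact_mod_cast h1
      have h3 : (p : ℤ) ∣ 1 := ⟨n, by linarith⟩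
      exact hp.one_lt.ne' (by exact_mod_cast Int.eq_one_of_dvd_one (by positivity) h3)
  · have : Fact p.Prime := ⟨hp⟩
    obtain ⟨θ, hθ, t, n, ht, hn, hdisc⟩ := exists_integral_generator (ι := ι) N hR.three_lt ha
    obtain ⟨ψ, hψ, hker, -, -⟩ := exists_reduction N hO p hpN
    have hθO : ι θ ∈ O := hS (apply_mem_fracImage_one.2 hθ)
    let JO : AddSubgroup O := J.toAddSubgroup.comap O.toSubmodule.subtype.toAddMonoidHom
    have hJO' : ∀ x : O, x ∈ JO ↔ (x : B) ∈ J := fun x => Iff.rfl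
    -- For `p ≠ N` the image of `J` in `M₂(𝔽_p)` is a proper right ideal on which `θ` acts as a
    -- scalar `m`; the enlarging element is `(θ - m) / p`.
    obtain ⟨l, hl⟩ := exists_scalar_of_mul_mem (r := JO.map ψ.toAddMonoidHom) (M := ψ ⟨ι θ, hθO⟩)
      (by
        rintro _ ⟨x, hx, rfl⟩ y
        obtain ⟨y, rfl⟩ := hψ y
        exact ⟨x * y, (hJO' _).2 (hmul x hx y y.2), map_mul ψ x y⟩)
      (by
        rintro ⟨x, hx, h1⟩
        have h2 : ψ (1 - x) = 0 := by
          rw [map_sub, map_one, sub_eq_zero]; exact h1.symm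
        obtain ⟨y, hy⟩ := (hker _).1 h2
        refine hpJ ⟨x, hx, y, y.2, ?_⟩
        have h3 := congrArg Subtype.val hy
        change (1 : B) - x = (p : ℤ) • (y : B) at h3
        rw [← h3]; abel)
      (by
        rintro _ ⟨x, hx, rfl⟩
        exact ⟨⟨ι θ, hθO⟩ * x, (hJO' _).2 (hSmul θ hθ x hx), map_mul ψ _ x⟩)
    obtain ⟨m, rfl⟩ := ZMod.intCast_surjective l
    have hp0 : (p : ℚ) ≠ 0 := by exact_mod_cast hp.ne_zero
    have hk : ι ((p : ℚ)⁻¹ • (θ - m)) = (p : ℚ)⁻¹ • (ι θ - m) := by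
      rw [map_smul, map_sub, map_intCast]
    refine ⟨(p : ℚ)⁻¹ • (θ - m), fun x hx => ?_, fun hmem => ?_⟩
    · have h1 : ψ (⟨ι θ, hθO⟩ * ⟨x, hle hx⟩ - m * ⟨x, hle hx⟩) = 0 := by
        have h2 : ψ ⟨ι θ, hθO⟩ * ψ ⟨x, hle hx⟩ = (m : ZMod p) • ψ ⟨x, hle hx⟩ :=
          hl _ ⟨⟨x, hle hx⟩, hx, rfl⟩
        rw [map_sub, map_mul, map_mul, h2, map_intCast, sub_eq_zero, Int.cast_smul_eq_zsmul,
          zsmul_eq_mul]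
      obtain ⟨y, hy⟩ := (hker _).1 h1
      have h3 := congrArg Subtype.val hy
      have h4 : (ι θ - m) * x = (p : ℚ) • (y : B) := by
        rw [sub_mul, Nat.cast_smul_eq_nsmul, ← natCast_zsmul]
        exact h3
      rw [hk, smul_mul_assoc, h4, smul_smul, inv_mul_cancel₀ hp0, one_smul]
      exact y.2
    · obtain ⟨u, hu⟩ := trd_int (isOrder_leftOrderAlg hJ) hmem
      obtain ⟨v, hv⟩ := nrd_int (isOrder_leftOrderAlg hJ) hmem
      apply hdisc p hp hpN u v
      have e : ι θ - (m : B) = algebraMap ℚ B (-(m : ℚ)) + ι θ := by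
        rw [map_neg, map_intCast]; abel
      rw [hk, e] at hu hv
      rw [map_smul, map_add, trd_algebraMap, ht] at hu
      rw [nrd_smul, nrd_add, nrd_algebraMap, hn, ← Algebra.smul_def, map_smul,
        show trd (qconj (ι θ)) = t by rw [trd_qconj, ht]] at hv
      simp only [smul_eq_mul] at hu hv
      have hu' : (2 * -(m : ℚ) + t) = p * u := by rw [← hu]; field_simp
      have hv' : ((-(m : ℚ)) ^ 2 + n + -m * t) = p ^ 2 * v := by rw [← hv]; field_simp
      have : (((4 * v - u ^ 2) * p ^ 2 : ℤ) : ℚ) = ((4 * n - t ^ 2 : ℤ) : ℚ) := by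
        push_cast
        have : (p * u : ℚ) ^ 2 = (2 * -(m : ℚ) + t) ^ 2 := by rw [hu']
        linear_combination -4 * hv' - this
      exact_mod_cast this

end Transitivity

end QuatForm

end

/-! ### Fractional ideals act simply transitively on `O_K`-stable right lattices -/

noncomputable section

namespace QuatForm

section FracAction

open scoped NumberField nonZeroDivisors

variable {B : Type*} [Ring B] [Algebra ℚ B] [DefiniteQuaternion B] {K : Type*} [Field K] [NumberField K]
  {ι : K →ₐ[ℚ] B} {a : K} {N : ℕ} [hNp : Fact N.Prime] [hR : RamifiedOnlyAt B N] {O : Subalgebra ℤ B}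

/-- Noetherian induction: as long as `J ≠ O`, the fractional ideal `(1, k)` with `k` from
`exists_enlarging` strictly enlarges `J` inside `O`; dividing by it recovers `J` from the larger
lattice. -/
theorem exists_fracImage_mul_eq_of_le (hO : IsMaximalOrder O) (ha : a ^ 2 = -(N : K))
    (hS : fracImage ι (1 : FractionalIdeal (𝓞 K)⁰ K) ≤ Subalgebra.toSubmodule O)
    (J : Submodule ℤ B) (hJ : Submodule.IsLattice ℚ J) (hJr : J * Subalgebra.toSubmodule O = J)
    (hSJ : fracImage ι (1 : FractionalIdeal (𝓞 K)⁰ K) * J = J) (hle : J ≤ Subalgebra.toSubmodule O) :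
    ∃ 𝔞 : (FractionalIdeal (𝓞 K)⁰ K)ˣ,
      fracImage ι (𝔞 : FractionalIdeal (𝓞 K)⁰ K) * Subalgebra.toSubmodule O = J := by
  have : Module.Finite ℤ (Subalgebra.toSubmodule O) := Module.Finite.iff_fg.2 hO.1.fg
  have hwf : WellFounded fun J J' : Submodule ℤ B =>
      J.comap (Subalgebra.toSubmodule O).subtype > J'.comap (Subalgebra.toSubmodule O).subtype :=
    InvImage.wf (fun J : Submodule ℤ B => J.comap (Subalgebra.toSubmodule O).subtype)
      (wellFounded_gt (α := Submodule ℤ (Subalgebra.toSubmodule O)))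
  have hSO : fracImage ι (1 : FractionalIdeal (𝓞 K)⁰ K) * Subalgebra.toSubmodule O =
      Subalgebra.toSubmodule O :=
    le_antisymm ((mul_le_mul' hS le_rfl).trans O.isIdempotentElem_toSubmodule.le)
      (le_fracImage_one_mul _)
  induction J using hwf.induction with | _ J ih
  by_cases hne : J = Subalgebra.toSubmodule O
  · exact ⟨1, by rw [Units.val_one, hSO, hne]⟩
  obtain ⟨k, hk, hkJ⟩ := exists_enlarging hO ha hS hJ hJr hSJ hle hne
  set 𝔟 : FractionalIdeal (𝓞 K)⁰ K := 1 + FractionalIdeal.spanSingleton _ k with h𝔟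
  have h1 : (1 : K) ∈ 𝔟 := (FractionalIdeal.mem_add _ _ _).2
    ⟨1, FractionalIdeal.one_mem_one _, 0, FractionalIdeal.zero_mem _, add_zero _⟩
  have hk𝔟 : k ∈ 𝔟 := (FractionalIdeal.mem_add _ _ _).2
    ⟨0, FractionalIdeal.zero_mem _, k, FractionalIdeal.mem_spanSingleton_self _ _, zero_add _⟩
  have h𝔟0 : 𝔟 ≠ 0 := fun h => one_ne_zero (FractionalIdeal.eq_zero_iff.1 h 1 h1)
  set J' := fracImage ι 𝔟 * J with hJ'
  have hJJ' : J ≤ J' := fun x hx => by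
    rw [hJ', ← one_mul x, ← map_one ι]
    exact Submodule.mul_mem_mul (apply_mem_fracImage h1) hx
  have hJ'O : J' ≤ Subalgebra.toSubmodule O := by
    refine Submodule.mul_le.2 ?_
    rintro _ ⟨l, hl, rfl⟩ x hx
    obtain ⟨i, hi, j, hj, rfl⟩ := (FractionalIdeal.mem_add _ _ _).1 hl
    obtain ⟨z, rfl⟩ := (FractionalIdeal.mem_spanSingleton _).1 hj
    have hz : ι (algebraMap (𝓞 K) K z) ∈ O := hS (apply_mem_fracImage_one.2 z.isIntegral_coe)
    rw [map_add, add_mul, Algebra.smul_def, map_mul, mul_assoc]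
    exact O.add_mem (O.mul_mem (hS (apply_mem_fracImage hi)) (hle hx)) (O.mul_mem hz (hk x hx))
  have hSJ' : fracImage ι (1 : FractionalIdeal (𝓞 K)⁰ K) * J' = J' := by
    rw [hJ', fracImage_mul_mul, one_mul]
  have hlt : J.comap (Subalgebra.toSubmodule O).subtype < J'.comap (Subalgebra.toSubmodule O).subtype := by
    refine lt_of_le_of_ne (Submodule.comap_mono hJJ') fun h => hkJ fun x hx => ?_
    have h2 : J = J' := by
      have h3 := congrArg (Submodule.map (Subalgebra.toSubmodule O).subtype) h
      rwa [Submodule.map_comap_eq_of_le (by rw [Submodule.range_subtype]; exact hle),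
        Submodule.map_comap_eq_of_le (by rw [Submodule.range_subtype]; exact hJ'O)] at h3
    rw [h2, hJ']
    exact Submodule.mul_mem_mul (apply_mem_fracImage hk𝔟) hx
  obtain ⟨𝔞, h𝔞⟩ := ih J' hlt (isLattice_fracImage_mul h𝔟0 hJ) (by rw [hJ', mul_assoc, hJr]) hSJ' hJ'O
  refine ⟨(Units.mk0 𝔟 h𝔟0)⁻¹ * 𝔞, ?_⟩
  rw [Units.val_mul, ← fracImage_mul_mul, h𝔞, hJ', fracImage_mul_mul,
    show (((Units.mk0 𝔟 h𝔟0)⁻¹ : (FractionalIdeal (𝓞 K)⁰ K)ˣ) : FractionalIdeal (𝓞 K)⁰ K) * 𝔟 = 1 from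
      (Units.mk0 𝔟 h𝔟0).inv_mul, hSJ]

omit hNp hR in
theorem fracImage_spanSingleton_mul {k : K} {c : Bˣ} (hc : (c : B) = ι k) {J : Submodule ℤ B}
    (hSJ : fracImage ι (1 : FractionalIdeal (𝓞 K)⁰ K) * J = J) :
    fracImage ι (FractionalIdeal.spanSingleton (𝓞 K)⁰ k) * J = c • J := by
  rw [fracImage_spanSingleton hc, unit_smul_mul, hSJ]

theorem isLattice_latticeInv (hO : IsMaximalOrder O) {I : Submodule ℤ B}
    (hI : Submodule.IsLattice ℚ I) : Submodule.IsLattice ℚ (latticeInv N O I) :=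
  isLattice_mul (isLattice_radPow_one N hO) (isLattice_trdDual hI)

/-- The fractional ideals of the field act transitively on the stable right lattices. -/
theorem exists_fracImage_mul_eq (hO : IsMaximalOrder O) (ha : a ^ 2 = -(N : K))
    {I J : Submodule ℤ B} (hI : Submodule.IsLattice ℚ I) (hIr : I * Subalgebra.toSubmodule O = I)
    (hSI : fracImage ι (1 : FractionalIdeal (𝓞 K)⁰ K) * I = I)
    (hJ : Submodule.IsLattice ℚ J) (hJr : J * Subalgebra.toSubmodule O = J)
    (hSJ : fracImage ι (1 : FractionalIdeal (𝓞 K)⁰ K) * J = J) :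
    ∃ 𝔞 : (FractionalIdeal (𝓞 K)⁰ K)ˣ, fracImage ι (𝔞 : FractionalIdeal (𝓞 K)⁰ K) * I = J := by
  have hO' := isMaximalOrder_leftOrderAlg N hO hI hIr
  -- `J I⁻¹` is a right lattice over the left order of `I`, which contains the ring of integers; a
  -- positive integer multiple of it lies inside that order, which is the case already treated.
  set M := J * latticeInv N O I with hM
  have hMl : Submodule.IsLattice ℚ M := isLattice_mul hJ (isLattice_latticeInv hO hI)
  have hSM : fracImage ι (1 : FractionalIdeal (𝓞 K)⁰ K) * M = M := by rw [hM, ← mul_assoc, hSJ]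
  have hMr : M * Subalgebra.toSubmodule (leftOrderAlg I) = M := by
    rw [hM, mul_assoc, toSubmodule_leftOrderAlg, latticeInv_mul_leftOrder]
  have hMI : M * I = J := by rw [hM, mul_assoc, latticeInv_mul_self N hO hI hIr, hJr]
  obtain ⟨m, hm, hmM⟩ := exists_zsmul_le (isOrder_leftOrderAlg hI) hMl.fg
  have hmK : (m : K) ≠ 0 := Nat.cast_ne_zero.2 hm.ne'
  have hmB : (m : B) ≠ 0 := Nat.cast_ne_zero.2 hm.ne'
  set c := qunit (m : B) hmB
  have hc : (c : B) = ι (m : K) := (map_natCast ι m).symm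
  have hcM : c • M ≤ Subalgebra.toSubmodule (leftOrderAlg I) := by
    rintro _ ⟨y, hy, rfl⟩
    have := hmM y hy
    rwa [natCast_zsmul, nsmul_eq_mul] at this
  have h1 := fracImage_spanSingleton_mul hc hSM
  have hm0 : FractionalIdeal.spanSingleton (𝓞 K)⁰ (m : K) ≠ 0 :=
    FractionalIdeal.spanSingleton_ne_zero_iff.2 hmK
  obtain ⟨𝔞, h𝔞⟩ := exists_fracImage_mul_eq_of_le hO' ha (le_leftOrder_iff.2 hSI.le) (c • M)
    (isLattice_unit_smul hMl c) (by rw [unit_smul_mul, hMr])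
    (by rw [← h1, fracImage_mul_mul, one_mul]) hcM
  refine ⟨(Units.mk0 _ hm0)⁻¹ * 𝔞, ?_⟩
  rw [Units.val_mul, ← fracImage_mul_mul]
  conv_lhs => rw [← leftOrder_mul_self I]
  rw [← mul_assoc (fracImage ι (𝔞 : FractionalIdeal (𝓞 K)⁰ K)), ← toSubmodule_leftOrderAlg, h𝔞, ← h1,
    mul_assoc, fracImage_mul_mul,
    show (((Units.mk0 _ hm0)⁻¹ : (FractionalIdeal (𝓞 K)⁰ K)ˣ) : FractionalIdeal (𝓞 K)⁰ K) *
      FractionalIdeal.spanSingleton (𝓞 K)⁰ (m : K) = 1 from (Units.mk0 _ hm0).inv_mul, hMI, hSJ]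

omit hNp hR in
theorem fracImage_mul_injective {I : Submodule ℤ B} (hI : Submodule.IsLattice ℚ I)
    (hSI : fracImage ι (1 : FractionalIdeal (𝓞 K)⁰ K) * I = I) {𝔞 𝔟 : (FractionalIdeal (𝓞 K)⁰ K)ˣ}
    (h : fracImage ι (𝔞 : FractionalIdeal (𝓞 K)⁰ K) * I = fracImage ι (𝔟 : FractionalIdeal (𝓞 K)⁰ K) * I) :
    𝔞 = 𝔟 := by
  rw [← inv_mul_eq_one]
  have h1 := congrArg (fun J => fracImage ι ((𝔞⁻¹ : (FractionalIdeal (𝓞 K)⁰ K)ˣ) :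
    FractionalIdeal (𝓞 K)⁰ K) * J) h
  simp only [fracImage_mul_mul, Units.inv_mul, hSI] at h1
  exact eq_one_of_fracImage_mul_eq hI _ hSI (by rw [Units.val_mul, ← h1])

omit hNp hR in
theorem fracImage_mul_unit_smul {𝔞 : FractionalIdeal (𝓞 K)⁰ K} {k : K} {c : Bˣ} (hc : (c : B) = ι k)
    (J : Submodule ℤ B) : fracImage ι 𝔞 * (c • J) = c • (fracImage ι 𝔞 * J) := by
  have hcomm : ∀ l : K, ι l * c = c * ι l := fun l => by rw [hc, ← map_mul, mul_comm, map_mul]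
  apply le_antisymm
  · refine Submodule.mul_le.2 ?_
    rintro _ ⟨l, hl, rfl⟩ _ ⟨y, hy, rfl⟩
    refine mem_unit_smul.2 ⟨ι l * y, Submodule.mul_mem_mul (apply_mem_fracImage hl) hy, ?_⟩
    change (c : B) * (ι l * y) = ι l * (c * y)
    rw [← mul_assoc, ← hcomm, mul_assoc]
  · rintro _ ⟨x, hx, rfl⟩
    change (c : B) * x ∈ _
    refine Submodule.mul_induction_on hx ?_ fun x y hx hy => ?_
    · rintro _ ⟨l, hl, rfl⟩ y hy
      rw [← mul_assoc, ← hcomm, mul_assoc]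
      exact Submodule.mul_mem_mul (apply_mem_fracImage hl) (mem_unit_smul.2 ⟨y, hy, rfl⟩)
    · rw [mul_add]
      exact add_mem hx hy

end FracAction

end QuatForm

end

/-! ### Lattices generating a given order over `O_K`: linear algebra modulo 2 and `N ≡ 1 (mod 4)` -/

noncomputable section

namespace QuatForm

section FieldTwo

open Matrix

theorem eq_zero_or_eq_of_mul_eq_mul : ∀ v c : Fin 2 → ZMod 2, v ≠ 0 → v 0 * c 1 = v 1 * c 0 →
    c = 0 ∨ c = v := by decide

theorem exists_smul_add_smul : ∀ v u y : Fin 2 → ZMod 2, v ≠ 0 → u ≠ 0 → u ≠ v →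
    ∃ c d : ZMod 2, y = c • v + d • u := by decide

theorem vecMulVec_ne_one (v w : Fin 2 → ZMod 2) : vecMulVec v w ≠ 1 := by
  intro h
  have h1 := congrArg Matrix.det h
  rw [det_fin_two, det_one] at h1
  simp only [vecMulVec_apply] at h1
  exact zero_ne_one ((by ring : (0 : ZMod 2) = _).trans h1)

/-- The vectors which together with their image form a basis of the plane. -/
def IsCyclicVec (M : Matrix (Fin 2) (Fin 2) (ZMod 2)) (v : Fin 2 → ZMod 2) : Prop :=
  v ≠ 0 ∧ M *ᵥ v ≠ 0 ∧ M *ᵥ v ≠ v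

instance (M : Matrix (Fin 2) (Fin 2) (ZMod 2)) : DecidablePred (IsCyclicVec M) := fun _ =>
  inferInstanceAs (Decidable (_ ∧ _ ∧ _))

/-- The characteristic polynomial is `X² + X + det`. For `det = 1` it is irreducible and all three
nonzero vectors are cyclic; for `det = 0` the eigenvalues 0 and 1 take away two of them. -/
theorem card_isCyclicVec (M : Matrix (Fin 2) (Fin 2) (ZMod 2)) (ht : M.trace = 1) :
    Nat.card {v // IsCyclicVec M v} = if M.det = 1 then 3 else 1 := by
  have key : ∀ a b c d : ZMod 2, a + d = 1 →
      Fintype.card {v // IsCyclicVec !![a, b; c, d] v} = if a * d - b * c = 1 then 3 else 1 := by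
    decide
  rw [Nat.card_eq_fintype_card, det_fin_two]
  rw [trace_fin_two] at ht
  rw [← key _ _ _ _ ht, ← eta_fin_two]

end FieldTwo

section StableHull

open scoped NumberField nonZeroDivisors

variable {B : Type*} [Ring B] [Algebra ℚ B] [DefiniteQuaternion B] {K : Type*} [Field K] [NumberField K]
  (ι : K →ₐ[ℚ] B) (a : K) {N : ℕ} [hNp : Fact N.Prime] [hR : RamifiedOnlyAt B N] {O : Subalgebra ℤ B}

/-- The right lattices over an order stable under `√-N` and generating the order over the ring of
integers. -/
def stableHull (O : Subalgebra ℤ B) : Set (Submodule ℤ B) :=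
  {M | Submodule.IsLattice ℚ M ∧ M * Subalgebra.toSubmodule O = M ∧ (∀ x ∈ M, ι a * x ∈ M) ∧
    fracImage ι (1 : FractionalIdeal (𝓞 K)⁰ K) * M = Subalgebra.toSubmodule O}

variable {ι a}

omit hNp hR in
theorem le_of_mem_stableHull {M : Submodule ℤ B} (hM : M ∈ stableHull ι a O) :
    M ≤ Subalgebra.toSubmodule O := hM.2.2.2 ▸ le_fracImage_one_mul M

omit hNp hR in
theorem self_mem_stableHull (hO : IsOrder O)
    (hS : fracImage ι (1 : FractionalIdeal (𝓞 K)⁰ K) ≤ Subalgebra.toSubmodule O) (haO : ι a ∈ O) :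
    Subalgebra.toSubmodule O ∈ stableHull ι a O :=
  ⟨hO, O.isIdempotentElem_toSubmodule, fun _ hx => O.mul_mem haO hx,
    le_antisymm ((mul_le_mul' hS le_rfl).trans O.isIdempotentElem_toSubmodule.le)
      (le_fracImage_one_mul _)⟩

omit hR in
/-- Integral elements of an imaginary quadratic field. -/
theorem exists_int_coords (hO : IsOrder O) (hN3 : 3 < N) (ha : a ^ 2 = -(N : K)) {k : K} (hk : ι k ∈ O) :
    ∃ u w v : ℤ, u ^ 2 + N * w ^ 2 = 4 * v ∧
      ι k = algebraMap ℚ B (u / 2) + ((w : ℚ) / 2) • ι a := by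
  have hN0 : N ≠ 0 := by omega
  have hNQ : (N : ℚ) ≠ 0 := Nat.cast_ne_zero.2 hN0
  have hb := apply_mul_self_of_sq (ι := ι) N ha
  obtain ⟨r, s, hrs⟩ := exists_of_commute_sqrt hN0 hb (x := ι k) (by rw [← map_mul, mul_comm, map_mul])
  obtain ⟨u, hu⟩ := trd_int hO hk
  obtain ⟨v, hv⟩ := nrd_int hO hk
  rw [hrs, trd_add_smul hN0 hb] at hu
  rw [hrs, nrd_add_smul hN0 hb] at hv
  have h1 : (2 * N * s) ^ 2 = ((N * (4 * v - u ^ 2) : ℤ) : ℚ) := by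
    push_cast
    rw [← hu]
    linear_combination (4 * N : ℚ) * hv
  obtain ⟨z, hz⟩ : ∃ z : ℤ, (z : ℚ) = 2 * N * s := by
    have h2 : IsIntegral ℤ (2 * N * s : ℚ) := by
      refine IsIntegral.of_pow (n := 2) two_pos ?_
      rw [h1]
      exact isIntegral_algebraMap
    exact IsIntegrallyClosed.isIntegral_iff.1 h2
  rw [← hz] at h1
  have h3 : z ^ 2 = N * (4 * v - u ^ 2) := by exact_mod_cast h1
  obtain ⟨w, rfl⟩ : (N : ℤ) ∣ z := Int.Prime.dvd_pow' hNp.out ⟨_, h3⟩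
  refine ⟨u, w, v, ?_, ?_⟩
  · have hN' : (N : ℤ) ≠ 0 := by exact_mod_cast hN0
    apply mul_left_cancel₀ hN'
    linear_combination h3
  · have hs : s = w / 2 := by
      push_cast at hz
      have : (N : ℚ) * (w - 2 * s) = 0 := by linear_combination hz
      rcases mul_eq_zero.1 this with h | h
      · exact absurd h hNQ
      · linarith
    rw [hrs, ← hs, ← hu]
    congr 2
    ring

omit hNp hR in
theorem sq_mod_four (u : ℤ) : u % 2 = 0 ∧ u ^ 2 % 4 = 0 ∨ u % 2 = 1 ∧ u ^ 2 % 4 = 1 := by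
  have h5 : u % 4 = 0 ∨ u % 4 = 1 ∨ u % 4 = 2 ∨ u % 4 = 3 := by omega
  rcases h5 with h5 | h5 | h5 | h5 <;> simp [sq, Int.mul_emod, h5] <;> omega

omit hR in
theorem exists_int_of_mod_four_eq_one (hO : IsOrder O) (hN3 : 3 < N) (hN1 : N % 4 = 1)
    (ha : a ^ 2 = -(N : K)) {k : K} (hk : ι k ∈ O) : ∃ e f : ℤ, ι k = e + f * ι a := by
  obtain ⟨u, w, v, h, hk'⟩ := exists_int_coords hO hN3 ha hk
  have h1 : u % 2 = 0 ∧ w % 2 = 0 := by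
    obtain ⟨m, hm⟩ : ∃ m : ℤ, (N : ℤ) = 4 * m + 1 := ⟨N / 4, by omega⟩
    have h2 : u ^ 2 + w ^ 2 = 4 * (v - m * w ^ 2) := by rw [hm] at h; linarith
    rcases sq_mod_four u with ⟨h3, h4⟩ | ⟨h3, h4⟩ <;> rcases sq_mod_four w with ⟨h5, h6⟩ | ⟨h5, h6⟩ <;>
      omega
  obtain ⟨e, rfl⟩ : (2 : ℤ) ∣ u := by omega
  obtain ⟨f, rfl⟩ : (2 : ℤ) ∣ w := by omega
  refine ⟨e, f, ?_⟩
  rw [hk']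
  push_cast
  rw [mul_div_cancel_left₀ _ two_ne_zero, mul_div_cancel_left₀ _ two_ne_zero, map_intCast,
    Int.cast_smul_eq_zsmul, zsmul_eq_mul]

omit hR in
theorem exists_int_of_mod_four_eq_three (hO : IsOrder O) (hN3 : 3 < N) (hN1 : N % 4 = 3)
    (ha : a ^ 2 = -(N : K)) {k : K} (hk : ι k ∈ O) : ∃ e f : ℤ, ι k = e + f * ι (halfSqrt a) := by
  obtain ⟨u, w, v, h, hk'⟩ := exists_int_coords hO hN3 ha hk
  have h1 : (u - w) % 2 = 0 := by
    obtain ⟨m, hm⟩ : ∃ m : ℤ, (N : ℤ) = 4 * m - 1 := ⟨(N + 1) / 4, by omega⟩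
    have h2 : u ^ 2 - w ^ 2 = 4 * (v - m * w ^ 2) := by rw [hm] at h; linarith
    rcases sq_mod_four u with ⟨h3, h4⟩ | ⟨h3, h4⟩ <;> rcases sq_mod_four w with ⟨h5, h6⟩ | ⟨h5, h6⟩ <;>
      omega
  obtain ⟨e, he⟩ : (2 : ℤ) ∣ u - w := by omega
  obtain rfl : u = 2 * e + w := by linarith
  refine ⟨e, w, ?_⟩
  have e1 : ((2 * e + w : ℤ) : ℚ) / 2 = e + w * (1 / 2) := by push_cast; ring
  have e2 : (w : ℚ) / 2 = w * (1 / 2) := by ring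
  rw [hk', apply_halfSqrt, e1, e2, mul_smul, map_add, map_mul, map_intCast, map_intCast,
    Int.cast_smul_eq_zsmul, zsmul_eq_mul, mul_add]
  abel

/-- Here `ℤ[√-N]` is the full ring of integers, so a lattice stable under `√-N` already equals what
it generates. -/
theorem card_stableHull_of_mod_four_eq_one (hO : IsMaximalOrder O) (hN1 : N % 4 = 1) (ha : a ^ 2 = -(N : K))
    (hS : fracImage ι (1 : FractionalIdeal (𝓞 K)⁰ K) ≤ Subalgebra.toSubmodule O) (haO : ι a ∈ O) :
    Nat.card (stableHull ι a O) = 1 := by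
  have h : stableHull ι a O = {Subalgebra.toSubmodule O} := by
    ext M
    rw [Set.mem_singleton_iff]
    constructor
    · intro hM
      refine le_antisymm (le_of_mem_stableHull hM) ?_
      rw [← hM.2.2.2]
      refine Submodule.mul_le.2 ?_
      rintro _ ⟨k, hk, rfl⟩ x hx
      obtain ⟨e, f, hef⟩ := exists_int_of_mod_four_eq_one hO.1 hR.three_lt hN1 ha
        (hS (apply_mem_fracImage hk))
      rw [hef, add_mul, mul_assoc, ← zsmul_eq_mul, ← zsmul_eq_mul]
      exact add_mem (M.smul_mem e hx) (M.smul_mem f (hM.2.2.1 x hx))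
    · rintro rfl
      exact self_mem_stableHull hO.1 hS haO
  rw [h, Nat.card_unique]

/-- The elements of an order whose reduction has its image in the line spanned by a vector. -/
def lineLattice (ψ : O →+* Matrix (Fin 2) (Fin 2) (ZMod 2)) (v : Fin 2 → ZMod 2) : Submodule ℤ B where
  carrier := {x | ∃ (h : x ∈ O) (w : Fin 2 → ZMod 2), ψ ⟨x, h⟩ = Matrix.vecMulVec v w}
  add_mem' := by
    rintro x y ⟨hx, w, hw⟩ ⟨hy, w', hw'⟩
    refine ⟨O.add_mem hx hy, w + w', ?_⟩
    rw [Matrix.vecMulVec_add, ← hw, ← hw', ← map_add]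
    rfl
  zero_mem' := ⟨O.zero_mem, 0, by
    rw [Matrix.vecMulVec_zero]
    exact map_zero ψ⟩
  smul_mem' := by
    rintro n x ⟨hx, w, hw⟩
    refine ⟨O.toSubmodule.smul_mem n hx, n • w, ?_⟩
    have : ψ ⟨n • x, O.toSubmodule.smul_mem n hx⟩ = n • ψ ⟨x, hx⟩ := map_zsmul ψ n ⟨x, hx⟩
    rw [this, hw]
    ext i j
    simp [Matrix.vecMulVec_apply]
    ring

end StableHull

end QuatForm

end

/-! ### Lattices generating a given order over `O_K`: the case `N ≡ 3 (mod 4)` -/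

noncomputable section

namespace QuatForm

section LineLattice

open scoped NumberField nonZeroDivisors Matrix

variable {B : Type*} [Ring B] [Algebra ℚ B] [DefiniteQuaternion B] {K : Type*} [Field K] [NumberField K]
  {ι : K →ₐ[ℚ] B} {a : K} {N : ℕ} [hNp : Fact N.Prime] [hR : RamifiedOnlyAt B N] {O : Subalgebra ℤ B}

omit hNp hR in
theorem two_smul_halfSqrt : (2 : B) * ι (halfSqrt a) = 1 + ι a := by
  have h : (2 : K) * halfSqrt a = 1 + a := by rw [halfSqrt]; field_simp
  rw [← map_ofNat ι 2, ← map_mul, h, map_add, map_one]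

/-- Twice the ring of integers is contained in `ℤ[√-N]`. Hence these lattices contain `2 O` and are
determined by their images in `O / 2O ≅ M₂(𝔽₂)`. -/
theorem two_smul_mem_of_mem_stableHull (hO : IsOrder O) (hN1 : N % 4 = 3) (ha : a ^ 2 = -(N : K))
    (hS : fracImage ι (1 : FractionalIdeal (𝓞 K)⁰ K) ≤ Subalgebra.toSubmodule O)
    {M : Submodule ℤ B} (hM : M ∈ stableHull ι a O) {x : B} (hx : x ∈ O) : (2 : ℤ) • x ∈ M := by
  have hx' : x ∈ Subalgebra.toSubmodule O := hx
  rw [← hM.2.2.2] at hx'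
  refine Submodule.mul_induction_on hx' ?_ fun x y hx hy => ?_
  · rintro _ ⟨k, hk, rfl⟩ m hm
    obtain ⟨e, f, hef⟩ := exists_int_of_mod_four_eq_three hO hR.three_lt hN1 ha
      (hS (apply_mem_fracImage hk))
    have e1 : (2 : ℤ) • (ι k * m) = (2 * e + f) • m + f • (ι a * m) := by
      have h2 : (2 : B) * ι k = (2 * e + f : ℤ) + f * ι a := by
        rw [hef, mul_add, ← mul_assoc, ← (Int.cast_commute f (2 : B)).eq, mul_assoc, two_smul_halfSqrt]
        push_cast
        noncomm_ring
      rw [zsmul_eq_mul, zsmul_eq_mul, zsmul_eq_mul, ← mul_assoc, ← mul_assoc, ← add_mul, Int.cast_ofNat,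
        h2]
    rw [e1]
    exact add_mem (M.smul_mem _ hm) (M.smul_mem _ (hM.2.2.1 m hm))
  · rw [smul_add]; exact add_mem hx hy

variable {ψ : O →+* Matrix (Fin 2) (Fin 2) (ZMod 2)} {v : Fin 2 → ZMod 2}

omit hNp hR in
theorem lineLattice_le : lineLattice ψ v ≤ Subalgebra.toSubmodule O := fun _ ⟨h, _⟩ => h

omit hNp hR in
theorem two_smul_mem_lineLattice (hker : ∀ x, ψ x = 0 ↔ ∃ y : O, x = (2 : ℤ) • y) {x : B} (hx : x ∈ O) :
    (2 : ℤ) • x ∈ lineLattice ψ v :=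
  ⟨O.toSubmodule.smul_mem 2 hx, 0, by
    rw [Matrix.vecMulVec_zero]
    exact (hker _).2 ⟨⟨x, hx⟩, rfl⟩⟩

omit hNp hR in
theorem mem_lineLattice {x : O} : (x : B) ∈ lineLattice ψ v ↔ ∃ w, ψ x = Matrix.vecMulVec v w :=
  ⟨fun ⟨_, h⟩ => h, fun h => ⟨x.2, h⟩⟩

omit hNp hR in
-- As `v` and `θ v` span the plane, the lattice and its translate by `θ` generate everything modulo
-- `2 O`, which the lattice contains; stability under `√-N = 2 θ - 1` follows from the same
-- containment.
theorem lineLattice_mem_stableHull (hO : IsOrder O)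
    (hS : fracImage ι (1 : FractionalIdeal (𝓞 K)⁰ K) ≤ Subalgebra.toSubmodule O)
    (hψ : Function.Surjective ψ) (hker : ∀ x, ψ x = 0 ↔ ∃ y : O, x = (2 : ℤ) • y)
    {θ : O} (hθ : (θ : B) = ι (halfSqrt a)) (hθi : IsIntegral ℤ (halfSqrt a))
    (hv : IsCyclicVec (ψ θ) v) : lineLattice ψ v ∈ stableHull ι a O := by
  have haθ : ι a = (2 : ℤ) • (θ : B) - 1 := by
    rw [hθ, zsmul_eq_mul, Int.cast_ofNat, two_smul_halfSqrt]; abel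
  have hle := lineLattice_le (ψ := ψ) (v := v)
  refine ⟨isLattice_of_forall_smul_mem hO hO.fg hle (two_ne_zero (α := ℤ))
    (fun x hx => two_smul_mem_lineLattice hker hx), ?_, ?_, ?_⟩
  · apply le_antisymm
    · refine Submodule.mul_le.2 ?_
      rintro x ⟨hx, w, hw⟩ y hy
      refine ⟨O.mul_mem hx hy, w ᵥ* ψ ⟨y, hy⟩, ?_⟩
      rw [← Matrix.vecMulVec_mul, ← hw, ← map_mul]
      rfl
    · intro x hx
      rw [← mul_one x]
      exact Submodule.mul_mem_mul hx O.one_mem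
  · intro x hx
    rw [haθ, sub_mul, one_mul, smul_mul_assoc]
    exact sub_mem (two_smul_mem_lineLattice hker (O.mul_mem θ.2 (hle hx))) hx
  · apply le_antisymm
    · exact (mul_le_mul' hS hle).trans O.isIdempotentElem_toSubmodule.le
    · intro y hy
      choose c d hcd using fun j => exists_smul_add_smul v (ψ θ *ᵥ v) (fun i => ψ ⟨y, hy⟩ i j) hv.1 hv.2.1
        hv.2.2
      obtain ⟨x₁, hx₁⟩ := hψ (Matrix.vecMulVec v c)
      obtain ⟨x₂, hx₂⟩ := hψ (Matrix.vecMulVec v d)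
      have h1 : ψ (⟨y, hy⟩ - x₁ - θ * x₂) = 0 := by
        rw [map_sub, map_sub, map_mul, hx₁, hx₂, Matrix.mul_vecMulVec]
        ext i j
        have := congrFun (hcd j) i
        simp only [Pi.add_apply, Pi.smul_apply, smul_eq_mul] at this
        simp only [Matrix.sub_apply, Matrix.vecMulVec_apply, Matrix.zero_apply]
        rw [this]; ring
      obtain ⟨z, hz⟩ := (hker _).1 h1
      have h2 : y = 1 * ((x₁ : B) + (2 : ℤ) • (z : B)) + ι (halfSqrt a) * x₂ := by
        have h3 := congrArg Subtype.val hz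
        change y - (x₁ : B) - θ * x₂ = (2 : ℤ) • (z : B) at h3
        rw [← h3, ← hθ, one_mul]; abel
      rw [h2]
      exact add_mem (Submodule.mul_mem_mul one_mem_fracImage_one
        (add_mem (mem_lineLattice.2 ⟨c, hx₁⟩) (two_smul_mem_lineLattice hker z.2)))
        (Submodule.mul_mem_mul (apply_mem_fracImage_one.2 hθi) (mem_lineLattice.2 ⟨d, hx₂⟩))

omit hNp hR in
theorem lineLattice_ne (v : Fin 2 → ZMod 2) : lineLattice ψ v ≠ Subalgebra.toSubmodule O := by
  intro h
  have h1 : ((1 : O) : B) ∈ lineLattice ψ v := by rw [h]; exact O.one_mem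
  obtain ⟨w, hw⟩ := mem_lineLattice.1 h1
  rw [map_one] at hw
  exact vecMulVec_ne_one v w hw.symm

omit hNp hR in
theorem lineLattice_injective (hψ : Function.Surjective ψ) {v v' : Fin 2 → ZMod 2} (hv : v ≠ 0)
    (h : lineLattice ψ v = lineLattice ψ v') : v = v' := by
  obtain ⟨x, hx⟩ := hψ (Matrix.vecMulVec v ![1, 0])
  have h1 : (x : B) ∈ lineLattice ψ v' := by rw [← h]; exact mem_lineLattice.2 ⟨_, hx⟩
  obtain ⟨w, hw⟩ := mem_lineLattice.1 h1
  have h2 : v = fun i => v' i * w 0 := by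
    funext i
    have := congrFun (congrFun (hx.symm.trans hw) i) 0
    simpa [Matrix.vecMulVec_apply] using this
  have h3 : ∀ t : ZMod 2, t = 0 ∨ t = 1 := by decide
  rcases h3 (w 0) with h4 | h4
  · exact absurd (by rw [h2, h4]; funext i; simp) hv
  · rw [h2, h4]; funext i; simp

/-- `M` contains `2 O`, so it is the preimage of a right ideal of `M₂(𝔽₂)`, proper because `M ≠ O`,
whose matrices have their columns on one line. Were the ideal zero or the line stable under `θ`, `M`
would be stable under the ring of integers and equal to `O`. -/
theorem exists_eq_lineLattice (hO : IsOrder O) (hN1 : N % 4 = 3) (ha : a ^ 2 = -(N : K))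
    (hS : fracImage ι (1 : FractionalIdeal (𝓞 K)⁰ K) ≤ Subalgebra.toSubmodule O)
    (hψ : Function.Surjective ψ) (hker : ∀ x, ψ x = 0 ↔ ∃ y : O, x = (2 : ℤ) • y)
    {θ : O} (hθ : (θ : B) = ι (halfSqrt a)) {M : Submodule ℤ B} (hM : M ∈ stableHull ι a O)
    (hne : M ≠ Subalgebra.toSubmodule O) : ∃ v, IsCyclicVec (ψ θ) v ∧ M = lineLattice ψ v := by
  have hle := le_of_mem_stableHull hM
  have hmul : ∀ x ∈ M, ∀ y ∈ O, x * y ∈ M := fun x hx y hy => by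
    rw [← hM.2.1]; exact Submodule.mul_mem_mul hx hy
  have h2M : ∀ x ∈ O, (2 : ℤ) • x ∈ M := fun x hx => two_smul_mem_of_mem_stableHull hO hN1 ha hS hM hx
  have hnθ : ¬ ∀ x ∈ M, (θ : B) * x ∈ M := by
    intro hst
    refine hne (le_antisymm hle ?_)
    rw [← hM.2.2.2]
    refine Submodule.mul_le.2 ?_
    rintro _ ⟨k, hk, rfl⟩ x hx
    obtain ⟨e, f, hef⟩ := exists_int_of_mod_four_eq_three hO hR.three_lt hN1 ha
      (hS (apply_mem_fracImage hk))
    rw [hef, ← hθ, add_mul, mul_assoc, ← zsmul_eq_mul, ← zsmul_eq_mul]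
    exact add_mem (M.smul_mem e hx) (M.smul_mem f (hst x hx))
  have hlift : ∀ x y : O, ψ x = ψ y → (x : B) ∈ M → (y : B) ∈ M := by
    intro x y hxy hx
    obtain ⟨z, hz⟩ := (hker (y - x)).1 (by rw [map_sub, hxy, sub_self])
    have h3 := congrArg Subtype.val hz
    change (y : B) - x = (2 : ℤ) • (z : B) at h3
    rw [← sub_add_cancel (y : B) x, h3]
    exact add_mem (h2M z z.2) hx
  let r : AddSubgroup (Matrix (Fin 2) (Fin 2) (ZMod 2)) :=
    (M.toAddSubgroup.comap O.toSubmodule.subtype.toAddMonoidHom).map ψ.toAddMonoidHom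
  have hr : ∀ x : O, ψ x ∈ r ↔ (x : B) ∈ M := fun x =>
    ⟨fun ⟨y, hy, hyx⟩ => hlift y x hyx hy, fun hx => ⟨x, hx, rfl⟩⟩
  have hright : ∀ x ∈ r, ∀ y, x * y ∈ r := by
    rintro _ ⟨x, hx, rfl⟩ y
    obtain ⟨y, rfl⟩ := hψ y
    exact ⟨x * y, hmul x hx y y.2, map_mul ψ x y⟩
  have hone : (1 : Matrix (Fin 2) (Fin 2) (ZMod 2)) ∉ r := by
    rw [← map_one ψ, hr]
    intro h1
    refine hne (le_antisymm hle fun x hx => ?_)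
    rw [← one_mul x]
    exact hmul 1 h1 x hx
  have hcol := mul_eq_mul_of_mem_right_ideal hright hone
  obtain ⟨x, hx, i, hxi⟩ : ∃ x ∈ r, ∃ i, (fun k => x k i) ≠ 0 := by
    by_contra! h
    apply hnθ
    intro x hx
    have h0 : ψ ⟨x, hle hx⟩ = 0 := by
      ext k i
      exact congrFun (h _ ((hr _).2 hx) i) k
    refine hlift 0 (θ * ⟨x, hle hx⟩) ?_ (zero_mem M)
    rw [map_mul, h0, mul_zero, map_zero]
  set v : Fin 2 → ZMod 2 := fun k => x k i with hv
  have hmem : ∀ y ∈ r, ∃ w, y = Matrix.vecMulVec v w := by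
    intro y hy
    have h1 : ∀ j, ∃ w : ZMod 2, ∀ k, y k j = v k * w := by
      intro j
      rcases eq_zero_or_eq_of_mul_eq_mul v (fun k => y k j) hxi (hcol x hx y hy i j) with h | h
      · exact ⟨0, fun k => by rw [mul_zero]; exact congrFun h k⟩
      · exact ⟨1, fun k => by rw [mul_one]; exact congrFun h k⟩
    choose w hw using h1
    exact ⟨w, by ext k j; rw [Matrix.vecMulVec_apply]; exact hw j k⟩
  have hmem' : ∀ w, Matrix.vecMulVec v w ∈ r := by
    intro w
    have e : Matrix.vecMulVec v w = x * Matrix.vecMulVec (Pi.single i 1) w := by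
      rw [Matrix.mul_vecMulVec, Matrix.mulVec_single_one]
      rfl
    rw [e]
    exact hright x hx _
  have hML : M = lineLattice ψ v := by
    apply le_antisymm
    · intro y hy
      exact ⟨hle hy, hmem _ ((hr ⟨y, hle hy⟩).2 hy)⟩
    · rintro y ⟨hy, w, hw⟩
      refine (hr ⟨y, hy⟩).1 ?_
      rw [hw]
      exact hmem' w
  have hstable : (∃ t : ZMod 2, ψ θ *ᵥ v = t • v) → False := by
    rintro ⟨t, ht⟩
    apply hnθ
    intro y hy
    obtain ⟨w, hw⟩ := hmem _ ((hr ⟨y, hle hy⟩).2 hy)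
    refine (hr (θ * ⟨y, hle hy⟩)).1 ?_
    rw [map_mul, hw, Matrix.mul_vecMulVec, ht, Matrix.smul_vecMulVec, ← Matrix.vecMulVec_smul]
    exact hmem' _
  exact ⟨v, ⟨hxi, fun h => hstable ⟨0, by rw [h, zero_smul]⟩, fun h => hstable ⟨1, by rw [h, one_smul]⟩⟩,
    hML⟩

/-- The lattices are `O` itself and one for each cyclic vector of `θ` modulo 2, giving `1 + 3` or `1
+ 1`. The norm of `θ` is `(N + 1) / 4`, odd exactly when `N ≡ 3 (mod 8)`. -/
theorem card_stableHull_of_mod_four_eq_three (hO : IsMaximalOrder O) (hN1 : N % 4 = 3)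
    (ha : a ^ 2 = -(N : K))
    (hS : fracImage ι (1 : FractionalIdeal (𝓞 K)⁰ K) ≤ Subalgebra.toSubmodule O) (haO : ι a ∈ O) :
    Nat.card (stableHull ι a O) = bConst N := by
  have hN3 : 3 < N := hR.three_lt
  have hN0 : N ≠ 0 := by omega
  have hb := apply_mul_self_of_sq (ι := ι) N ha
  obtain ⟨ψ, hψ, hker, htr, hdet⟩ := exists_reduction N hO 2 (by omega)
  rw [Nat.cast_ofNat] at hker
  obtain ⟨n, hn⟩ : ∃ n : ℤ, 4 * n = N + 1 := ⟨(N + 1) / 4, by omega⟩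
  have hθi : IsIntegral ℤ (halfSqrt a) := isIntegral_of_sq (halfSqrt_mul_self N ha hn)
  set θ : O := ⟨ι (halfSqrt a), hS (apply_mem_fracImage_one.2 hθi)⟩ with hθdef
  have hθ : (θ : B) = ι (halfSqrt a) := rfl
  have htθ : (ψ θ).trace = 1 := by
    rw [htr θ 1 (by rw [hθ, apply_halfSqrt, trd_add_smul hN0 hb]; norm_num), Int.cast_one]
  have hdθ : (ψ θ).det = n := hdet θ n (by
    rw [hθ, apply_halfSqrt, nrd_add_smul hN0 hb]
    have : (4 : ℚ) * n = N + 1 := by exact_mod_cast hn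
    linarith)
  let f : Option {v // IsCyclicVec (ψ θ) v} → stableHull ι a O := fun o =>
    o.elim ⟨Subalgebra.toSubmodule O, self_mem_stableHull hO.1 hS haO⟩
      fun v => ⟨lineLattice ψ v.1, lineLattice_mem_stableHull hO.1 hS hψ hker hθ hθi v.2⟩
  have hf : Function.Bijective f := by
    constructor
    · rintro (_ | v) (_ | v') h
      · rfl
      · exact absurd (congrArg Subtype.val h).symm (lineLattice_ne v'.1)
      · exact absurd (congrArg Subtype.val h) (lineLattice_ne v.1)
      · exact congrArg some (Subtype.ext (lineLattice_injective hψ v.2.1 (congrArg Subtype.val h)))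
    · rintro ⟨M, hM⟩
      by_cases hne : M = Subalgebra.toSubmodule O
      · exact ⟨none, Subtype.ext hne.symm⟩
      · obtain ⟨v, hv, h⟩ := exists_eq_lineLattice hO.1 hN1 ha hS hψ hker hθ hM hne
        exact ⟨some ⟨v, hv⟩, Subtype.ext h.symm⟩
  rw [← Nat.card_congr (Equiv.ofBijective f hf), Finite.card_option, card_isCyclicVec _ htθ, hdθ, bConst,
    if_neg (show ¬ N % 4 = 1 by omega)]
  have h1 : (n : ZMod 2) = 1 ↔ N % 8 = 3 := by
    rw [← Int.cast_one, ZMod.intCast_eq_intCast_iff_dvd_sub]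
    constructor
    · rintro ⟨m, hm⟩; push_cast at hm; omega
    · intro h; exact ⟨(1 - n) / 2, by push_cast; omega⟩
  by_cases h8 : N % 8 = 3
  · rw [if_pos (h1.2 h8), if_neg (show ¬ N % 8 = 7 by omega)]
  · rw [if_neg (fun h => h8 (h1.1 h)), if_pos (show N % 8 = 7 by omega)]

end LineLattice

end QuatForm

end

/-! ### Counting stable ideals over the class group of `K` -/

noncomputable section

namespace QuatForm

section ClassCount

open scoped NumberField nonZeroDivisors

variable {B : Type*} [Ring B] [Algebra ℚ B] [DefiniteQuaternion B] {K : Type*} [Field K] [NumberField K]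
  {ι : K →ₐ[ℚ] B} {a : K} {N : ℕ} [hNp : Fact N.Prime] [hR : RamifiedOnlyAt B N] {O : Subalgebra ℤ B}

theorem card_stableHull (hO : IsMaximalOrder O) (ha : a ^ 2 = -(N : K))
    (hS : fracImage ι (1 : FractionalIdeal (𝓞 K)⁰ K) ≤ Subalgebra.toSubmodule O) :
    Nat.card (stableHull ι a O) = bConst N := by
  have hN3 := hR.three_lt
  have haO : ι a ∈ O := hS (apply_mem_fracImage_one.2
    (isIntegral_of_sq (t := 0) (n := N) (by push_cast; linear_combination ha)))
  have hodd : N % 2 = 1 := hNp.out.eq_two_or_odd.resolve_left (by omega)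
  have h2 : N % 4 = 1 ∨ N % 4 = 3 := by omega
  rcases h2 with h2 | h2
  · rw [card_stableHull_of_mod_four_eq_one hO h2 ha hS haO, bConst, if_pos h2]
  · exact card_stableHull_of_mod_four_eq_three hO h2 ha hS haO

/-- Right multiplication by `J⁻¹` moves the question to the left order of `J`, again maximal and
containing the ring of integers, so the count does not depend on `J`. -/
theorem card_stableIdeal_hull_eq (hO : IsMaximalOrder O) (ha : a ^ 2 = -(N : K)) {J : Submodule ℤ B}
    (hJ : Submodule.IsLattice ℚ J) (hJO : J * Subalgebra.toSubmodule O = J)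
    (hSJ : fracImage ι (1 : FractionalIdeal (𝓞 K)⁰ K) * J = J) :
    Nat.card {I : StableIdeal O (ι a) //
      fracImage ι (1 : FractionalIdeal (𝓞 K)⁰ K) * I.1.carrier = J} = bConst N := by
  rw [← card_stableHull (ι := ι) (isMaximalOrder_leftOrderAlg N hO hJ hJO) ha (le_leftOrder_iff.2 hSJ.le)]
  have hinv := isLattice_latticeInv (N := N) hO hJ
  have hstab : ∀ I L : Submodule ℤ B, (∀ x ∈ I, ι a * x ∈ I) → ∀ x ∈ I * L, ι a * x ∈ I * L := by
    intro I L hI x hx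
    refine Submodule.mul_induction_on hx (fun m hm n hn => ?_) fun x y hx hy => ?_
    · rw [← mul_assoc]; exact Submodule.mul_mem_mul (hI m hm) hn
    · rw [mul_add]; exact add_mem hx hy
  refine Nat.card_congr
    { toFun := fun I => ⟨I.1.1.carrier * latticeInv N O J, isLattice_mul I.1.1.isLattice hinv, ?_,
        hstab _ _ I.1.2, ?_⟩
      invFun := fun M => ⟨⟨rightIdealOf N hO (M.1 * J) (isLattice_mul M.2.1 hJ) ?_,
        hstab _ _ M.2.2.2.1⟩, ?_⟩
      left_inv := fun I => ?_
      right_inv := fun M => ?_ }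
  · rw [mul_assoc, toSubmodule_leftOrderAlg, latticeInv_mul_leftOrder]
  · rw [← mul_assoc, I.2, mul_latticeInv N hO hJ hJO]; rfl
  · rw [mul_assoc, hJO]
  · change fracImage ι (1 : FractionalIdeal (𝓞 K)⁰ K) * (M.1 * J) = J
    rw [← mul_assoc, M.2.2.2.2, toSubmodule_leftOrderAlg, leftOrder_mul_self]
  · refine Subtype.ext (Subtype.ext (InvRightIdeal.ext ?_))
    change I.1.1.carrier * latticeInv N O J * J = I.1.1.carrier
    rw [mul_assoc, latticeInv_mul_self N hO hJ hJO, I.1.1.mul_order]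
  · refine Subtype.ext ?_
    change M.1 * J * latticeInv N O J = M.1
    rw [mul_assoc, mul_latticeInv N hO hJ hJO]
    exact M.2.2.1

variable (ι O) in
/-- The right lattice generated by the ring of integers and the order. -/
def baseLattice : Submodule ℤ B :=
  fracImage ι (1 : FractionalIdeal (𝓞 K)⁰ K) * Subalgebra.toSubmodule O

omit hNp hR in
theorem isLattice_baseLattice (hO : IsOrder O) : Submodule.IsLattice ℚ (baseLattice ι O) :=
  isLattice_fracImage_mul (one_ne_zero (α := FractionalIdeal (𝓞 K)⁰ K)) hO

omit hNp hR [DefiniteQuaternion B] in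
theorem baseLattice_mul_order : baseLattice ι O * Subalgebra.toSubmodule O = baseLattice ι O := by
  rw [baseLattice, mul_assoc, O.isIdempotentElem_toSubmodule.eq]

omit hNp hR [DefiniteQuaternion B] in
theorem fracImage_one_mul_baseLattice :
    fracImage ι (1 : FractionalIdeal (𝓞 K)⁰ K) * baseLattice ι O = baseLattice ι O := by
  rw [baseLattice, fracImage_mul_mul, one_mul]

theorem exists_fracClass (hO : IsMaximalOrder O) (ha : a ^ 2 = -(N : K)) (I : StableIdeal O (ι a)) :
    ∃ 𝔞 : (FractionalIdeal (𝓞 K)⁰ K)ˣ, fracImage ι (𝔞 : FractionalIdeal (𝓞 K)⁰ K) * baseLattice ι O =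
      fracImage ι (1 : FractionalIdeal (𝓞 K)⁰ K) * I.1.carrier :=
  exists_fracImage_mul_eq hO ha (isLattice_baseLattice hO.1) baseLattice_mul_order
    fracImage_one_mul_baseLattice (isLattice_fracImage_mul (one_ne_zero (α := FractionalIdeal (𝓞 K)⁰ K)) I.1.isLattice)
    (by rw [mul_assoc, I.1.mul_order]) (by rw [fracImage_mul_mul, one_mul])

/-- The fractional ideal attached to a stable ideal. -/
def fracClass (hO : IsMaximalOrder O) (ha : a ^ 2 = -(N : K)) (I : StableIdeal O (ι a)) :
    (FractionalIdeal (𝓞 K)⁰ K)ˣ := (exists_fracClass hO ha I).choose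

theorem fracClass_eq_iff (hO : IsMaximalOrder O) (ha : a ^ 2 = -(N : K)) (I : StableIdeal O (ι a))
    (𝔞 : (FractionalIdeal (𝓞 K)⁰ K)ˣ) : fracClass hO ha I = 𝔞 ↔
      fracImage ι (1 : FractionalIdeal (𝓞 K)⁰ K) * I.1.carrier =
        fracImage ι (𝔞 : FractionalIdeal (𝓞 K)⁰ K) * baseLattice ι O := by
  have h := (exists_fracClass hO ha I).choose_spec
  constructor
  · rintro rfl
    exact h.symm
  · intro h1
    exact fracImage_mul_injective (isLattice_baseLattice hO.1) fracImage_one_mul_baseLattice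
      (h.trans h1)

theorem fracClass_smul (hO : IsMaximalOrder O) (ha : a ^ 2 = -(N : K)) {I I' : StableIdeal O (ι a)}
    {k : Kˣ} {c : Bˣ} (hc : (c : B) = ι k) (h : I'.1.carrier = c • I.1.carrier) :
    fracClass hO ha I' = toPrincipalIdeal (𝓞 K) K k * fracClass hO ha I := by
  rw [fracClass_eq_iff, h, fracImage_mul_unit_smul hc, (fracClass_eq_iff hO ha I _).1 rfl, Units.val_mul,
    coe_toPrincipalIdeal, ← fracImage_mul_mul, fracImage_spanSingleton_mul hc]
  rw [fracImage_mul_mul, one_mul]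

omit hNp hR in
theorem exists_unit_of_commute (hN3 : 3 < N) (ha : a ^ 2 = -(N : K)) {c : Bˣ}
    (hc : (c : B) * ι a = ι a * c) : ∃ k : Kˣ, (c : B) = ι k := by
  obtain ⟨r, s, h⟩ := exists_of_commute_sqrt (by omega) (apply_mul_self_of_sq (ι := ι) N ha) hc
  have h1 : (c : B) = ι (algebraMap ℚ K r + s • a) := by
    rw [h, map_add, map_smul, AlgHom.commutes]
  have h2 : algebraMap ℚ K r + s • a ≠ 0 := by
    intro h0
    rw [h0, map_zero] at h1
    exact c.ne_zero h1
  exact ⟨Units.mk0 _ h2, h1⟩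

/-- The ideal class attached to a class of stable ideals. -/
def stableToClass (hO : IsMaximalOrder O) (ha : a ^ 2 = -(N : K)) :
    Quotient (stableSetoid (O := O) (ι a)) →
      (FractionalIdeal (𝓞 K)⁰ K)ˣ ⧸ (toPrincipalIdeal (𝓞 K) K).range :=
  Quotient.lift (fun I => QuotientGroup.mk (fracClass hO ha I)) (by
    rintro I I' ⟨c, hc, h⟩
    obtain ⟨k, hk⟩ := exists_unit_of_commute hR.three_lt ha hc
    rw [QuotientGroup.eq, fracClass_smul hO ha hk h, mul_comm, mul_assoc, mul_inv_cancel, mul_one]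
    exact ⟨k, rfl⟩)

/-- The element of `K` corresponding to `c` generates the unit ideal, so `c` preserves the base
lattice; it has norm 1 and integral trace, hence is `±1`. -/
theorem smul_eq_self_of_fracClass_eq (hO : IsMaximalOrder O) (ha : a ^ 2 = -(N : K))
    {I I' : StableIdeal O (ι a)} {c : Bˣ} (hc : (c : B) * ι a = ι a * c)
    (h : I'.1.carrier = c • I.1.carrier) (hf : fracClass hO ha I' = fracClass hO ha I) :
    I'.1.carrier = I.1.carrier := by
  obtain ⟨k, hk⟩ := exists_unit_of_commute hR.three_lt ha hc
  have h1 := fracClass_smul hO ha hk h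
  rw [hf, right_eq_mul] at h1
  have h2 : c • baseLattice ι O = baseLattice ι O := by
    rw [← fracImage_spanSingleton_mul hk fracImage_one_mul_baseLattice, ← coe_toPrincipalIdeal, h1,
      Units.val_one, fracImage_one_mul_baseLattice]
  have hb := isLattice_baseLattice (ι := ι) hO.1
  obtain ⟨t, ht⟩ := trd_int (isOrder_leftOrderAlg hb) (coe_mem_leftOrderAlg h2)
  rcases eq_one_or_neg_one_of_commute_sqrt hR.three_lt (apply_mul_self_of_sq (ι := ι) N ha) hc ht
    (one_of_smul_eq_self_of_nrd hb h2) with h3 | h3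
  · rw [h, show c = 1 from Units.ext h3, one_smul]
  · rw [h, show c = -1 from Units.ext (by simpa using h3)]
    ext x
    rw [mem_unit_smul]
    constructor
    · rintro ⟨y, hy, rfl⟩
      simpa using hy
    · intro hx
      exact ⟨-x, neg_mem hx, by simp⟩

/-- Each class in the fibre has a representative whose fractional ideal is exactly `𝔞`, unique
because only `±1` can relate two of them. The fibre is thus the set of stable ideals generating one
fixed lattice over the ring of integers. -/
theorem card_fiber_stableToClass (hO : IsMaximalOrder O) (ha : a ^ 2 = -(N : K))
    (q : (FractionalIdeal (𝓞 K)⁰ K)ˣ ⧸ (toPrincipalIdeal (𝓞 K) K).range) :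
    Nat.card {x // stableToClass (ι := ι) hO ha x = q} = bConst N := by
  obtain ⟨𝔞, rfl⟩ := QuotientGroup.mk_surjective q
  have hb := isLattice_baseLattice (ι := ι) hO.1
  rw [← card_stableIdeal_hull_eq (ι := ι) hO ha (isLattice_fracImage_mul 𝔞.ne_zero hb)
    (by rw [mul_assoc, baseLattice_mul_order]) (by rw [fracImage_mul_mul, one_mul])]
  symm
  refine Nat.card_eq_of_bijective (fun I => ⟨Quotient.mk _ I.1, congrArg QuotientGroup.mk
    ((fracClass_eq_iff hO ha I.1 𝔞).2 I.2)⟩) ⟨fun I I' h => ?_, ?_⟩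
  · obtain ⟨c, hc, h1⟩ : ∃ c : Bˣ, (c : B) * ι a = ι a * c ∧ I.1.1.carrier = c • I'.1.1.carrier :=
      Quotient.exact (congrArg Subtype.val h).symm
    exact Subtype.ext (Subtype.ext (InvRightIdeal.ext (smul_eq_self_of_fracClass_eq hO ha hc h1
      (((fracClass_eq_iff hO ha I.1 𝔞).2 I.2).trans ((fracClass_eq_iff hO ha I'.1 𝔞).2 I'.2).symm))))
  · rintro ⟨x, hx⟩
    induction x using Quotient.inductionOn with | _ I
    have hx' : (QuotientGroup.mk (fracClass hO ha I) :
        (FractionalIdeal (𝓞 K)⁰ K)ˣ ⧸ (toPrincipalIdeal (𝓞 K) K).range) = QuotientGroup.mk 𝔞 := hx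
    obtain ⟨k, hk⟩ := QuotientGroup.eq.1 hx'
    have hk0 : ι (k : K) ≠ 0 := (map_ne_zero_iff _ (ι : K →+* B).injective).2 k.ne_zero
    set c := qunit (ι (k : K)) hk0 with hcdef
    have hc : (c : B) = ι k := rfl
    have hcomm : (c : B) * ι a = ι a * c := by rw [hc, ← map_mul, mul_comm, map_mul]
    let I' : StableIdeal O (ι a) := ⟨smulIdeal N hO c I.1, by
      rintro _ ⟨y, hy, rfl⟩
      refine mem_unit_smul.2 ⟨ι a * y, I.2 y hy, ?_⟩
      change (c : B) * (ι a * y) = ι a * (c * y)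
      rw [← mul_assoc, hcomm, mul_assoc]⟩
    have hI' : fracClass hO ha I' = 𝔞 := by
      rw [fracClass_smul hO ha (I := I) hc rfl, hk, mul_comm, mul_inv_cancel_left]
    exact ⟨⟨I', (fracClass_eq_iff hO ha I' 𝔞).1 hI'⟩, Subtype.ext (Quotient.sound
      (Setoid.symm (show stableSetoid (ι a) I I' from ⟨c, hcomm, rfl⟩)))⟩

theorem card_stable_eq_classNumber_mul (hO : IsMaximalOrder O) (ha : a ^ 2 = -(N : K)) :
    Nat.card (Quotient (stableSetoid (O := O) (ι a))) = NumberField.classNumber K * bConst N := by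
  have hb0 : bConst N ≠ 0 := by
    unfold bConst
    split_ifs <;> norm_num
  rw [card_eq_card_mul_of_fibers (stableToClass (ι := ι) hO ha) hb0
    (card_fiber_stableToClass (ι := ι) hO ha), NumberField.classNumber, ← Nat.card_eq_fintype_card,
    Nat.card_congr (ClassGroup.equiv K).toEquiv]

end ClassCount

end QuatForm

end

/-! ### Trivial zeroes are the fixed points of `σ_N` -/

noncomputable section

namespace QuatForm

section TrivialZero

variable {B : Type*} [Ring B] [Algebra ℚ B] [DefiniteQuaternion B] (N : ℕ) [hNp : Fact N.Prime]
  [hR : RamifiedOnlyAt B N] {O : Subalgebra ℤ B}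

theorem mul_radIdeal_mul_radIdeal (hO : IsMaximalOrder O) (x : Cl O) :
    (x.mul (radIdeal N hO)).mul (radIdeal N hO) = x := by
  induction x using Quotient.inductionOn with | _ I
  have hN0 : (N : B) ≠ 0 := Nat.cast_ne_zero.2 hNp.out.ne_zero
  refine Quotient.sound (Setoid.symm (show classSetoid O I _ from ⟨qunit (N : B) hN0, ?_⟩))
  change I.carrier * radPow O N 1 * radPow O N 1 = _
  rw [mul_assoc, radPow_mul N hO.1, one_add_one_eq_two]
  apply le_antisymm
  · refine Submodule.mul_le.2 fun m hm z hz => ?_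
    obtain ⟨y, hy, rfl⟩ := (radPow_two N hO).1 hz
    refine mem_unit_smul.2 ⟨m * y, ?_, ?_⟩
    · rw [← I.mul_order]; exact Submodule.mul_mem_mul hm hy
    · change (N : B) * (m * y) = _
      rw [mul_smul_comm, natCast_zsmul, nsmul_eq_mul]
  · rintro _ ⟨y, hy, rfl⟩
    change (N : B) * y ∈ _
    have h : (N : B) * y = y * ((N : ℤ) • (1 : B)) := by
      rw [mul_smul_comm, mul_one, natCast_zsmul, nsmul_eq_mul]
    rw [h]
    exact Submodule.mul_mem_mul hy ((radPow_two N hO).2 ⟨1, O.one_mem, rfl⟩)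

omit hR [Algebra ℚ B] [DefiniteQuaternion B] [Ring B] in
theorem minusPattern_sign {p : N.divisors} (hp : (p : ℕ).Prime) :
    (p : ℕ) = N ∧ (minusPattern N).sign p = -1 := by
  have h := (Nat.prime_dvd_prime_iff_eq hp hNp.out).1 (Nat.dvd_of_mem_divisors p.2)
  refine ⟨h, ?_⟩
  change (-1) ^ (p : ℕ).primeFactors.card = (-1 : ℤˣ)
  rw [hp.primeFactors, Finset.card_singleton, pow_one]

theorem isEdge_minusPattern_iff (hO : IsMaximalOrder O) {x y : Cl O} {s : ℤˣ} :
    IsEdge (minusPattern N) x y s ↔ s = -1 ∧ y = x.mul (radIdeal N hO) := by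
  constructor
  · rintro ⟨p, hp, rfl, P, hP, h⟩
    obtain ⟨hpN, hs⟩ := minusPattern_sign N hp
    rw [hpN, hasNorm_iff_eq_radIdeal N hO] at hP
    subst hP
    refine ⟨hs, ?_⟩
    rcases h with h | h
    · exact h
    · rw [h, mul_radIdeal_mul_radIdeal]
  · rintro ⟨rfl, h⟩
    exact ⟨⟨N, Nat.mem_divisors_self N hNp.out.ne_zero⟩, hNp.out,
      (minusPattern_sign N (p := ⟨N, Nat.mem_divisors_self N hNp.out.ne_zero⟩) hNp.out).2.symm,
      radIdeal N hO, (hasNorm_iff_eq_radIdeal N hO _).2 rfl, Or.inl h⟩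

/-- The sign records the parity of the length, and `σ_N` is an involution. -/
theorem hasPath_minusPattern (hO : IsMaximalOrder O) {x z : Cl O} {s : ℤˣ}
    (h : HasPath (minusPattern N) x z s) : s = 1 ∧ z = x ∨ s = -1 ∧ z = x.mul (radIdeal N hO) := by
  induction h with
  | nil x => exact Or.inl ⟨rfl, rfl⟩
  | cons he _ ih =>
    obtain ⟨rfl, rfl⟩ := (isEdge_minusPattern_iff N hO).1 he
    rcases ih with ⟨rfl, rfl⟩ | ⟨rfl, rfl⟩
    · exact Or.inr ⟨by simp, rfl⟩
    · exact Or.inl ⟨by simp, mul_radIdeal_mul_radIdeal N hO _⟩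

/-- The prime above `N` commutes with every invertible two-sided ideal `Q`, so `Q` can be cancelled
from `I Q = c I Q P`. -/
theorem mul_radIdeal_eq_of_mul (hO : IsMaximalOrder O) {x : Cl O} (Q : InvTwoSidedIdeal O)
    (h : (x.mul Q).mul (radIdeal N hO) = x.mul Q) : x.mul (radIdeal N hO) = x := by
  induction x using Quotient.inductionOn with | _ I
  obtain ⟨c, hc⟩ : ∃ c : Bˣ, I.carrier * Q.carrier = c • (I.carrier * Q.carrier * radPow O N 1) :=
    Quotient.exact h
  obtain ⟨Q', hQQ', hQ'Q⟩ := Q.invertible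
  have hcomm : Q.carrier * radPow O N 1 = radPow O N 1 * Q.carrier := by
    have hOO := O.isIdempotentElem_toSubmodule.eq
    -- The inverse `Q'` is not assumed stable under `O`, so it is replaced by `O Q' O`.
    refine mul_radPow_comm N hO hO (J := Subalgebra.toSubmodule O * Q' * Subalgebra.toSubmodule O)
      Q.mul_order (by rw [mul_assoc, hOO]) ?_ ?_ 1
    · rw [← mul_assoc, ← mul_assoc, Q.mul_order, hQQ', hOO]
    · rw [mul_assoc, Q.order_mul, mul_assoc, hQ'Q, hOO]
  refine Quotient.sound (show classSetoid O _ I from ⟨c, ?_⟩)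
  change I.carrier = c • (I.carrier * radPow O N 1)
  have h1 := congrArg (· * Q') hc
  simp only [mul_assoc, hcomm, unit_smul_mul, hQQ', radPow_mul_order N hO, I.mul_order] at h1
  exact h1

variable (O) in
/-- The order itself as a two-sided ideal. -/
def unitIdeal (hO : IsOrder O) : InvTwoSidedIdeal O where
  carrier := Subalgebra.toSubmodule O
  isLattice := hO
  order_mul := O.isIdempotentElem_toSubmodule
  mul_order := O.isIdempotentElem_toSubmodule
  invertible := ⟨_, O.isIdempotentElem_toSubmodule, O.isIdempotentElem_toSubmodule⟩

omit [DefiniteQuaternion B] hNp hR in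
theorem mul_unitIdeal (hO : IsOrder O) (x : Cl O) : x.mul (unitIdeal O hO) = x := by
  induction x using Quotient.inductionOn with | _ I
  exact congrArg (Quotient.mk _) (InvRightIdeal.ext I.mul_order)

/-- A closed path of sign `-1` has odd length, so its base point is fixed, and fixedness passes to
`x` by cancelling a two-sided ideal. Conversely a fixed point carries a loop of sign `-1`. -/
theorem isTrivialZero_minusPattern_iff (hO : IsMaximalOrder O) (x : Cl O) :
    IsTrivialZero (minusPattern N) x ↔ x.mul (radIdeal N hO) = x := by
  rw [IsTrivialZero, IsAdmissible]
  push Not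
  constructor
  · rintro ⟨_, ⟨Q, rfl⟩, h⟩
    rcases hasPath_minusPattern N hO h with ⟨h1, -⟩ | ⟨-, h1⟩
    · exact absurd h1 (by decide)
    · exact mul_radIdeal_eq_of_mul N hO Q h1.symm
  · intro h
    refine ⟨x, ⟨unitIdeal O hO.1, (mul_unitIdeal hO.1 x).symm⟩, ?_⟩
    have := HasPath.cons ((isEdge_minusPattern_iff N hO (x := x) (y := x)).2 ⟨rfl, h.symm⟩)
      (HasPath.nil x)
    simpa using this

end TrivialZero

end QuatForm

end

/-- For a prime `N > 3`, a maximal order `O` in the definite quaternion algebra of discriminant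
`N`, and `K = ℚ(√-N)`: the number of trivial zeroes of `-_N` on `Cl(O)` is `½ h(K) b(N,1)`, and
so is the number of fixed points of the involution `σ_N`, which is right multiplication by `P`,
the unique two-sided `O`-ideal of norm `N`. -/
theorem proposition3p11 (N : ℕ) (hN : N.Prime) (hN3 : 3 < N)
    (B : Type*) [Ring B] [Algebra ℚ B]
    (hB : QuatForm.IsQuaternionAlgebra B) (hdef : QuatForm.IsDefinite B)
    (hdisc : QuatForm.discriminant B = N)
    (O : Subalgebra ℤ B) (hO : QuatForm.IsMaximalOrder O)
    (K : Type*) [Field K] [NumberField K]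
    (hK2 : Module.finrank ℚ K = 2) (hK : ∃ a : K, a ^ 2 = -(N : K)) :
    ({x : QuatForm.Cl O | QuatForm.IsTrivialZero (QuatForm.minusPattern N) x}.ncard : ℚ) =
        1 / 2 * (NumberField.classNumber K : ℚ) * (QuatForm.bConst N : ℚ) ∧
      ∃ P : QuatForm.InvTwoSidedIdeal O,
        (∀ Q : QuatForm.InvTwoSidedIdeal O, Q.HasNorm N ↔ Q = P) ∧
        (∀ x : QuatForm.Cl O, (x.mul P).mul P = x) ∧
        ({x : QuatForm.Cl O | x.mul P = x}.ncard : ℚ) =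
          1 / 2 * (NumberField.classNumber K : ℚ) * (QuatForm.bConst N : ℚ) := by
  have : QuatForm.DefiniteQuaternion B := hB.definiteQuaternion hdef
  have : Fact N.Prime := ⟨hN⟩
  have : QuatForm.RamifiedOnlyAt B N := QuatForm.ramifiedOnlyAt hN hN3 hdisc
  obtain ⟨a, ha⟩ := hK
  obtain ⟨b, hb⟩ := QuatForm.exists_mul_self_eq_neg N hO
  obtain ⟨ι, rfl⟩ := QuatForm.exists_lift_sqrt hK2 hN.ne_zero ha hb
  have hcard : ({x : QuatForm.Cl O | x.mul (QuatForm.radIdeal N hO) = x}.ncard : ℚ) =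
      1 / 2 * (NumberField.classNumber K : ℚ) * (QuatForm.bConst N : ℚ) := by
    -- Classes of `b`-stable ideals are counted twice: over the fixed classes with fibres of size 2,
    -- and over the class group with fibres of size `b(N,1)`.
    have h1 := (QuatForm.card_stable_eq N hO hb).symm.trans
      (QuatForm.card_stable_eq_classNumber_mul hO ha)
    have h2 : (({x : QuatForm.Cl O | x.mul (QuatForm.radIdeal N hO) = x}.ncard * 2 : ℕ) : ℚ) =
        ((NumberField.classNumber K * QuatForm.bConst N : ℕ) : ℚ) := congrArg Nat.cast h1
    push_cast at h2
    linarith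
  refine ⟨?_, QuatForm.radIdeal N hO, QuatForm.hasNorm_iff_eq_radIdeal N hO,
    QuatForm.mul_radIdeal_mul_radIdeal N hO, hcard⟩
  simp only [QuatForm.isTrivialZero_minusPattern_iff N hO]
  exact hcard
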